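/- Let $V:\mathbb R^4\to\mathbb R$ be short-range, that is, $V\in L^2(\mathbb R^4)$ and there are $R,\delta>0$ with $|V(x)|\le |x|^{-2-2\delta}$ for almost every $x$ with $|x|>R$. For $W\in L^2(\mathbb R^4)$ real-valued let $P^2+W$, $P=-i\nabla$, denote the self-adjoint operator on $L^2(\mathbb R^4)$ associated with the quadratic form $\langle u,(P^2+W)u\rangle=\int|\nabla u|^2\,dx+\int W|u|^2\,dx$ with domain $H^1(\mathbb R^4)$. Assume that $P^2+V$ has a virtual level at zero, that is, $P^2+V\ge 0$ and $\inf\sigma(P^2+(1+\eta)V)<0$ for all $\eta>0$. For $\ell\in\mathbb R^4$ put $$H[\ell]=P^2+V(x-\ell/2)+V(x+\ell/2)\quad\text{on }L^2(\mathbb R^4).$$ Then for every $\varepsilon>0$ there are $L_0=L_0(\varepsilon)>0$ and a family $\{\widetilde\Phi(\ell,\cdot)\}_{\ell\in\mathbb R^4}\subset H^1(\mathbb R^4)$ such that, for every $\ell\in\mathbb R^4$ with $L=|\ell|>L_0$, $$\|\widetilde\Phi(\ell,\cdot)\|_{L^2(\mathbb R^4)}=1\quad\text{and}\quad\langle\widetilde\Phi(\ell,\cdot),H[\ell]\widetilde\Phi(\ell,\cdot)\rangle\le-(2-\varepsilon)\,L^{-2}\log(L)^{-1}.$$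 Moreover, the same family has the following property. The map $\mathbb R^2\ni r\mapsto\widetilde\Phi((0,0,r),\cdot)$ belongs to $H^1_{\mathrm{loc}}(\mathbb R^2;L^2(\mathbb R^4))$, and, for a suitable representative of its weak gradient $\nabla_r\widetilde\Phi$, for every $r\in\mathbb R^2$ with $L=|r|>L_0$ and with $\ell=(0,0,r)$, $$\Big\langle\widetilde\Phi(\ell,\cdot),\big(P_r^2-\tfrac14P_{(x_3,x_4)}^2\big)\widetilde\Phi(\ell,\cdot)\Big\rangle_{L^2(dx)}:=\int_{\mathbb R^4}|\nabla_r\widetilde\Phi(\ell,x)|^2\,dx-\tfrac14\int_{\mathbb R^4}|\nabla_{(x_3,x_4)}\widetilde\Phi(\ell,x)|^2\,dx\le\Big(\tfrac23+\varepsilon\Big)L^{-2}\log(L)^{-1}.$$ -/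

import Mathlib

open MeasureTheory
open scoped ContDiff ComplexConjugate

/-- `ℝ²`, the space of the separation parameter `r`. -/
abbrev R2 : Type := EuclideanSpace ℝ (Fin 2)

/-- `ℝ⁴`, the configuration space. -/
abbrev R4 : Type := EuclideanSpace ℝ (Fin 4)

/-- The complex Hilbert space `L²(ℝ⁴, dx)`. -/
abbrev L2R4 : Type := Lp ℂ 2 (volume : Measure R4)

noncomputable section

/-- `g` is the weak partial derivative `∂ᵢ f` of the Banach-space valued function `f` on `ℝⁿ`:
both are locally integrable and `∫ (∂ᵢφ) f = - ∫ φ g` for every real test function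
`φ ∈ C_c^∞(ℝⁿ)`. -/
def HasWeakPartial {n : ℕ} {F : Type*} [NormedAddCommGroup F] [NormedSpace ℝ F]
    (i : Fin n) (f g : EuclideanSpace ℝ (Fin n) → F) : Prop :=
  LocallyIntegrable f volume ∧ LocallyIntegrable g volume ∧
    ∀ φ : EuclideanSpace ℝ (Fin n) → ℝ, ContDiff ℝ ∞ φ → HasCompactSupport φ →
      ∫ x, (fderiv ℝ φ x (EuclideanSpace.single i 1)) • f x = - ∫ x, φ x • g x

/-- Weak partial derivatives are unique up to null sets. -/
theorem HasWeakPartial.ae_eq {n : ℕ} {F : Type*} [NormedAddCommGroup F] [NormedSpace ℝ F]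
    [CompleteSpace F] {i : Fin n} {f g g' : EuclideanSpace ℝ (Fin n) → F}
    (h : HasWeakPartial i f g) (h' : HasWeakPartial i f g') : g =ᵐ[volume] g' :=
  ae_eq_of_integral_contDiff_smul_eq h.2.1 h'.2.1 fun φ hφ hc =>
    neg_injective ((h.2.2 φ hφ hc).symm.trans (h'.2.2 φ hφ hc))

/-- `f ∈ L²_loc(ℝⁿ; F)`. -/
def MemL2loc {n : ℕ} {F : Type*} [NormedAddCommGroup F]
    (f : EuclideanSpace ℝ (Fin n) → F) : Prop :=
  ∀ K : Set (EuclideanSpace ℝ (Fin n)), IsCompact K → MemLp f 2 (volume.restrict K)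

/-- `u ∈ H¹(ℝ⁴)`: all weak partial derivatives of `u ∈ L²(ℝ⁴)` exist and lie in `L²(ℝ⁴)`. -/
def MemH1 (u : L2R4) : Prop :=
  ∀ i : Fin 4, ∃ g : L2R4, HasWeakPartial i (⇑u) (⇑g)

open Classical in
/-- The weak partial derivative `∂ᵢ u ∈ L²(ℝ⁴)` of `u ∈ H¹(ℝ⁴)` (and `0` if there is none). -/
def weakPartial (i : Fin 4) (u : L2R4) : L2R4 :=
  if h : ∃ g : L2R4, HasWeakPartial i (⇑u) (⇑g) then h.choose else 0

/-- For `u ∈ H¹(ℝ⁴)`, `weakPartial i u` is the one and only weak partial derivative. -/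
theorem weakPartial_eq {i : Fin 4} {u g : L2R4} (h : HasWeakPartial i (⇑u) (⇑g)) :
    weakPartial i u = g := by
  have hex : ∃ g : L2R4, HasWeakPartial i (⇑u) (⇑g) := ⟨g, h⟩
  rw [weakPartial, dif_pos hex]
  exact Lp.ext (hex.choose_spec.ae_eq h)

/-- The sesquilinear form `⟨v, (P² + W) u⟩ = ⟨∇v, ∇u⟩ + ∫ W v̄ u` of the Schrödinger operator
`P² + W` on its form domain `H¹(ℝ⁴)`. For `W ∈ L²(ℝ⁴)` and `u, v ∈ H¹(ℝ⁴) ⊆ L⁴(ℝ⁴)` the last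
integral converges absolutely. -/
def schrodingerForm (W : R4 → ℝ) (v u : L2R4) : ℂ :=
  (∑ i : Fin 4, inner ℂ (weakPartial i v) (weakPartial i u))
    + ∫ x, (W x : ℂ) * (conj (v x) * u x)

/-- The expectation value `⟨u, (P² + W) u⟩`. -/
def energy (W : R4 → ℝ) (u : L2R4) : ℝ := (schrodingerForm W u u).re

/-- The graph of the self-adjoint operator `P² + W` on `L²(ℝ⁴)` associated with the form:
`u` is in the operator domain and `(P² + W) u = f`. -/
def SchrodingerGraph (W : R4 → ℝ) (u f : L2R4) : Prop :=
  MemH1 u ∧ ∀ v : L2R4, MemH1 v → schrodingerForm W v u = inner ℂ v f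

/-- The spectrum of the operator `P² + W` on `L²(ℝ⁴)`: those `z` for which `P² + W - z` has no
bounded everywhere defined two-sided inverse `T`. -/
def schrodingerSpectrum (W : R4 → ℝ) : Set ℂ :=
  {z | ¬ ∃ T : L2R4 →L[ℂ] L2R4, ∀ u f : L2R4, SchrodingerGraph W u (f + z • u) ↔ u = T f}

/-- A short-range potential on `ℝ⁴`: `V ∈ L²(ℝ⁴)` is real-valued and `|V(x)| ≤ |x|^(-2-2δ)` for
`|x| > R`, with some `R, δ > 0`. -/
def IsShortRange (V : R4 → ℝ) : Prop :=
  MemLp V 2 volume ∧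
    ∃ R δ : ℝ, 0 < R ∧ 0 < δ ∧ ∀ᵐ x : R4, R < ‖x‖ → |V x| ≤ ‖x‖ ^ (-2 - 2 * δ)

/-- `P² + V` has a virtual level at zero: `P² + V ≥ 0`, and `inf σ(P² + (1 + ε) V) < 0` for every
`ε > 0`. -/
def HasVirtualLevel (V : R4 → ℝ) : Prop :=
  (∀ u : L2R4, MemH1 u → 0 ≤ energy V u) ∧
    ∀ ε : ℝ, 0 < ε →
      ∃ E : ℝ, E < 0 ∧ (E : ℂ) ∈ schrodingerSpectrum (fun x => (1 + ε) * V x)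

/-- The double-well potential `V(x - ℓ/2) + V(x + ℓ/2)` of the operator `H[ℓ]`. -/
def doubleWell (V : R4 → ℝ) (ℓ : R4) : R4 → ℝ :=
  fun x => V (x - (1 / 2 : ℝ) • ℓ) + V (x + (1 / 2 : ℝ) • ℓ)

/-- The separation vector `(0, 0, r) ∈ ℝ⁴` for `r ∈ ℝ²`. -/
def sepVec (r : R2) : R4 := !₂[0, 0, r 0, r 1]

end

open Filter Topology Real Metric
open scoped ENNReal NNReal Convolution
open ENNReal (coe_ne_top continuous_rpow_const mul_ne_top ofReal ofReal_le_ofReal ofReal_lt_top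
  ofReal_ne_top tendsto_toReal toReal_mono toReal_mul toReal_ofReal zero_ne_top zero_rpow_of_pos)
open Set (Icc Ioc Ioi indicator_of_mem indicator_of_notMem)
open Finset (card_univ mem_univ mul_sum single_le_sum sum_add_distrib sum_congr sum_const sum_le_sum
  sum_mul sum_nonneg sum_pair univ)
open EuclideanSpace (inner_single_right norm_eq norm_sq_eq proj single)
open Function (comp_def uncurry)
open Complex (imCLM norm_real reCLM sq_norm)

local notation "w(" x ")" => (1 + ‖x‖^2)

local notation "pos!" => by positivity

local notation "lin!" => by linarith

local notation "num!" => by norm_num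

local notation "b(" x ")" => (1 + ‖x‖)

local notation "s(" n ")" => ((n : ℝ) + 1)

local notation "by!" h:max => by simpa using h
variable {F : Type*} [NormedAddCommGroup F] [NormedSpace ℝ F] {f W : R4 → ℝ}

noncomputable section

/-- The partial derivative `∂ᵢ f`. -/
def pd (i : Fin 4) (f : R4 → F) (x : R4) : F := fderiv ℝ f x (single i 1)

lemma sum_apply_single_smul (L : R4 →L[ℝ] F) (y : R4) : L y = ∑ i, y i • L (single i 1) := by
  have h : y = ∑ i, y i • (single i (1 : ℝ) : R4) := by
    ext j
    simp [Pi.single_apply]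
  conv_lhs => rw [h]
  simp

lemma norm_sq_eq_sum_apply_single (L : R4 →L[ℝ] ℝ) :
    ‖L‖^2 = ∑ i, (L (single i 1))^2 := by
  set z : R4 := (InnerProductSpace.toDual ℝ R4).symm L
  have h1 : ‖z‖ = ‖L‖ := LinearIsometryEquiv.norm_map _ _
  have h2 : ∀ y, inner ℝ z y = L y := fun y => InnerProductSpace.toDual_symm_apply
  rw [← h1, norm_sq_eq]
  refine sum_congr rfl fun i _ => ?_
  rw [← h2, inner_single_right]
  simp

lemma norm_fderiv_sq (f : R4 → ℝ) (x : R4) : ‖fderiv ℝ f x‖^2 = ∑ i, pd i f x^2 := norm_sq_eq_sum_apply_single _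

lemma norm_pd_le (i : Fin 4) (f : R4 → F) (x : R4) : ‖pd i f x‖ ≤ ‖fderiv ℝ f x‖ := by
  refine ((fderiv ℝ f x).le_opNorm _).trans ?_
  simp

lemma norm_fderiv_le_sum (f : R4 → F) (x : R4) : ‖fderiv ℝ f x‖ ≤ ∑ i, ‖pd i f x‖ := by
  refine ContinuousLinearMap.opNorm_le_bound _ pos! fun y => ?_
  rw [sum_apply_single_smul, sum_mul]
  refine (norm_sum_le _ _).trans (sum_le_sum fun i _ => ?_)
  rw [norm_smul, mul_comm]
  exact mul_le_mul_of_nonneg_left (PiLp.norm_apply_le y i) (norm_nonneg _)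

lemma HasWeakPartial.congr_ae {n : ℕ} {i : Fin n} {f g f' g' : EuclideanSpace ℝ (Fin n) → F}
    (h : HasWeakPartial i f g) (hf : f =ᵐ[volume] f') (hg : g =ᵐ[volume] g') :
    HasWeakPartial i f' g' := by
  refine ⟨h.1.congr hf, h.2.1.congr hg, fun z hz hc => ?_⟩
  have h1 : ∫ x, (fderiv ℝ z x (single i 1)) • f' x = ∫ x, (fderiv ℝ z x (single i 1)) • f x :=
    integral_congr_ae (hf.mono fun x hx => by simp only [hx])
  have h2 : ∫ x, z x • g' x = ∫ x, z x • g x := integral_congr_ae (hg.mono fun x hx => by simp only [hx])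
  rw [h1, h2]
  exact h.2.2 z hz hc

lemma HasWeakPartial.of_hasLineDerivAt {n : ℕ} {i : Fin n}
    {f g : EuclideanSpace ℝ (Fin n) → F} (hf : Continuous f) (hg : Continuous g)
    (h : ∀ x, HasLineDerivAt ℝ f (g x) x (single i 1)) : HasWeakPartial i f g := by
  refine ⟨hf.locallyIntegrable, hg.locallyIntegrable, fun z hz hc => ?_⟩
  have hz' : Continuous fun x => fderiv ℝ z x (single i 1) :=
    (hz.continuous_fderiv (by simp)).clm_apply continuous_const
  have := integral_bilinear_hasLineDerivAt_right_eq_neg_left_of_integrable (μ := volume) (f := z) (g := f) (g' := g)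
    (f' := fun x => fderiv ℝ z x (single i 1)) (B := ContinuousLinearMap.lsmul ℝ ℝ)
    (v := single i 1)
    ((hz'.smul hf).integrable_of_hasCompactSupport (hc.fderiv_apply (𝕜 := ℝ) _).smul_right)
    ((hz.continuous.smul hg).integrable_of_hasCompactSupport hc.smul_right)
    ((hz.continuous.smul hf).integrable_of_hasCompactSupport hc.smul_right)
    (fun x _ => ((hz.differentiable (by simp) x).hasFDerivAt).hasLineDerivAt _) (fun x _ => h x)
  simp only [ContinuousLinearMap.lsmul_apply] at this
  rw [this, neg_neg]

lemma HasWeakPartial.of_contDiff {n : ℕ} {i : Fin n} {f : EuclideanSpace ℝ (Fin n) → F} (hf : ContDiff ℝ 1 f) :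
    HasWeakPartial i f (fun x => fderiv ℝ f x (single i 1)) :=
  .of_hasLineDerivAt hf.continuous ((hf.continuous_fderiv one_ne_zero).clm_apply continuous_const)
    fun x => (hf.differentiable one_ne_zero x).hasFDerivAt.hasLineDerivAt _

section Mollify

variable [CompleteSpace F]

lemma enorm_average_sub_rpow_le {m : R4 → ℝ} (h0 : ∀ y, 0 ≤ m y) (hint : Integrable m)
    (h1 : ∫ y, m y = 1) {u : R4 → F} (hu : AEStronglyMeasurable u) {p : ℝ} (hp : 1 ≤ p) (x : R4) :
    ‖(∫ y, m y • u (x - y)) - u x‖ₑ^p ≤ ∫⁻ y, ofReal (m y)*‖u (x - y) - u x‖ₑ^p := by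
  have hp0 : 0 < p := lin!
  have hmm : AEMeasurable (fun y => ofReal (m y)) := hint.aemeasurable.ennreal_ofReal
  set n : Measure R4 := volume.withDensity fun y => ofReal (m y) with hn
  have hprob : IsProbabilityMeasure n := by
    refine ⟨?_⟩
    rw [hn, withDensity_apply _ MeasurableSet.univ, setLIntegral_univ,
      ← ofReal_integral_eq_lintegral_ofReal hint (.of_forall h0), h1, ENNReal.ofReal_one]
  have hum : AEStronglyMeasurable (fun y => u (x - y)) :=
    hu.comp_quasiMeasurePreserving (quasiMeasurePreserving_sub_left volume x)
  have hD : AEStronglyMeasurable (fun y => u (x - y) - u x) := hum.sub aestronglyMeasurable_const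
  have hac : n ≪ volume := withDensity_absolutelyContinuous _ _
  have hdens : ∀ f : R4 → ℝ≥0∞, AEMeasurable f →
      ∫⁻ y, f y ∂n = ∫⁻ y, ofReal (m y)*f y := fun f hf => by
    rw [hn, lintegral_withDensity_eq_lintegral_mul₀ hmm hf]; rfl
  have step1 : ‖(∫ y, m y • u (x - y)) - u x‖ₑ ≤ ∫⁻ y, ‖u (x - y) - u x‖ₑ ∂n := by
    rw [hdens _ hD.enorm]
    by_cases hfin : (∫⁻ y, ofReal (m y)*‖u (x - y) - u x‖ₑ) = ⊤
    · rw [hfin]; exact le_top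
    have hi1 : Integrable (fun y => m y • (u (x - y) - u x)) := by
      refine ⟨hint.aestronglyMeasurable.smul hD, ?_⟩
      rw [hasFiniteIntegral_iff_enorm]
      refine lt_of_le_of_lt (le_of_eq ?_) (lt_top_iff_ne_top.2 hfin)
      refine lintegral_congr fun y => ?_
      rw [enorm_smul, enorm_of_nonneg (h0 y)]
    have hi2 : Integrable (fun y => m y • u x) := hint.smul_const _
    have : (∫ y, m y • u (x - y)) - u x = ∫ y, m y • (u (x - y) - u x) := by
      have e : (fun y => m y • u (x - y)) = fun y => m y • (u (x - y) - u x) + m y • u x := by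
        funext y; rw [← smul_add, sub_add_cancel]
      rw [e, integral_add hi1 hi2, integral_smul_const, h1, one_smul, add_sub_cancel_right]
    rw [this]
    refine (enorm_integral_le_lintegral_enorm _).trans (le_of_eq ?_)
    refine lintegral_congr fun y => ?_
    rw [enorm_smul, enorm_of_nonneg (h0 y)]
  have step2 : ∫⁻ y, ‖u (x - y) - u x‖ₑ ∂n
      ≤ (∫⁻ y, ‖u (x - y) - u x‖ₑ^p ∂n)^(1/p) := by
    have := eLpNorm_le_eLpNorm_of_exponent_le (p := 1) (q := ofReal p) (μ := n)
      (f := fun y => u (x - y) - u x) (by! hp) (hD.mono_ac hac)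
    rwa [eLpNorm_one_eq_lintegral_enorm, eLpNorm_eq_lintegral_rpow_enorm_toReal
      (by! hp0) ofReal_ne_top, toReal_ofReal hp0.le] at this
  calc _ ≤ ((∫⁻ y, ‖u (x - y) - u x‖ₑ^p ∂n)^(1/p))^p := ENNReal.rpow_le_rpow (step1.trans step2) hp0.le
    _ = ∫⁻ y, ‖u (x - y) - u x‖ₑ^p ∂n := by
        rw [← ENNReal.rpow_mul, one_div_mul_cancel hp0.ne', ENNReal.rpow_one]
    _ = _ := hdens _ (hD.enorm.pow_const p)

lemma lintegral_enorm_average_sub_le {m : R4 → ℝ} (h0 : ∀ y, 0 ≤ m y) (hint : Integrable m)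
    (h1 : ∫ y, m y = 1) {u : R4 → F} (hu : AEStronglyMeasurable u) {p : ℝ} (hp : 1 ≤ p) :
    ∫⁻ x, ‖(∫ y, m y • u (x - y)) - u x‖ₑ^p ≤ ∫⁻ y, ofReal (m y)*∫⁻ x, ‖u (x - y) - u x‖ₑ^p := by
  have hmm : AEMeasurable (fun y => ofReal (m y)) := hint.aemeasurable.ennreal_ofReal
  have hm : AEStronglyMeasurable (fun z : R4 × R4 => u (z.1 - z.2) - u z.1)
      (volume.prod volume) := by
    refine AEStronglyMeasurable.sub ?_ hu.comp_fst
    exact hu.comp_quasiMeasurePreserving (quasiMeasurePreserving_sub volume volume)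
  calc _ ≤ ∫⁻ x, ∫⁻ y, ofReal (m y)*‖u (x - y) - u x‖ₑ^p :=
        lintegral_mono fun x => enorm_average_sub_rpow_le h0 hint h1 hu hp x
    _ = ∫⁻ y, ∫⁻ x, ofReal (m y)*‖u (x - y) - u x‖ₑ^p := by
        refine lintegral_lintegral_swap ?_
        exact (hmm.comp_quasiMeasurePreserving Measure.quasiMeasurePreserving_snd).mul (hm.enorm.pow_const p)
    _ = _ := by
        refine lintegral_congr fun y => ?_
        rw [lintegral_const_mul' _ _ ofReal_ne_top]

lemma continuous_eLpNorm_translate_sub {F : Type*} [NormedAddCommGroup F] {u : R4 → F}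
    {p : ℝ≥0∞} [Fact (1 ≤ p)] (hp : p ≠ ⊤) (hu : MemLp u p) :
    Continuous (fun y => eLpNorm (fun x => u (x - y) - u x) p) := by
  let g : R4 → C(R4, R4) := fun y => ⟨fun x => x - y, by fun_prop⟩
  have hg : Continuous g := ContinuousMap.continuous_of_continuous_uncurry _ (by
    simp only [g, Function.uncurry_def, ContinuousMap.coe_mk]; fun_prop)
  have hgm : ∀ y, MeasurePreserving (g y) (volume : Measure R4) volume := fun y =>
    measurePreserving_sub_right volume y
  have hcont := Continuous.compMeasurePreservingLp (f := fun _ : R4 => hu.toLp u) (g := g)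
    continuous_const hg hgm hp
  have key : ∀ y, eLpNorm (fun x => u (x - y) - u x) p
      = ‖Lp.compMeasurePreserving (g y) (hgm y) (hu.toLp u) - hu.toLp u‖ₑ := fun y => by
    rw [Lp.enorm_def]
    refine eLpNorm_congr_ae ?_
    have e1 := Lp.coeFn_compMeasurePreserving (hu.toLp u) (hgm y)
    have e2 := (hgm y).quasiMeasurePreserving.ae_eq_comp hu.coeFn_toLp
    filter_upwards [e1, e2, hu.coeFn_toLp, Lp.coeFn_sub
      (Lp.compMeasurePreserving (g y) (hgm y) (hu.toLp u)) (hu.toLp u)] with x h1 h2 h3 h4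
    rw [h4, Pi.sub_apply, h1, h2, h3]; rfl
  simp_rw [key]
  exact (hcont.sub continuous_const).enorm

lemma lintegral_comp_smul_R4 {f : R4 → ℝ≥0∞} (hf : Measurable f) {e : ℝ} (he : 0 < e) :
    ∫⁻ z, f (e • z) = ofReal ((e^4)⁻¹)*∫⁻ y, f y := by
  rw [← lintegral_map (μ := volume) hf (measurable_const_smul e),
    Measure.map_addHaar_smul _ he.ne', lintegral_smul_measure]
  simp [abs_of_pos he]

lemma tendsto_lintegral_average_sub {m : R4 → ℝ} (hc : Continuous m) (h0 : ∀ y, 0 ≤ m y) (hint : Integrable m)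
    (h1 : ∫ y, m y = 1) {u : R4 → F} {p : ℝ} (hp : 1 ≤ p) (hu : MemLp u (ofReal p)) :
    Tendsto (fun e : ℝ => ∫⁻ x, ‖(∫ y, ((e⁻¹)^4*m (e⁻¹ • y)) • u (x - y)) - u x‖ₑ^p) (𝓝[>] 0) (𝓝 0) := by
  have hp0 : 0 < p := lin!
  have : Fact (1 ≤ ofReal p) := ⟨by! hp⟩
  set Φ : R4 → ℝ≥0∞ := fun y => eLpNorm (fun x => u (x - y) - u x) (ofReal p)^p with hΦ
  have hΦc : Continuous Φ := continuous_rpow_const.comp (continuous_eLpNorm_translate_sub ofReal_ne_top hu)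
  have hΦe : ∀ y, ∫⁻ x, ‖u (x - y) - u x‖ₑ^p = Φ y := fun y => by
    simp only [hΦ]
    rw [eLpNorm_eq_lintegral_rpow_enorm_toReal (by! hp0) ofReal_ne_top,
      toReal_ofReal hp0.le, ← ENNReal.rpow_mul, one_div_mul_cancel hp0.ne',
      ENNReal.rpow_one]
  have hΦ0 : Φ 0 = 0 := by simp [hΦ, hp0]
  have hΦb : ∀ y, Φ y ≤ (2*eLpNorm u (ofReal p))^p := fun y => by
    refine ENNReal.rpow_le_rpow ?_ hp0.le
    have hmp := measurePreserving_sub_right (volume : Measure R4) y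
    refine (eLpNorm_sub_le (hu.1.comp_measurePreserving hmp) hu.1 Fact.out).trans ?_
    rw [two_mul]
    exact add_le_add (le_of_eq (eLpNorm_comp_measurePreserving hu.1 hmp)) le_rfl
  have hlim : Tendsto (fun e : ℝ => ∫⁻ z, ofReal (m z)*Φ (e • z)) (𝓝[>] 0) (𝓝 0) := by
    have := tendsto_lintegral_filter_of_dominated_convergence (l := 𝓝[>] (0 : ℝ))
      (F := fun e z => ofReal (m z)*Φ (e • z)) (f := fun _ => 0) (μ := volume)
      (fun z => ofReal (m z)*(2*eLpNorm u (ofReal p))^p) ?_ ?_ ?_ ?_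
    · simpa using this
    · exact .of_forall fun e => by fun_prop
    · exact .of_forall fun e => .of_forall fun z => mul_le_mul_right (hΦb _) _
    · rw [lintegral_mul_const' _ _ (by
        refine ENNReal.rpow_ne_top_of_nonneg hp0.le (mul_ne_top (by simp) hu.2.ne)),
        ← ofReal_integral_eq_lintegral_ofReal hint (.of_forall h0)]
      exact mul_ne_top ofReal_ne_top (ENNReal.rpow_ne_top_of_nonneg hp0.le (mul_ne_top (by simp) hu.2.ne))
    · refine .of_forall fun z => ?_
      have : Tendsto (fun e : ℝ => Φ (e • z)) (𝓝[>] 0) (𝓝 (Φ ((0 : ℝ) • z))) :=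
        ((hΦc.comp (continuous_id.smul continuous_const)).tendsto 0).mono_left nhdsWithin_le_nhds
      rw [zero_smul, hΦ0] at this
      simpa using ENNReal.Tendsto.const_mul this (Or.inr ofReal_ne_top)
  refine tendsto_of_tendsto_of_tendsto_of_le_of_le' tendsto_const_nhds hlim (.of_forall fun _ => zero_le) ?_
  filter_upwards [self_mem_nhdsWithin] with e (he : 0 < e)
  have hsi : Integrable fun y : R4 => (e⁻¹)^4*m (e⁻¹ • y) := (hint.comp_smul (inv_ne_zero he.ne')).const_mul _
  have hs1 : ∫ y : R4, (e⁻¹)^4*m (e⁻¹ • y) = 1 := by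
    rw [integral_const_mul, Measure.integral_comp_inv_smul, h1]
    simp only [finrank_euclideanSpace, Fintype.card_fin, abs_pow, abs_of_pos he, smul_eq_mul]
    field_simp
  refine (lintegral_enorm_average_sub_le (fun y => by have := h0 (e⁻¹ • y); positivity)
    hsi hs1 hu.1 hp).trans ?_
  simp_rw [hΦe]
  have hm : Measurable fun y : R4 => ofReal (m (e⁻¹ • y))*Φ y := by fun_prop
  have := lintegral_comp_smul_R4 hm he
  simp only [inv_smul_smul₀ he.ne'] at this
  rw [this, ← lintegral_const_mul _ hm]
  refine lintegral_mono fun y => ?_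
  rw [ENNReal.ofReal_mul pos!, mul_assoc, inv_pow]

end Mollify

lemma tendsto_eLpNorm_of_dominated {a ι F : Type*} [MeasurableSpace a] {μ : Measure a}
    [NormedAddCommGroup F] {l : Filter ι} [l.IsCountablyGenerated] {p : ℝ≥0∞} (hp0 : p ≠ 0)
    (hp : p ≠ ⊤) {G : ι → a → F} {b : a → ℝ} (hG : ∀ n, AEStronglyMeasurable (G n) μ)
    (hb : MemLp b p μ) (hle : ∀ᶠ n in l, ∀ᵐ x ∂μ, ‖G n x‖ ≤ b x)
    (hlim : ∀ᵐ x ∂μ, Tendsto (fun n => G n x) l (𝓝 0)) :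
    Tendsto (fun n => eLpNorm (G n) p μ) l (𝓝 0) := by
  have hp' : 0 < p.toReal := ENNReal.toReal_pos hp0 hp
  have key : Tendsto (fun n => ∫⁻ x, ‖G n x‖ₑ^p.toReal ∂μ) l (𝓝 0) := by
    have := tendsto_lintegral_filter_of_dominated_convergence' (l := l) (μ := μ)
      (F := fun n x => ‖G n x‖ₑ^p.toReal) (f := fun _ => 0) (fun x => ‖b x‖ₑ^p.toReal) ?_ ?_ ?_ ?_
    · simpa using this
    · exact .of_forall fun n => (hG n).enorm.pow_const _
    · filter_upwards [hle] with n hn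
      filter_upwards [hn] with x hx
      refine ENNReal.rpow_le_rpow ?_ hp'.le
      rw [← ofReal_norm, ← ofReal_norm]
      exact ofReal_le_ofReal (hx.trans (le_abs_self _))
    · exact (lintegral_rpow_enorm_lt_top_of_eLpNorm_lt_top hp0 hp hb.2).ne
    · filter_upwards [hlim] with x hx
      have h1 : Tendsto (fun n => ‖G n x‖ₑ) l (𝓝 0) := by! hx.enorm
      simpa [hp', comp_def] using (continuous_rpow_const (y := p.toReal)).tendsto 0 |>.comp h1
  have h2 := (continuous_rpow_const (y := 1/p.toReal)).tendsto 0 |>.comp key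
  rw [zero_rpow_of_pos pos!] at h2
  refine h2.congr fun n => ?_
  rw [eLpNorm_eq_lintegral_rpow_enorm_toReal hp0 hp]; rfl

/-- A smooth compactly supported probability density on `ℝ⁴`. -/
def stdMollifier : R4 → ℝ := (⟨1/2, 1, num!, num!⟩ : ContDiffBump (0 : R4)).normed volume

lemma stdMollifier_contDiff : ContDiff ℝ ∞ stdMollifier := ContDiffBump.contDiff_normed _
lemma stdMollifier_nonneg (y : R4) : 0 ≤ stdMollifier y := ContDiffBump.nonneg_normed _ y
lemma stdMollifier_hasCompactSupport : HasCompactSupport stdMollifier := ContDiffBump.hasCompactSupport_normed _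
lemma stdMollifier_integral : ∫ y, stdMollifier y = 1 := ContDiffBump.integral_normed _
lemma stdMollifier_integrable : Integrable stdMollifier :=
  stdMollifier_contDiff.continuous.integrable_of_hasCompactSupport stdMollifier_hasCompactSupport
lemma stdMollifier_eq_zero {y : R4} (hy : 1 ≤ ‖y‖) : stdMollifier y = 0 := by
  have h := ContDiffBump.support_normed_eq (⟨1/2, 1, num!, num!⟩ : ContDiffBump (0 : R4)) (μ := volume)
  by_contra hne
  have : y ∈ ball (0 : R4) 1 := by rw [← h]; exact hne
  rw [mem_ball_zero_iff] at this
  linarith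

/-- The mollifier at scale `e`. -/
def mollifier (e : ℝ) (y : R4) : ℝ := (e⁻¹)^4*stdMollifier (e⁻¹ • y)

lemma mollifier_contDiff (e : ℝ) : ContDiff ℝ ∞ (mollifier e) :=
  contDiff_const.mul (stdMollifier_contDiff.comp (contDiff_const_smul _))

lemma mollifier_hasCompactSupport {e : ℝ} (he : 0 < e) : HasCompactSupport (mollifier e) :=
  (stdMollifier_hasCompactSupport.comp_smul (inv_ne_zero he.ne')).mul_left

lemma mollifier_nonneg {e : ℝ} (he : 0 < e) (y : R4) : 0 ≤ mollifier e y :=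
  mul_nonneg pos! (stdMollifier_nonneg _)

lemma mollifier_integrable {e : ℝ} (he : 0 < e) : Integrable (mollifier e) :=
  (mollifier_contDiff e).continuous.integrable_of_hasCompactSupport (mollifier_hasCompactSupport he)

lemma mollifier_integral {e : ℝ} (he : 0 < e) : ∫ y, mollifier e y = 1 := by
  simp only [mollifier]
  rw [integral_const_mul, Measure.integral_comp_inv_smul, stdMollifier_integral]
  simp only [finrank_euclideanSpace, Fintype.card_fin, abs_pow, abs_of_pos he, smul_eq_mul]
  field_simp

lemma mollifier_eq_zero {e : ℝ} (he : 0 < e) {y : R4} (hy : e ≤ ‖y‖) : mollifier e y = 0 := by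
  rw [mollifier, stdMollifier_eq_zero, mul_zero]
  rw [norm_smul, norm_inv, norm_of_nonneg he.le, inv_mul_eq_div, le_div_iff₀ he]
  linarith

section

/-- Mollification of `u` at scale `e`. -/
def mollify (e : ℝ) (u : R4 → F) (x : R4) : F := ∫ y, mollifier e y • u (x - y)

lemma mollify_eq_convolution (e : ℝ) (u : R4 → F) :
    mollify e u = mollifier e ⋆[ContinuousLinearMap.lsmul ℝ ℝ, volume] u := rfl

lemma mollify_contDiff [CompleteSpace F] {e : ℝ} (he : 0 < e) {u : R4 → F}
    (hu : LocallyIntegrable u) : ContDiff ℝ ∞ (mollify e u) := by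
  rw [mollify_eq_convolution]
  exact (mollifier_hasCompactSupport he).contDiff_convolution_left _ (mollifier_contDiff e) hu

lemma pd_mollify [CompleteSpace F] {e : ℝ} (he : 0 < e) {u g : R4 → F} {i : Fin 4}
    (h : HasWeakPartial i u g) : pd i (mollify e u) = mollify e g := by
  funext x
  have hc1 : ContDiff ℝ 1 (mollifier e) := (mollifier_contDiff e).of_le (by simp)
  have hd := (mollifier_hasCompactSupport he).hasFDerivAt_convolution_left
    (ContinuousLinearMap.lsmul ℝ ℝ) hc1 h.1 x
  rw [← mollify_eq_convolution] at hd
  have hex : Integrable (fun t => ((ContinuousLinearMap.lsmul ℝ ℝ).precompL R4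
      (fderiv ℝ (mollifier e) t)) (u (x - t))) volume :=
    ((mollifier_hasCompactSupport he).fderiv (𝕜 := ℝ)).convolutionExists_left _
      (hc1.continuous_fderiv one_ne_zero) h.1 x
  rw [pd, hd.fderiv, convolution_def, ContinuousLinearMap.integral_apply hex]
  simp only [ContinuousLinearMap.precompL_apply, ContinuousLinearMap.lsmul_apply]
  rw [← integral_sub_left_eq_self _ volume x]
  simp only [sub_sub_cancel]
  have hz : ContDiff ℝ ∞ fun t => mollifier e (x - t) :=
    (mollifier_contDiff e).comp (contDiff_const.sub contDiff_id)
  have hzc : HasCompactSupport fun t => mollifier e (x - t) :=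
    (mollifier_hasCompactSupport he).comp_homeomorph (Homeomorph.subLeft x)
  have hzd : ∀ t, fderiv ℝ (fun t => mollifier e (x - t)) t = - fderiv ℝ (mollifier e) (x - t) :=
    fun t => by
      have h1 := (hc1.differentiable one_ne_zero (x - t)).hasFDerivAt.comp t ((hasFDerivAt_id t).const_sub x)
      have h2 := h1.fderiv
      simp only [comp_def] at h2
      rw [h2]
      ext y; simp
  have key := h.2.2 _ hz hzc
  simp only [hzd, neg_apply, neg_smul, integral_neg, neg_inj] at key
  rw [key, mollify, ← integral_sub_left_eq_self _ volume x]
  simp only [sub_sub_cancel]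

lemma tendsto_eLpNorm_mollify_sub [CompleteSpace F] {u : R4 → F} {p : ℝ} (hp : 1 ≤ p)
    (hu : MemLp u (ofReal p)) :
    Tendsto (fun e => eLpNorm (mollify e u - u) (ofReal p)) (𝓝[>] 0) (𝓝 0) := by
  have hp0 : 0 < p := lin!
  have key := tendsto_lintegral_average_sub stdMollifier_contDiff.continuous stdMollifier_nonneg
    stdMollifier_integrable stdMollifier_integral hp hu
  have h2 := (continuous_rpow_const (y := 1/p)).tendsto 0 |>.comp key
  rw [zero_rpow_of_pos pos!] at h2
  refine h2.congr fun n => ?_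
  rw [eLpNorm_eq_lintegral_rpow_enorm_toReal (by! hp0) ofReal_ne_top, toReal_ofReal hp0.le]
  rfl

end

/-- A smooth cutoff: `1` on the unit ball, `0` outside the ball of radius `2`. -/
def stdCutoff : R4 → ℝ := (⟨1, 2, num!, num!⟩ : ContDiffBump (0 : R4))

lemma stdCutoff_contDiff : ContDiff ℝ ∞ stdCutoff := ContDiffBump.contDiff _
lemma stdCutoff_nonneg (x : R4) : 0 ≤ stdCutoff x := ContDiffBump.nonneg _
lemma stdCutoff_le_one (x : R4) : stdCutoff x ≤ 1 := ContDiffBump.le_one _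
lemma stdCutoff_hasCompactSupport : HasCompactSupport stdCutoff := ContDiffBump.hasCompactSupport _
lemma stdCutoff_eq_one {x : R4} (hx : ‖x‖ ≤ 1) : stdCutoff x = 1 :=
  ContDiffBump.one_of_mem_closedBall _ (by! hx)
/-- The cutoff at scale `R`. -/
def cutoff (R : ℝ) (x : R4) : ℝ := stdCutoff (R⁻¹ • x)

lemma cutoff_contDiff (R : ℝ) : ContDiff ℝ ∞ (cutoff R) := stdCutoff_contDiff.comp (contDiff_const_smul _)
lemma cutoff_nonneg (R : ℝ) (x : R4) : 0 ≤ cutoff R x := stdCutoff_nonneg _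
lemma cutoff_le_one (R : ℝ) (x : R4) : cutoff R x ≤ 1 := stdCutoff_le_one _
lemma abs_cutoff_le_one (R : ℝ) (x : R4) : |cutoff R x| ≤ 1 := by
  rw [abs_of_nonneg (cutoff_nonneg R x)]; exact cutoff_le_one R x
lemma cutoff_hasCompactSupport {R : ℝ} (hR : 0 < R) : HasCompactSupport (cutoff R) :=
  stdCutoff_hasCompactSupport.comp_smul (inv_ne_zero hR.ne')
lemma cutoff_eq_one {R : ℝ} (hR : 0 < R) {x : R4} (hx : ‖x‖ ≤ R) : cutoff R x = 1 := by
  refine stdCutoff_eq_one ?_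
  rw [norm_smul, norm_inv, norm_of_nonneg hR.le, inv_mul_eq_div, div_le_one hR]
  exact hx
lemma exists_pd_cutoff_le : ∃ C : ℝ, 0 < C ∧ ∀ (R : ℝ), 0 < R → ∀ (i : Fin 4) (x : R4),
    |pd i (cutoff R) x| ≤ C*R⁻¹ := by
  obtain ⟨C, hC⟩ := (stdCutoff_contDiff.continuous_fderiv (by simp)).bounded_above_of_compact_support
    (stdCutoff_hasCompactSupport.fderiv (𝕜 := ℝ))
  refine ⟨|C| + 1, pos!, fun R hR i x => ?_⟩
  have h1 := (stdCutoff_contDiff.differentiable (by simp) (R⁻¹ • x)).hasFDerivAt.comp x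
        ((hasFDerivAt_id x).const_smul R⁻¹)
  have h2 : fderiv ℝ (cutoff R) x = _ := h1.fderiv
  rw [pd, h2]
  simp only [ContinuousLinearMap.comp_apply, smul_apply,
    ContinuousLinearMap.id_apply, map_smul, smul_eq_mul, abs_mul, abs_inv, abs_of_pos hR]
  rw [mul_comm]
  gcongr
  refine (norm_pd_le i stdCutoff (R⁻¹ • x)).trans ((hC _).trans ?_)
  linarith [le_abs_self C]

lemma pd_cutoff_eq_zero {R : ℝ} (hR : 0 < R) (i : Fin 4) {x : R4} (hx : ‖x‖ < R) :
    pd i (cutoff R) x = 0 := by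
  have : cutoff R =ᶠ[𝓝 x] fun _ => 1 := by
    have hmem : ball (0 : R4) R ∈ 𝓝 x := isOpen_ball.mem_nhds (by! hx)
    filter_upwards [hmem] with y hy
    exact cutoff_eq_one hR (by simpa using (mem_ball_zero_iff.1 hy).le)
  rw [pd, this.fderiv_eq]
  simp

lemma tendsto_cutoff (x : R4) : Tendsto (fun n : ℕ => cutoff s(n) x) atTop (𝓝 1) := by
  refine tendsto_const_nhds.congr' ?_
  obtain ⟨N, hN⟩ := exists_nat_ge ‖x‖
  filter_upwards [eventually_ge_atTop N] with n hn
  refine (cutoff_eq_one pos! ?_).symm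
  have : (N : ℝ) ≤ n := by exact_mod_cast hn
  linarith

lemma pd_mul {g : R4 → ℝ} {x : R4} (i : Fin 4) (hf : DifferentiableAt ℝ f x) (hg : DifferentiableAt ℝ g x) :
    pd i (fun y => f y*g y) x = pd i f x*g x + f x*pd i g x := by
  simp only [pd]
  rw [fderiv_fun_mul hf hg]
  simp
  ring

lemma pd_smul {g : R4 → F} {x : R4} (i : Fin 4) (hf : DifferentiableAt ℝ f x) (hg : DifferentiableAt ℝ g x) :
    pd i (fun y => f y • g y) x = pd i f x • g x + f x • pd i g x := by
  simp only [pd]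
  rw [fderiv_fun_smul hf hg]
  simp [add_comm]

section H1

lemma MemLp.locallyIntegrable_two {F : Type*} [NormedAddCommGroup F] {u : R4 → F} (hu : MemLp u 2) : LocallyIntegrable u :=
  hu.locallyIntegrable num!

lemma aestronglyMeasurable_mollify [CompleteSpace F] {e : ℝ} (he : 0 < e) {u : R4 → F}
    (hu : LocallyIntegrable u) : AEStronglyMeasurable (mollify e u) volume :=
  (mollify_contDiff he hu).continuous.aestronglyMeasurable

/-- Smooth compactly supported functions are dense in `H¹(ℝ⁴)`. -/
lemma exists_contDiff_approx [CompleteSpace F] {u : R4 → F} {g : Fin 4 → R4 → F}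
    (hu : MemLp u 2) (hg : ∀ j, MemLp (g j) 2) (hw : ∀ j, HasWeakPartial j u (g j)) :
    ∃ f : ℕ → R4 → F, (∀ n, ContDiff ℝ ∞ (f n) ∧ HasCompactSupport (f n)) ∧
      Tendsto (fun n => eLpNorm (f n - u) 2) atTop (𝓝 0) ∧
      ∀ j, Tendsto (fun n => eLpNorm (pd j (f n) - g j) 2) atTop (𝓝 0) := by
  set e : ℕ → ℝ := fun n => 1/s(n) with he
  have hepos : ∀ n, 0 < e n := fun n => by simp only [he]; positivity
  have helim : Tendsto e atTop (𝓝[>] 0) :=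
    tendsto_nhdsWithin_iff.2 ⟨tendsto_one_div_add_atTop_nhds_zero_nat, .of_forall fun n => hepos n⟩
  have h2 : ofReal 2 = 2 := num!
  have hmol : ∀ v : R4 → F, MemLp v 2 →
      Tendsto (fun n => eLpNorm (mollify (e n) v - v) 2) atTop (𝓝 0) := fun v hv => by
    have := tendsto_eLpNorm_mollify_sub (p := 2) (u := v) num! (by rwa [h2])
    rw [h2] at this
    exact this.comp helim
  set q : ℕ → R4 → ℝ := fun n => cutoff s(n)
  have hcut : ∀ v : R4 → F, MemLp v 2 →
      Tendsto (fun n => eLpNorm (fun x => (q n x - 1) • v x) 2) atTop (𝓝 0) := fun v hv => by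
    refine tendsto_eLpNorm_of_dominated num! num! (b := fun x => ‖v x‖)
      (fun n => ?_) hv.norm (.of_forall fun n => .of_forall fun x => ?_)
      (.of_forall fun x => ?_)
    · exact (((cutoff_contDiff _).continuous.sub continuous_const).aestronglyMeasurable).smul hv.1
    · rw [norm_smul]
      refine mul_le_of_le_one_left (norm_nonneg _) ?_
      rw [norm_eq_abs, abs_le]
      constructor <;> linarith [cutoff_nonneg s(n) x, cutoff_le_one s(n) x]
    · have := ((tendsto_cutoff x).sub_const 1).smul_const (v x)
      simpa using this
  have hprod : ∀ v : R4 → F, MemLp v 2 →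
      Tendsto (fun n => eLpNorm ((fun x => q n x • mollify (e n) v x) - v) 2) atTop (𝓝 0) :=
    fun v hv => by
    have hsum := (hmol v hv).add (hcut v hv)
    rw [add_zero] at hsum
    refine tendsto_of_tendsto_of_tendsto_of_le_of_le tendsto_const_nhds hsum (fun _ => zero_le) fun n => ?_
    have hmm := aestronglyMeasurable_mollify (hepos n) (MemLp.locallyIntegrable_two hv)
    have hqm : AEStronglyMeasurable (q n) volume := (cutoff_contDiff _).continuous.aestronglyMeasurable
    have e1 : ((fun x => q n x • mollify (e n) v x) - v)
        = (fun x => q n x • (mollify (e n) v - v) x) + fun x => (q n x - 1) • v x := by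
      funext x
      simp only [Pi.sub_apply, Pi.add_apply, smul_sub, sub_smul, one_smul]
      abel
    rw [e1]
    refine (eLpNorm_add_le (hqm.smul (hmm.sub hv.1))
      ((hqm.sub aestronglyMeasurable_const).smul hv.1) num!).trans ?_
    refine add_le_add (eLpNorm_mono fun x => ?_) le_rfl
    rw [Pi.smul_apply', norm_smul]
    exact mul_le_of_le_one_left (norm_nonneg _) (abs_cutoff_le_one _ x)
  refine ⟨fun n x => q n x • mollify (e n) u x, fun n => ⟨?_, ?_⟩, hprod u hu, fun j => ?_⟩
  · exact (cutoff_contDiff _).smul (mollify_contDiff (hepos n) (MemLp.locallyIntegrable_two hu))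
  · exact (cutoff_hasCompactSupport pos!).smul_right
  · obtain ⟨C, hC, hCb⟩ := exists_pd_cutoff_le
    have hsmall : Tendsto (fun n : ℕ => ofReal (C*s(n)⁻¹) *
        eLpNorm (mollify (e n) u) 2) atTop (𝓝 0) := by
      have hb : ∀ᶠ n in atTop, eLpNorm (mollify (e n) u) 2 ≤ eLpNorm u 2 + 1 := by
        have := (hmol u hu).eventually (gt_mem_nhds (show (0 : ℝ≥0∞) < 1 by norm_num))
        filter_upwards [this] with n hn
        have hmm := aestronglyMeasurable_mollify (hepos n) (MemLp.locallyIntegrable_two hu)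
        have : mollify (e n) u = (mollify (e n) u - u) + u := by simp
        rw [this]
        refine (eLpNorm_add_le (hmm.sub hu.1) hu.1 num!).trans ?_
        rw [add_comm]
        exact add_le_add le_rfl hn.le
      have h1 : Tendsto (fun n : ℕ => C*s(n)⁻¹) atTop (𝓝 0) := by
        have := (tendsto_one_div_add_atTop_nhds_zero_nat (𝕜 := ℝ)).const_mul C
        simpa using this
      have h3 := ENNReal.Tendsto.mul_const (b := eLpNorm u 2 + 1) (ENNReal.tendsto_ofReal h1)
        (Or.inr (by simp [hu.2.ne]))
      rw [ENNReal.ofReal_zero, zero_mul] at h3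
      refine tendsto_of_tendsto_of_tendsto_of_le_of_le' tendsto_const_nhds h3 (.of_forall fun _ => zero_le) ?_
      filter_upwards [hb] with n hn
      gcongr
    have hsum := hsmall.add (hprod (g j) (hg j))
    rw [add_zero] at hsum
    refine tendsto_of_tendsto_of_tendsto_of_le_of_le tendsto_const_nhds hsum (fun _ => zero_le) fun n => ?_
    have hmm := aestronglyMeasurable_mollify (hepos n) (MemLp.locallyIntegrable_two hu)
    have hmg := aestronglyMeasurable_mollify (hepos n) (MemLp.locallyIntegrable_two (hg j))
    have hqm : AEStronglyMeasurable (q n) volume := (cutoff_contDiff _).continuous.aestronglyMeasurable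
    have hqd : AEStronglyMeasurable (pd j (q n)) volume :=
      (((cutoff_contDiff _).continuous_fderiv (by simp)).clm_apply continuous_const).aestronglyMeasurable
    have e1 : pd j (fun x => q n x • mollify (e n) u x) - g j = (fun x => pd j (q n) x • mollify (e n) u x) +
          ((fun x => q n x • mollify (e n) (g j) x) - g j) := by
      funext x
      simp only [Pi.sub_apply, Pi.add_apply]
      rw [pd_smul j ((cutoff_contDiff _).differentiable (by simp) x)
        ((mollify_contDiff (hepos n) (MemLp.locallyIntegrable_two hu)).differentiable (by simp) x),
        pd_mollify (hepos n) (hw j)]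
      abel
    rw [e1]
    refine (eLpNorm_add_le (hqd.smul hmm) ((hqm.smul hmg).sub (hg j).1) num!).trans ?_
    refine add_le_add ?_ le_rfl
    refine eLpNorm_le_mul_eLpNorm_of_ae_le_mul (.of_forall fun x => ?_) 2
    rw [Pi.smul_apply', norm_smul]
    exact mul_le_mul_of_nonneg_right (hCb _ pos! j x) (norm_nonneg _)

lemma eLpNorm_fderiv_le_sum {u : R4 → F} (hu : ContDiff ℝ 1 u) :
    eLpNorm (fderiv ℝ u) 2 ≤ ∑ j, eLpNorm (pd j u) 2 := by
  have hc : ∀ j, Continuous (pd j u) := fun j => (hu.continuous_fderiv one_ne_zero).clm_apply continuous_const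
  have h1 : eLpNorm (fderiv ℝ u) 2 ≤ eLpNorm (∑ j, fun x => ‖pd j u x‖) 2 :=
    eLpNorm_mono_real fun x => by
      rw [Finset.sum_apply]
      exact norm_fderiv_le_sum u x
  have h2 := eLpNorm_sum_le (s := univ) (f := fun (j : Fin 4) x => ‖pd j u x‖) (p := 2)
    (μ := volume) (fun j _ => (hc j).norm.aestronglyMeasurable) num!
  refine h1.trans (h2.trans (sum_le_sum fun j _ => ?_))
  rw [eLpNorm_norm]

variable (F) in
/-- The constant of the Sobolev inequality `‖u‖₄ ≤ C ‖∇u‖₂` on `ℝ⁴`. -/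
def sobC [FiniteDimensional ℝ F] : ℝ≥0 := SNormLESNormFDerivOfEqConst F (volume : Measure R4) 2

lemma sobolev_contDiff [FiniteDimensional ℝ F] {u : R4 → F} (hu : ContDiff ℝ 1 u)
    (hc : HasCompactSupport u) : eLpNorm u 4 ≤ sobC F*eLpNorm (fderiv ℝ u) 2 := by
  have := eLpNorm_le_eLpNorm_fderiv_of_eq (F := F) (volume : Measure R4) hu hc (p := 2) (p' := 4)
    num! (by simp) (by simp; norm_num)
  exact_mod_cast this

/-- The Sobolev inequality on `H¹(ℝ⁴)`. -/
lemma sobolev_H1 [FiniteDimensional ℝ F] {u : R4 → F} {g : Fin 4 → R4 → F}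
    (hu : MemLp u 2) (hg : ∀ j, MemLp (g j) 2) (hw : ∀ j, HasWeakPartial j u (g j)) :
    eLpNorm u 4 ≤ sobC F*∑ j, eLpNorm (g j) 2 := by
  have : CompleteSpace F := FiniteDimensional.complete ℝ F
  obtain ⟨f, hf, hfu, hfg⟩ := exists_contDiff_approx hu hg hw
  have hfm : ∀ n, AEStronglyMeasurable (f n) volume := fun n => (hf n).1.continuous.aestronglyMeasurable
  obtain ⟨ns, hns, hae⟩ := (tendstoInMeasure_of_tendsto_eLpNorm num! hfm hu.1 hfu).exists_seq_tendsto_ae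
  have h1 := Lp.eLpNorm_lim_le_liminf_eLpNorm (p := 4) (fun n => hfm (ns n)) u hae
  refine h1.trans ?_
  have hlim : Tendsto (fun n => sobC F*∑ j, (eLpNorm (pd j (f (ns n)) - g j) 2
      + eLpNorm (g j) 2)) atTop (𝓝 (sobC F*∑ j, (0 + eLpNorm (g j) 2))) := by
    refine ENNReal.Tendsto.const_mul (tendsto_finsetSum _ fun j _ => ?_) (Or.inr coe_ne_top)
    exact ((hfg j).comp hns.tendsto_atTop).add tendsto_const_nhds
  simp only [zero_add] at hlim
  rw [← hlim.liminf_eq]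
  refine liminf_le_liminf (.of_forall fun n => ?_)
  have hc1 : ContDiff ℝ 1 (f (ns n)) := (hf _).1.of_le (by simp)
  refine (sobolev_contDiff hc1 (hf _).2).trans ?_
  gcongr
  refine (eLpNorm_fderiv_le_sum hc1).trans (sum_le_sum fun j _ => ?_)
  have hcj : Continuous (pd j (f (ns n))) := (hc1.continuous_fderiv one_ne_zero).clm_apply continuous_const
  have e1 : pd j (f (ns n)) = (pd j (f (ns n)) - g j) + g j := by simp
  conv_lhs => rw [e1]
  exact eLpNorm_add_le (hcj.aestronglyMeasurable.sub (hg j).1) (hg j).1 num!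

end H1

instance holderTriple_four_four_two : ENNReal.HolderTriple 4 4 2 where
  inv_add_inv_eq_inv := by
    have h : (4 : ℝ≥0∞) = 2*2 := num!
    rw [h, ENNReal.mul_inv (by simp) (by simp), ← two_mul, ← mul_assoc,
      ENNReal.mul_inv_cancel (by simp) (by simp), one_mul]

/-- The `Lᵖ` norm as a real number. -/
def nrm {F : Type*} [NormedAddCommGroup F] (p : ℝ≥0∞) (f : R4 → F) : ℝ := (eLpNorm f p volume).toReal

lemma nrm_nonneg {F : Type*} [NormedAddCommGroup F] (p : ℝ≥0∞) (f : R4 → F) : 0 ≤ nrm p f :=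
  ENNReal.toReal_nonneg

lemma nrm_norm {F : Type*} [NormedAddCommGroup F] (p : ℝ≥0∞) (f : R4 → F) :
    nrm p (fun x => ‖f x‖) = nrm p f := by
  simp only [nrm, eLpNorm_norm]

lemma nrm_sub_comm {F : Type*} [NormedAddCommGroup F] (p : ℝ≥0∞) (f g : R4 → F) :
    nrm p (f - g) = nrm p (g - f) := by
  simp only [nrm, eLpNorm_sub_comm f g]

lemma nrm_add_le {F : Type*} [NormedAddCommGroup F] {p : ℝ≥0∞} (hp : 1 ≤ p) {f g : R4 → F}
    (hf : MemLp f p) (hg : MemLp g p) : nrm p (f + g) ≤ nrm p f + nrm p g := by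
  rw [nrm, nrm, nrm, ← ENNReal.toReal_add hf.2.ne hg.2.ne]
  exact toReal_mono (ENNReal.add_ne_top.2 ⟨hf.2.ne, hg.2.ne⟩) (eLpNorm_add_le hf.1 hg.1 hp)

lemma memLp_mul_four_four {u v : R4 → ℝ} (hu : MemLp u 4) (hv : MemLp v 4) :
    MemLp (fun x => u x*v x) 2 := MemLp.mul hv hu

lemma memLp_sq_four {u : R4 → ℝ} (hu : MemLp u 4) : MemLp (fun x => u x^2) 2 := by
  simpa only [sq] using memLp_mul_four_four hu hu

lemma integrable_mul_mul {u v : R4 → ℝ} (hW : MemLp W 2) (hu : MemLp u 4) (hv : MemLp v 4) :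
    Integrable (fun x => W x*(u x*v x)) :=
  memLp_one_iff_integrable.1 (MemLp.mul (memLp_mul_four_four hu hv) hW)

lemma integral_abs_mul_le {g : R4 → ℝ} {p q : ℝ≥0∞} [ENNReal.HolderTriple p q 1]
    (hf : MemLp f p) (hg : MemLp g q) : ∫ x, |f x*g x| ≤ nrm p f*nrm q g := by
  have h1 : eLpNorm (f • g) 1 volume ≤ eLpNorm f p volume*eLpNorm g q volume :=
    eLpNorm_smul_le_mul_eLpNorm hg.1 hf.1
  have h2 : Integrable (fun x => f x*g x) := memLp_one_iff_integrable.1 (MemLp.mul hg hf)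
  have h3 : ∫ x, |f x*g x| = (eLpNorm (f • g) 1 volume).toReal := by
    rw [eLpNorm_one_eq_lintegral_enorm]
    exact integral_norm_eq_lintegral_enorm h2.1
  rw [h3, nrm, nrm, ← toReal_mul]
  exact toReal_mono (mul_ne_top hf.2.ne hg.2.ne) h1

lemma nrm_mul_four_four_le {u v : R4 → ℝ} (hu : MemLp u 4) (hv : MemLp v 4) :
    nrm 2 (fun x => u x*v x) ≤ nrm 4 u*nrm 4 v := by
  have h1 : eLpNorm (u • v) 2 volume ≤ eLpNorm u 4 volume*eLpNorm v 4 volume :=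
    eLpNorm_smul_le_mul_eLpNorm hv.1 hu.1
  rw [nrm, nrm, nrm, ← toReal_mul]
  exact toReal_mono (mul_ne_top hu.2.ne hv.2.ne) h1

lemma integral_abs_mul_mul_le {u v : R4 → ℝ} (hW : MemLp W 2) (hu : MemLp u 4)
    (hv : MemLp v 4) : ∫ x, |W x*(u x*v x)| ≤ nrm 2 W*(nrm 4 u*nrm 4 v) :=
  (integral_abs_mul_le hW (memLp_mul_four_four hu hv)).trans
    (mul_le_mul_of_nonneg_left (nrm_mul_four_four_le hu hv) (nrm_nonneg _ _))

/-- An `L²` potential is, up to a small `L²` part, bounded with bounded support. -/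
lemma exists_integral_abs_mul_sq_le (hW : MemLp W 2) {τ : ℝ} (hτ : 0 < τ) :
    ∃ M : ℝ, 0 ≤ M ∧ ∀ f : R4 → ℝ, MemLp f 4 →
      ∫ x, |W x| *f x^2 ≤ M*(∫ x in closedBall 0 M, f x^2) + τ*nrm 4 f^2 := by
  set S : ℕ → Set R4 := fun n => {x | |W x| ≤ n} ∩ closedBall 0 n with hS
  have hSm : ∀ n, NullMeasurableSet (S n) volume := fun n =>
    (nullMeasurableSet_le hW.1.norm.aemeasurable aemeasurable_const).inter
      measurableSet_closedBall.nullMeasurableSet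
  have hlim : Tendsto (fun n => eLpNorm ((S n)ᶜ.indicator W) 2) atTop (𝓝 0) := by
    refine tendsto_eLpNorm_of_dominated num! num! (b := fun x => ‖W x‖)
      (fun n => hW.1.indicator₀ (hSm n).compl) hW.norm
      (.of_forall fun n => .of_forall fun x => norm_indicator_le_norm_self _ _)
      (.of_forall fun x => ?_)
    refine tendsto_const_nhds.congr' ?_
    obtain ⟨N, hN⟩ := exists_nat_ge (max |W x| ‖x‖)
    filter_upwards [eventually_ge_atTop N] with n hn
    have hn' : (N : ℝ) ≤ n := by exact_mod_cast hn
    rw [indicator_of_notMem]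
    simp only [hS, Set.mem_compl_iff, not_not, Set.mem_inter_iff, Set.mem_ofPred_eq, mem_closedBall_zero_iff]
    exact ⟨(le_max_left _ _).trans (hN.trans hn'), (le_max_right _ _).trans (hN.trans hn')⟩
  obtain ⟨n, hn⟩ := (hlim.eventually (gt_mem_nhds (ENNReal.ofReal_pos.2 hτ))).exists
  have hW1 : MemLp ((S n)ᶜ.indicator W) 2 := ⟨hW.1.indicator₀ (hSm n).compl, hn.trans ofReal_lt_top⟩
  have hW1n : nrm 2 ((S n)ᶜ.indicator W) ≤ τ := by rw [nrm]; exact ENNReal.toReal_le_of_le_ofReal hτ.le hn.le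
  refine ⟨n, pos!, fun f hf => ?_⟩
  have hf2 : MemLp (fun x => f x^2) 2 := memLp_sq_four hf
  have hfl : IntegrableOn (fun x => f x^2) (closedBall 0 (n : ℝ)) :=
    (hf2.locallyIntegrable num!).integrableOn_isCompact (isCompact_closedBall _ _)
  have hi2 : Integrable (fun x => |(S n)ᶜ.indicator W x*(f x*f x)|) := (integrable_mul_mul hW1 hf hf).abs
  have hi1 : Integrable ((closedBall (0 : R4) n).indicator fun x => (n : ℝ)*f x^2) :=
    IntegrableOn.integrable_indicator (hfl.const_mul (n : ℝ)) measurableSet_closedBall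
  calc ∫ x, |W x| *f x^2 ≤ ∫ x, ((closedBall (0 : R4) n).indicator
          (fun x => (n : ℝ)*f x^2) x + |(S n)ᶜ.indicator W x*(f x*f x)|) := by
        refine integral_mono_of_nonneg (.of_forall fun x => pos!) (hi1.add hi2) (.of_forall fun x => ?_)
        show |W x| *f x^2 ≤ (closedBall (0 : R4) n).indicator
          (fun x => (n : ℝ)*f x^2) x + |(S n)ᶜ.indicator W x*(f x*f x)|
        by_cases hx : x ∈ S n
        · rw [indicator_of_mem hx.2, indicator_of_notMem (by! hx)]
          simp only [zero_mul, abs_zero, add_zero]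
          exact mul_le_mul_of_nonneg_right hx.1 (sq_nonneg _)
        · rw [indicator_of_mem (s := (S n)ᶜ) (by! hx), abs_mul, abs_mul_self, ← sq]
          refine le_add_of_nonneg_left (Set.indicator_nonneg (fun y _ => pos!) _)
    _ = n*(∫ x in closedBall 0 (n : ℝ), f x^2)
          + ∫ x, |(S n)ᶜ.indicator W x*(f x*f x)| := by
        rw [integral_add hi1 hi2, integral_indicator measurableSet_closedBall, integral_const_mul]
    _ ≤ _ := by
        refine add_le_add le_rfl ((integral_abs_mul_mul_le hW1 hf hf).trans ?_)
        rw [← sq]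
        exact mul_le_mul_of_nonneg_right hW1n (sq_nonneg _)

/-! ### The Hilbert space `H¹(ℝ⁴)` -/

lemma memLp_ofReal_test {ψ : R4 → ℝ} (hψ : Continuous ψ) (hc : HasCompactSupport ψ) :
    MemLp (fun x => (ψ x : ℂ)) 2 :=
  (hψ.memLp_of_hasCompactSupport hc).ofReal

lemma inner_test_eq {ψ : R4 → ℝ} (hψ : Continuous ψ) (hc : HasCompactSupport ψ) (u : L2R4) :
    inner ℂ ((memLp_ofReal_test hψ hc).toLp _) u = ∫ x, ψ x • u x := by
  rw [L2.inner_def]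
  refine integral_congr_ae ?_
  filter_upwards [(memLp_ofReal_test hψ hc).coeFn_toLp] with x hx
  rw [hx]
  simp [mul_comm]

lemma continuous_fderiv_apply_test {z : R4 → ℝ} (hz : ContDiff ℝ ∞ z) (v : R4) :
    Continuous fun x => fderiv ℝ z x v :=
  (hz.continuous_fderiv (by simp)).clm_apply continuous_const

lemma hasWeakPartial_L2_iff (i : Fin 4) (u g : L2R4) :
    HasWeakPartial i (⇑u) (⇑g) ↔ ∀ (z : R4 → ℝ) (hz : ContDiff ℝ ∞ z) (hc : HasCompactSupport z),
      inner ℂ ((memLp_ofReal_test (continuous_fderiv_apply_test hz (single i 1))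
        (hc.fderiv_apply (𝕜 := ℝ) _)).toLp _) u
      + inner ℂ ((memLp_ofReal_test hz.continuous hc).toLp _) g = 0 := by
  refine ⟨fun h z hz hc => ?_, fun h => ⟨MemLp.locallyIntegrable_two (Lp.memLp u),
    MemLp.locallyIntegrable_two (Lp.memLp g), fun z hz hc => ?_⟩⟩
  · rw [inner_test_eq (continuous_fderiv_apply_test hz _) (hc.fderiv_apply (𝕜 := ℝ) _) u,
      inner_test_eq hz.continuous hc g, h.2.2 z hz hc, neg_add_cancel]
  · have := h z hz hc
    rw [inner_test_eq (continuous_fderiv_apply_test hz _) (hc.fderiv_apply (𝕜 := ℝ) _) u,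
      inner_test_eq hz.continuous hc g] at this
    exact eq_neg_of_add_eq_zero_left this

/-- `H¹(ℝ⁴)` as a space of tuples `(u, ∂₀u, …, ∂₃u)`. -/
def H1space : Submodule ℂ (PiLp 2 fun _ : Option (Fin 4) => L2R4) where
  carrier := {p | ∀ i : Fin 4, HasWeakPartial i (⇑(p none)) (⇑(p (some i)))}
  zero_mem' := fun i => by rw [hasWeakPartial_L2_iff]; intros; simp
  add_mem' := fun {p q} hp hq i => by
    have h1 := (hasWeakPartial_L2_iff i _ _).1 (hp i)
    have h2 := (hasWeakPartial_L2_iff i _ _).1 (hq i)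
    rw [hasWeakPartial_L2_iff]
    intro z hz hc
    simp only [PiLp.add_apply, inner_add_right]
    linear_combination h1 z hz hc + h2 z hz hc
  smul_mem' := fun c p hp i => by
    have h1 := (hasWeakPartial_L2_iff i _ _).1 (hp i)
    rw [hasWeakPartial_L2_iff]
    intro z hz hc
    simp only [PiLp.smul_apply, inner_smul_right]
    linear_combination c*h1 z hz hc

lemma H1space_isClosed : IsClosed (H1space : Set (PiLp 2 fun _ : Option (Fin 4) => L2R4)) := by
  have : (H1space : Set (PiLp 2 fun _ : Option (Fin 4) => L2R4))
      = ⋂ (i : Fin 4) (z : R4 → ℝ) (hz : ContDiff ℝ ∞ z) (hc : HasCompactSupport z),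
        {p | inner ℂ ((memLp_ofReal_test (continuous_fderiv_apply_test hz
            (single i 1)) (hc.fderiv_apply (𝕜 := ℝ) _)).toLp _) (p none)
          + inner ℂ ((memLp_ofReal_test hz.continuous hc).toLp _) (p (some i)) = 0} := by
    ext p
    simp only [Set.mem_iInter, Set.mem_ofPred_eq]
    exact forall_congr' fun i => hasWeakPartial_L2_iff i _ _
  rw [this]
  refine isClosed_iInter fun i => isClosed_iInter fun z => isClosed_iInter fun hz =>
    isClosed_iInter fun hc => isClosed_eq ?_ continuous_const
  fun_prop

instance : CompleteSpace H1space := H1space_isClosed.completeSpace_coe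

lemma memH1_iff (u : L2R4) : MemH1 u ↔ ∃ p : H1space, p.1 none = u := by
  constructor
  · intro h
    choose g hg using h
    exact ⟨⟨WithLp.toLp 2 (fun o => o.elim u g), fun i => hg i⟩, rfl⟩
  · rintro ⟨p, rfl⟩ i
    exact ⟨_, p.2 i⟩

lemma weakPartial_H1space (p : H1space) (i : Fin 4) :
    weakPartial i (p.1 none) = p.1 (some i) := weakPartial_eq (p.2 i)

lemma H1space_norm_sq (p : H1space) :
    ‖p‖^2 = ‖p.1 none‖^2 + ∑ i, ‖p.1 (some i)‖^2 := by
  rw [Submodule.coe_norm, PiLp.norm_sq_eq_of_L2, Fintype.sum_option]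

lemma memLp_four_of_H1space (p : H1space) : MemLp (⇑(p.1 none)) 4 := by
  refine ⟨(Lp.memLp _).1, ?_⟩
  refine (sobolev_H1 (Lp.memLp _) (fun j => Lp.memLp (p.1 (some j))) p.2).trans_lt ?_
  exact ENNReal.mul_lt_top ENNReal.coe_lt_top (ENNReal.sum_lt_top.2 fun j _ => Lp.eLpNorm_lt_top _)

lemma nrm_four_H1space_le (p : H1space) :
    nrm 4 (⇑(p.1 none)) ≤ sobC ℂ*∑ j, ‖p.1 (some j)‖ := by
  have h := sobolev_H1 (Lp.memLp _) (fun j => Lp.memLp (p.1 (some j))) p.2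
  have hfin : ∀ j ∈ univ, eLpNorm (⇑(p.1 (some j))) 2 volume ≠ ⊤ := fun j _ => Lp.eLpNorm_ne_top _
  have := toReal_mono (mul_ne_top coe_ne_top (ENNReal.sum_ne_top.2 hfin)) h
  rw [toReal_mul, ENNReal.toReal_sum hfin] at this
  simpa [nrm, Lp.norm_def] using this

lemma nrm_four_H1space_sq_le (p : H1space) :
    nrm 4 (⇑(p.1 none))^2 ≤ 4*(sobC ℂ : ℝ)^2*∑ j, ‖p.1 (some j)‖^2 := by
  have h1 := pow_le_pow_left₀ (nrm_nonneg _ _) (nrm_four_H1space_le p) 2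
  refine h1.trans ?_
  rw [mul_pow]
  have h2 := sq_sum_le_card_mul_sum_sq (s := univ) (f := fun j : Fin 4 => ‖p.1 (some j)‖)
  simp only [card_univ, Fintype.card_fin, Nat.cast_ofNat] at h2
  nlinarith [sq_nonneg (sobC ℂ : ℝ)]

lemma integrable_potential (hW : MemLp W 2) (p q : H1space) :
    Integrable (fun x => (W x : ℂ)*(conj (p.1 none x)*q.1 none x)) := by
  have h := integrable_mul_mul hW (memLp_four_of_H1space p).norm (memLp_four_of_H1space q).norm
  refine h.mono ?_ (.of_forall fun x => ?_)
  · refine (Complex.measurable_ofReal.comp_aemeasurable hW.1.aemeasurable).aestronglyMeasurable.mul ?_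
    exact (RCLike.continuous_conj.comp_aestronglyMeasurable (Lp.memLp (p.1 none)).1).mul (Lp.memLp (q.1 none)).1
  · simp

lemma norm_potential_le (hW : MemLp W 2) (p q : H1space) : ‖∫ x, (W x : ℂ)*(conj (p.1 none x)*q.1 none x)‖
      ≤ nrm 2 W*(nrm 4 (⇑(p.1 none))*nrm 4 (⇑(q.1 none))) := by
  refine (norm_integral_le_integral_norm _).trans ?_
  have h := integral_abs_mul_mul_le hW (memLp_four_of_H1space p).norm (memLp_four_of_H1space q).norm
  simp only [nrm_norm] at h
  refine le_trans (le_of_eq (integral_congr_ae (.of_forall fun x => ?_))) h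
  simp [abs_mul]

lemma nrm_four_le_norm (p : H1space) : nrm 4 (⇑(p.1 none)) ≤ 4*sobC ℂ*‖p‖ := by
  refine (nrm_four_H1space_le p).trans ?_
  have : ∑ j, ‖p.1 (some j)‖ ≤ ∑ _j : Fin 4, ‖p‖ := sum_le_sum fun j _ => PiLp.norm_apply_le p.1 (some j)
  simp only [sum_const, card_univ, Fintype.card_fin, nsmul_eq_mul, Nat.cast_ofNat] at this
  calc (sobC ℂ : ℝ)*∑ j, ‖p.1 (some j)‖ ≤ sobC ℂ*(4*‖p‖) := by gcongr
    _ = _ := by ring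

/-- The form of `P² + W - E` on `H¹`. -/
def shiftedForm {W : R4 → ℝ} (hW : MemLp W 2) (E : ℝ) : H1space →L⋆[ℂ] H1space →L[ℂ] ℂ :=
  LinearMap.mkContinuous₂ (LinearMap.mk₂'ₛₗ (starRingEnd ℂ) (RingHom.id ℂ)
      (fun p q : H1space => (∑ i : Fin 4, inner ℂ (p.1 (some i)) (q.1 (some i)))
        + (∫ x, (W x : ℂ)*(conj (p.1 none x)*q.1 none x))
        - (E : ℂ)*inner ℂ (p.1 none) (q.1 none))
      (fun p p' q => by
        have : ∫ x, (W x : ℂ)*(conj ((p + p').1 none x)*q.1 none x)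
            = (∫ x, (W x : ℂ)*(conj (p.1 none x)*q.1 none x))
              + ∫ x, (W x : ℂ)*(conj (p'.1 none x)*q.1 none x) := by
          rw [← integral_add (integrable_potential hW p q) (integrable_potential hW p' q)]
          refine integral_congr_ae ?_
          filter_upwards [Lp.coeFn_add (p.1 none) (p'.1 none)] with x hx
          have hx' : (p + p').1 none x = p.1 none x + p'.1 none x := hx
          rw [hx', map_add]; ring
        rw [this]
        simp only [Submodule.coe_add, PiLp.add_apply, inner_add_left, sum_add_distrib]
        ring)
      (fun c p q => by
        have : ∫ x, (W x : ℂ)*(conj ((c • p).1 none x)*q.1 none x)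
            = conj c*∫ x, (W x : ℂ)*(conj (p.1 none x)*q.1 none x) := by
          rw [← integral_const_mul]
          refine integral_congr_ae ?_
          filter_upwards [Lp.coeFn_smul c (p.1 none)] with x hx
          have hx' : (c • p).1 none x = c*p.1 none x := hx
          rw [hx', map_mul]; ring
        rw [this]
        simp only [Submodule.coe_smul, PiLp.smul_apply, inner_smul_left, ← mul_sum, smul_eq_mul]
        ring)
      (fun p q q' => by
        have : ∫ x, (W x : ℂ)*(conj (p.1 none x)*(q + q').1 none x)
            = (∫ x, (W x : ℂ)*(conj (p.1 none x)*q.1 none x))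
              + ∫ x, (W x : ℂ)*(conj (p.1 none x)*q'.1 none x) := by
          rw [← integral_add (integrable_potential hW p q) (integrable_potential hW p q')]
          refine integral_congr_ae ?_
          filter_upwards [Lp.coeFn_add (q.1 none) (q'.1 none)] with x hx
          have hx' : (q + q').1 none x = q.1 none x + q'.1 none x := hx
          rw [hx']; ring
        rw [this]
        simp only [Submodule.coe_add, PiLp.add_apply, inner_add_right, sum_add_distrib]
        ring)
      (fun c p q => by
        have : ∫ x, (W x : ℂ)*(conj (p.1 none x)*(c • q).1 none x)
            = c*∫ x, (W x : ℂ)*(conj (p.1 none x)*q.1 none x) := by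
          rw [← integral_const_mul]
          refine integral_congr_ae ?_
          filter_upwards [Lp.coeFn_smul c (q.1 none)] with x hx
          have hx' : (c • q).1 none x = c*q.1 none x := hx
          rw [hx']; ring
        rw [this]
        simp only [Submodule.coe_smul, PiLp.smul_apply, inner_smul_right, ← mul_sum,
          smul_eq_mul, RingHom.id_apply]
        ring))
    (4 + nrm 2 W*(4*sobC ℂ)^2 + |E|) fun p q => by
      rw [LinearMap.mk₂'ₛₗ_apply]
      have h1 : ∀ o : Option (Fin 4), ‖inner ℂ (p.1 o) (q.1 o)‖ ≤ ‖p‖*‖q‖ := fun o =>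
        (norm_inner_le_norm _ _).trans (mul_le_mul (PiLp.norm_apply_le p.1 o)
          (PiLp.norm_apply_le q.1 o) (norm_nonneg _) (norm_nonneg _))
      have h2 : ‖∑ i : Fin 4, inner ℂ (p.1 (some i)) (q.1 (some i))‖ ≤ 4*(‖p‖*‖q‖) := by
        refine (norm_sum_le _ _).trans ((sum_le_sum fun i _ => h1 (some i)).trans ?_)
        simp
      have h3 : ‖∫ x, (W x : ℂ)*(conj (p.1 none x)*q.1 none x)‖
          ≤ nrm 2 W*(4*sobC ℂ)^2*(‖p‖*‖q‖) := by
        refine (norm_potential_le hW p q).trans ?_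
        rw [mul_assoc]
        refine mul_le_mul_of_nonneg_left ?_ (nrm_nonneg _ _)
        refine (mul_le_mul (nrm_four_le_norm p) (nrm_four_le_norm q) (nrm_nonneg _ _)
          pos!).trans (le_of_eq (by ring))
      have h4 : ‖(E : ℂ)*inner ℂ (p.1 none) (q.1 none)‖ ≤ |E| *(‖p‖*‖q‖) := by
        rw [norm_mul, norm_real, norm_eq_abs]
        exact mul_le_mul_of_nonneg_left (h1 none) (abs_nonneg _)
      refine (norm_sub_le _ _).trans ((add_le_add ((norm_add_le _ _).trans
        (add_le_add h2 h3)) h4).trans (le_of_eq (by ring)))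

lemma shiftedForm_apply (hW : MemLp W 2) (E : ℝ) (p q : H1space) : shiftedForm hW E p q
      = schrodingerForm W (p.1 none) (q.1 none) - (E : ℂ)*inner ℂ (p.1 none) (q.1 none) := by
  simp only [schrodingerForm, weakPartial_H1space]
  rfl

lemma schrodingerForm_conj (W : R4 → ℝ) (u v : L2R4) :
    conj (schrodingerForm W u v) = schrodingerForm W v u := by
  simp only [schrodingerForm, map_add, map_sum, inner_conj_symm]
  rw [← integral_conj]
  congr 2
  funext x
  simp [mul_comm]

lemma schrodingerForm_self (W : R4 → ℝ) (u : L2R4) : schrodingerForm W u u = ((energy W u : ℝ) : ℂ) :=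
  (Complex.conj_eq_iff_re.1 (schrodingerForm_conj W u u)).symm

lemma energy_H1space (W : R4 → ℝ) (p : H1space) :
    energy W (p.1 none) = ∑ i, ‖p.1 (some i)‖^2 + ∫ x, W x*‖p.1 none x‖^2 := by
  have h : schrodingerForm W (p.1 none) (p.1 none)
      = ((∑ i, ‖p.1 (some i)‖^2 + ∫ x, W x*‖p.1 none x‖^2 : ℝ) : ℂ) := by
    simp only [schrodingerForm, weakPartial_H1space, inner_self_eq_norm_sq_to_K]
    push_cast
    congr 1
    rw [← integral_complex_ofReal]
    congr 1
    funext x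
    push_cast
    rw [← Complex.conj_mul']
  rw [energy, h, Complex.ofReal_re]

lemma energy_H1space_ge (hW : MemLp W 2) : ∃ C : ℝ, 0 ≤ C ∧ ∀ p : H1space,
      1/2*∑ i, ‖p.1 (some i)‖^2 - C*‖p.1 none‖^2 ≤ energy W (p.1 none) := by
  obtain ⟨M, hM, hb⟩ := exists_integral_abs_mul_sq_le hW (τ := (8*(sobC ℂ : ℝ)^2 + 1)⁻¹) pos!
  refine ⟨M, hM, fun p => ?_⟩
  have h4 := (memLp_four_of_H1space p).norm
  have h1 := hb _ h4
  rw [nrm_norm] at h1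
  have h2 : ∫ x in closedBall 0 M, ‖p.1 none x‖^2 ≤ ‖p.1 none‖^2 := by
    have e : ‖p.1 none‖^2 = ∫ x, ‖p.1 none x‖^2 := by
      have := inner_self_eq_norm_sq_to_K (𝕜 := ℂ) (p.1 none)
      rw [L2.inner_def] at this
      simp only [inner_self_eq_norm_sq_to_K] at this
      have e2 : ((∫ x, ‖p.1 none x‖^2 : ℝ) : ℂ) = ((‖p.1 none‖^2 : ℝ) : ℂ) := by
        rw [← integral_complex_ofReal]
        push_cast
        exact this
      exact_mod_cast e2.symm
    rw [e]
    refine setIntegral_le_integral ?_ (.of_forall fun x => pos!)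
    exact (memLp_two_iff_integrable_sq_norm (Lp.memLp (p.1 none)).1).1 (Lp.memLp _)
  have h3 : -(∫ x, |W x| *‖p.1 none x‖^2) ≤ ∫ x, W x*‖p.1 none x‖^2 := by
    rw [← integral_neg]
    have hi : Integrable (fun x => W x*‖p.1 none x‖^2) := by simpa only [sq] using integrable_mul_mul hW h4 h4
    refine integral_mono (by simpa [abs_mul] using hi.abs.neg) hi fun x => ?_
    have := neg_abs_le (W x)
    nlinarith [sq_nonneg ‖p.1 none x‖]
  have h5 : (8*(sobC ℂ : ℝ)^2 + 1)⁻¹*nrm 4 (⇑(p.1 none))^2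
      ≤ 1/2*∑ i, ‖p.1 (some i)‖^2 := by
    have hs : 0 ≤ ∑ i, ‖p.1 (some i)‖^2 := sum_nonneg fun i _ => sq_nonneg _
    rw [inv_mul_le_iff₀ pos!]
    have := nrm_four_H1space_sq_le p
    nlinarith
  rw [energy_H1space]
  nlinarith [mul_le_mul_of_nonneg_left h2 hM]

/-- If the form of `P² + W` is nonnegative then no negative number is in the spectrum. -/
lemma notMem_spectrum_of_nonneg (hW : MemLp W 2)
    (hpos : ∀ p : H1space, 0 ≤ energy W (p.1 none)) {E : ℝ} (hE : E < 0) :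
    (E : ℂ) ∉ schrodingerSpectrum W := by
  obtain ⟨C, hC, hCb⟩ := energy_H1space_ge hW
  set A := InnerProductSpace.continuousLinearMapOfBilin (shiftedForm hW E)
  have hAin : ∀ p q : H1space, inner ℂ (A p) q = shiftedForm hW E p q := fun p q =>
    InnerProductSpace.continuousLinearMapOfBilin_apply _ _ _
  set t : ℝ := min 1 (-E/(2*(C + 1)))
  have htpos : 0 < t := lt_min one_pos (div_pos lin! pos!)
  have ht1 : t ≤ 1 := min_le_left _ _
  have htC : t*C ≤ -E/2 := by
    have : t ≤ -E/(2*(C + 1)) := min_le_right _ _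
    rw [le_div_iff₀ pos!] at this
    nlinarith
  have hcoer : ∀ p : H1space, ‖p‖^2*min (t/2) (-E/2) ≤ ‖inner ℂ (A p) p‖ := fun p => by
    have e1 : inner ℂ (A p) p = ((energy W (p.1 none) - E*‖p.1 none‖^2 : ℝ) : ℂ) := by
      rw [hAin, shiftedForm_apply, schrodingerForm_self, inner_self_eq_norm_sq_to_K]
      push_cast; rfl
    rw [e1, norm_real, norm_eq_abs]
    refine le_trans ?_ (le_abs_self _)
    rw [H1space_norm_sq]
    have h1 := hCb p
    have h0 := hpos p
    have hs : 0 ≤ ∑ i, ‖p.1 (some i)‖^2 := sum_nonneg fun i _ => sq_nonneg _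
    have hn : 0 ≤ ‖p.1 none‖^2 := sq_nonneg _
    have m1 := min_le_left (t/2) (-E/2)
    have m2 := min_le_right (t/2) (-E/2)
    nlinarith [mul_le_mul_of_nonneg_left h1 htpos.le, mul_le_mul_of_nonneg_right m1 hs,
      mul_le_mul_of_nonneg_right m2 hn, mul_le_mul_of_nonneg_right htC hn,
      mul_nonneg (sub_nonneg.2 ht1) h0]
  have hc0 : 0 < min (t/2) (-E/2) := lt_min pos! lin!
  have hunit : IsUnit A := ContinuousLinearMap.isUnit_of_forall_le_norm_inner_map A
    (c := ⟨min (t/2) (-E/2), hc0.le⟩) hc0 hcoer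
  obtain ⟨Au, hAu⟩ := hunit
  let J : H1space →L[ℂ] L2R4 :=
    (PiLp.proj 2 (fun _ : Option (Fin 4) => L2R4) none : _ →L[ℂ] L2R4).comp H1space.subtypeL
  have hJ : ∀ p, J p = p.1 none := fun p => rfl
  have hinv1 : ∀ p, (↑Au⁻¹ : H1space →L[ℂ] H1space) (A p) = p := fun p => by
    have := congrArg (fun T : H1space →L[ℂ] H1space => T p) Au.inv_mul
    simpa [hAu] using this
  have hinv2 : ∀ p, A ((↑Au⁻¹ : H1space →L[ℂ] H1space) p) = p := fun p => by
    have := congrArg (fun T : H1space →L[ℂ] H1space => T p) Au.mul_inv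
    simpa [hAu] using this
  have hgraph : ∀ (p : H1space) (f : L2R4), SchrodingerGraph W (p.1 none) (f + (E : ℂ) • p.1 none) ↔
      A p = ContinuousLinearMap.adjoint J f := fun p f => by
    have key : ∀ q : H1space, schrodingerForm W (q.1 none) (p.1 none)
        = inner ℂ (q.1 none) (f + (E : ℂ) • p.1 none) ↔
        inner ℂ (A p) q = inner ℂ (ContinuousLinearMap.adjoint J f) q := fun q => by
      rw [ContinuousLinearMap.adjoint_inner_left, hAin, shiftedForm_apply, hJ,
        ← schrodingerForm_conj W (q.1 none), ← inner_conj_symm (p.1 none) (q.1 none),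
        ← inner_conj_symm f (q.1 none), inner_add_right, inner_smul_right]
      constructor
      · intro h
        rw [h]
        simp
      · intro h
        have := congrArg conj h
        simp only [map_sub, map_mul, Complex.conj_conj, Complex.conj_ofReal] at this
        linear_combination this
    constructor
    · rintro ⟨-, h⟩
      refine ext_inner_right ℂ fun q => (key q).1 (h _ ((memH1_iff _).2 ⟨q, rfl⟩))
    · intro h
      refine ⟨(memH1_iff _).2 ⟨p, rfl⟩, fun v hv => ?_⟩
      obtain ⟨q, rfl⟩ := (memH1_iff v).1 hv
      exact (key q).2 (by rw [h])
  simp only [schrodingerSpectrum, Set.mem_ofPred_eq, not_not]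
  refine ⟨J.comp ((↑Au⁻¹ : H1space →L[ℂ] H1space).comp (ContinuousLinearMap.adjoint J)),
    fun u f => ⟨fun h => ?_, fun h => ?_⟩⟩
  · obtain ⟨p, rfl⟩ := (memH1_iff u).1 h.1
    have := (hgraph p f).1 h
    simp only [ContinuousLinearMap.comp_apply]
    rw [← this, hinv1, hJ]
  · simp only [ContinuousLinearMap.comp_apply, hJ] at h
    rw [h]
    exact (hgraph _ f).2 (hinv2 _)

/-- The element of `H¹` given by a function and its weak partial derivatives. -/
def mkH1 {f : R4 → ℂ} {g : Fin 4 → R4 → ℂ} (hf : MemLp f 2) (hg : ∀ j, MemLp (g j) 2)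
    (hw : ∀ j, HasWeakPartial j f (g j)) : H1space :=
  ⟨WithLp.toLp 2 (fun o => o.elim (hf.toLp f) (fun j => (hg j).toLp (g j))), fun i =>
    (hw i).congr_ae hf.coeFn_toLp.symm (hg i).coeFn_toLp.symm⟩

lemma mkH1_none {f : R4 → ℂ} {g : Fin 4 → R4 → ℂ} (hf : MemLp f 2) (hg : ∀ j, MemLp (g j) 2)
    (hw : ∀ j, HasWeakPartial j f (g j)) : (mkH1 hf hg hw).1 none = hf.toLp f := rfl

lemma mkH1_some {f : R4 → ℂ} {g : Fin 4 → R4 → ℂ} (hf : MemLp f 2) (hg : ∀ j, MemLp (g j) 2)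
    (hw : ∀ j, HasWeakPartial j f (g j)) (j : Fin 4) :
    (mkH1 hf hg hw).1 (some j) = (hg j).toLp (g j) := rfl

lemma norm_toLp_sq {f : R4 → ℂ} (hf : MemLp f 2) : ‖hf.toLp f‖^2 = ∫ x, ‖f x‖^2 := by
  have := inner_self_eq_norm_sq_to_K (𝕜 := ℂ) (hf.toLp f)
  rw [L2.inner_def] at this
  have e2 : ((∫ x, ‖f x‖^2 : ℝ) : ℂ) = ((‖hf.toLp f‖^2 : ℝ) : ℂ) := by
    rw [← integral_complex_ofReal]
    push_cast
    refine Eq.trans (integral_congr_ae ?_) this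
    filter_upwards [hf.coeFn_toLp] with x hx
    rw [hx, inner_self_eq_norm_sq_to_K]; rfl
  exact_mod_cast e2.symm

lemma energy_mkH1 (W : R4 → ℝ) {f : R4 → ℂ} {g : Fin 4 → R4 → ℂ} (hf : MemLp f 2)
    (hg : ∀ j, MemLp (g j) 2) (hw : ∀ j, HasWeakPartial j f (g j)) :
    energy W (hf.toLp f) = ∑ j, (∫ x, ‖g j x‖^2) + ∫ x, W x*‖f x‖^2 := by
  have h := energy_H1space W (mkH1 hf hg hw)
  simp only [mkH1_none, mkH1_some, norm_toLp_sq] at h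
  rw [h]
  congr 1
  refine integral_congr_ae ?_
  filter_upwards [hf.coeFn_toLp] with x hx
  rw [hx]

lemma continuous_pd {f : R4 → F} (hf : ContDiff ℝ 1 f) (j : Fin 4) : Continuous (pd j f) :=
  (hf.continuous_fderiv one_ne_zero).clm_apply continuous_const

lemma hasCompactSupport_pd {f : R4 → F} (hf : HasCompactSupport f) (j : Fin 4) : HasCompactSupport (pd j f) :=
  hf.fderiv_apply (𝕜 := ℝ) _

lemma memLp_of_contDiff {f : R4 → F} (hf : ContDiff ℝ 1 f) (hc : HasCompactSupport f) (p : ℝ≥0∞) : MemLp f p :=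
  hf.continuous.memLp_of_hasCompactSupport hc

lemma memLp_pd {f : R4 → F}
    (hf : ContDiff ℝ 1 f) (hc : HasCompactSupport f) (j : Fin 4) (p : ℝ≥0∞) : MemLp (pd j f) p :=
  (continuous_pd hf j).memLp_of_hasCompactSupport (hasCompactSupport_pd hc j)

/-- The quadratic form of `P² + W` on real `C_c¹` functions. -/
def qf (W f : R4 → ℝ) : ℝ := ∑ j, (∫ x, pd j f x^2) + ∫ x, W x*f x^2

lemma HasWeakPartial.ofReal {n : ℕ} {i : Fin n} {f g : EuclideanSpace ℝ (Fin n) → ℝ}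
    (h : HasWeakPartial i f g) : HasWeakPartial i (fun x => (f x : ℂ)) (fun x => (g x : ℂ)) := by
  refine ⟨?_, ?_, fun z hz hc => ?_⟩
  · intro x
    obtain ⟨s, hs, hi⟩ := h.1 x
    exact ⟨s, hs, hi.ofReal⟩
  · intro x
    obtain ⟨s, hs, hi⟩ := h.2.1 x
    exact ⟨s, hs, hi.ofReal⟩
  · have := congrArg (fun r : ℝ => (r : ℂ)) (h.2.2 z hz hc)
    simp only [smul_eq_mul] at this
    push_cast [← integral_complex_ofReal] at this
    simpa using this

lemma qf_nonneg_of_energy_nonneg (hpos : ∀ u : L2R4, MemH1 u → 0 ≤ energy W u)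
    (hf : ContDiff ℝ 1 f) (hc : HasCompactSupport f) : 0 ≤ qf W f := by
  have h1 : MemLp (fun x => (f x : ℂ)) 2 := (memLp_of_contDiff hf hc 2).ofReal
  have h2 : ∀ j, MemLp (fun x => ((pd j f x : ℝ) : ℂ)) 2 := fun j => (memLp_pd hf hc j 2).ofReal
  have h3 : ∀ j, HasWeakPartial j (fun x => (f x : ℂ)) (fun x => ((pd j f x : ℝ) : ℂ)) := fun j =>
    (HasWeakPartial.of_contDiff hf).ofReal
  have h4 := hpos _ ((memH1_iff _).2 ⟨mkH1 h1 h2 h3, mkH1_none h1 h2 h3⟩)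
  rw [energy_mkH1 W h1 h2 h3] at h4
  simpa [qf] using h4

lemma continuous_energy_H1space (hW : MemLp W 2) :
    Continuous fun p : H1space => energy W (p.1 none) := by
  have h : (fun p : H1space => energy W (p.1 none)) = fun p => (shiftedForm hW 0 p p).re := by
    funext p
    rw [shiftedForm_apply, schrodingerForm_self]; simp
  rw [h]
  exact Complex.continuous_re.comp ((shiftedForm hW 0).continuous.clm_apply continuous_id)

lemma exists_complex_qf_neg (hW : MemLp W 2) {p : H1space} (hp : energy W (p.1 none) < 0) :
    ∃ f : R4 → ℂ, ContDiff ℝ ∞ f ∧ HasCompactSupport f ∧ ∑ j, (∫ x, ‖pd j f x‖^2) + ∫ x, W x*‖f x‖^2 < 0 := by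
  obtain ⟨f, hf, hfu, hfg⟩ := exists_contDiff_approx (Lp.memLp _) (fun j => Lp.memLp (p.1 (some j))) p.2
  have hf1 : ∀ n, ContDiff ℝ 1 (f n) := fun n => (hf n).1.of_le (by simp)
  have h1 : ∀ n, MemLp (f n) 2 := fun n => memLp_of_contDiff (hf1 n) (hf n).2 2
  have h2 : ∀ n j, MemLp (pd j (f n)) 2 := fun n j => memLp_pd (hf1 n) (hf n).2 j 2
  have h3 : ∀ n j, HasWeakPartial j (f n) (pd j (f n)) := fun n j => HasWeakPartial.of_contDiff (hf1 n)
  set P : ℕ → H1space := fun n => mkH1 (h1 n) (h2 n) (h3 n) with hP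
  have hlim : Tendsto P atTop (𝓝 p) := by
    rw [tendsto_iff_norm_sub_tendsto_zero]
    have hsq : Tendsto (fun n => ‖P n - p‖^2) atTop (𝓝 0) := by
      have e : ∀ n, ‖P n - p‖^2 = (eLpNorm (f n - ⇑(p.1 none)) 2).toReal^2
          + ∑ j, (eLpNorm (pd j (f n) - ⇑(p.1 (some j))) 2).toReal^2 := fun n => by
        rw [H1space_norm_sq]
        have aux : ∀ (v : R4 → ℂ) (hv : MemLp v 2 (volume : Measure R4)) (u : L2R4),
            ‖hv.toLp v - u‖ = (eLpNorm (v - ⇑u) 2 volume).toReal := fun v hv u => by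
          rw [Lp.norm_def]
          congr 1
          refine eLpNorm_congr_ae ?_
          filter_upwards [Lp.coeFn_sub (hv.toLp v) u, hv.coeFn_toLp] with x hx hx'
          rw [hx, Pi.sub_apply, Pi.sub_apply, hx']
        rw [← aux _ (h1 n)]
        refine congrArg₂ _ rfl (sum_congr rfl fun j _ => ?_)
        rw [← aux _ (h2 n j)]
        rfl
      simp_rw [e]
      have t1 : Tendsto (fun n => (eLpNorm (f n - ⇑(p.1 none)) 2).toReal^2) atTop (𝓝 0) := by
        have := ((tendsto_toReal zero_ne_top).comp hfu).pow 2
        simpa [comp_def] using this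
      have t2 : ∀ j, Tendsto (fun n => (eLpNorm (pd j (f n) - ⇑(p.1 (some j))) 2).toReal^2)
          atTop (𝓝 0) := fun j => by
        have := ((tendsto_toReal zero_ne_top).comp (hfg j)).pow 2
        simpa [comp_def] using this
      simpa using t1.add (tendsto_finsetSum univ fun j _ => t2 j)
    have := hsq.sqrt
    simpa [sqrt_sq (norm_nonneg _)] using this
  have hlim2 := ((continuous_energy_H1space hW).tendsto p).comp hlim
  obtain ⟨n, hn⟩ := (hlim2.eventually (gt_mem_nhds hp)).exists
  refine ⟨f n, (hf n).1, (hf n).2, ?_⟩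
  simp only [Function.comp_apply, hP, mkH1_none] at hn
  rwa [energy_mkH1 W (h1 n) (h2 n) (h3 n)] at hn

lemma integrable_mul_sq (hW : MemLp W 2) (hf : MemLp f 4) :
    Integrable (fun x => W x*f x^2) := by
  simpa only [sq] using integrable_mul_mul hW hf hf

lemma integrable_pd_sq (hf : ContDiff ℝ 1 f) (hc : HasCompactSupport f) (j : Fin 4) :
    Integrable (fun x => pd j f x^2) :=
  (memLp_pd hf hc j 2).integrable_sq

lemma exists_real_qf_neg (hW : MemLp W 2) {f : R4 → ℂ} (hf : ContDiff ℝ ∞ f) (hc : HasCompactSupport f)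
    (hneg : ∑ j, (∫ x, ‖pd j f x‖^2) + ∫ x, W x*‖f x‖^2 < 0) :
    ∃ a : R4 → ℝ, ContDiff ℝ ∞ a ∧ HasCompactSupport a ∧ qf W a < 0 := by
  set a : R4 → ℝ := fun x => (f x).re
  set b : R4 → ℝ := fun x => (f x).im
  have ha1 : ContDiff ℝ ∞ a := reCLM.contDiff.comp hf
  have hb1 : ContDiff ℝ ∞ b := imCLM.contDiff.comp hf
  have ha2 : HasCompactSupport a := hc.comp_left (g := Complex.re) rfl
  have hb2 : HasCompactSupport b := hc.comp_left (g := Complex.im) rfl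
  have ha3 : ContDiff ℝ 1 a := ha1.of_le (by simp)
  have hb3 : ContDiff ℝ 1 b := hb1.of_le (by simp)
  have hpa : ∀ j x, pd j a x = (pd j f x).re := fun j x => by
    have h := (reCLM.hasFDerivAt (x := f x)).comp x (hf.differentiable (by simp) x).hasFDerivAt
    have h' : fderiv ℝ a x = _ := h.fderiv
    rw [pd, h']; rfl
  have hpb : ∀ j x, pd j b x = (pd j f x).im := fun j x => by
    have h := (imCLM.hasFDerivAt (x := f x)).comp x (hf.differentiable (by simp) x).hasFDerivAt
    have h' : fderiv ℝ b x = _ := h.fderiv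
    rw [pd, h']; rfl
  have hsum : ∑ j, (∫ x, ‖pd j f x‖^2) + ∫ x, W x*‖f x‖^2 = qf W a + qf W b := by
    have e1 : ∀ j, ∫ x, ‖pd j f x‖^2 = (∫ x, pd j a x^2) + ∫ x, pd j b x^2 := fun j => by
      rw [← integral_add (integrable_pd_sq ha3 ha2 j) (integrable_pd_sq hb3 hb2 j)]
      congr 1; funext x
      rw [hpa, hpb, sq_norm, Complex.normSq_apply]; ring
    have e2 : ∫ x, W x*‖f x‖^2 = (∫ x, W x*a x^2) + ∫ x, W x*b x^2 := by
      rw [← integral_add (integrable_mul_sq hW (memLp_of_contDiff ha3 ha2 4))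
        (integrable_mul_sq hW (memLp_of_contDiff hb3 hb2 4))]
      congr 1; funext x
      rw [sq_norm, Complex.normSq_apply]; ring
    simp only [e1, e2, qf, sum_add_distrib]
    ring
  rw [hsum] at hneg
  by_cases h : qf W a < 0
  · exact ⟨a, ha1, ha2, h⟩
  · exact ⟨b, hb1, hb2, lin!⟩

lemma exists_nonneg_qf_neg (hW : MemLp W 2) {a : R4 → ℝ} (ha : ContDiff ℝ ∞ a)
    (hc : HasCompactSupport a) (hneg : qf W a < 0) :
    ∃ v : R4 → ℝ, ContDiff ℝ ∞ v ∧ HasCompactSupport v ∧ (∀ x, 0 ≤ v x) ∧ qf W v < 0 := by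
  have ha1 : ContDiff ℝ 1 a := ha.of_le (by simp)
  set v : ℕ → R4 → ℝ := fun n x => √(a x^2 + (1/s(n))^2) - 1/s(n) with hv
  have hs : ∀ n : ℕ, 0 < 1/s(n) := fun n => pos!
  have hpos : ∀ (n : ℕ) x, 0 < a x^2 + (1/s(n))^2 := fun n x => by have := hs n; positivity
  have hvs : ∀ n, ContDiff ℝ ∞ (v n) := fun n =>
    (((ha.pow 2).add contDiff_const).sqrt fun x => (hpos n x).ne').sub contDiff_const
  have hv0 : ∀ n x, 0 ≤ v n x := fun n x => by
    have := le_sqrt_of_sq_le (show (1/s(n))^2 ≤ a x^2 + (1/s(n))^2 by nlinarith [sq_nonneg (a x)])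
    simp only [hv]; linarith
  have hva : ∀ n x, v n x ≤ |a x| := fun n x => by
    have : √(a x^2 + (1/s(n))^2) ≤ |a x| + 1/s(n) := by
      refine sqrt_le_iff.2 ⟨pos!, ?_⟩
      have := hs n
      have h2 := abs_nonneg (a x)
      nlinarith [sq_abs (a x), mul_nonneg h2 this.le]
    simp only [hv]; linarith
  have hvc : ∀ n, HasCompactSupport (v n) := fun n =>
    hc.mono fun x hx => by
      rw [Function.mem_support] at hx ⊢
      intro h0
      have h1 := hva n x
      rw [h0, abs_zero] at h1
      exact hx (le_antisymm h1 (hv0 n x))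
  have hvp : ∀ n j x, pd j (v n) x^2 ≤ pd j a x^2 := fun n j x => by
    have hd : HasFDerivAt a (fderiv ℝ a x) x := (ha.differentiable (by simp) x).hasFDerivAt
    have h1 := ((hd.pow 2).add_const ((1/s(n))^2)).sqrt (hpos n x).ne'
    have h2 := (h1.sub_const (1/s(n))).fderiv
    have h3 : fderiv ℝ (v n) x = _ := h2
    rw [pd, h3]
    simp only [smul_apply, smul_eq_mul, Nat.cast_ofNat, Nat.add_one_sub_one, pow_one, nsmul_eq_mul]
    show _ ≤ (fderiv ℝ a x (single j 1))^2
    set d := fderiv ℝ a x (single j 1)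
    set S := √(a x^2 + (1/s(n))^2) with hSdef
    have hS : 0 < S := sqrt_pos.2 (hpos n x)
    have hS2 : a x^2 ≤ S^2 := by rw [hSdef, sq_sqrt (hpos n x).le]; nlinarith [sq_nonneg (1/s(n))]
    have e : (1/(2*S)*(2*a x*d))^2 = a x^2/S^2*d^2 := by field_simp
    rw [e]
    exact mul_le_of_le_one_left (sq_nonneg _) ((div_le_one pos!).2 hS2)
  have hlim : Tendsto (fun n => ∫ x, W x*v n x^2) atTop (𝓝 (∫ x, W x*a x^2)) := by
    refine tendsto_integral_of_dominated_convergence (fun x => |W x*a x^2|) (fun n => ?_)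
      (integrable_mul_sq hW (memLp_of_contDiff ha1 hc 4)).abs (fun n => .of_forall fun x => ?_)
      (.of_forall fun x => ?_)
    · exact hW.1.mul ((hvs n).continuous.pow 2).aestronglyMeasurable
    · rw [norm_eq_abs, abs_mul, abs_mul]
      gcongr 1
      rw [abs_of_nonneg (sq_nonneg _), abs_of_nonneg (sq_nonneg _), ← sq_abs (a x)]
      exact pow_le_pow_left₀ (hv0 n x) (hva n x) 2
    · refine Tendsto.const_mul _ ?_
      have t0 := tendsto_one_div_add_atTop_nhds_zero_nat (𝕜 := ℝ)
      have t1 : Tendsto (fun n => v n x) atTop (𝓝 (√(a x^2 + 0^2) - 0)) :=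
        ((tendsto_const_nhds.add (t0.pow 2)).sqrt).sub t0
      have t2 := t1.pow 2
      have e : (√(a x^2 + 0^2) - 0)^2 = a x^2 := by
        rw [sub_zero, zero_pow two_ne_zero, add_zero, sq_sqrt (sq_nonneg _)]
      rwa [e] at t2
  have hlim2 : Tendsto (fun n => ∑ j, (∫ x, pd j a x^2) + ∫ x, W x*v n x^2) atTop
      (𝓝 (qf W a)) := tendsto_const_nhds.add hlim
  obtain ⟨n, hn⟩ := (hlim2.eventually (gt_mem_nhds hneg)).exists
  refine ⟨v n, hvs n, hvc n, hv0 n, lt_of_le_of_lt ?_ hn⟩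
  have hv1 : ContDiff ℝ 1 (v n) := (hvs n).of_le (by simp)
  refine add_le_add (sum_le_sum fun j _ => ?_) le_rfl
  exact integral_mono (integrable_pd_sq hv1 (hvc n) j) (integrable_pd_sq ha1 hc j) (hvp n j)

/-- A virtual level yields nonnegative test functions with negative energy after strengthening. -/
lemma HasVirtualLevel.exists_test {V : R4 → ℝ} (hV : MemLp V 2) (h : HasVirtualLevel V) {e : ℝ}
    (he : 0 < e) : ∃ v : R4 → ℝ, ContDiff ℝ ∞ v ∧ HasCompactSupport v ∧ (∀ x, 0 ≤ v x) ∧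
      qf (fun x => (1 + e)*V x) v < 0 := by
  have hW : MemLp (fun x => (1 + e)*V x) 2 := hV.const_mul _
  obtain ⟨E, hE, hmem⟩ := h.2 e he
  have : ∃ p : H1space, energy (fun x => (1 + e)*V x) (p.1 none) < 0 := by
    by_contra hcon
    push Not at hcon
    exact notMem_spectrum_of_nonneg hW hcon hE hmem
  obtain ⟨p, hp⟩ := this
  obtain ⟨f, hf, hfc, hneg⟩ := exists_complex_qf_neg hW hp
  obtain ⟨a, ha, hac, haneg⟩ := exists_real_qf_neg hW hf hfc hneg
  exact exists_nonneg_qf_neg hW ha hac haneg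

/-- Real `C¹` functions with compact support. -/
structure Test (f : R4 → ℝ) : Prop where
  contDiff : ContDiff ℝ 1 f
  supp : HasCompactSupport f

namespace Test

variable {f g : R4 → ℝ}

lemma diff (hf : Test f) (x : R4) : DifferentiableAt ℝ f x := hf.contDiff.differentiable one_ne_zero x
lemma memLp (hf : Test f) (p : ℝ≥0∞) : MemLp f p := memLp_of_contDiff hf.contDiff hf.supp p
lemma memLp_pd (hf : Test f) (j : Fin 4) (p : ℝ≥0∞) : MemLp (pd j f) p :=
  _root_.memLp_pd hf.contDiff hf.supp j p
lemma add (hf : Test f) (hg : Test g) : Test (fun x => f x + g x) :=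
  ⟨hf.contDiff.add hg.contDiff, hf.supp.add hg.supp⟩
lemma const_mul (hf : Test f) (c : ℝ) : Test (fun x => c*f x) :=
  ⟨contDiff_const.mul hf.contDiff, hf.supp.mul_left⟩
lemma sub (hf : Test f) (hg : Test g) : Test (fun x => f x - g x) := by
  simpa [sub_eq_add_neg] using hf.add (hg.const_mul (-1))
lemma mul_left (hf : Test f) (hg : ContDiff ℝ 1 g) : Test (fun x => g x*f x) :=
  ⟨hg.mul hf.contDiff, hf.supp.mul_left⟩
lemma pd_add (hf : Test f) (hg : Test g) (j : Fin 4) (x : R4) :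
    pd j (fun y => f y + g y) x = pd j f x + pd j g x := by
  simp only [pd]; rw [fderiv_fun_add (hf.diff x) (hg.diff x)]; rfl
lemma pd_sub (hf : Test f) (hg : Test g) (j : Fin 4) (x : R4) :
    pd j (fun y => f y - g y) x = pd j f x - pd j g x := by
  simp only [pd]; rw [fderiv_fun_sub (hf.diff x) (hg.diff x)]; rfl
lemma pd_const_mul (hf : Test f) (c : ℝ) (j : Fin 4) (x : R4) :
    pd j (fun y => c*f y) x = c*pd j f x := by
  simp only [pd]; rw [fderiv_const_mul (hf.diff x)]; rfl
lemma integrable_pd_mul (hf : Test f) (hg : Test g) (j : Fin 4) : Integrable (fun x => pd j f x*pd j g x) :=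
  (hf.memLp_pd j 2).integrable_mul (hg.memLp_pd j 2)

end Test

/-- The Dirichlet integral. -/
def dir (f : R4 → ℝ) : ℝ := ∑ j, ∫ x, pd j f x^2

/-- The bilinear form of `P² + V`. -/
def bf (V f g : R4 → ℝ) : ℝ := ∑ j, (∫ x, pd j f x*pd j g x) + ∫ x, V x*(f x*g x)

lemma dir_nonneg (f : R4 → ℝ) : 0 ≤ dir f := sum_nonneg fun _ _ => integral_nonneg fun _ => sq_nonneg _

lemma qf_eq (V f : R4 → ℝ) : qf V f = dir f + ∫ x, V x*f x^2 := rfl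

lemma qf_add_mul {V g : R4 → ℝ} (hV : MemLp V 2) (hf : Test f) (hg : Test g) (t : ℝ) :
    qf V (fun x => f x + t*g x) = qf V f + 2*t*bf V f g + t^2*qf V g := by
  have e1 : ∀ j, ∫ x, pd j (fun x => f x + t*g x) x^2
      = (∫ x, pd j f x^2) + 2*t*(∫ x, pd j f x*pd j g x) + t^2*∫ x, pd j g x^2 :=
    fun j => by
      have i1 := (hf.memLp_pd j 2).integrable_sq
      have i2 := (hf.integrable_pd_mul hg j).const_mul (2*t)
      have i3 := ((hg.memLp_pd j 2).integrable_sq).const_mul (t^2)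
      rw [← integral_const_mul, ← integral_const_mul, ← integral_add i1 i2, ← integral_add (i1.fun_add i2) i3]
      congr 1; funext x
      rw [hf.pd_add (hg.const_mul t), hg.pd_const_mul]; ring
  have e2 : ∫ x, V x*(f x + t*g x)^2
      = (∫ x, V x*f x^2) + 2*t*(∫ x, V x*(f x*g x)) + t^2*∫ x, V x*g x^2 := by
    have i1 := integrable_mul_sq hV (hf.memLp 4)
    have i2 := (integrable_mul_mul hV (hf.memLp 4) (hg.memLp 4)).const_mul (2*t)
    have i3 := (integrable_mul_sq hV (hg.memLp 4)).const_mul (t^2)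
    rw [← integral_const_mul, ← integral_const_mul, ← integral_add i1 i2, ← integral_add (i1.fun_add i2) i3]
    congr 1; funext x; ring
  simp only [qf, bf, e1, e2, sum_add_distrib, ← mul_sum]
  ring

lemma dir_const_mul (hf : Test f) (c : ℝ) :
    dir (fun x => c*f x) = c^2*dir f := by
  simp only [dir, mul_sum, ← integral_const_mul]
  refine sum_congr rfl fun j _ => ?_
  congr 1; funext x
  rw [hf.pd_const_mul]; ring

lemma dir_sub_le {g : R4 → ℝ} (hf : Test f) (hg : Test g) :
    dir (fun x => f x - g x) ≤ 2*dir f + 2*dir g := by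
  simp only [dir, mul_sum, ← sum_add_distrib]
  refine sum_le_sum fun j _ => ?_
  have i1 := ((hf.memLp_pd j 2).integrable_sq).const_mul 2
  have i2 := ((hg.memLp_pd j 2).integrable_sq).const_mul 2
  rw [← integral_const_mul, ← integral_const_mul, ← integral_add i1 i2]
  refine integral_mono ((hf.sub hg).memLp_pd j 2).integrable_sq (i1.add i2) fun x => ?_
  simp only [hf.pd_sub hg]
  nlinarith [sq_nonneg (pd j f x + pd j g x)]

lemma bf_sq_le {V g : R4 → ℝ} (hV : MemLp V 2) (hpos : ∀ f, Test f → 0 ≤ qf V f) (hf : Test f)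
    (hg : Test g) : bf V f g^2 ≤ qf V f*qf V g := by
  have h : ∀ t : ℝ, 0 ≤ qf V g*(t*t) + 2*bf V f g*t + qf V f := fun t => by
    have := hpos _ (hf.add (hg.const_mul t))
    rw [qf_add_mul hV hf hg] at this
    linarith
  have := discrim_le_zero h
  rw [discrim] at this
  nlinarith

lemma qf_sub_le {V g : R4 → ℝ} (hV : MemLp V 2) (hpos : ∀ f, Test f → 0 ≤ qf V f) (hf : Test f)
    (hg : Test g) : qf V (fun x => f x - g x) ≤ 2*qf V f + 2*qf V g := by
  have h1 := qf_add_mul hV hf hg 1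
  have h2 := qf_add_mul hV hf hg (-1)
  have h3 := hpos _ (hf.add (hg.const_mul 1))
  have e : (fun x => f x - g x) = fun x => f x + (-1)*g x := by funext x; ring
  rw [e, h2]
  rw [h1] at h3
  linarith

lemma nrm_two_sq {F : Type*} [NormedAddCommGroup F] {f : R4 → F} (hf : MemLp f 2) :
    nrm 2 f^2 = ∫ x, ‖f x‖^2 := by
  have h := MemLp.eLpNorm_eq_integral_rpow_norm (p := 2) num! num! hf
  rw [nrm, h, toReal_ofReal pos!]
  simp only [ENNReal.toReal_ofNat, rpow_ofNat]
  rw [← rpow_natCast, ← rpow_mul (integral_nonneg fun x => pos!)]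
  norm_num

lemma nrm_two_sq_real (hf : MemLp f 2) : nrm 2 f^2 = ∫ x, f x^2 := by rw [nrm_two_sq hf]; simp

lemma Test.nrm_fderiv_sq (hf : Test f) : nrm 2 (fderiv ℝ f)^2 = dir f := by
  have h : MemLp (fderiv ℝ f) 2 :=
    (hf.contDiff.continuous_fderiv one_ne_zero).memLp_of_hasCompactSupport (hf.supp.fderiv (𝕜 := ℝ))
  rw [nrm_two_sq h, dir, ← integral_finsetSum _ fun j _ => (hf.memLp_pd j 2).integrable_sq]
  congr 1; funext x
  exact norm_fderiv_sq f x

lemma Test.sobolev (hf : Test f) : nrm 4 f^2 ≤ (sobC ℝ : ℝ)^2*dir f := by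
  have h : MemLp (fderiv ℝ f) 2 :=
    (hf.contDiff.continuous_fderiv one_ne_zero).memLp_of_hasCompactSupport (hf.supp.fderiv (𝕜 := ℝ))
  have h1 : nrm 4 f ≤ sobC ℝ * nrm 2 (fderiv ℝ f) := by
    have := toReal_mono (mul_ne_top coe_ne_top h.2.ne) (sobolev_contDiff hf.contDiff hf.supp)
    simpa [nrm, toReal_mul] using this
  have := pow_le_pow_left₀ (nrm_nonneg _ _) h1 2
  rwa [mul_pow, hf.nrm_fderiv_sq] at this

lemma Test.nrm_pd_sq_le (hf : Test f) (j : Fin 4) : nrm 2 (pd j f)^2 ≤ dir f := by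
  rw [nrm_two_sq_real (hf.memLp_pd j 2)]
  exact single_le_sum (f := fun j => ∫ x, pd j f x^2)
    (fun i _ => integral_nonneg fun x => sq_nonneg _) (mem_univ j)

lemma sq_sub_le_setLIntegral (hf : ContDiff ℝ 1 f) (x y : R4) : ‖f (x - y) - f x‖ₑ^(2 : ℝ)
      ≤ ∫⁻ t in Ioc (0 : ℝ) 1, ofReal (‖y‖^2*‖fderiv ℝ f (x - t • y)‖^2) := by
  set g : ℝ → ℝ := fun t => fderiv ℝ f (x - t • y) (-y)
  have hgc : Continuous g := by
    have : Continuous fun t : ℝ => fderiv ℝ f (x - t • y) :=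
      (hf.continuous_fderiv one_ne_zero).comp (by fun_prop)
    exact this.clm_apply continuous_const
  have hd : ∀ t : ℝ, HasDerivAt (fun t : ℝ => f (x - t • y)) (g t) t := fun t => by
    have h1 : HasDerivAt (fun t : ℝ => x - t • y) (-y) t := by
      simpa using ((hasDerivAt_id t).smul_const y).const_sub x
    exact (hf.differentiable one_ne_zero (x - t • y)).hasFDerivAt.comp_hasDerivAt t h1
  have hftc : ∫ t in (0 : ℝ)..1, g t = f (x - y) - f x := by
    rw [intervalIntegral.integral_eq_sub_of_hasDerivAt (fun t _ => hd t) (hgc.intervalIntegrable _ _)]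
    simp
  set m := f (x - y) - f x
  have hsq : m^2 ≤ ∫ t in (0 : ℝ)..1, g t^2 := by
    have h0 : 0 ≤ ∫ t in (0 : ℝ)..1, (g t - m)^2 := intervalIntegral.integral_nonneg num! fun t _ => sq_nonneg _
    have e : ∫ t in (0 : ℝ)..1, (g t - m)^2
        = (∫ t in (0 : ℝ)..1, g t^2) - m^2 := by
      have : (fun t => (g t - m)^2) = fun t => g t^2 - 2*m*g t + m^2 := by funext t; ring
      rw [this, intervalIntegral.integral_add, intervalIntegral.integral_sub,
        intervalIntegral.integral_const_mul, hftc]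
      · simp; ring
      all_goals exact Continuous.intervalIntegrable (by fun_prop) _ _
    linarith
  have hle : ∀ t, g t^2 ≤ ‖y‖^2*‖fderiv ℝ f (x - t • y)‖^2 := fun t => by
    have := (fderiv ℝ f (x - t • y)).le_opNorm (-y)
    rw [norm_neg, norm_eq_abs] at this
    have h2 := pow_le_pow_left₀ (abs_nonneg _) this 2
    rw [sq_abs] at h2
    refine h2.trans (le_of_eq (by ring))
  have hcc : Continuous fun t : ℝ => ‖y‖^2*‖fderiv ℝ f (x - t • y)‖^2 := by
    have : Continuous fun t : ℝ => fderiv ℝ f (x - t • y) :=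
      (hf.continuous_fderiv one_ne_zero).comp (by fun_prop)
    fun_prop
  have h3 : m^2 ≤ ∫ t in Ioc (0 : ℝ) 1, ‖y‖^2*‖fderiv ℝ f (x - t • y)‖^2 := by
    rw [← intervalIntegral.integral_of_le num!]
    refine hsq.trans (intervalIntegral.integral_mono_on num!
      ((hgc.pow 2).intervalIntegrable _ _) (hcc.intervalIntegrable _ _) fun t _ => hle t)
  have h4 : ‖m‖ₑ^(2 : ℝ) = ofReal (m^2) := by
    rw [← ofReal_norm, ENNReal.ofReal_rpow_of_nonneg (norm_nonneg _) num!]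
    simp
  rw [h4, ← ofReal_integral_eq_lintegral_ofReal]
  · exact ofReal_le_ofReal h3
  · exact (hcc.integrableOn_Icc).mono_set Set.Ioc_subset_Icc_self
  · exact .of_forall fun t => pos!

lemma Test.lintegral_translate_sub_le (hf : Test f) (y : R4) :
    ∫⁻ x, ‖f (x - y) - f x‖ₑ^(2 : ℝ) ≤ ofReal (‖y‖^2*dir f) := by
  have hc := hf.contDiff.continuous_fderiv one_ne_zero
  have hL : MemLp (fderiv ℝ f) 2 :=
    (hf.contDiff.continuous_fderiv one_ne_zero).memLp_of_hasCompactSupport (hf.supp.fderiv (𝕜 := ℝ))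
  calc _ ≤ ∫⁻ x, ∫⁻ t in Ioc (0 : ℝ) 1, ofReal (‖y‖^2*‖fderiv ℝ f (x - t • y)‖^2) :=
        lintegral_mono fun x => sq_sub_le_setLIntegral hf.contDiff x y
    _ = ∫⁻ t in Ioc (0 : ℝ) 1, ∫⁻ x,
            ofReal (‖y‖^2*‖fderiv ℝ f (x - t • y)‖^2) := by
        refine lintegral_lintegral_swap ?_
        have : Continuous (fun z : R4 × ℝ => fderiv ℝ f (z.1 - z.2 • y)) := hc.comp (by fun_prop)
        exact (ENNReal.continuous_ofReal.comp (by fun_prop)).measurable.aemeasurable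
    _ = ∫⁻ _t in Ioc (0 : ℝ) 1, ofReal (‖y‖^2*dir f) := by
        refine lintegral_congr fun t => ?_
        rw [lintegral_sub_right_eq_self (fun x => ofReal (‖y‖^2*‖fderiv ℝ f x‖^2)),
          ← ofReal_integral_eq_lintegral_ofReal, integral_const_mul, ← nrm_two_sq hL,
          hf.nrm_fderiv_sq]
        · exact ((memLp_two_iff_integrable_sq_norm hL.1).1 hL).const_mul _
        · exact .of_forall fun x => pos!
    _ = _ := by simp

lemma Test.integral_mollify_sub_sq_le (hf : Test f) {e : ℝ} (he : 0 < e) :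
    Integrable (fun x => (mollify e f x - f x)^2) ∧
    ∫ x, (mollify e f x - f x)^2 ≤ e^2*dir f := by
  have hl : LocallyIntegrable f := hf.contDiff.continuous.locallyIntegrable
  have hmc : Continuous (mollify e f) := (mollify_contDiff he hl).continuous
  have h1 := lintegral_enorm_average_sub_le (p := 2) (mollifier_nonneg he) (mollifier_integrable he)
    (mollifier_integral he) hf.contDiff.continuous.aestronglyMeasurable num!
  have h2 : ∫⁻ x, ‖mollify e f x - f x‖ₑ^(2 : ℝ) ≤ ofReal (e^2*dir f) := by
    refine h1.trans ?_
    calc _ ≤ ∫⁻ y, ofReal (mollifier e y)*ofReal (e^2*dir f) := by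
          refine lintegral_mono fun y => ?_
          by_cases hy : e ≤ ‖y‖
          · simp [mollifier_eq_zero he hy]
          · refine mul_le_mul_right ((hf.lintegral_translate_sub_le y).trans ?_) _
            refine ofReal_le_ofReal (mul_le_mul_of_nonneg_right ?_ (dir_nonneg f))
            exact pow_le_pow_left₀ (norm_nonneg _) (not_le.1 hy).le 2
      _ = _ := by
          rw [lintegral_mul_const' _ _ ofReal_ne_top, ← ofReal_integral_eq_lintegral_ofReal
            (mollifier_integrable he) (.of_forall (mollifier_nonneg he)), mollifier_integral he]
          simp
  have h3 : ∀ x, ‖mollify e f x - f x‖ₑ^(2 : ℝ) = ofReal ((mollify e f x - f x)^2) :=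
    fun x => by
      rw [← ofReal_norm, ENNReal.ofReal_rpow_of_nonneg (norm_nonneg _) num!]
      simp
  simp_rw [h3] at h2
  have hcont : Continuous fun x => (mollify e f x - f x)^2 := (hmc.sub hf.contDiff.continuous).pow 2
  have hi : Integrable (fun x => (mollify e f x - f x)^2) := by
    refine ⟨hcont.aestronglyMeasurable, ?_⟩
    rw [hasFiniteIntegral_iff_ofReal (.of_forall fun x => sq_nonneg _)]
    exact h2.trans_lt ofReal_lt_top
  refine ⟨hi, ?_⟩
  rw [← ofReal_integral_eq_lintegral_ofReal hi (.of_forall fun x => sq_nonneg _)] at h2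
  exact (ENNReal.ofReal_le_ofReal_iff (mul_nonneg (sq_nonneg _) (dir_nonneg f))).1 h2

lemma mollifier_memLp {e : ℝ} (he : 0 < e) (p : ℝ≥0∞) : MemLp (mollifier e) p :=
  (mollifier_contDiff e).continuous.memLp_of_hasCompactSupport (mollifier_hasCompactSupport he)

lemma nrm_comp_sub_left {F : Type*} [NormedAddCommGroup F] {p : ℝ≥0∞} {f : R4 → F}
    (hf : MemLp f p) (x : R4) : nrm p (fun y => f (x - y)) = nrm p f := by
  have := eLpNorm_comp_measurePreserving (p := p) hf.1
    (Measure.measurePreserving_sub_left (volume : Measure R4) x)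
  rw [nrm, nrm, ← this]; rfl

lemma MeasureTheory.MemLp.comp_sub_left_R4 {F : Type*} [NormedAddCommGroup F] {p : ℝ≥0∞} {f : R4 → F}
    (hf : MemLp f p) (x : R4) : MemLp (fun y => f (x - y)) p :=
  hf.comp_measurePreserving (Measure.measurePreserving_sub_left (volume : Measure R4) x)

lemma abs_mollify_le_two {e : ℝ} (he : 0 < e) (hf : MemLp f 2) (x : R4) :
    |mollify e f x| ≤ nrm 2 (mollifier e)*nrm 2 f := by
  have h := integral_abs_mul_le (p := 2) (q := 2) (mollifier_memLp he 2) (hf.comp_sub_left_R4 x)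
  rw [nrm_comp_sub_left hf] at h
  exact (norm_integral_le_integral_norm (fun y => mollifier e y • f (x - y))).trans h

lemma exists_abs_mollify_le_four {e : ℝ} (he : 0 < e) :
    ∃ C : ℝ, ∀ f : R4 → ℝ, MemLp f 4 → ∀ x, |mollify e f x| ≤ C*nrm 4 f := by
  have hW : MemLp (cutoff e) 2 :=
    (cutoff_contDiff e).continuous.memLp_of_hasCompactSupport (cutoff_hasCompactSupport he)
  refine ⟨nrm 2 (cutoff e)*nrm 4 (mollifier e), fun f hf x => ?_⟩
  have h := integral_abs_mul_mul_le hW (mollifier_memLp he 4) (hf.comp_sub_left_R4 x)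
  rw [nrm_comp_sub_left hf, ← mul_assoc] at h
  refine (norm_integral_le_integral_norm (fun y => mollifier e y • f (x - y))).trans (le_trans (le_of_eq ?_) h)
  congr 1; funext y
  by_cases hy : e ≤ ‖y‖
  · simp [mollifier_eq_zero he hy]
  · rw [cutoff_eq_one he (not_le.1 hy).le]; simp

lemma Test.mollify_lipschitz (hf : Test f) {e : ℝ} (he : 0 < e) (x y : R4) :
    |mollify e f x - mollify e f y|
      ≤ 4*(nrm 2 (mollifier e)*√(dir f))*‖x - y‖ := by
  have hl : LocallyIntegrable f := hf.contDiff.continuous.locallyIntegrable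
  have hb : ∀ z ∈ Set.univ, ‖fderiv ℝ (mollify e f) z‖
      ≤ 4*(nrm 2 (mollifier e)*√(dir f)) := fun z _ => by
    refine (norm_fderiv_le_sum _ z).trans ?_
    have : ∀ j ∈ univ, ‖pd j (mollify e f) z‖
        ≤ nrm 2 (mollifier e)*√(dir f) := fun j _ => by
      rw [pd_mollify he (HasWeakPartial.of_contDiff hf.contDiff : HasWeakPartial j f (pd j f))]
      refine (abs_mollify_le_two he (hf.memLp_pd j 2) z).trans ?_
      exact mul_le_mul_of_nonneg_left (le_sqrt_of_sq_le (hf.nrm_pd_sq_le j)) (nrm_nonneg _ _)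
    refine (sum_le_sum this).trans (le_of_eq ?_)
    simp
  have := convex_univ.norm_image_sub_le_of_norm_fderiv_le (𝕜 := ℝ)
    (fun z _ => (mollify_contDiff he hl).differentiable (by simp) z) hb (Set.mem_univ y)
    (Set.mem_univ x)
  simpa using this

lemma Test.mollify_sub {g : R4 → ℝ} (hf : Test f) (hg : Test g) {e : ℝ} (he : 0 < e) (x : R4) :
    mollify e (fun y => f y - g y) x = mollify e f x - mollify e g x := by
  have i : ∀ h : R4 → ℝ, Test h → Integrable (fun y => mollifier e y • h (x - y)) := fun h hh =>
    (mollifier_memLp he 2).integrable_mul ((hh.memLp 2).comp_sub_left_R4 x)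
  simp only [mollify]
  rw [← integral_sub (i f hf) (i g hg)]
  congr 1; funext y
  rw [smul_sub]

/-- Rellich's compactness theorem: sets bounded in the Dirichlet norm are precompact in
`L²_loc`. -/
lemma rellich {ι : Type*} (𝓤 : Ultrafilter ι) {v : ι → R4 → ℝ} (hv : ∀ n, Test (v n))
    (hd : ∀ n, dir (v n) ≤ 1) (r : ℝ) {τ : ℝ} (hτ : 0 < τ) :
    ∃ S ∈ 𝓤, ∀ n ∈ S, ∀ m ∈ S, ∫ x in closedBall 0 r, (v n x - v m x)^2 ≤ τ := by
  set B : Set R4 := closedBall 0 r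
  have hBfin : volume B < ⊤ := measure_closedBall_lt_top
  set e : ℝ := √(τ/16)
  have he : 0 < e := sqrt_pos.2 pos!
  have he2 : e^2 = τ/16 := sq_sqrt pos!
  set Vb : ℝ := (volume B).toReal with hVb
  set σ : ℝ := √(τ/(4*(Vb + 1)))
  have hσ2 : σ^2 = τ/(4*(Vb + 1)) := sq_sqrt pos!
  set K : ℝ := 4*nrm 2 (mollifier e) + 1
  have hK0 : 0 < K := by have := nrm_nonneg 2 (mollifier e); positivity
  have hlip : ∀ n x y, |mollify e (v n) x - mollify e (v n) y| ≤ K*‖x - y‖ := fun n x y => by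
    refine ((hv n).mollify_lipschitz he x y).trans ?_
    refine mul_le_mul_of_nonneg_right ?_ (norm_nonneg _)
    have h1 : √(dir (v n)) ≤ 1 := sqrt_le_one.2 (hd n)
    have h2 := nrm_nonneg 2 (mollifier e)
    nlinarith
  obtain ⟨C, hC⟩ := exists_abs_mollify_le_four he
  have hbd : ∀ n x, |mollify e (v n) x| ≤ |C| *(sobC ℝ) := fun n x => by
    refine (hC _ ((hv n).memLp 4) x).trans ?_
    have h1 : nrm 4 (v n) ≤ sobC ℝ := by
      refine le_of_sq_le_sq ?_ (NNReal.coe_nonneg _)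
      refine (hv n).sobolev.trans ?_
      exact mul_le_of_le_one_right (sq_nonneg _) (hd n)
    exact (mul_le_mul_of_nonneg_right (le_abs_self C) (nrm_nonneg _ _)).trans
      (mul_le_mul_of_nonneg_left h1 (abs_nonneg _))
  obtain ⟨T, hTfin, hTcov⟩ := totallyBounded_iff.1
    (isCompact_closedBall (0 : R4) r).totallyBounded _ (show 0 < σ/(4*K) by positivity)
  have hlim : ∀ t : R4, ∃ a : ℝ, Tendsto (fun n => mollify e (v n) t) 𝓤 (𝓝 a) := fun t => by
    have hmem : ((𝓤.map fun n => mollify e (v n) t) : Filter ℝ)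
        ≤ 𝓟 (Icc (-(|C| *sobC ℝ)) (|C| *sobC ℝ)) := by
      rw [le_principal_iff]
      exact Filter.Eventually.of_forall (f := (𝓤 : Filter ι))
        (p := fun n => mollify e (v n) t ∈ Icc (-(|C| *sobC ℝ)) (|C| *sobC ℝ))
        fun n => abs_le.1 (hbd n t)
    obtain ⟨a, -, ha⟩ := isCompact_Icc.ultrafilter_le_nhds _ hmem
    exact ⟨a, ha⟩
  choose a ha using hlim
  have hS : {n | ∀ t ∈ T, |mollify e (v n) t - a t| < σ/4} ∈ 𝓤 := by
    have : ∀ᶠ n in (𝓤 : Filter ι), ∀ t ∈ T, |mollify e (v n) t - a t| < σ/4 := by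
      rw [eventually_all_finite hTfin]
      intro t _
      have := Metric.tendsto_nhds.1 (ha t) (σ/4) pos!
      simpa [dist_eq] using this
    exact this
  refine ⟨_, hS, fun n hn m hm => ?_⟩
  have hsup : ∀ x ∈ B, |mollify e (v n) x - mollify e (v m) x| ≤ σ := fun x hx => by
    obtain ⟨t, ht, hxt⟩ := Set.mem_iUnion₂.1 (hTcov hx)
    have hxt' : ‖x - t‖ < σ/(4*K) := by simpa [dist_eq_norm] using hxt
    have hKx : K*‖x - t‖ ≤ σ/4 := by
      rw [lt_div_iff₀ pos!] at hxt'
      linarith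
    have h1 := abs_le.1 ((hlip n x t).trans hKx)
    have h2 := abs_le.1 ((hlip m x t).trans hKx)
    have h3 := abs_lt.1 (hn t ht)
    have h4 := abs_lt.1 (hm t ht)
    rw [abs_le]
    constructor <;> linarith [h1.1, h1.2, h2.1, h2.2, h3.1, h3.2, h4.1, h4.2]
  have hdt := (hv n).sub (hv m)
  obtain ⟨hi, hle⟩ := hdt.integral_mollify_sub_sq_le he
  have hdd : dir (fun x => v n x - v m x) ≤ 4 := by linarith [dir_sub_le (hv n) (hv m), hd n, hd m]
  have hic : IntegrableOn (fun _ : R4 => σ^2) B := integrableOn_const hBfin.ne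
  calc ∫ x in B, (v n x - v m x)^2
      ≤ ∫ x in B, (2*(mollify e (fun y => v n y - v m y) x - (v n x - v m x))^2
          + 2*σ^2) := by
        refine setIntegral_mono_on ((hdt.memLp 2).integrable_sq.integrableOn)
          ((hi.integrableOn.const_mul 2).add (hic.const_mul 2)) measurableSet_closedBall fun x hx => ?_
        rw [(hv n).mollify_sub (hv m) he]
        have h1 := hsup x hx
        set A := mollify e (v n) x - mollify e (v m) x
        have h2 : A^2 ≤ σ^2 := by rw [← sq_abs A]; exact pow_le_pow_left₀ (abs_nonneg _) h1 2
        nlinarith [sq_nonneg (2*A - (v n x - v m x))]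
    _ = 2*(∫ x in B, (mollify e (fun y => v n y - v m y) x - (v n x - v m x))^2)
          + 2*σ^2*Vb := by
        rw [integral_add (hi.integrableOn.const_mul 2) (hic.const_mul 2), integral_const_mul,
          setIntegral_const, hVb, smul_eq_mul, Measure.real]
        ring
    _ ≤ 2*(e^2*4) + 2*σ^2*Vb := by
        have h1 : ∫ x in B, (mollify e (fun y => v n y - v m y) x - (v n x - v m x))^2 ≤ e^2*4 :=
          (setIntegral_le_integral hi (.of_forall fun x => sq_nonneg _)).trans
            (hle.trans (mul_le_mul_of_nonneg_left hdd (sq_nonneg _)))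
        linarith
    _ ≤ τ := by
        have h1 : σ^2*Vb ≤ τ/4 := by
          rw [hσ2, div_mul_eq_mul_div, div_le_div_iff₀ pos! num!]
          nlinarith
        rw [he2]; linarith

lemma exists_mem_integral_abs_mul_sq_le {ι : Type*} (𝓤 : Ultrafilter ι) {v : ι → R4 → ℝ}
    (hv : ∀ n, Test (v n)) (hd : ∀ n, dir (v n) ≤ 1) {V : R4 → ℝ} (hV : MemLp V 2) {τ : ℝ}
    (hτ : 0 < τ) :
    ∃ S ∈ 𝓤, ∀ n ∈ S, ∀ m ∈ S, ∫ x, |V x| *(v n x - v m x)^2 ≤ τ := by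
  obtain ⟨M, hM, hb⟩ := exists_integral_abs_mul_sq_le hV (τ := τ/(8*(sobC ℝ : ℝ)^2 + 1)) pos!
  obtain ⟨S, hS, hSb⟩ := rellich 𝓤 hv hd M (τ := τ/(2*(M + 1))) pos!
  refine ⟨S, hS, fun n hn m hm => (hb _ (((hv n).sub (hv m)).memLp 4)).trans ?_⟩
  have h1 : M*∫ x in closedBall 0 M, (v n x - v m x)^2 ≤ τ/2 := by
    have := mul_le_mul_of_nonneg_left (hSb n hn m hm) hM
    refine this.trans ?_
    rw [mul_div_assoc', div_le_div_iff₀ pos! num!]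
    nlinarith
  have h2 : τ/(8*(sobC ℝ : ℝ)^2 + 1)*nrm 4 (fun x => v n x - v m x)^2 ≤ τ/2 := by
    have h3 := ((hv n).sub (hv m)).sobolev
    have h4 := dir_sub_le (hv n) (hv m)
    have h5 : nrm 4 (fun x => v n x - v m x)^2 ≤ 4*(sobC ℝ : ℝ)^2 := by
      nlinarith [hd n, hd m, sq_nonneg (sobC ℝ : ℝ)]
    rw [div_mul_eq_mul_div, div_le_div_iff₀ pos! num!]
    nlinarith
  linarith

/-- A minimizing sequence that is Cauchy in the Dirichlet norm. -/
lemma exists_cauchy_sequence {V : R4 → ℝ} (hV : MemLp V 2) (h : HasVirtualLevel V) :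
    ∃ v : ℕ → R4 → ℝ, (∀ n0, ContDiff ℝ ∞ (v n0)) ∧ (∀ n0, Test (v n0)) ∧ (∀ n0 x, 0 ≤ v n0 x) ∧
      (∀ n0, dir (v n0) = 1) ∧ (∀ n0, qf V (v n0) ≤ (1/2)^n0) ∧
      ∀ N, ∀ n0 ≥ N, ∀ m ≥ N, dir (fun x => v n0 x - v m x) ≤ (1/2)^N := by
  have hpos : ∀ f, Test f → 0 ≤ qf V f := fun f hf => qf_nonneg_of_energy_nonneg h.1 hf.contDiff hf.supp
  have h1 : ∀ n0 : ℕ, ∃ v : R4 → ℝ, ContDiff ℝ ∞ v ∧ Test v ∧ (∀ x, 0 ≤ v x) ∧ dir v = 1 ∧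
      qf V v ≤ 1/((n0 : ℝ) + 1) := fun n0 => by
    set e : ℝ := 1/((n0 : ℝ) + 1)
    have hepos : 0 < e := pos!
    obtain ⟨v, hv, hvc, hv0, hvn⟩ := h.exists_test hV hepos
    have hvt : Test v := ⟨hv.of_le (by simp), hvc⟩
    have e1 : qf (fun x => (1 + e)*V x) v = dir v + (1 + e)*∫ x, V x*v x^2 := by
      rw [qf_eq, ← integral_const_mul]
      congr 2; funext x; ring
    rw [e1] at hvn
    have h2 := hpos v hvt
    rw [qf_eq] at h2
    have hdpos : 0 < dir v := by
      rcases (dir_nonneg v).lt_or_eq with h3 | h3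
      · exact h3
      · rw [← h3] at h2 hvn
        nlinarith
    set s : ℝ := (√(dir v))⁻¹ with hs
    have hs2 : s^2 = (dir v)⁻¹ := by rw [hs, inv_pow, sq_sqrt hdpos.le]
    have hs0 : 0 ≤ s := pos!
    refine ⟨fun x => s*v x, contDiff_const.mul hv, hvt.const_mul s, fun x => mul_nonneg hs0 (hv0 x), ?_, ?_⟩
    · rw [dir_const_mul hvt, hs2, inv_mul_cancel₀ hdpos.ne']
    · rw [qf_eq, dir_const_mul hvt, hs2, inv_mul_cancel₀ hdpos.ne']
      have e2 : ∫ x, V x*(s*v x)^2 = (dir v)⁻¹*∫ x, V x*v x^2 := by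
        rw [← hs2, ← integral_const_mul]
        congr 1; funext x; ring
      rw [e2]
      set I := ∫ x, V x*v x^2
      have h4 : I < 0 := by nlinarith
      have h5 : I ≤ -dir v + e*dir v := by nlinarith
      have : (dir v)⁻¹*I ≤ -1 + e := by rw [inv_mul_le_iff₀ hdpos]; linarith
      linarith
  choose w hws hwt hw0 hwd hwq using h1
  set 𝓤 : Ultrafilter ℕ := Filter.hyperfilter ℕ
  have hstep : ∀ k : ℕ, ∃ S ∈ 𝓤, ∀ n0 ∈ S, qf V (w n0) ≤ (1/2)^k ∧
      ∀ m ∈ S, dir (fun x => w n0 x - w m x) ≤ (1/2)^k := fun k => by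
    have hp : (0 : ℝ) < (1/2)^k := pos!
    obtain ⟨S, hS, hSb⟩ := exists_mem_integral_abs_mul_sq_le 𝓤 hwt (fun n0 => (hwd n0).le) hV
      (τ := (1/2)^k/2) pos!
    have hq : {n0 | qf V (w n0) ≤ (1/2)^k/8} ∈ 𝓤 := by
      have t0 := tendsto_one_div_add_atTop_nhds_zero_nat (𝕜 := ℝ)
      have : ∀ᶠ n0 in atTop, qf V (w n0) ≤ (1/2)^k/8 := by
        filter_upwards [t0.eventually (gt_mem_nhds (show (0 : ℝ) < (1/2)^k/8 by positivity))] with n0 hn0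
        exact (hwq n0).trans hn0.le
      exact (Nat.hyperfilter_le_atTop) this
    refine ⟨S ∩ {n0 | qf V (w n0) ≤ (1/2)^k/8}, inter_mem hS hq, fun n0 hn0 => ⟨?_, fun m hm => ?_⟩⟩
    · have : qf V (w n0) ≤ (1/2)^k/8 := hn0.2
      linarith
    · have h3 := qf_sub_le hV hpos (hwt n0) (hwt m)
      rw [qf_eq] at h3
      have h4 := hSb n0 hn0.1 m hm.1
      have h5 : -(∫ x, |V x| *(w n0 x - w m x)^2) ≤ ∫ x, V x*(w n0 x - w m x)^2 := by
        rw [← integral_neg]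
        have hi := integrable_mul_sq hV (((hwt n0).sub (hwt m)).memLp 4)
        refine integral_mono (by simpa [abs_mul] using hi.abs.neg) hi fun x => ?_
        have := neg_abs_le (V x)
        simp only []
        nlinarith [sq_nonneg (w n0 x - w m x)]
      have h6 : qf V (w n0) ≤ (1/2)^k/8 := hn0.2
      have h7 : qf V (w m) ≤ (1/2)^k/8 := hm.2
      linarith
  choose S hS hSb using hstep
  have hne : ∀ k : ℕ, ∃ n0, ∀ i ≤ k, n0 ∈ S i := fun k => by
    have : ∀ᶠ n0 in (𝓤 : Filter ℕ), ∀ i ∈ Finset.range (k + 1), n0 ∈ S i :=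
      (eventually_all_finset _).2 fun i _ => hS i
    obtain ⟨n0, hn0⟩ := this.exists
    exact ⟨n0, fun i hi => hn0 i (Finset.mem_range.2 (by omega))⟩
  choose n hn using hne
  exact ⟨fun k => w (n k), fun k => hws _, fun k => hwt _, fun k => hw0 _, fun k => hwd _,
    fun k => (hSb k _ (hn k k le_rfl)).1, fun N n0 hn0 m hm =>
    (hSb N _ (hn n0 N hn0)).2 _ (hn m N hm)⟩

variable {V z : R4 → ℝ} {v : ℕ → R4 → ℝ} {g : Fin 4 → R4 → ℝ} {R r d A k N e s : ℝ}

/-- A minimizing sequence `v` of nonnegative test functions together with its limit `z` in `L⁴`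
and the limit `g` of the gradients in `L²`. -/
structure ResonanceSeq (V : R4 → ℝ) (v : ℕ → R4 → ℝ) (z : R4 → ℝ) (g : Fin 4 → R4 → ℝ) : Prop where
  memV : MemLp V 2
  pos : ∀ f, Test f → 0 ≤ qf V f
  test : ∀ n, Test (v n)
  nonneg : ∀ n x, 0 ≤ v n x
  dir_eq : ∀ n, dir (v n) = 1
  qf_le : ∀ n, qf V (v n) ≤ (1/2)^n
  memz : MemLp z 4
  memg : ∀ j, MemLp (g j) 2
  lim : Tendsto (fun n => nrm 4 (v n - z)) atTop (𝓝 0)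
  lim_pd : ∀ j, Tendsto (fun n => nrm 2 (pd j (v n) - g j)) atTop (𝓝 0)
  lim_ae : ∀ᵐ x, Tendsto (fun n => v n x) atTop (𝓝 (z x))

lemma exists_limit_of_nrm_le {p : ℝ≥0∞} [hp : Fact (1 ≤ p)] {f : ℕ → R4 → ℝ} {C : ℝ} (hf : ∀ n, MemLp (f n) p)
    (h : ∀ N, ∀ n ≥ N, ∀ m ≥ N, nrm p (f n - f m) ≤ C*(1/2)^N) :
    ∃ u : R4 → ℝ, MemLp u p ∧ Tendsto (fun n => eLpNorm (f n - u) p) atTop (𝓝 0) := by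
  have hC : 0 ≤ C := by simpa using (nrm_nonneg _ _).trans (h 0 0 le_rfl 0 le_rfl)
  refine Lp.cauchy_complete_eLpNorm hp.1 hf (B := fun N => ofReal ((C + 1)*(1/2)^N)) ?_ ?_
  · rw [← ENNReal.ofReal_tsum_of_nonneg (fun n => pos!) ((summable_geometric_of_lt_one num! num!).mul_left _)]
    exact ofReal_ne_top
  · intro N n m hn hm
    have h1 := h N n hn m hm
    rw [nrm, ← ENNReal.le_ofReal_iff_toReal_le ((hf n).sub (hf m)).2.ne pos!] at h1
    refine h1.trans_lt ?_
    rw [ENNReal.ofReal_lt_ofReal_iff pos!]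
    have : (0 : ℝ) < (1/2)^N := pos!
    nlinarith

lemma exists_resonanceSeq (hV : MemLp V 2) (h : HasVirtualLevel V) :
    ∃ v z g, ResonanceSeq V v z g := by
  obtain ⟨v, -, hvt, hv0, hvd, hvq, hvc⟩ := exists_cauchy_sequence hV h
  have hc : ∀ N, ∀ n ≥ N, ∀ m ≥ N,
      dir (fun x => v (2*n) x - v (2*m) x) ≤ ((1/2)^N)^2 := fun N n hn m hm => by
    refine (hvc (2*N) _ (by omega) _ (by omega)).trans (le_of_eq ?_)
    rw [← pow_mul, mul_comm]
  have : Fact ((1 : ℝ≥0∞) ≤ 4) := ⟨num!⟩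
  obtain ⟨z, hz, hlim⟩ := exists_limit_of_nrm_le (p := 4) (f := fun n => v (2*n)) (C := sobC ℝ)
    (fun n => (hvt _).memLp 4) fun N n hn m hm => by
      refine le_of_sq_le_sq ?_ pos!
      refine ((hvt (2*n)).sub (hvt (2*m))).sobolev.trans ?_
      rw [mul_pow]
      exact mul_le_mul_of_nonneg_left (hc N n hn m hm) (sq_nonneg _)
  have hg : ∀ j, ∃ u : R4 → ℝ, MemLp u 2 ∧
      Tendsto (fun n => eLpNorm (pd j (v (2*n)) - u) 2) atTop (𝓝 0) := fun j => by
    refine exists_limit_of_nrm_le (p := 2) (C := 1) (fun n => (hvt _).memLp_pd j 2)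
      fun N n hn m hm => le_of_sq_le_sq ?_ pos!
    rw [one_mul]
    refine le_trans (le_of_eq ?_) ((((hvt (2*n)).sub (hvt (2*m))).nrm_pd_sq_le j).trans (hc N n hn m hm))
    congr 2; funext x
    exact ((hvt (2*n)).pd_sub (hvt (2*m)) j x).symm
  choose g hgm hglim using hg
  obtain ⟨ns, hns, hae⟩ := (tendstoInMeasure_of_tendsto_eLpNorm num!
    (fun n => ((hvt (2*n)).memLp 4).1) hz.1 hlim).exists_seq_tendsto_ae
  refine ⟨fun n => v (2*ns n), z, g, hV, fun f hf =>
    qf_nonneg_of_energy_nonneg h.1 hf.contDiff hf.supp, fun n => hvt _, fun n => hv0 _,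
    fun n => hvd _, fun n => (hvq _).trans ?_, hz, hgm, ?_, fun j => ?_, hae⟩
  · refine pow_le_pow_of_le_one num! num! ?_
    have := hns.id_le n
    simp only [id] at this
    omega
  · exact (tendsto_toReal zero_ne_top).comp (hlim.comp hns.tendsto_atTop)
  · exact (tendsto_toReal zero_ne_top).comp ((hglim j).comp hns.tendsto_atTop)

lemma tendsto_integral_mul {p q : ℝ≥0∞} [ENNReal.HolderTriple p q 1] {f : ℕ → R4 → ℝ}
    {u w : R4 → ℝ} (hf : ∀ n, MemLp (f n) p) (hu : MemLp u p) (hw : MemLp w q)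
    (h : Tendsto (fun n => nrm p (f n - u)) atTop (𝓝 0)) :
    Tendsto (fun n => ∫ x, f n x*w x) atTop (𝓝 (∫ x, u x*w x)) := by
  rw [tendsto_iff_norm_sub_tendsto_zero]
  refine squeeze_zero (fun _ => norm_nonneg _) (fun n => ?_) (by simpa using h.mul_const (nrm q w))
  have hw1 : MemLp (fun x => f n x*w x) 1 := hw.mul (hf n)
  have hw2 : MemLp (fun x => u x*w x) 1 := hw.mul hu
  rw [← integral_sub (memLp_one_iff_integrable.1 hw1) (memLp_one_iff_integrable.1 hw2)]
  refine (norm_integral_le_integral_norm _).trans (le_trans (le_of_eq ?_)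
    (integral_abs_mul_le ((hf n).sub hu) hw))
  congr 1; funext x
  simp [sub_mul]

lemma tendsto_integral_mul_mul (hV : MemLp V 2) {f : ℕ → R4 → ℝ}
    {u w : R4 → ℝ} (hf : ∀ n, MemLp (f n) 4) (hu : MemLp u 4) (hw : MemLp w 4)
    (h : Tendsto (fun n => nrm 4 (f n - u)) atTop (𝓝 0)) :
    Tendsto (fun n => ∫ x, V x*(f n x*w x)) atTop (𝓝 (∫ x, V x*(u x*w x))) := by
  rw [tendsto_iff_norm_sub_tendsto_zero]
  refine squeeze_zero (fun _ => norm_nonneg _) (fun n => ?_)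
    (by simpa using (h.mul_const (nrm 4 w)).const_mul (nrm 2 V))
  rw [← integral_sub (integrable_mul_mul hV (hf n) hw) (integrable_mul_mul hV hu hw)]
  refine (norm_integral_le_integral_norm _).trans (le_trans (le_of_eq ?_)
    (integral_abs_mul_mul_le hV ((hf n).sub hu) hw))
  congr 1; funext x
  rw [norm_eq_abs, Pi.sub_apply]; congr 1; ring

namespace ResonanceSeq

variable (h : ResonanceSeq V v z g)
include h

lemma tendsto_bf {f : ℕ → R4 → ℝ} (hf : ∀ n, Test (f n)) {C : ℝ}
    (hC : ∀ n, qf V (f n) ≤ C) : Tendsto (fun n => bf V (v n) (f n)) atTop (𝓝 0) := by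
  have h1 : ∀ n, bf V (v n) (f n)^2 ≤ C*(1/2)^n := fun n => by
    refine (bf_sq_le h.memV h.pos (h.test n) (hf n)).trans ?_
    rw [mul_comm]
    exact mul_le_mul (hC n) (h.qf_le n) (h.pos _ (h.test n)) ((h.pos _ (hf n)).trans (hC n))
  have h2 : Tendsto (fun n => bf V (v n) (f n)^2) atTop (𝓝 0) :=
    squeeze_zero (fun n => sq_nonneg _) h1 (by
      simpa using (tendsto_pow_atTop_nhds_zero_of_lt_one num! (num! : (1/2 : ℝ) < 1)).const_mul C)
  have h3 := (continuous_sqrt.tendsto 0).comp h2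
  simp only [sqrt_zero] at h3
  refine (tendsto_zero_iff_abs_tendsto_zero _).2 ?_
  refine h3.congr fun n => ?_
  simp [sqrt_sq_eq_abs]

lemma weak_eq (hf : Test f) :
    ∑ j, (∫ x, g j x*pd j f x) + ∫ x, V x*(z x*f x) = 0 := by
  refine tendsto_nhds_unique ?_ (h.tendsto_bf (fun _ => hf) fun _ => le_rfl)
  exact (tendsto_finsetSum _ fun j _ => tendsto_integral_mul (fun n => (h.test n).memLp_pd j 2)
    (h.memg j) (hf.memLp_pd j 2) (h.lim_pd j)).add
    (tendsto_integral_mul_mul h.memV (fun n => (h.test n).memLp 4) h.memz (hf.memLp 4) h.lim)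

lemma integral_mul_pd (hf : Test f) (j : Fin 4) :
    ∫ x, z x*pd j f x = -∫ x, g j x*f x := by
  have : ENNReal.HolderTriple 4 (4/3) 1 := ⟨by
    rw [ENNReal.inv_div (by simp) (by simp), inv_one]
    rw [← one_div, ENNReal.div_add_div_same]; norm_num
    exact ENNReal.div_self (by simp) (by simp)⟩
  have h1 := tendsto_integral_mul (p := 4) (q := 4/3) (fun n => (h.test n).memLp 4) h.memz
    (hf.memLp_pd j _) h.lim
  have h2 := (tendsto_integral_mul (p := 2) (q := 2) (fun n => (h.test n).memLp_pd j 2) (h.memg j)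
    (hf.memLp _) (h.lim_pd j)).neg
  refine tendsto_nhds_unique h1 (h2.congr fun n => ?_)
  have h3 := integral_mul_fderiv_eq_neg_fderiv_mul_of_integrable (μ := (volume : Measure R4))
    (f := v n) (g := f) (v := single j 1)
    (((h.test n).memLp_pd j 2).integrable_mul (hf.memLp 2))
    (((h.test n).memLp 2).integrable_mul (hf.memLp_pd j 2))
    (((h.test n).memLp 2).integrable_mul (hf.memLp 2)) (fun x _ => (h.test n).diff x)
    (fun x _ => hf.diff x)
  exact h3.symm

lemma ae_nonneg : ∀ᵐ x, 0 ≤ z x := by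
  filter_upwards [h.lim_ae] with x hx
  exact ge_of_tendsto' hx fun n => h.nonneg n x

lemma integral_potential : ∫ x, V x*z x^2 = -1 := by
  have h1 : Tendsto (fun n => ∫ x, V x*v n x^2) atTop (𝓝 (-1)) := by
    have h2 : Tendsto (fun n => qf V (v n)) atTop (𝓝 0) := squeeze_zero (fun n => h.pos _ (h.test n)) h.qf_le
        (tendsto_pow_atTop_nhds_zero_of_lt_one num! num!)
    have h3 := h2.sub_const 1
    rw [zero_sub] at h3
    refine h3.congr fun n => ?_
    rw [qf_eq, h.dir_eq]; ring
  refine tendsto_nhds_unique ?_ h1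
  rw [tendsto_iff_norm_sub_tendsto_zero]
  have hb : ∀ n, nrm 4 (v n) ≤ sobC ℝ := fun n => by
    refine le_of_sq_le_sq ?_ pos!
    simpa [h.dir_eq] using (h.test n).sobolev
  refine squeeze_zero (fun _ => norm_nonneg _) (fun n => ?_)
    (by simpa using (h.lim.mul_const (sobC ℝ + nrm 4 z)).const_mul (nrm 2 V))
  rw [← integral_sub (integrable_mul_sq h.memV ((h.test n).memLp 4)) (integrable_mul_sq h.memV h.memz)]
  have h4 := integral_abs_mul_mul_le h.memV (((h.test n).memLp 4).sub h.memz) (((h.test n).memLp 4).add h.memz)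
  have h5 : nrm 4 (v n + z) ≤ sobC ℝ + nrm 4 z :=
    (nrm_add_le num! ((h.test n).memLp 4) h.memz).trans (by linarith [hb n])
  refine (norm_integral_le_integral_norm _).trans (le_trans (le_of_eq ?_) (h4.trans
    (mul_le_mul_of_nonneg_left (mul_le_mul_of_nonneg_left h5 (nrm_nonneg _ _)) (nrm_nonneg _ _))))
  congr 1; funext x
  rw [norm_eq_abs, Pi.sub_apply, Pi.add_apply]; congr 1; ring

end ResonanceSeq

/-- The Laplacian. -/
def lap (f : R4 → ℝ) (x : R4) : ℝ := ∑ i, pd i (pd i f) x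

lemma pd_contDiff {n : ℕ} (hf : ContDiff ℝ (n + 1 : ℕ) f) (i : Fin 4) :
    ContDiff ℝ n (pd i f) := by
  have : ContDiff ℝ n (fderiv ℝ f) := hf.fderiv_right (m := n) (by norm_cast)
  exact this.clm_apply contDiff_const

lemma continuous_lap (hf : ContDiff ℝ 2 f) : Continuous (lap f) := by
  unfold lap
  exact continuous_finsetSum _ fun i _ => continuous_pd (pd_contDiff (n := 1) hf i) i

lemma pd_comp_smul (c : ℝ) (i : Fin 4) {x : R4} (hf : DifferentiableAt ℝ f (c • x)) :
    pd i (fun y => f (c • y)) x = c*pd i f (c • x) := by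
  have h1 := hf.hasFDerivAt.comp x ((hasFDerivAt_id x).const_smul c)
  have h2 : fderiv ℝ (fun y => f (c • y)) x = _ := h1.fderiv
  rw [pd, h2]
  simp [pd]

lemma pd_cutoff (R : ℝ) (i : Fin 4) :
    pd i (cutoff R) = fun x => R⁻¹*pd i stdCutoff (R⁻¹ • x) := by
  funext x
  exact pd_comp_smul _ i (stdCutoff_contDiff.differentiable (by simp) _)

lemma pd_pd_cutoff (R : ℝ) (i : Fin 4) (x : R4) :
    pd i (pd i (cutoff R)) x = R⁻¹*(R⁻¹*pd i (pd i stdCutoff) (R⁻¹ • x)) := by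
  have hd : Differentiable ℝ (pd i stdCutoff) :=
    (pd_contDiff (n := 1) (contDiff_infty.1 stdCutoff_contDiff 2) i).differentiable (by simp)
  have hd' : DifferentiableAt ℝ (fun y => pd i stdCutoff (R⁻¹ • y)) x :=
    (hd _).comp x (differentiableAt_id.const_smul R⁻¹)
  rw [pd_cutoff]
  have := pd_comp_smul (f := pd i stdCutoff) R⁻¹ i (x := x) (hd _)
  rw [← this]
  simp only [pd] at hd' ⊢
  rw [fderiv_const_mul hd']; rfl

lemma exists_weight_bound (hf : Continuous f) (hc : HasCompactSupport f) (k : ℕ) :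
    ∃ C : ℝ, 0 < C ∧ ∀ R : ℝ, 1 ≤ R → ∀ x, |(R⁻¹)^k*f (R⁻¹ • x)| ≤ C/b(x)^k := by
  obtain ⟨C, hC⟩ := (hf.mul (by fun_prop : Continuous fun x : R4 => b(x)^k)).bounded_above_of_compact_support
    hc.mul_right
  refine ⟨|C| + 1, pos!, fun R hR x => ?_⟩
  have h0 : 0 < R := lin!
  have h := hC (R⁻¹ • x)
  simp only [Pi.mul_apply] at h
  rw [norm_mul, norm_smul, norm_inv, norm_of_nonneg h0.le, norm_eq_abs, norm_of_nonneg pos!] at h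
  rw [le_div_iff₀ pos!, abs_mul, abs_of_nonneg pos!]
  have h1 : R⁻¹*b(x) ≤ 1 + R⁻¹*‖x‖ := by
    have : R⁻¹ ≤ 1 := inv_le_one_of_one_le₀ hR
    linarith
  have h2 : (R⁻¹*b(x))^k ≤ (1 + R⁻¹*‖x‖)^k := pow_le_pow_left₀ pos! h1 k
  calc R⁻¹^k*|f (R⁻¹ • x)| *b(x)^k = |f (R⁻¹ • x)| *(R⁻¹*b(x))^k := by
        rw [mul_pow]; ring
    _ ≤ |f (R⁻¹ • x)| *(1 + R⁻¹*‖x‖)^k := by gcongr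
    _ ≤ C := h
    _ ≤ |C| + 1 := by linarith [le_abs_self C]

lemma exists_cutoff_bound : ∃ C : ℝ, 0 < C ∧ ∀ R : ℝ, 1 ≤ R → ∀ i x,
    |pd i (cutoff R) x| ≤ C/b(x) ∧ |pd i (pd i (cutoff R)) x| ≤ C/b(x)^2 := by
  have h1 : ∀ i, Continuous (pd i stdCutoff) := fun i =>
    continuous_pd (stdCutoff_contDiff.of_le (by exact_mod_cast le_top)) i
  have h2 : ∀ i, Continuous (pd i (pd i stdCutoff)) := fun i =>
    continuous_pd (pd_contDiff (n := 1) (contDiff_infty.1 stdCutoff_contDiff 2) i) i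
  have c1 : ∀ i, HasCompactSupport (pd i stdCutoff) := fun i =>
    hasCompactSupport_pd stdCutoff_hasCompactSupport i
  have c2 : ∀ i, HasCompactSupport (pd i (pd i stdCutoff)) := fun i => hasCompactSupport_pd (c1 i) i
  choose A hA0 hA using fun i => exists_weight_bound (h1 i) (c1 i) 1
  choose B hB0 hB using fun i => exists_weight_bound (h2 i) (c2 i) 2
  refine ⟨∑ i, (A i + B i), Finset.sum_pos (fun i _ => add_pos (hA0 i) (hB0 i)) ⟨0, mem_univ _⟩,
    fun R hR i x => ?_⟩
  have hle : A i + B i ≤ ∑ i, (A i + B i) :=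
    single_le_sum (f := fun i => A i + B i) (fun i _ => (add_pos (hA0 i) (hB0 i)).le) (mem_univ i)
  constructor
  · rw [pd_cutoff]
    refine le_trans (by simpa using hA i R hR x) ?_
    gcongr
    linarith [hB0 i]
  · rw [pd_pd_cutoff, ← mul_assoc, ← sq]
    refine (hB i R hR x).trans ?_
    gcongr
    linarith [hA0 i]

lemma pd_pd_cutoff_eq_zero (hR : 0 < R) (i : Fin 4) {x : R4} (hx : ‖x‖ < R) :
    pd i (pd i (cutoff R)) x = 0 := by
  have : pd i (cutoff R) =ᶠ[𝓝 x] fun _ => 0 := by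
    have hmem : ball (0 : R4) R ∈ 𝓝 x := isOpen_ball.mem_nhds (by! hx)
    filter_upwards [hmem] with y hy
    exact pd_cutoff_eq_zero hR i (by! hy)
  rw [pd, this.fderiv_eq]
  simp

lemma pd_pd_mul {g : R4 → ℝ} (hf : ContDiff ℝ 2 f) (hg : ContDiff ℝ 2 g) (i : Fin 4) (x : R4) :
    pd i (pd i (fun y => f y*g y)) x = pd i (pd i f) x*g x + 2*(pd i f x*pd i g x) + f x*pd i (pd i g) x := by
  have df : Differentiable ℝ f := hf.differentiable (by simp)
  have dg : Differentiable ℝ g := hg.differentiable (by simp)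
  have df' : Differentiable ℝ (pd i f) := (pd_contDiff (n := 1) hf i).differentiable (by simp)
  have dg' : Differentiable ℝ (pd i g) := (pd_contDiff (n := 1) hg i).differentiable (by simp)
  have e : pd i (fun y => f y*g y) = fun y => pd i f y*g y + f y*pd i g y :=
    funext fun y => pd_mul i (df y) (dg y)
  have e2 : pd i (fun y => pd i f y*g y + f y*pd i g y) x
      = pd i (fun y => pd i f y*g y) x + pd i (fun y => f y*pd i g y) x := by
    rw [pd, fderiv_fun_add ((df' x).fun_mul (dg x)) ((df x).fun_mul (dg' x))]; rfl
  rw [e, e2, pd_mul i (df' x) (dg x), pd_mul i (df x) (dg' x)]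
  ring

namespace ResonanceSeq

lemma very_weak (h : ResonanceSeq V v z g) (hf : ContDiff ℝ 2 f)
    (hc : HasCompactSupport f) : ∫ x, z x*lap f x = ∫ x, V x*(z x*f x) := by
  have ht : Test f := ⟨hf.of_le num!, hc⟩
  have htp : ∀ j, Test (pd j f) := fun j => ⟨pd_contDiff (n := 1) hf j, hasCompactSupport_pd hc j⟩
  have h1 := h.weak_eq ht
  have h2 : ∫ x, z x*lap f x = ∑ j, ∫ x, z x*pd j (pd j f) x := by
    rw [← integral_finsetSum]
    · simp only [lap, mul_sum]
    · intro j _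
      exact h.memz.locallyIntegrable num! |>.integrable_smul_right_of_hasCompactSupport
        (continuous_pd (htp j).contDiff j) (hasCompactSupport_pd (htp j).supp j)
  rw [h2, sum_congr rfl fun j _ => h.integral_mul_pd (htp j) j, Finset.sum_neg_distrib]
  linarith

lemma ext_very_weak (h : ResonanceSeq V v z g) {F : R4 → ℝ} (hF : ContDiff ℝ 2 F) {C b : ℝ}
    (h0 : ∀ x, |F x| ≤ C*b(x)^(-b)) (h1 : ∀ j x, |pd j F x| ≤ C*b(x)^(-b - 1))
    (hi : Integrable fun x => z x*b(x)^(-b - 2)) (hiL : Integrable fun x => z x*lap F x)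
    (hiV : Integrable fun x => V x*(z x*F x)) :
    ∫ x, z x*lap F x = ∫ x, V x*(z x*F x) := by
  obtain ⟨K, hK0, hK⟩ := exists_cutoff_bound
  set q : ℕ → R4 → ℝ := fun n => cutoff s(n) with hq
  have hqs : ∀ n, ContDiff ℝ 2 (q n) := fun n => contDiff_infty.1 (cutoff_contDiff _) 2
  have hs : ∀ n, ContDiff ℝ 2 (fun x => q n x*F x) := fun n => (hqs n).mul hF
  have hcs : ∀ n, HasCompactSupport (fun x => q n x*F x) := fun n => (cutoff_hasCompactSupport pos!).mul_right
  have key : ∀ n, ∫ x, z x*lap (fun y => q n y*F y) x = ∫ x, V x*(z x*(q n x*F x)) :=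
    fun n => h.very_weak (hs n) (hcs n)
  have hone : ∀ n : ℕ, (1 : ℝ) ≤ n + 1 := fun n => by
    have : (0 : ℝ) ≤ n := n.cast_nonneg
    linarith
  have hlap : ∀ n x, lap (fun y => q n y*F y) x
      = q n x*lap F x + ∑ i, (pd i (pd i (q n)) x*F x + 2*(pd i (q n) x*pd i F x)) := by
    intro n x
    simp only [lap, mul_sum, ← sum_add_distrib]
    refine sum_congr rfl fun i _ => ?_
    rw [pd_pd_mul (hqs n) hF]; ring
  have hae := h.memz.1
  have l1 : Tendsto (fun n => ∫ x, z x*lap (fun y => q n y*F y) x) atTop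
      (𝓝 (∫ x, z x*lap F x)) := by
    refine tendsto_integral_of_dominated_convergence (fun x => |z x*lap F x| + 12*(K*C)*|z x*b(x)^(-b - 2)|)
      (fun n => hae.mul (continuous_lap (hs n)).aestronglyMeasurable)
      (hiL.abs.add (hi.abs.const_mul _)) (fun n => .of_forall fun x => ?_) (.of_forall fun x => ?_)
    · rw [hlap, norm_eq_abs, abs_mul, abs_mul, abs_mul, mul_left_comm, ← mul_add]
      refine mul_le_mul_of_nonneg_left ?_ (abs_nonneg _)
      refine (abs_add_le _ _).trans (add_le_add ?_ ?_)
      · rw [abs_mul]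
        exact mul_le_of_le_one_left (abs_nonneg _) (abs_cutoff_le_one _ _)
      · have hx : 0 < 1 + ‖x‖ := pos!
        have hterm : ∀ i ∈ univ, |pd i (pd i (q n)) x*F x + 2*(pd i (q n) x*pd i F x)|
            ≤ 3*(K*C*b(x)^(-b - 2)) := by
          intro i _
          obtain ⟨ha, hb⟩ := hK _ (hone n) i x
          have e1 : b(x)^(-b - 2) = b(x)^(-b)/b(x)^2 := by rw [rpow_sub hx]; norm_num
          have e2 : b(x)^(-b - 2) = b(x)^(-b - 1)/b(x) := by rw [← rpow_sub_one hx.ne']; congr 1; ring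
          have t1 : |pd i (pd i (q n)) x*F x| ≤ K*C*b(x)^(-b - 2) := by
            rw [abs_mul, e1]
            refine (mul_le_mul hb (h0 x) (abs_nonneg _) pos!).trans (le_of_eq ?_)
            field_simp
          have t2 : |pd i (q n) x*pd i F x| ≤ K*C*b(x)^(-b - 2) := by
            rw [abs_mul, e2]
            refine (mul_le_mul ha (h1 i x) (abs_nonneg _) pos!).trans (le_of_eq ?_)
            field_simp
          refine (abs_add_le _ _).trans ?_
          rw [abs_mul 2, abs_two]
          linarith
        refine (Finset.abs_sum_le_sum_abs _ _).trans ((sum_le_sum hterm).trans (le_of_eq ?_))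
        rw [abs_of_nonneg (pos! : 0 ≤ b(x)^(-b - 2))]
        simp; ring
    · refine tendsto_const_nhds.congr' ?_
      obtain ⟨N, hN⟩ := exists_nat_ge ‖x‖
      filter_upwards [eventually_ge_atTop N] with n hn
      have hnx : ‖x‖ < (n : ℝ) + 1 := by
        have : (N : ℝ) ≤ n := by exact_mod_cast hn
        linarith
      have hp : (0 : ℝ) < n + 1 := by linarith [hone n]
      rw [hlap]
      simp only [hq, cutoff_eq_one hp hnx.le, pd_cutoff_eq_zero hp _ hnx, pd_pd_cutoff_eq_zero hp _ hnx]
      simp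
  have l2 : Tendsto (fun n => ∫ x, V x*(z x*(q n x*F x))) atTop
      (𝓝 (∫ x, V x*(z x*F x))) := by
    refine tendsto_integral_of_dominated_convergence (fun x => |V x*(z x*F x)|)
      (fun n => h.memV.1.mul (hae.mul (hs n).continuous.aestronglyMeasurable)) hiV.abs
      (fun n => .of_forall fun x => ?_) (.of_forall fun x => ?_)
    · rw [norm_eq_abs, show V x*(z x*(q n x*F x)) = q n x*(V x*(z x*F x)) by ring, abs_mul]
      exact mul_le_of_le_one_left (abs_nonneg _) (abs_cutoff_le_one _ _)
    · have := (((tendsto_cutoff x).mul_const (F x)).const_mul (z x)).const_mul (V x)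
      simpa using this
  exact tendsto_nhds_unique l1 (l2.congr fun n => (key n).symm)

end ResonanceSeq

/-! ### Radial functions -/

lemma contDiff_radial {f : ℝ → ℝ} {n : WithTop ℕ∞} {t : ℝ} (hf : ContDiffOn ℝ n f (Ioi 0))
    (ht : 0 < t) (a : R4) : ContDiff ℝ n (fun y : R4 => f (t + ‖y - a‖^2)) := by
  rw [contDiff_iff_contDiffAt]
  intro y
  have h1 : ContDiffAt ℝ n f (t + ‖y - a‖^2) :=
    hf.contDiffAt (isOpen_Ioi.mem_nhds (by simp only [Set.mem_Ioi]; positivity))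
  exact h1.comp y (f := fun y : R4 => t + ‖y - a‖^2)
    (contDiff_const.add ((contDiff_id.sub contDiff_const).norm_sq ℝ)).contDiffAt

lemma hasFDerivAt_radial {f : ℝ → ℝ} {f' t : ℝ} {a y : R4} (hf : HasDerivAt f f' (t + ‖y - a‖^2)) :
    HasFDerivAt (fun y : R4 => f (t + ‖y - a‖^2)) (f' • ((2 : ℝ) • innerSL ℝ (y - a))) y := by
  have h1 : HasFDerivAt (fun y : R4 => t + ‖y - a‖^2) ((2 : ℝ) • innerSL ℝ (y - a)) y := by
    have := (((hasFDerivAt_id y).sub_const a).norm_sq).const_add t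
    refine this.congr_fderiv ?_
    ext z
    simp
  exact hf.comp_hasFDerivAt y h1

lemma pd_radial {f : ℝ → ℝ} {f' t : ℝ} {a y : R4} (i : Fin 4) (hf : HasDerivAt f f' (t + ‖y - a‖^2)) :
    pd i (fun y : R4 => f (t + ‖y - a‖^2)) y = 2*f'*(y i - a i) := by
  rw [pd, (hasFDerivAt_radial hf).fderiv]
  simp only [smul_apply, innerSL_apply_apply, inner_single_right]
  simp
  ring

lemma pd_coord (k i : Fin 4) (a y : R4) :
    pd i (fun y : R4 => y k - a k) y = if i = k then 1 else 0 := by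
  have h : HasFDerivAt (fun y : R4 => y k - a k) (proj k : R4 →L[ℝ] ℝ) y :=
    ((proj k : R4 →L[ℝ] ℝ).hasFDerivAt).sub_const (a k)
  rw [pd, h.fderiv]
  simp [eq_comm]

lemma differentiable_coord (k : Fin 4) (a : R4) : Differentiable ℝ (fun y : R4 => y k - a k) :=
  fun _ => (((proj k : R4 →L[ℝ] ℝ).hasFDerivAt).sub_const (a k)).differentiableAt

lemma contDiff_coord {n : WithTop ℕ∞} (k : Fin 4) (a : R4) : ContDiff ℝ n (fun y : R4 => y k - a k) :=
  (proj k : R4 →L[ℝ] ℝ).contDiff.sub contDiff_const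

lemma pd_pd_radial {f f1 : ℝ → ℝ} {f2 t : ℝ} {a y : R4} (ht : 0 < t) (i : Fin 4)
    (h1 : ∀ s > 0, HasDerivAt f (f1 s) s) (h2 : HasDerivAt f1 f2 (t + ‖y - a‖^2)) :
    pd i (pd i (fun y : R4 => f (t + ‖y - a‖^2))) y = 2*f1 (t + ‖y - a‖^2) + 4*(y i - a i)^2*f2 := by
  have e : pd i (fun y : R4 => f (t + ‖y - a‖^2))
      = fun y => f1 (t + ‖y - a‖^2)*(2*(y i - a i)) := by
    funext z
    rw [pd_radial i (h1 _ pos!)]; ring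
  have d : DifferentiableAt ℝ (fun y : R4 => 2*(y i - a i)) y := (differentiable_coord i a y).const_mul 2
  have e2 : pd i (fun y : R4 => 2*(y i - a i)) y = 2 := by
    have := fderiv_const_mul (differentiable_coord i a y) (2 : ℝ)
    have e3 := pd_coord i i a y
    simp only [pd] at this e3 ⊢
    rw [this, smul_apply, e3]; simp
  rw [e, pd_mul i (hasFDerivAt_radial h2).differentiableAt d, pd_radial i h2, e2]
  ring

lemma sum_coord_sq (a y : R4) : ∑ i, (y i - a i)^2 = ‖y - a‖^2 := by
  rw [norm_sq_eq]
  simp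

lemma lap_radial {f f1 : ℝ → ℝ} {f2 t : ℝ} {a y : R4} (ht : 0 < t)
    (h1 : ∀ s > 0, HasDerivAt f (f1 s) s) (h2 : HasDerivAt f1 f2 (t + ‖y - a‖^2)) :
    lap (fun y : R4 => f (t + ‖y - a‖^2)) y = 8*f1 (t + ‖y - a‖^2) + 4*‖y - a‖^2*f2 := by
  rw [lap, sum_congr rfl fun i _ => pd_pd_radial ht i h1 h2, sum_add_distrib,
    ← sum_mul, ← sum_mul, ← mul_sum, sum_coord_sq]
  simp only [sum_const, card_univ, Fintype.card_fin, nsmul_eq_mul]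
  push_cast
  ring

lemma integrable_of_tendsto_of_integral_le {a : Type*} [MeasurableSpace a] {μ : Measure a}
    {f : ℕ → a → ℝ} {u : a → ℝ} {M : ℝ} (hf : ∀ n, Integrable (f n) μ) (h0 : ∀ n, 0 ≤ᵐ[μ] f n)
    (hM : ∀ n, ∫ x, f n x ∂μ ≤ M) (hlim : ∀ᵐ x ∂μ, Tendsto (fun n => f n x) atTop (𝓝 (u x))) :
    Integrable u μ ∧ ∫ x, u x ∂μ ≤ M := by
  have hu : AEStronglyMeasurable u μ := aestronglyMeasurable_of_tendsto_ae _ (fun n => (hf n).1) hlim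
  have hu0 : 0 ≤ᵐ[μ] u := by
    filter_upwards [hlim, ae_all_iff.2 h0] with x hx hx0
    exact ge_of_tendsto' hx hx0
  have h1 : ∫⁻ x, ofReal (u x) ∂μ ≤ ofReal M := by
    calc ∫⁻ x, ofReal (u x) ∂μ
        = ∫⁻ x, liminf (fun n => ofReal (f n x)) atTop ∂μ := by
          refine lintegral_congr_ae ?_
          filter_upwards [hlim] with x hx
          exact ((ENNReal.continuous_ofReal.tendsto _).comp hx).liminf_eq.symm
      _ ≤ liminf (fun n => ∫⁻ x, ofReal (f n x) ∂μ) atTop :=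
          lintegral_liminf_le' fun n => (hf n).1.aemeasurable.ennreal_ofReal
      _ ≤ ofReal M := by
          refine liminf_le_of_le (by isBoundedDefault) fun b hb => ?_
          obtain ⟨n, hn⟩ := hb.exists
          refine hn.trans ?_
          rw [← ofReal_integral_eq_lintegral_ofReal (hf n) (h0 n)]
          exact ofReal_le_ofReal (hM n)
  have hM0 : 0 ≤ M := (integral_nonneg_of_ae (h0 0)).trans (hM 0)
  refine ⟨⟨hu, ?_⟩, ?_⟩
  · rw [hasFiniteIntegral_iff_ofReal hu0]
    exact h1.trans_lt ofReal_lt_top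
  · rw [integral_eq_lintegral_of_nonneg_ae hu0 hu]
    exact ENNReal.toReal_le_of_le_ofReal hM0 h1

lemma memLp_weight {p : ℝ} (hp : 0 < p) (h : 4 < r*p) :
    MemLp (fun x : R4 => b(x)^(-r)) (ofReal p) := by
  have hc : Continuous (fun x : R4 => b(x)^(-r)) :=
    (by fun_prop : Continuous fun x : R4 => 1 + ‖x‖).rpow_const fun x => Or.inl pos!
  rw [← integrable_norm_rpow_iff hc.aestronglyMeasurable (by! hp) ofReal_ne_top]
  have := integrable_one_add_norm (E := R4) (μ := volume) (r := r*p) (by! h)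
  refine this.congr (.of_forall fun x => ?_)
  simp only []
  rw [toReal_ofReal hp.le, norm_of_nonneg pos!, ← rpow_mul pos!]
  congr 1; ring

lemma integrable_mul_weight (hz : MemLp z 4) (hr : 3 < r) :
    Integrable fun x => z x*b(x)^(-r) := by
  have h4 : MemLp z (ofReal 4) := by convert hz using 1; norm_num
  have : ENNReal.HolderTriple (ofReal 4) (ofReal (4/3)) 1 := ⟨by
    rw [← ENNReal.ofReal_inv_of_pos num!, ← ENNReal.ofReal_inv_of_pos num!, ← ENNReal.ofReal_add num! num!]
    norm_num⟩
  exact h4.integrable_mul (memLp_weight (p := 4/3) num! lin!)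

lemma one_add_norm_sq_rpow_le (x : R4) (hr : 0 ≤ r) :
    w(x)^(-r) ≤ 2^r*b(x)^(-(2*r)) := by
  have h1 : b(x)^2/2 ≤ w(x) := by nlinarith [sq_nonneg (1 - ‖x‖)]
  have h2 : w(x)^(-r) ≤ (b(x)^2/2)^(-r) := rpow_le_rpow_of_nonpos pos! h1 lin!
  refine h2.trans (le_of_eq ?_)
  rw [div_rpow pos! num!, ← rpow_natCast, ← rpow_mul pos!, rpow_neg (num! : (0:ℝ) ≤ 2)]
  push_cast
  rw [div_inv_eq_mul, mul_comm]
  congr 2; ring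

lemma norm_le_rpow_half (x : R4) : ‖x‖ ≤ w(x)^(1/2 : ℝ) := by
  rw [← sqrt_eq_rpow]
  exact le_sqrt_of_sq_le lin!

/-- The profile `s^{-a} (N + s)^{-b}` of the comparison functions. -/
def prof (a b N s : ℝ) : ℝ := s^(-a)*(N + s)^(-b)

/-- The negative logarithmic derivative of `prof`. -/
def profμ (a b N s : ℝ) : ℝ := a/s + b/(N + s)

section Prof

variable {a b N : ℝ}

lemma hasDerivAt_prof (hN : 0 ≤ N) (hs : 0 < s) :
    HasDerivAt (prof a b N) (-(prof a b N s*profμ a b N s)) s := by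
  have hNs : 0 < N + s := lin!
  have h1 := (hasDerivAt_id s).rpow_const (p := -a) (Or.inl hs.ne')
  have h2 := ((hasDerivAt_id s).const_add N).rpow_const (p := -b) (Or.inl hNs.ne')
  have h3 := h1.mul h2
  refine h3.congr_deriv ?_
  simp only [id, prof, profμ]
  rw [rpow_sub_one hs.ne', rpow_sub_one hNs.ne']
  field_simp
  ring

lemma hasDerivAt_profμ (hN : 0 ≤ N) (hs : 0 < s) :
    HasDerivAt (profμ a b N) (-(a/s^2 + b/(N + s)^2)) s := by
  have hNs : 0 < N + s := lin!
  have h1 := (hasDerivAt_const s a).div (hasDerivAt_id s) hs.ne'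
  have h2 := (hasDerivAt_const s b).div ((hasDerivAt_id s).const_add N) hNs.ne'
  refine (h1.add h2).congr_deriv ?_
  simp
  field_simp
  ring

lemma hasDerivAt_prof_two (hN : 0 ≤ N) (hs : 0 < s) : HasDerivAt (fun s => -(prof a b N s*profμ a b N s))
      (prof a b N s*(profμ a b N s^2 + a/s^2 + b/(N + s)^2)) s := by
  refine ((hasDerivAt_prof hN hs).mul (hasDerivAt_profμ hN hs)).neg.congr_deriv ?_
  ring

lemma prof_pos (hN : 0 ≤ N) (hs : 0 < s) : 0 < prof a b N s := by unfold prof; positivity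

lemma contDiffOn_prof (hN : 0 ≤ N) {n : WithTop ℕ∞} :
    ContDiffOn ℝ n (prof a b N) (Ioi 0) := by
  intro s hs
  have hs : 0 < s := hs
  refine ContDiffAt.contDiffWithinAt ?_
  exact (contDiffAt_id.rpow_const_of_ne hs.ne').mul
    ((contDiffAt_const.add contDiffAt_id).rpow_const_of_ne (by simp only [id]; linarith))

lemma prof_le (hb : 0 ≤ b) (hN : 0 ≤ N) (hs : 0 < s) :
    prof a b N s ≤ s^(-(a + b)) := by
  rw [neg_add, rpow_add hs, prof]
  exact mul_le_mul_of_nonneg_left (rpow_le_rpow_of_nonpos hs lin! lin!) pos!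

lemma profμ_le (hb : 0 ≤ b) (hN : 0 ≤ N) (hs : 0 < s) :
    profμ a b N s ≤ (a + b)/s := by
  rw [add_div, profμ]
  gcongr
  linarith

lemma profμ_nonneg (ha : 0 ≤ a) (hb : 0 ≤ b) (hN : 0 ≤ N) (hs : 0 < s) :
    0 ≤ profμ a b N s := by
  unfold profμ; positivity

/-- The comparison function is a0 strict supersolution. -/
lemma prof_supersolution (ha : 0 < a) (hb : 0 ≤ b) (hab : a + b ≤ 3/4) (hN : 0 ≤ N) (hs : 0 < s) (hrs : r ≤ s) :
    8 * -(prof a b N s*profμ a b N s) + 4*r*(prof a b N s*(profμ a b N s^2 + a/s^2 + b/(N + s)^2))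
      ≤ -(a*(prof a b N s/s)) := by
  have hNs : 0 < N + s := lin!
  set G := prof a b N s
  have hG : 0 < G := prof_pos hN hs
  set μ := profμ a b N s with hμ
  set p := s/(N + s) with hp
  have hp0 : 0 ≤ p := pos!
  have hp1 : p ≤ 1 := by rw [hp, div_le_one hNs]; linarith
  have hP : μ = (a + b*p)/s := by rw [hμ, profμ, hp]; field_simp
  have hQ : a/s^2 + b/(N + s)^2 = (a + b*p^2)/s^2 := by rw [hp]; field_simp
  have e1 : 4*r*(G*(μ^2 + a/s^2 + b/(N + s)^2))
      ≤ 4*s*(G*(μ^2 + a/s^2 + b/(N + s)^2)) := by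
    gcongr
  rw [add_assoc (μ^2), hQ] at e1 ⊢
  refine (add_le_add_right e1 _).trans ?_
  rw [hP]
  have e2 : 8 * -(G*((a + b*p)/s)) + 4*s*(G*(((a + b*p)/s)^2 + (a + b*p^2)/s^2))
      = (G/s)*(4*(-2*(a + b*p) + (a + b*p)^2 + (a + b*p^2))) := by
    field_simp
    ring
  rw [e2]
  have hGs : 0 < G/s := pos!
  have e3 : 4*(-2*(a + b*p) + (a + b*p)^2 + (a + b*p^2)) ≤ -a := by
    have t1 : b*p^2 ≤ b*p := by
      apply mul_le_mul_of_nonneg_left _ hb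
      nlinarith
    have t2 : 0 ≤ b*p := pos!
    have t3 : b*p ≤ b := by nlinarith
    nlinarith [mul_nonneg ha.le (lin! : 0 ≤ 3/4 - (a + b*p)), mul_nonneg t2 (lin! : 0 ≤ 3/4 - (a + b*p))]
  nlinarith

end Prof

namespace ResonanceSeq

lemma prof_estimate (h : ResonanceSeq V v z g) {a : ℝ} (ha : 0 < a) (ha1 : a ≤ 1/2) (hN : 0 ≤ N) {R' : ℝ}
    (hV : ∀ᵐ x, R' < ‖x‖ → |V x| ≤ a/(2*w(x))) :
    Integrable (fun x => z x*(prof a (3/4 - a) N w(x)/w(x))) ∧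
    a/2*∫ x, z x*(prof a (3/4 - a) N w(x)/w(x))
      ≤ ∫ x in closedBall 0 R', |V x| *(z x*prof a (3/4 - a) N w(x)) := by
  set b := 3/4 - a with hbd
  have hb : 0 ≤ b := lin!
  have hab : a + b = 3/4 := by rw [hbd]; ring
  set f : ℝ → ℝ := prof a b N
  set F : R4 → ℝ := fun x => f (1 + ‖x - 0‖^2) with hF
  have hFx : ∀ x, F x = f w(x) := fun x => by simp [hF]
  have hs : ∀ x : R4, 0 < w(x) := fun x => pos!
  have hsm : ContDiff ℝ 2 F := contDiff_radial (contDiffOn_prof hN) one_pos 0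
  have hF0 : ∀ x, 0 < F x := fun x => by rw [hFx]; exact prof_pos hN (hs x)
  have hFle : ∀ x, F x ≤ w(x)^(-(3/4) : ℝ) := fun x => by rw [hFx, ← hab]; exact prof_le hb hN (hs x)
  have hFle' : ∀ x, F x ≤ 2^(3/4 : ℝ)*b(x)^(-(3/2) : ℝ) := fun x => by
    refine (hFle x).trans ((one_add_norm_sq_rpow_le x num!).trans (le_of_eq ?_))
    norm_num
  set F1 : R4 → ℝ := fun x => F x/w(x) with hF1
  have hF1le : ∀ x, F1 x ≤ 2^(7/4 : ℝ)*b(x)^(-(7/2) : ℝ) := fun x => by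
    have : F1 x ≤ w(x)^(-(7/4) : ℝ) := by
      rw [hF1]
      have : w(x)^(-(7/4) : ℝ) = w(x)^(-(3/4) : ℝ)/w(x) := by rw [← rpow_sub_one (hs x).ne']; norm_num
      rw [this]
      exact div_le_div_of_nonneg_right (hFle x) (hs x).le
    refine this.trans ((one_add_norm_sq_rpow_le x num!).trans (le_of_eq ?_))
    norm_num
  have hF10 : ∀ x, 0 ≤ F1 x := fun x => div_nonneg (hF0 x).le (hs x).le
  have hF1c : Continuous F1 := hsm.continuous.div (by fun_prop) fun x => (hs x).ne'
  have hw : Integrable fun x => z x*b(x)^(-(7/2) : ℝ) := integrable_mul_weight h.memz num!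
  have hi1 : Integrable fun x => z x*F1 x := by
    refine (hw.norm.const_mul (2^(7/4 : ℝ))).mono' (h.memz.1.mul hF1c.aestronglyMeasurable)
      (.of_forall fun x => ?_)
    rw [norm_mul, norm_mul, norm_of_nonneg (hF10 x), norm_of_nonneg (pos! : 0 ≤ b(x)^(-(7/2) : ℝ))]
    calc ‖z x‖*F1 x ≤ ‖z x‖*(2^(7/4 : ℝ)*b(x)^(-(7/2) : ℝ)) := by
          gcongr; exact hF1le x
      _ = _ := by ring
  have hlap : ∀ x, lap F x = 8 * -(F x*profμ a b N w(x))
      + 4*‖x‖^2*(F x*(profμ a b N w(x)^2 + a/w(x)^2 + b/(N + w(x))^2)) := fun x => by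
    have := lap_radial (f := f) (t := 1) (a := 0) (y := x) one_pos
      (fun s hs => hasDerivAt_prof hN hs) (hasDerivAt_prof_two hN pos!)
    rw [show F = fun y => f w(y) from funext hFx]
    simp only [sub_zero] at this
    exact this
  have hsup : ∀ x, lap F x ≤ -(a*F1 x) := fun x => by
    have e : F1 x = f w(x)/w(x) := by rw [← hFx]
    rw [hlap, e, hFx]
    exact prof_supersolution ha hb hab.le hN (hs x) (le_add_of_nonneg_left zero_le_one)
  have hμ0 : ∀ x : R4, 0 ≤ profμ a b N w(x) := fun x => profμ_nonneg ha.le hb hN (hs x)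
  have hμ1 : ∀ x : R4, profμ a b N w(x) ≤ (3/4)/w(x) := fun x => by rw [← hab]; exact profμ_le hb hN (hs x)
  have hlow : ∀ x, -(6*F1 x) ≤ lap F x := fun x => by
    rw [hlap]
    have : F x*profμ a b N w(x) ≤ 3/4*F1 x := by
      refine (mul_le_mul_of_nonneg_left (hμ1 x) (hF0 x).le).trans (le_of_eq ?_)
      rw [hF1]; ring
    have h2 : 0 ≤ 4*‖x‖^2*(F x*(profμ a b N w(x)^2 + a/w(x)^2
        + b/(N + w(x))^2)) := by
      have := hF0 x
      positivity
    linarith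
  have habs : ∀ x, |lap F x| ≤ 6*F1 x := fun x => by
    rw [abs_le]
    exact ⟨hlow x, (hsup x).trans (by have := hF10 x; nlinarith)⟩
  have hiL : Integrable fun x => z x*lap F x := by
    refine (hi1.norm.const_mul 6).mono' (h.memz.1.mul (continuous_lap hsm).aestronglyMeasurable)
      (.of_forall fun x => ?_)
    rw [norm_mul, norm_mul, norm_of_nonneg (hF10 x), norm_eq_abs (lap F x)]
    calc ‖z x‖*|lap F x| ≤ ‖z x‖*(6*F1 x) := by gcongr; exact habs x
      _ = _ := by ring
  have hF4 : MemLp F 4 := by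
    have := memLp_weight (r := 3/2) (p := 4) num! num!
    have h4 : MemLp (fun x : R4 => 2^(3/4 : ℝ)*b(x)^(-(3/2) : ℝ)) 4 := by
      convert this.const_mul (2^(3/4 : ℝ)) using 1; norm_num
    refine h4.mono' hsm.continuous.aestronglyMeasurable (.of_forall fun x => ?_)
    rw [norm_of_nonneg (hF0 x).le]
    exact hFle' x
  have hiV : Integrable fun x => V x*(z x*F x) := integrable_mul_mul h.memV h.memz hF4
  have key := h.ext_very_weak hsm (C := 2^(11/4 : ℝ)) (b := 3/2) (fun x => by
      rw [abs_of_pos (hF0 x)]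
      refine (hFle' x).trans ?_
      gcongr <;> norm_num)
    (fun j x => by
      have e : pd j F x = 2 * -(F x*profμ a b N w(x))*x j := by
        have := pd_radial (f := f) (t := 1) (a := 0) (y := x) j (hasDerivAt_prof hN pos!)
        rw [show F = fun y => f w(y) from funext hFx]
        simp only [sub_zero, PiLp.zero_apply] at this
        exact this
      have hxj : |x j| ≤ ‖x‖ := by simpa using PiLp.norm_apply_le x j
      have hx : ‖x‖ ≤ w(x)^(1/2 : ℝ) := norm_le_rpow_half x
      have e2 : |pd j F x| ≤ 2*w(x)^(-(5/4) : ℝ) := by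
        rw [e, abs_mul, abs_mul, abs_neg, abs_two, abs_of_nonneg (mul_nonneg (hF0 x).le (hμ0 x))]
        have e3 : w(x)^(-(5/4) : ℝ)
            = w(x)^(-(3/4) : ℝ)*(1/w(x))*w(x)^(1/2 : ℝ) := by
          rw [one_div, ← rpow_neg_one, ← rpow_add (hs x), ← rpow_add (hs x)]
          norm_num
        rw [e3]
        have hμ2 : profμ a b N w(x) ≤ 1/w(x) := (hμ1 x).trans (by have := hs x; gcongr; norm_num)
        refine (mul_le_mul (mul_le_mul_of_nonneg_left (mul_le_mul (hFle x) hμ2 (hμ0 x)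
          pos!) (zero_le_two)) (hxj.trans hx) (abs_nonneg _) pos!).trans
          (le_of_eq (by ring))
      refine e2.trans ((mul_le_mul_of_nonneg_left (one_add_norm_sq_rpow_le x num!) num!).trans ?_)
      rw [show (-(3/2) - 1 : ℝ) = -(2*(5/4)) by norm_num, ← mul_assoc]
      gcongr
      rw [show (11/4 : ℝ) = 1 + 7/4 by norm_num, rpow_add num!, rpow_one]
      gcongr <;> norm_num)
    (by convert hw using 3; norm_num) hiL hiV
  have e1 : (fun x => z x*(f w(x)/w(x))) = fun x => z x*F1 x := by funext x; rw [← hFx]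
  have e2 : (fun x => |V x| *(z x*f w(x))) = fun x => |V x| *(z x*F x) := by funext x; rw [hFx]
  rw [e1, e2]
  refine ⟨hi1, ?_⟩
  have hz0 := h.ae_nonneg
  have hiV' : Integrable fun x => |V x| *(z x*F x) := by
    refine hiV.norm.congr ?_
    filter_upwards [hz0] with x hx
    rw [norm_mul, norm_eq_abs, norm_of_nonneg (mul_nonneg hx (hF0 x).le)]
  have s1 : a*∫ x, z x*F1 x ≤ ∫ x, |V x| *(z x*F x) := by
    calc a*∫ x, z x*F1 x = ∫ x, a*(z x*F1 x) := (integral_const_mul _ _).symm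
      _ ≤ ∫ x, -(z x*lap F x) := by
          refine integral_mono_ae (hi1.const_mul a) hiL.neg ?_
          filter_upwards [hz0] with x hx
          have := mul_le_mul_of_nonneg_left (hsup x) hx
          linarith
      _ = -∫ x, V x*(z x*F x) := by rw [integral_neg, key]
      _ = ∫ x, -(V x*(z x*F x)) := (integral_neg _).symm
      _ ≤ _ := by
          refine integral_mono_ae hiV.neg hiV' ?_
          filter_upwards [hz0] with x hx
          have := mul_nonneg hx (hF0 x).le
          have := neg_abs_le (V x)
          nlinarith
  have s2 : ∫ x, |V x| *(z x*F x) ≤ (∫ x in closedBall 0 R', |V x| *(z x*F x))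
      + a/2*∫ x, z x*F1 x := by
    rw [← integral_const_mul, ← integral_indicator measurableSet_closedBall,
      ← integral_add (hiV'.indicator measurableSet_closedBall) (hi1.const_mul _)]
    refine integral_mono_ae hiV' ((hiV'.indicator measurableSet_closedBall).add (hi1.const_mul _)) ?_
    filter_upwards [hz0, hV] with x hx hVx
    by_cases hxR : x ∈ closedBall (0 : R4) R'
    · simp only [indicator_of_mem hxR]
      have := mul_nonneg hx (hF10 x)
      have : 0 ≤ a/2*(z x*F1 x) := pos!
      linarith
    · simp only [indicator_of_notMem hxR]
      have hb0 := hVx (by! hxR)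
      have hm := mul_le_mul_of_nonneg_right hb0 (mul_nonneg hx (hF0 x).le)
      refine hm.trans (le_of_eq ?_)
      rw [hF1]
      have := hs x
      field_simp
      ring
  linarith

/-- Weighted integrability of the resonance function. -/
lemma integrable_weight (h : ResonanceSeq V v z g) (hd : 0 < d)
    (hV : ∀ᵐ x, R < ‖x‖ → |V x| ≤ ‖x‖^(-2 - 2*d)) {a : ℝ} (ha : 0 < a) (ha1 : a ≤ 1/2) :
    Integrable fun x => z x*w(x)^(-a - 1) := by
  obtain ⟨R', hR'1, hR'R, hR'⟩ : ∃ R' : ℝ, 1 ≤ R' ∧ R ≤ R' ∧ ∀ r, R' < r → r^(-(2*d)) ≤ a/4 := by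
    have := (tendsto_rpow_neg_atTop (show 0 < 2*d by positivity)).eventually
      (ge_mem_nhds (show (0 : ℝ) < a/4 by positivity))
    obtain ⟨a0, ha0⟩ := eventually_atTop.1 this
    exact ⟨max (max 1 R) a0, (le_max_left _ _).trans (le_max_left _ _),
      (le_max_right _ _).trans (le_max_left _ _), fun r hr => ha0 r ((le_max_right _ _).trans hr.le)⟩
  have hV' : ∀ᵐ x, R' < ‖x‖ → |V x| ≤ a/(2*w(x)) := by
    filter_upwards [hV] with x hx hxR
    refine (hx (hR'R.trans_lt hxR)).trans ?_
    have hx1 : 1 < ‖x‖ := hR'1.trans_lt hxR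
    have hx0 : 0 < ‖x‖ := lin!
    have e : ‖x‖^(-2 - 2*d) = ‖x‖^(-(2*d))/‖x‖^2 := by
      rw [show -2 - 2*d = -(2*d) - 2 by ring, rpow_sub hx0]; norm_num
    rw [e, div_le_div_iff₀ pos! pos!]
    have := hR' _ hxR
    have h2 : w(x) ≤ 2*‖x‖^2 := by nlinarith
    calc ‖x‖^(-(2*d))*(2*w(x)) ≤ a/4*(2*(2*‖x‖^2)) := by gcongr
      _ = a*‖x‖^2 := by ring
  have hz0 := h.ae_nonneg
  have hloc : IntegrableOn (fun x => |V x| *z x) (closedBall 0 R') := by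
    have : IntegrableOn (fun x => V x*(z x*cutoff R' x)) (closedBall 0 R') :=
      (integrable_mul_mul h.memV h.memz ((cutoff_contDiff R').continuous.memLp_of_hasCompactSupport
        (cutoff_hasCompactSupport lin!))).integrableOn
    refine this.norm.congr ?_
    filter_upwards [ae_restrict_of_ae hz0, ae_restrict_mem measurableSet_closedBall] with x hx hxR
    rw [cutoff_eq_one lin! (by! hxR), mul_one, norm_mul, norm_eq_abs, norm_of_nonneg hx]
  set b := 3/4 - a with hb
  have hb0 : 0 ≤ b := lin!
  have lim1 : ∀ x : R4, Tendsto (fun n : ℕ => s(n)^b * (z x*(prof a b s(n) w(x)/w(x)))) atTop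
      (𝓝 (z x*w(x)^(-a - 1))) := fun x => by
    have hs : 0 < w(x) := pos!
    have e : ∀ n : ℕ, s(n)^b*(z x*(prof a b s(n) w(x)/w(x)))
        = z x*w(x)^(-a - 1)*(1 + w(x)*(1/s(n)))^(-b) := fun n => by
      have hn : (0 : ℝ) < n + 1 := pos!
      have : 1 + w(x)*(1/s(n)) = ((n : ℝ) + 1 + w(x))/(n + 1) := by field_simp
      rw [this, div_rpow pos! hn.le, rpow_neg hn.le, rpow_sub_one hs.ne', prof]
      field_simp
    simp only [e]
    have t := ((tendsto_one_div_add_atTop_nhds_zero_nat (𝕜 := ℝ)).const_mul w(x)).const_add 1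
    rw [mul_zero, add_zero] at t
    have t2 := (t.rpow_const (p := -b) (Or.inl one_ne_zero)).const_mul (z x*w(x)^(-a - 1))
    simpa using t2
  have est := fun n : ℕ => h.prof_estimate ha ha1 (show (0 : ℝ) ≤ (n : ℝ) + 1 by positivity) hV'
  refine (integrable_of_tendsto_of_integral_le (M := 2/a*∫ x in closedBall 0 R', |V x| *z x)
    (fun n => (est n).1.const_mul (s(n)^b)) (fun n => ?_) (fun n => ?_) (.of_forall lim1)).1
  · filter_upwards [hz0] with x hx
    have := prof_pos (a := a) (b := b) (show (0 : ℝ) ≤ (n : ℝ) + 1 by positivity) (show 0 < w(x) by positivity)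
    simp only [Pi.zero_apply]
    positivity
  · rw [integral_const_mul]
    have h2 := (est n).2
    have hn : (0 : ℝ) < n + 1 := pos!
    have h3 : s(n)^b*(∫ x in closedBall 0 R',
        |V x| *(z x*prof a b s(n) w(x)))
        ≤ ∫ x in closedBall 0 R', |V x| *z x := by
      rw [← integral_const_mul]
      refine integral_mono_of_nonneg ?_ hloc ?_
      · filter_upwards [ae_restrict_of_ae hz0] with x hx
        have := prof_pos (a := a) (b := b) (show (0 : ℝ) ≤ (n : ℝ) + 1 by positivity)
          (show 0 < w(x) by positivity)
        simp only [Pi.zero_apply]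
        positivity
      · filter_upwards [ae_restrict_of_ae hz0] with x hx
        have hs1 : 1 ≤ w(x) := by nlinarith [sq_nonneg ‖x‖]
        have t1 : w(x)^(-a) ≤ 1 := rpow_le_one_of_one_le_of_nonpos hs1 lin!
        have t2 : s(n)^b*((n : ℝ) + 1 + w(x))^(-b) ≤ 1 := by
          rw [rpow_neg pos!, ← div_eq_mul_inv]
          exact div_le_one_of_le₀ (rpow_le_rpow hn.le lin! hb0) pos!
        have t3 : s(n)^b*prof a b s(n) w(x) ≤ 1 := by
          rw [prof, mul_left_comm]
          exact mul_le_one₀ t1 pos! t2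
        calc _ = |V x| *z x*(s(n)^b*prof a b s(n) w(x)) := by ring
          _ ≤ |V x| *z x := mul_le_of_le_one_right pos! t3
    have h4 := mul_le_mul_of_nonneg_left h2 (show 0 ≤ s(n)^b*(2/a) by positivity)
    have h5 := mul_le_mul_of_nonneg_left h3 (show 0 ≤ 2/a by positivity)
    calc _ = s(n)^b*(2/a)*(a/2*∫ x, z x *
            (prof a b s(n) w(x)/w(x))) := by
          rw [← mul_assoc]; congr 1; field_simp
      _ ≤ _ := h4
      _ = 2/a*(s(n)^b*(∫ x in closedBall 0 R',
            |V x| *(z x*prof a b s(n) w(x)))) := by ring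
      _ ≤ _ := h5

end ResonanceSeq

/-! ### Integrals of radial functions -/

lemma volume_unit_ball_R4 : (volume : Measure R4).real (ball 0 1) = π^2/2 := by
  rw [Measure.real, EuclideanSpace.volume_ball]
  have h1 : Gamma ((Fintype.card (Fin 4) : ℝ)/2 + 1) = 2 := by
    have := Gamma_nat_eq_factorial 2
    norm_num at this ⊢
  have h2 : √π^Fintype.card (Fin 4) = π^2 := by
    rw [Fintype.card_fin, show 4 = 2*2 from rfl, pow_mul, sq_sqrt pi_pos.le]
  rw [h1, h2]
  simp [toReal_ofReal (pos! : 0 ≤ π^2/2)]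

lemma integral_radial (f : ℝ → ℝ) :
    ∫ x : R4, f ‖x‖ = 2*π^2*∫ r in Ioi (0 : ℝ), r^3*f r := by
  rw [integral_fun_norm_addHaar (volume : Measure R4) f, volume_unit_ball_R4]
  simp
  ring

lemma integrable_radial_iff {f : ℝ → ℝ} :
    Integrable (fun x : R4 => f ‖x‖) ↔ IntegrableOn (fun r => r^3*f r) (Ioi 0) := by
  have := integrable_fun_norm_addHaar (volume : Measure R4) (f := f)
  simpa using this

lemma integral_radial_of_hasDerivAt {f Q : ℝ → ℝ} {l : ℝ} (hc : ContinuousWithinAt Q (Set.Ici 0) 0)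
    (hQ : ∀ r ∈ Ioi (0 : ℝ), HasDerivAt Q (r^3*f r) r) (h0 : ∀ r ∈ Ioi (0 : ℝ), 0 ≤ f r)
    (hl : Tendsto Q atTop (𝓝 l)) :
    Integrable (fun x : R4 => f ‖x‖) ∧ ∫ x : R4, f ‖x‖ = 2*π^2*(l - Q 0) := by
  have hp : ∀ r ∈ Ioi (0 : ℝ), 0 ≤ r^3*f r := fun r hr => mul_nonneg (pow_nonneg (le_of_lt hr) 3) (h0 r hr)
  refine ⟨integrable_radial_iff.2 (integrableOn_Ioi_deriv_of_nonneg hc hQ hp hl), ?_⟩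
  rw [integral_radial, integral_Ioi_of_hasDerivAt_of_nonneg hc hQ hp hl]

lemma integral_ball_norm_rpow {q : ℝ} (hq : q < 4) (hr : 0 ≤ r) :
    IntegrableOn (fun z : R4 => ‖z‖^(-q)) (closedBall 0 r) ∧
    ∫ z in closedBall (0 : R4) r, ‖z‖^(-q) = 2*π^2*(r^(4 - q)/(4 - q)) := by
  set f : ℝ → ℝ := (Set.Iic r).indicator fun t => t^(-q) with hf
  have e1 : (fun x : R4 => f ‖x‖) = (closedBall (0 : R4) r).indicator fun z => ‖z‖^(-q) := by
    funext x
    by_cases hx : ‖x‖ ≤ r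
    · rw [hf, indicator_of_mem (by! hx), indicator_of_mem (by! hx)]
    · rw [hf, indicator_of_notMem (by! hx), indicator_of_notMem (by! hx)]
  have e2 : ∀ t ∈ Ioi (0 : ℝ), t^3*f t = (Ioc 0 r).indicator (fun t => t^(3 - q)) t := by
    intro t ht
    by_cases hx : t ≤ r
    · rw [hf, indicator_of_mem (by! hx), indicator_of_mem (by simpa using ⟨ht, hx⟩),
        ← rpow_natCast, ← rpow_add ht]
      congr 1
    · rw [hf, indicator_of_notMem (by! hx), indicator_of_notMem (by simp [hx]), mul_zero]
  have hint : IntegrableOn (fun t : ℝ => t^(3 - q)) (Ioc 0 r) := by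
    have := (intervalIntegral.intervalIntegrable_rpow' (a := 0) (b := r) (r := 3 - q) lin!)
    rwa [intervalIntegrable_iff_integrableOn_Ioc_of_le hr] at this
  have hres : (volume.restrict (Ioi (0 : ℝ))).restrict (Ioc 0 r) = volume.restrict (Ioc 0 r) := by
    rw [Measure.restrict_restrict measurableSet_Ioc, Set.inter_eq_left.2 Set.Ioc_subset_Ioi_self]
  constructor
  · rw [← integrable_indicator_iff measurableSet_closedBall, ← e1, integrable_radial_iff,
      integrableOn_congr_fun e2 measurableSet_Ioi]
    exact (hint.integrable_indicator measurableSet_Ioc).integrableOn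
  · rw [← integral_indicator measurableSet_closedBall, ← e1, integral_radial,
      setIntegral_congr_fun measurableSet_Ioi e2, integral_indicator measurableSet_Ioc, hres,
      ← intervalIntegral.integral_of_le hr, integral_rpow (Or.inl lin!),
      zero_rpow lin!]
    congr 2
    · rw [sub_zero]; congr 1; ring
    · ring

/-! ### The Green function -/

/-- The approximate identity generated by the regularized Green function. -/
def greenKernel (z : R4) : ℝ := 2/π^2*(w(z)^3)⁻¹

lemma continuous_greenKernel : Continuous greenKernel :=
  continuous_const.mul (Continuous.inv₀ (by fun_prop) fun x => pos!)

lemma greenKernel_nonneg (z : R4) : 0 ≤ greenKernel z := by unfold greenKernel; positivity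

lemma integral_one_add_norm_sq_inv_cube : Integrable (fun z : R4 => (w(z)^3)⁻¹) ∧
    ∫ z : R4, (w(z)^3)⁻¹ = π^2/2 := by
  have hd : ∀ r : ℝ, HasDerivAt (fun r : ℝ => 1/4*(1 - 1/(1 + r^2))^2)
      (r^3*((1 + r^2)^3)⁻¹) r := fun r => by
    have h0 : (1 + r^2) ≠ 0 := pos!
    have h1 : HasDerivAt (fun r : ℝ => 1 + r^2) (2*r) r := by simpa using (hasDerivAt_pow 2 r).const_add 1
    have h2 := (((((hasDerivAt_const r (1 : ℝ)).div h1 h0).const_sub 1).pow 2).const_mul (1/4))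
    refine h2.congr_deriv ?_
    simp
    field_simp
    ring
  have hl : Tendsto (fun r : ℝ => 1/4*(1 - 1/(1 + r^2))^2) atTop (𝓝 (1/4)) := by
    have h1 : Tendsto (fun r : ℝ => 1 + r^2) atTop atTop :=
      tendsto_atTop_add_const_left _ _ (tendsto_pow_atTop num!)
    have h2 := (((h1.const_div_atTop 1).const_sub 1).pow 2).const_mul (1/4)
    simpa using h2
  obtain ⟨hi, he⟩ := integral_radial_of_hasDerivAt (f := fun r => ((1 + r^2)^3)⁻¹)
    (hd 0).continuousAt.continuousWithinAt (fun r _ => hd r) (fun r _ => pos!) hl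
  refine ⟨hi, he.trans ?_⟩
  norm_num
  ring

lemma integrable_greenKernel : Integrable greenKernel := integral_one_add_norm_sq_inv_cube.1.const_mul _

lemma integral_greenKernel : ∫ z, greenKernel z = 1 := by
  unfold greenKernel
  rw [integral_const_mul, integral_one_add_norm_sq_inv_cube.2]
  field_simp

lemma average_greenKernel (he : 0 < e) (u : R4 → ℝ) (x : R4) :
    ∫ y, ((e⁻¹)^4*greenKernel (e⁻¹ • y)) • u (x - y) = 2/π^2*e^2*∫ y, u y*((e^2 + ‖y - x‖^2)^3)⁻¹ := by
  rw [← integral_const_mul, ← integral_sub_left_eq_self _ _ x]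
  congr 1; funext y
  rw [sub_sub_cancel, greenKernel, norm_smul, norm_inv, norm_of_nonneg he.le, smul_eq_mul, norm_sub_rev y x]
  have : 1 + (e⁻¹*‖x - y‖)^2 = (e^2 + ‖x - y‖^2)/e^2 := by field_simp
  rw [this]
  field_simp

lemma exists_weight_compare {t : ℝ} (ht : 0 < t) (a : R4) :
    ∃ A : ℝ, 0 < A ∧ ∀ y, 1 + ‖y‖ ≤ A*√(t + ‖y - a‖^2) := by
  refine ⟨b(a)/√t + 1, pos!, fun y => ?_⟩
  have h1 : ‖y‖ ≤ ‖a‖ + ‖y - a‖ := by have := norm_add_le a (y - a); simpa using this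
  have h2 : √t ≤ √(t + ‖y - a‖^2) := sqrt_le_sqrt (by nlinarith [sq_nonneg ‖y - a‖])
  have h3 : ‖y - a‖ ≤ √(t + ‖y - a‖^2) := le_sqrt_of_sq_le lin!
  have h4 : 1 + ‖a‖ ≤ b(a)/√t*√(t + ‖y - a‖^2) := by
    rw [div_mul_eq_mul_div, le_div_iff₀ (sqrt_pos.2 ht)]
    gcongr
  linarith

lemma hasDerivAt_inv_pow (m : ℕ) (hs : 0 < s) :
    HasDerivAt (fun s : ℝ => (s^m)⁻¹) (-(m : ℝ)*(s^(m + 1))⁻¹) s := by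
  have h := (hasDerivAt_pow m s).inv pos!
  refine h.congr_deriv ?_
  rcases m with _ | m
  · simp
  · have := hs.ne'
    simp only [Nat.add_sub_cancel]
    field_simp
    ring

lemma contDiffOn_inv_pow (m : ℕ) {n : WithTop ℕ∞} : ContDiffOn ℝ n (fun s : ℝ => (s^m)⁻¹) (Ioi 0) :=
  (contDiffOn_id.pow m).inv fun _ hs => pow_ne_zero m (ne_of_gt hs)

lemma rpow_neg_natCast_weight (x : R4) (n : ℕ) : b(x)^(-(n : ℝ)) = (b(x)^n)⁻¹ := by
  rw [rpow_neg pos!, rpow_natCast]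

lemma abs_coord_le (y a : R4) (k : Fin 4) : |y k - a k| ≤ ‖y - a‖ := by simpa using PiLp.norm_apply_le (y - a) k

lemma pow_weight_compare {w σ : ℝ} (hw : 0 < w) (hσ : 0 < σ) (h : w ≤ A*σ) (n : ℕ) :
    (σ^n)⁻¹ ≤ A^n*(w^n)⁻¹ := by
  have h2 := pow_le_pow_left₀ hw.le h n
  rw [mul_pow] at h2
  rw [← div_eq_mul_inv, le_div_iff₀ pos!, inv_mul_le_iff₀ pos!]
  linarith

namespace ResonanceSeq

lemma integrable_mul_bdd {u : R4 → ℝ} (hu : Integrable u) (hf : Continuous f) {C : ℝ}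
    (hC : ∀ x, |f x| ≤ C) : Integrable fun x => u x*f x :=
  (hu.bdd_mul hf.aestronglyMeasurable (.of_forall hC)).congr (.of_forall fun _ => mul_comm _ _)

lemma integrable_mul_of_le_weight {u : R4 → ℝ} (hu : MemLp u 4) (hf : Continuous f) {C : ℝ}
    {n : ℕ} (hn : 3 < n) (hC : ∀ x, |f x| ≤ C*(b(x)^n)⁻¹) : Integrable fun x => u x*f x := by
  have h1 := integrable_mul_weight hu (r := n) (by exact_mod_cast hn)
  refine (h1.norm.const_mul C).mono' (hu.1.mul hf.aestronglyMeasurable) (.of_forall fun x => ?_)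
  rw [norm_mul, norm_mul, rpow_neg_natCast_weight, norm_eq_abs (f x), norm_of_nonneg (pos! : 0 ≤ (b(x)^n)⁻¹)]
  calc ‖u x‖*|f x| ≤ ‖u x‖*(C*(b(x)^n)⁻¹) := by gcongr; exact hC x
    _ = _ := by ring

lemma green_identity (h : ResonanceSeq V v z g) (hr : Integrable fun x => V x*z x) (he : 0 < e) (x : R4) :
    8*e^2*∫ y, z y*((e^2 + ‖y - x‖^2)^3)⁻¹ = ∫ y, -(V y*z y)*((e^2 + ‖y - x‖^2)^1)⁻¹ := by
  have ht : 0 < e^2 := pos!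
  obtain ⟨A, hA, hAy⟩ := exists_weight_compare ht x
  have hs : ∀ y, 0 < e^2 + ‖y - x‖^2 := fun y => pos!
  have hσ : ∀ y, 0 < √(e^2 + ‖y - x‖^2) := fun y => sqrt_pos.2 (hs y)
  have hsq : ∀ y, e^2 + ‖y - x‖^2 = √(e^2 + ‖y - x‖^2)^2 := fun y => (sq_sqrt (hs y).le).symm
  have hz : ∀ y, ‖y - x‖ ≤ √(e^2 + ‖y - x‖^2) := fun y => le_sqrt_of_sq_le lin!
  set F : R4 → ℝ := fun y => ((e^2 + ‖y - x‖^2)^1)⁻¹ with hF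
  have hsm : ContDiff ℝ 2 F := contDiff_radial (contDiffOn_inv_pow 1) ht x
  have hlap : ∀ y, lap F y = -8*e^2*((e^2 + ‖y - x‖^2)^3)⁻¹ := fun y => by
    have := lap_radial (f := fun s => (s^1)⁻¹) (a := x) (y := y) ht (fun s hs => hasDerivAt_inv_pow 1 hs)
      ((hasDerivAt_inv_pow 2 (hs y)).const_mul _)
    rw [this]
    have := (hs y).ne'
    field_simp
    push_cast
    ring
  have hFle : ∀ y, |F y| ≤ A^2*(b(y)^2)⁻¹ := fun y => by
    rw [hF]
    simp only [pow_one]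
    rw [abs_of_pos (by have := hs y; positivity), hsq]
    exact pow_weight_compare pos! (hσ y) (hAy y) 2
  have hpd : ∀ j y, |pd j F y| ≤ 2*A^3*(b(y)^3)⁻¹ := fun j y => by
    rw [hF, pd_radial (f := fun s => (s^1)⁻¹) j (hasDerivAt_inv_pow 1 (hs y))]
    rw [abs_mul]
    have e1 : |2*(-((1 : ℕ) : ℝ)*((e^2 + ‖y - x‖^2)^(1 + 1))⁻¹)|
        = 2*(√(e^2 + ‖y - x‖^2)^4)⁻¹ := by
      rw [hsq y, sqrt_sq (hσ y).le, ← pow_mul]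
      simp [abs_mul]
    rw [e1]
    have := pow_weight_compare pos! (hσ y) (hAy y) 3
    calc _ ≤ 2*(√(e^2 + ‖y - x‖^2)^4)⁻¹*√(e^2 + ‖y - x‖^2) := by
          gcongr; exact (abs_coord_le _ _ _).trans (hz y)
      _ = 2*(√(e^2 + ‖y - x‖^2)^3)⁻¹ := by
          have := hσ y
          field_simp
      _ ≤ _ := lin!
  have hsix : ∀ y, |lap F y| ≤ (8*e^2*A^6)*(b(y)^6)⁻¹ := fun y => by
    rw [hlap, abs_mul]
    have := pow_weight_compare pos! (hσ y) (hAy y) 6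
    have e0 : |((e^2 + ‖y - x‖^2)^3)⁻¹| = (√(e^2 + ‖y - x‖^2)^6)⁻¹ := by
      rw [abs_of_pos (by have := hs y; positivity), show 6 = 2*3 from rfl, pow_mul, ← hsq]
    rw [e0, show |-8*e^2| = 8*e^2 by rw [abs_mul, abs_of_pos ht]; norm_num, mul_assoc (8*e^2)]
    gcongr
  have hbd : ∀ y, |F y| ≤ (e^2)⁻¹ := fun y => by
    rw [hF]
    simp only [pow_one]
    rw [abs_of_pos (by have := hs y; positivity)]
    gcongr
    nlinarith [sq_nonneg ‖y - x‖]
  have key := h.ext_very_weak hsm (C := A^2 + 2*A^3) (b := 2)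
    (fun y => by
      have := rpow_neg_natCast_weight y 2
      norm_cast at this ⊢
      rw [this]
      refine (hFle y).trans ?_
      gcongr
      have : 0 < A^3 := pos!
      linarith)
    (fun j y => by
      have := rpow_neg_natCast_weight y 3
      rw [show (-2 - 1 : ℝ) = -((3 : ℕ) : ℝ) by norm_num, this]
      refine (hpd j y).trans ?_
      gcongr
      have : 0 < A^2 := pos!
      linarith)
    (by have := integrable_mul_weight h.memz (r := 4) num!; convert this using 3; norm_num)
    (integrable_mul_of_le_weight h.memz (continuous_lap hsm) (n := 6) num! hsix)
    ((integrable_mul_bdd hr hsm.continuous hbd).congr (.of_forall fun y => mul_assoc _ _ _))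
  have e1 : ∫ y, z y*lap F y = -(8*e^2*∫ y, z y*((e^2 + ‖y - x‖^2)^3)⁻¹) := by
    rw [← integral_const_mul, ← integral_neg]
    congr 1; funext y
    rw [hlap]; ring
  have e2 : ∫ y, V y*(z y*F y) = -∫ y, -(V y*z y)*((e^2 + ‖y - x‖^2)^1)⁻¹ := by
    rw [← integral_neg]
    congr 1; funext y
    rw [hF]; ring
  rw [e1, e2] at key
  linarith

end ResonanceSeq

lemma ae_tendsto_average {m : R4 → ℝ} (hc : Continuous m) (h0 : ∀ y, 0 ≤ m y) (hint : Integrable m)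
    (h1 : ∫ y, m y = 1) {u : R4 → ℝ} {p : ℝ} (hp : 1 ≤ p) (hu : MemLp u (ofReal p))
    {e : ℕ → ℝ} (he : ∀ n, 0 < e n) (hlim : Tendsto e atTop (𝓝 0)) :
    ∃ ns : ℕ → ℕ, StrictMono ns ∧ ∀ᵐ x, Tendsto (fun n =>
      ∫ y, (((e (ns n))⁻¹)^4*m ((e (ns n))⁻¹ • y)) • u (x - y)) atTop (𝓝 (u x)) := by
  have hp0 : 0 < p := lin!
  have hw : Tendsto e atTop (𝓝[>] 0) := tendsto_nhdsWithin_iff.2 ⟨hlim, .of_forall he⟩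
  have key := (tendsto_lintegral_average_sub hc h0 hint h1 hp hu).comp hw
  have h2 := (continuous_rpow_const (y := 1/p)).tendsto 0 |>.comp key
  rw [zero_rpow_of_pos pos!] at h2
  set A : ℕ → R4 → ℝ := fun n x => ∫ y, ((e n)⁻¹^4*m ((e n)⁻¹ • y)) • u (x - y)
  have hAm : ∀ n, AEStronglyMeasurable (A n) := fun n => by
    have hk : AEStronglyMeasurable (fun y : R4 => (e n)⁻¹^4*m ((e n)⁻¹ • y)) volume :=
      (by fun_prop : Continuous fun y : R4 => (e n)⁻¹^4*m ((e n)⁻¹ • y)).aestronglyMeasurable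
    exact (hk.convolution_integrand (ContinuousLinearMap.lsmul ℝ ℝ) hu.1).integral_prod_right'
  have h3 : Tendsto (fun n => eLpNorm (A n - u) (ofReal p)) atTop (𝓝 0) := by
    refine h2.congr fun n => ?_
    rw [eLpNorm_eq_lintegral_rpow_enorm_toReal (by! hp0) ofReal_ne_top, toReal_ofReal hp0.le]
    rfl
  exact (tendstoInMeasure_of_tendsto_eLpNorm (by! hp0) hAm hu.1 h3).exists_seq_tendsto_ae

lemma norm_rpow_neg_natCast (z : R4) (m : ℕ) : ‖z‖^(-(m : ℝ)) = (‖z‖^m)⁻¹ := by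
  rw [rpow_neg (norm_nonneg _), rpow_natCast]

lemma integrable_ball_kernel {m : ℕ} (hm : m < 4) (hr : 0 ≤ r) :
    IntegrableOn (fun z : R4 => (‖z‖^m)⁻¹) (closedBall 0 r) := by
  have := (integral_ball_norm_rpow (q := m) (by exact_mod_cast hm) hr).1
  simpa only [norm_rpow_neg_natCast] using this

lemma measurable_kernel (m : ℕ) : Measurable fun z : R4 => (‖z‖^m)⁻¹ := by fun_prop

lemma exists_integrable_kernel_le {m : ℕ} (hm : m < 4) :
    ∃ k : R4 → ℝ, Integrable k ∧ ∀ z, (‖z‖^m)⁻¹ ≤ |k z| + 1 := by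
  refine ⟨(closedBall (0 : R4) 1).indicator fun z => (‖z‖^m)⁻¹,
    (integrable_indicator_iff measurableSet_closedBall).2 (integrable_ball_kernel hm zero_le_one),
    fun z => ?_⟩
  by_cases h : ‖z‖ ≤ 1
  · rw [indicator_of_mem (by! h)]
    linarith [le_abs_self ((‖z‖^m)⁻¹)]
  · exact (inv_le_one_of_one_le₀ (one_le_pow₀ lin!)).trans (le_add_of_nonneg_left (abs_nonneg _))

/-- Riesz potentials of integrable functions converge absolutely almost everywhere. -/
lemma ae_integrable_kernel {r : R4 → ℝ} (hr : Integrable r) {m : ℕ} (hm : m < 4) :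
    ∀ᵐ x, Integrable fun y => r y*(‖y - x‖^m)⁻¹ := by
  obtain ⟨k, hk, hle⟩ := exists_integrable_kernel_le hm
  filter_upwards [hr.ae_convolution_exists (ContinuousLinearMap.mul ℝ ℝ) hk] with x hx
  have hx' : Integrable fun y => r y*k (x - y) := hx
  refine (hx'.norm.add hr.norm).mono' (hr.1.mul ((measurable_kernel m).comp (measurable_id.sub_const x)).aestronglyMeasurable)
    (.of_forall fun y => ?_)
  rw [norm_mul, Pi.add_apply, norm_mul, ← mul_add_one, norm_sub_rev, norm_of_nonneg (pos! : 0 ≤ (‖x - y‖^m)⁻¹)]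
  exact mul_le_mul_of_nonneg_left (hle _) (norm_nonneg _)

lemma integrable_prod_kernel {r t : R4 → ℝ} (hr : Integrable r) (ht : Continuous t)
    (hc : HasCompactSupport t) {m : ℕ} (hm : m < 4) : Integrable
      (fun p : R4 × R4 => t p.1*(r p.2*(‖p.2 - p.1‖^m)⁻¹)) (volume.prod volume) := by
  obtain ⟨k, hk, hle⟩ := exists_integrable_kernel_le hm
  obtain ⟨C, hC⟩ := hc.exists_bound_of_continuous ht
  refine (((hr.convolution_integrand (ContinuousLinearMap.mul ℝ ℝ) hk).norm.const_mul C).add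
    ((ht.integrable_of_hasCompactSupport hc).mul_prod hr).norm).mono'
    (ht.comp_aestronglyMeasurable measurable_fst.aestronglyMeasurable |>.mul
      (hr.1.comp_snd.mul (by fun_prop))) (.of_forall fun p => ?_)
  have h1 := mul_le_mul_of_nonneg_left (hle (p.1 - p.2)) (norm_nonneg (r p.2))
  have h2 := mul_le_mul_of_nonneg_right (hC p.1) (norm_nonneg (r p.2*k (p.1 - p.2)))
  rw [norm_mul, norm_mul, norm_of_nonneg (pos! : 0 ≤ (‖p.2 - p.1‖^m)⁻¹), norm_sub_rev]
  refine (mul_le_mul_of_nonneg_left h1 (norm_nonneg _)).trans ?_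
  simp only [Pi.add_apply, ContinuousLinearMap.mul_apply', norm_mul, ← norm_eq_abs] at h2 ⊢
  linarith

/-- The weak derivative of the Newton kernel, tested against `ψ`. -/
lemma integral_pd_mul_kernel {ψ : R4 → ℝ} (hψ : ContDiff ℝ ∞ ψ) (hc : HasCompactSupport ψ) (k : Fin 4)
    {y : R4} (h2 : Integrable fun x => pd k ψ x*(r*(‖y - x‖^2)⁻¹))
    (h3 : Integrable fun x => ψ x*(r*(‖y - x‖^3)⁻¹)) :
    ∫ x, pd k ψ x*(r*(‖y - x‖^2)⁻¹) = -∫ x, ψ x*(r*(2*((y - x) k*(‖y - x‖^4)⁻¹))) := by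
  have he := tendsto_one_div_add_atTop_nhds_zero_nat (𝕜 := ℝ)
  set e : ℕ → ℝ := fun n => 1/s(n) with hed
  have hs : ∀ n x, 0 < e n^2 + ‖x - y‖^2 := fun n x => by
    have : 0 < e n := pos!
    positivity
  have hne : ∀ᵐ x : R4, 0 < ‖y - x‖ := by
    simp only [norm_pos_iff, sub_ne_zero]
    simp [ae_iff, measure_singleton]
  have hcd : ∀ n, ContDiff ℝ 1 fun x : R4 => ((e n^2 + ‖x - y‖^2)^1)⁻¹ := fun n =>
    contDiff_radial (contDiffOn_inv_pow 1) (by have : 0 < e n := pos!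
                                               positivity) y
  have key : ∀ n, ∫ x, pd k ψ x*(r*(e n^2 + ‖y - x‖^2)⁻¹)
      = -∫ x, ψ x*(r*(2*((y - x) k*((e n^2 + ‖y - x‖^2)^2)⁻¹))) := fun n => by
    have := congrArg (r*·) ((HasWeakPartial.of_contDiff (i := k) (hcd n)).2.2 ψ hψ hc)
    simp only [mul_neg, ← integral_const_mul] at this
    refine Eq.trans ?_ (this.trans (congrArg Neg.neg ?_)) <;> congr 1 <;> funext x
    · rw [pow_one, norm_sub_rev, smul_eq_mul, pd]; ring
    · have := pd_radial (f := fun s => (s^1)⁻¹) k (hasDerivAt_inv_pow 1 (hs n x))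
      rw [pd] at this
      rw [this, norm_sub_rev, smul_eq_mul, PiLp.sub_apply]; push_cast; ring
  refine tendsto_nhds_unique (l := atTop) (f := fun n => ∫ x, pd k ψ x*(r*(e n^2 + ‖y - x‖^2)⁻¹)) ?_
    (Tendsto.congr (fun n => (key n).symm) (Tendsto.neg ?_))
  · refine tendsto_integral_of_dominated_convergence _ (fun n => ?_) h2.norm
      (fun n => ?_) ?_
    · exact (continuous_pd (hψ.of_le (by simp)) k).aestronglyMeasurable.mul (by fun_prop)
    · filter_upwards [hne] with x hx
      simp only [norm_mul]
      gcongr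
      exact abs_le_abs_of_nonneg pos! (by gcongr; exact le_add_of_nonneg_left pos!)
    · filter_upwards [hne] with x hx
      have : Tendsto (fun n => pd k ψ x*(r*(e n^2 + ‖y - x‖^2)⁻¹)) atTop
        (𝓝 (pd k ψ x*(r*(0^2 + ‖y - x‖^2)⁻¹))) :=
        ((((he.pow 2).add_const _).inv₀ pos!).const_mul _).const_mul _
      simpa using this
  · refine tendsto_integral_of_dominated_convergence _ (fun n => ?_) (h3.norm.const_mul 2)
      (fun n => ?_) ?_
    · exact hψ.continuous.aestronglyMeasurable.mul (by fun_prop)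
    · filter_upwards [hne] with x hx
      have h4 : |(y - x) k| ≤ ‖y - x‖ := by simpa using PiLp.norm_apply_le (y - x) k
      have h5 : |(y - x) k| *((e n^2 + ‖y - x‖^2)^2)⁻¹ ≤ (‖y - x‖^3)⁻¹ := by
        calc _ ≤ ‖y - x‖*((0 + ‖y - x‖^2)^2)⁻¹ := by gcongr; positivity
          _ = _ := by rw [zero_add]; field_simp
      simp only [norm_mul, norm_inv, norm_pow, norm_norm, Real.norm_ofNat, norm_eq_abs ((y - x) k),
        norm_of_nonneg (pos! : 0 ≤ e n^2 + ‖y - x‖^2)]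
      calc _ = 2*(‖ψ x‖*(‖r‖*(|(y - x) k| *((e n^2 + ‖y - x‖^2)^2)⁻¹))) := by ring
        _ ≤ _ := by gcongr
    · filter_upwards [hne] with x hx
      have : Tendsto (fun n => ψ x*(r*(2*((y - x) k*((e n^2 + ‖y - x‖^2)^2)⁻¹)))) atTop
        (𝓝 (ψ x*(r*(2*((y - x) k*((0^2 + ‖y - x‖^2)^2)⁻¹))))) :=
        (((((((he.pow 2).add_const _).pow 2).inv₀ pos!).const_mul _).const_mul _).const_mul _).const_mul _
      simpa [← pow_mul] using this

namespace ResonanceSeq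

lemma green_repr (h : ResonanceSeq V v z g) (hr : Integrable fun x => V x*z x) :
    ∀ᵐ x, Integrable (fun y => -(V y*z y)*(‖y - x‖^2)⁻¹) ∧ z x = 1/(4*π^2)*∫ y, -(V y*z y)*(‖y - x‖^2)⁻¹ := by
  obtain ⟨ns, hns, hae⟩ := ae_tendsto_average continuous_greenKernel greenKernel_nonneg
    integrable_greenKernel integral_greenKernel (p := 4) num! (u := z) (by! h.memz)
    (e := fun n : ℕ => 1/s(n)) (fun n => pos!) tendsto_one_div_add_atTop_nhds_zero_nat
  filter_upwards [hae, ae_integrable_kernel hr.neg (m := 2) num!] with x hx hi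
  refine ⟨hi, tendsto_nhds_unique hx ?_⟩
  have he := tendsto_one_div_add_atTop_nhds_zero_nat (𝕜 := ℝ) |>.comp hns.tendsto_atTop
  refine Tendsto.congr (fun n => ?_) (Tendsto.const_mul (1/(4*π^2)) (tendsto_integral_of_dominated_convergence
      (F := fun n y => -(V y*z y)*(((1/((ns n : ℝ) + 1))^2 + ‖y - x‖^2)^1)⁻¹) _ (fun n => ?_)
      hi.norm (fun n => ?_) ?_))
  · have hp : 0 < 1/((ns n : ℝ) + 1) := pos!
    rw [average_greenKernel hp, ← h.green_identity hr hp x]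
    ring
  · exact hr.neg.1.mul (by fun_prop)
  all_goals
    have hne : ∀ᵐ y : R4, y ≠ x := by simp [ae_iff, measure_singleton]
    filter_upwards [hne] with y hy
    have hp : ‖y - x‖ ≠ 0 := norm_ne_zero_iff.2 (sub_ne_zero.2 hy)
  · simp only [norm_mul, pow_one]
    exact mul_le_mul_of_nonneg_left (abs_le_abs_of_nonneg pos!
      (by gcongr; exact le_add_of_nonneg_left pos!)) (norm_nonneg _)
  · have := (((he.pow 2).add_const (‖y - x‖^2)).inv₀ (by! hp)).const_mul (-(V y*z y))
    simpa using this

lemma green_repr_pd (h : ResonanceSeq V v z g) (hr : Integrable fun x => V x*z x) (k : Fin 4) :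
    ∀ᵐ x, Integrable (fun y => -(V y*z y)*(‖y - x‖^3)⁻¹) ∧
      g k x = 1/(2*π^2)*∫ y, -(V y*z y)*((y - x) k*(‖y - x‖^4)⁻¹) := by
  have hD : ∀ {t : R4 → ℝ}, Continuous t → HasCompactSupport t → Integrable (fun p : R4 × R4 =>
      t p.1*(-(V p.2*z p.2)*(2*((p.2 - p.1) k*(‖p.2 - p.1‖^4)⁻¹)))) (volume.prod volume) :=
    fun {t} ht hc => by
    refine ((integrable_prod_kernel hr.neg ht hc (m := 3) num!).norm.const_mul 2).mono'
      (ht.comp_aestronglyMeasurable measurable_fst.aestronglyMeasurable |>.mul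
        (hr.neg.1.comp_snd.mul (by fun_prop))) (.of_forall fun p => ?_)
    have h4 : |(p.2 - p.1) k| ≤ ‖p.2 - p.1‖ := by simpa using PiLp.norm_apply_le (p.2 - p.1) k
    have h5 : |(p.2 - p.1) k| *(‖p.2 - p.1‖^4)⁻¹ ≤ (‖p.2 - p.1‖^3)⁻¹ := by
      rcases (norm_nonneg (p.2 - p.1)).eq_or_lt with h0 | h0
      · simp [← h0]
      · calc _ ≤ ‖p.2 - p.1‖*(‖p.2 - p.1‖^4)⁻¹ := by gcongr
          _ = _ := by field_simp
    simp only [norm_mul, norm_inv, norm_pow, norm_norm, Real.norm_ofNat, norm_eq_abs ((p.2 - p.1) k)]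
    calc _ = 2*(‖t p.1‖*(‖-(V p.2*z p.2)‖*(|(p.2 - p.1) k| *(‖p.2 - p.1‖^4)⁻¹))) := by ring
      _ ≤ _ := by gcongr; rfl
  set c : ℝ := 1/(4*π^2) with hcd
  have hu : ∀ x, 1/(2*π^2)*∫ y, -(V y*z y)*((y - x) k*(‖y - x‖^4)⁻¹)
      = c*∫ y, -(V y*z y)*(2*((y - x) k*(‖y - x‖^4)⁻¹)) := fun x => by
    rw [hcd, ← integral_const_mul, ← integral_const_mul]
    congr 1; funext y; ring
  simp only [hu]
  refine (ae_integrable_kernel hr.neg num!).and ?_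
  refine ae_eq_of_integral_contDiff_smul_eq ((h.memg k).locallyIntegrable num!) ?_ fun ψ hψ hc => ?_
  · refine locallyIntegrable_iff.2 fun K hK => ?_
    obtain ⟨R, hR, hKR⟩ := hK.isBounded.subset_closedBall_lt 0 0
    have := ((hD (cutoff_contDiff R).continuous (cutoff_hasCompactSupport hR)).integral_prod_left.const_mul
      c).integrableOn (s := K)
    refine this.congr_fun (fun x hx => ?_) hK.measurableSet
    simp only [integral_const_mul]
    rw [cutoff_eq_one hR (by simpa using hKR hx), one_mul]
  have hc1 := hasCompactSupport_pd hc k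
  have hψ1 := continuous_pd (hψ.of_le (by simp)) k
  have i2 := integrable_prod_kernel hr.neg hψ1 hc1 (m := 2) num!
  have i3 := integrable_prod_kernel hr.neg hψ.continuous hc (m := 3) num!
  have e1 : ∫ x, z x*pd k ψ x = c*∫ x, ∫ y, pd k ψ x*(-(V y*z y)*(‖y - x‖^2)⁻¹) := by
    rw [← integral_const_mul]
    refine integral_congr_ae ?_
    filter_upwards [h.green_repr hr] with x hx
    rw [hx.2, integral_const_mul]; ring
  have e2 := h.integral_mul_pd ⟨hψ.of_le (by simp), hc⟩ k
  rw [e1, integral_integral_swap i2] at e2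
  have e3 : ∫ x, ψ x • (c*∫ y, -(V y*z y)*(2*((y - x) k*(‖y - x‖^4)⁻¹)))
      = c*∫ x, ∫ y, ψ x*(-(V y*z y)*(2*((y - x) k*(‖y - x‖^4)⁻¹))) := by
    rw [← integral_const_mul]
    congr 1; funext x
    rw [integral_const_mul, smul_eq_mul]; ring
  have e4 : ∫ y, ∫ x, pd k ψ x*(-(V y*z y)*(‖y - x‖^2)⁻¹)
      = -∫ y, ∫ x, ψ x*(-(V y*z y)*(2*((y - x) k*(‖y - x‖^4)⁻¹))) := by
    rw [← integral_neg]
    refine integral_congr_ae ?_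
    filter_upwards [i2.prod_left_ae, i3.prod_left_ae] with y h2 h3
    exact integral_pd_mul_kernel hψ hc k h2 h3
  rw [e3, integral_integral_swap (hD hψ.continuous hc)]
  rw [e4] at e2
  simp only [smul_eq_mul, mul_comm (ψ _) (g k _)]
  linarith

end ResonanceSeq

/-! ### Asymptotics of potentials -/

lemma potential_asymptotics {r K : R4 → ℝ} {m : ℕ} {C : ℝ} (hC : 0 ≤ C) (hd : 0 < d) (hd1 : d ≤ 1)
    (hKm : Measurable K) (hK : ∀ z, |K z| ≤ (‖z‖^m)⁻¹)
    (hKd : ∀ x y, x ≠ 0 → ‖y‖ ≤ ‖x‖/2 → |K (y - x) - K (-x)| ≤ C*‖y‖*(‖x‖^(m + 1))⁻¹)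
    (hr1 : Integrable r) (hr : Integrable fun y => r y*b(y)^d) {x : R4} (hx : x ≠ 0)
    (hi : Integrable fun y => r y*(‖y - x‖^m)⁻¹) :
    |(∫ y, r y*K (y - x)) - K (-x)*∫ y, r y|
      ≤ (C + 2^(m + 2))*(‖x‖^(-d)*(‖x‖^m)⁻¹)*(∫ y, |r y*b(y)^d|)
        + ∫ y in closedBall x (‖x‖/2), |r y*(‖y - x‖^m)⁻¹| := by
  have hx0 : 0 < ‖x‖ := norm_pos_iff.2 hx
  have i1 : Integrable fun y => r y*K (y - x) := by
    refine hi.norm.mono' (hr1.1.mul (hKm.comp (measurable_id.sub_const x)).aestronglyMeasurable)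
      (.of_forall fun y => ?_)
    rw [norm_mul, norm_mul, norm_of_nonneg (pos! : 0 ≤ (‖y - x‖^m)⁻¹)]
    exact mul_le_mul_of_nonneg_left (hK _) (norm_nonneg _)
  set D : ℝ := (C + 2^(m + 2))*(‖x‖^(-d)*(‖x‖^m)⁻¹) with hD
  rw [mul_comm (K (-x)), ← integral_mul_const, ← integral_sub i1 (hr1.mul_const _),
    ← integral_const_mul, ← integral_indicator isClosed_closedBall.measurableSet,
    ← integral_add (hr.abs.const_mul D) (hi.abs.indicator isClosed_closedBall.measurableSet)]
  refine (norm_integral_le_integral_norm _).trans (integral_mono (i1.sub (hr1.mul_const _)).norm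
    ((hr.abs.const_mul D).add (hi.abs.indicator isClosed_closedBall.measurableSet)) fun y => ?_)
  simp only [norm_eq_abs, Pi.sub_apply, Pi.add_apply]
  rw [← mul_sub, abs_mul, abs_mul, abs_of_nonneg (pos! : 0 ≤ b(y)^d)]
  have hm0 : 0 < (‖x‖^m)⁻¹ := pos!
  set w : ℝ := b(y)^d*‖x‖^(-d) with hw
  have hwD : D*(|r y| *b(y)^d) = |r y| *((C + 2^(m + 2))*w*(‖x‖^m)⁻¹) := by rw [hD, hw]; ring
  have hweq : w = (b(y)/‖x‖)^d := by rw [hw, div_rpow pos! hx0.le, rpow_neg hx0.le, div_eq_mul_inv]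
  rw [hwD]
  have hind : 0 ≤ (closedBall x (‖x‖/2)).indicator (fun a => |r a*(‖a - x‖^m)⁻¹|) y :=
    Set.indicator_nonneg (fun _ _ => abs_nonneg _) y
  by_cases hy : ‖y‖ ≤ ‖x‖/2
  · have h1 : ‖y‖/‖x‖ ≤ w := by
      have h2 : ‖y‖/‖x‖ ≤ 1 := by rw [div_le_one hx0]; linarith
      calc ‖y‖/‖x‖ ≤ (‖y‖/‖x‖)^d := by
            have := rpow_le_rpow_of_exponent_ge' (x := ‖y‖/‖x‖) pos! h2 hd.le hd1
            simpa using this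
        _ ≤ w := by rw [hweq]; gcongr; linarith
    have h3 : |K (y - x) - K (-x)| ≤ (C + 2^(m + 2))*w*(‖x‖^m)⁻¹ := by
      refine (hKd x y hx hy).trans ?_
      calc C*‖y‖*(‖x‖^(m + 1))⁻¹ = C*(‖y‖/‖x‖)*(‖x‖^m)⁻¹ := by
            rw [pow_succ]; field_simp
        _ ≤ (C + 2^(m + 2))*w*(‖x‖^m)⁻¹ := by
            gcongr
            have : (0 : ℝ) < 2^(m + 2) := pos!
            linarith
    have := mul_le_mul_of_nonneg_left h3 (abs_nonneg (r y))
    linarith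
  · push Not at hy
    have h1 : 1 ≤ 2*w := by
      have h2 : 1/2 ≤ b(y)/‖x‖ := by rw [div_le_div_iff₀ num! hx0]; linarith
      have h3 : (1/2 : ℝ) ≤ (1/2 : ℝ)^d := by
        have := rpow_le_rpow_of_exponent_ge' (x := (1/2 : ℝ)) num! num! hd.le hd1
        simpa using this
      have h4 : (1/2 : ℝ)^d ≤ w := by rw [hweq]; gcongr
      linarith
    have hp : (2 : ℝ)^(m + 2) = 2*2^(m + 1) := by ring
    have hp1 : (2 : ℝ) ≤ 2^(m + 1) := by
      have : (1 : ℝ) ≤ 2^m := one_le_pow₀ num!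
      rw [pow_succ]; linarith
    have hKx : |K (-x)| ≤ 2*w*(‖x‖^m)⁻¹ := by
      refine (hK _).trans ?_
      rw [norm_neg]
      exact le_mul_of_one_le_left hm0.le h1
    by_cases hn : y ∈ closedBall x (‖x‖/2)
    · rw [indicator_of_mem hn, abs_mul, ← mul_add]
      refine mul_le_mul_of_nonneg_left ?_ (abs_nonneg _)
      have h5 := (hK (y - x)).trans (le_abs_self _)
      have h6 : 2*w*(‖x‖^m)⁻¹ ≤ (C + 2^(m + 2))*w*(‖x‖^m)⁻¹ := by gcongr; linarith
      linarith [abs_sub (K (y - x)) (K (-x))]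
    · have hn' : ‖x‖/2 < ‖y - x‖ := by simpa [dist_eq_norm] using hn
      have h5 : |K (y - x)| ≤ 2^(m + 1)*w*(‖x‖^m)⁻¹ := by
        refine (hK _).trans ?_
        calc (‖y - x‖^m)⁻¹ ≤ ((‖x‖/2)^m)⁻¹ := by gcongr
          _ = 2^m*(‖x‖^m)⁻¹ := by rw [div_pow, inv_div, div_eq_mul_inv]
          _ ≤ 2^m*(‖x‖^m)⁻¹*(2*w) := le_mul_of_one_le_right pos! h1
          _ = _ := by ring
      have h6 : |K (y - x) - K (-x)| ≤ (C + 2^(m + 2))*w*(‖x‖^m)⁻¹ := by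
        have h7 : (2^(m + 1) + 2)*(w*(‖x‖^m)⁻¹) ≤ (C + 2^(m + 2))*(w*(‖x‖^m)⁻¹) :=
          mul_le_mul_of_nonneg_right lin! pos!
        linarith [abs_sub (K (y - x)) (K (-x))]
      have := mul_le_mul_of_nonneg_left h6 (abs_nonneg (r y))
      linarith

lemma norm_sub_ge_half {x y : R4} (h : ‖y‖ ≤ ‖x‖/2) : ‖x‖/2 ≤ ‖y - x‖ := by
  have := norm_sub_norm_le x y
  rw [norm_sub_rev]
  linarith

lemma newton_kernel_diff {x y : R4} (hx : x ≠ 0) (hy : ‖y‖ ≤ ‖x‖/2) :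
    |(‖y - x‖^2)⁻¹ - (‖-x‖^2)⁻¹| ≤ 10*‖y‖*(‖x‖^(2 + 1))⁻¹ := by
  have hx0 : 0 < ‖x‖ := norm_pos_iff.2 hx
  have h1 := norm_sub_ge_half hy
  have h0 : 0 < ‖y - x‖ := lin!
  rw [norm_neg, inv_sub_inv pos! pos!, abs_div, abs_of_pos (pos! : 0 < ‖y - x‖^2*‖x‖^2), div_le_iff₀ pos!]
  have h2 : |‖x‖^2 - ‖y - x‖^2| ≤ ‖y‖*(5/2*‖x‖) := by
    have h3 : |‖x‖ - ‖y - x‖| ≤ ‖y‖ := by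
      have := abs_norm_sub_norm_le x (x - y)
      rw [norm_sub_rev x y] at this
      simpa using this
    have h4 : ‖y - x‖ ≤ ‖y‖ + ‖x‖ := norm_sub_le _ _
    rw [show ‖x‖^2 - ‖y - x‖^2 = (‖x‖ - ‖y - x‖)*(‖x‖ + ‖y - x‖) by ring, abs_mul,
      abs_of_pos (pos! : 0 < ‖x‖ + ‖y - x‖)]
    gcongr
    linarith
  have h5 : ‖x‖^2/4 ≤ ‖y - x‖^2 := by nlinarith
  calc _ ≤ ‖y‖*(5/2*‖x‖) := h2
    _ = 10*‖y‖*(‖x‖^(2 + 1))⁻¹*(‖x‖^2/4*‖x‖^2) := by field_simp; ring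
    _ ≤ _ := by gcongr

lemma newton_kernel_pd_diff {x y : R4} (k : Fin 4) (hx : x ≠ 0) (hy : ‖y‖ ≤ ‖x‖/2) :
    |(y - x) k*(‖y - x‖^4)⁻¹ - (-x) k*(‖-x‖^4)⁻¹| ≤ 66*‖y‖*(‖x‖^(3 + 1))⁻¹ := by
  have hx0 : 0 < ‖x‖ := norm_pos_iff.2 hx
  have h1 := norm_sub_ge_half hy
  have h0 : 0 < ‖y - x‖ := lin!
  have hd := newton_kernel_diff hx hy
  rw [norm_neg] at hd ⊢
  set a := (‖y - x‖^2)⁻¹ with ha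
  set b := (‖x‖^2)⁻¹ with hb
  have hb0 : 0 < b := pos!
  have ha0 : 0 < a := pos!
  have hab : a ≤ 4*b := by
    have : ((‖x‖/2)^2)⁻¹ = 4*b := by rw [hb]; field_simp; norm_num
    rw [← this, ha]
    gcongr
  have e1 : (‖y - x‖^4)⁻¹ = a^2 := by rw [ha, inv_pow, ← pow_mul]
  have e2 : (‖x‖^4)⁻¹ = b^2 := by rw [hb, inv_pow, ← pow_mul]
  have hyk : |y k| ≤ ‖y‖ := by simpa using PiLp.norm_apply_le y k
  have hxk : |x k| ≤ ‖x‖ := by simpa using PiLp.norm_apply_le x k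
  rw [e1, e2]
  have e3 : (y - x) k*a^2 - (-x) k*b^2 = y k*a^2 - x k*((a - b)*(a + b)) := by
    simp only [PiLp.sub_apply, PiLp.neg_apply]; ring
  rw [e3]
  have e5 : (‖x‖^(2 + 1))⁻¹*‖x‖ = b := by rw [hb]; field_simp
  have t1 : |y k*a^2| ≤ ‖y‖*(16*b^2) := by
    rw [abs_mul, abs_of_pos (pos! : 0 < a^2)]
    gcongr
    nlinarith
  have t2 : |x k*((a - b)*(a + b))| ≤ 50*‖y‖*b^2 := by
    rw [abs_mul, abs_mul, abs_of_pos (pos! : 0 < a + b)]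
    calc _ ≤ ‖x‖*(10*‖y‖*(‖x‖^(2 + 1))⁻¹*(5*b)) := by gcongr; linarith
      _ = 50*‖y‖*((‖x‖^(2 + 1))⁻¹*‖x‖)*b := by ring
      _ = _ := by rw [e5]; ring
  linarith [abs_sub (y k*a^2) (x k*((a - b)*(a + b)))]

/-- Normalized form of the short-range condition. -/
structure ShortRange (V : R4 → ℝ) (R d : ℝ) : Prop where
  one_le : 1 ≤ R
  pos : 0 < d
  le_half : d ≤ 1/2
  bound : ∀ᵐ x : R4, R < ‖x‖ → |V x| ≤ ‖x‖^(-2 - 2*d)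

lemma IsShortRange.exists_shortRange (h : IsShortRange V) :
    ∃ R d, ShortRange V R d := by
  obtain ⟨-, R, d, hR, hd, hb⟩ := h
  refine ⟨max 1 R, min d (1/2), le_max_left _ _, lt_min hd num!, min_le_right _ _, ?_⟩
  filter_upwards [hb] with x hx hxR
  have h1 : 1 < ‖x‖ := (le_max_left _ _).trans_lt hxR
  refine (hx ((le_max_right _ _).trans_lt hxR)).trans (rpow_le_rpow_of_exponent_le h1.le ?_)
  linarith [min_le_left d (1/2)]

lemma setIntegral_closedBall_sub (f : R4 → ℝ) (x : R4) (r : ℝ) :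
    ∫ y in closedBall x r, f (y - x) = ∫ z in closedBall 0 r, f z := by
  rw [← integral_indicator isClosed_closedBall.measurableSet,
    ← integral_indicator isClosed_closedBall.measurableSet,
    ← integral_sub_right_eq_self ((closedBall 0 r).indicator f) x]
  congr 1; funext y
  by_cases hy : y ∈ closedBall x r
  · have hy' : y - x ∈ closedBall (0 : R4) r := by simpa [dist_eq_norm] using hy
    rw [indicator_of_mem hy, indicator_of_mem hy']
  · have hy' : y - x ∉ closedBall (0 : R4) r := by simpa [dist_eq_norm] using hy
    rw [indicator_of_notMem hy, indicator_of_notMem hy']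

lemma integrableOn_closedBall_sub (hf : IntegrableOn f (closedBall 0 r)) (x : R4) :
    IntegrableOn (fun y => f (y - x)) (closedBall x r) := by
  rw [← integrable_indicator_iff isClosed_closedBall.measurableSet] at hf ⊢
  refine (hf.comp_sub_right x).congr (.of_forall fun y => ?_)
  by_cases hy : y ∈ closedBall x r
  · have hy' : y - x ∈ closedBall (0 : R4) r := by simpa [dist_eq_norm] using hy
    simp only []
    rw [indicator_of_mem hy, indicator_of_mem hy']
  · have hy' : y - x ∉ closedBall (0 : R4) r := by simpa [dist_eq_norm] using hy
    simp only []
    rw [indicator_of_notMem hy, indicator_of_notMem hy']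

lemma half_norm_le_of_mem {x y : R4} (h : y ∈ closedBall x (‖x‖/2)) : ‖x‖/2 ≤ ‖y‖ := by
  have h1 : ‖y - x‖ ≤ ‖x‖/2 := by simpa [dist_eq_norm] using h
  have h2 := norm_sub_norm_le x y
  rw [norm_sub_rev] at h2
  linarith

lemma rpow_neg_half_le {x y : R4} (hx : 0 < ‖x‖) (h : ‖x‖/2 ≤ ‖y‖) {q : ℝ} (hq : 0 ≤ q) :
    ‖y‖^(-q) ≤ 2^q*‖x‖^(-q) := by
  calc ‖y‖^(-q) ≤ (‖x‖/2)^(-q) := rpow_le_rpow_of_nonpos pos! h lin!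
    _ = 2^q*‖x‖^(-q) := by
      rw [div_rpow hx.le num!, rpow_neg (num! : (0 : ℝ) ≤ 2), div_inv_eq_mul, mul_comm]

/-- Polynomial decay of order `p` of a function from above. -/
def Decay (z : R4 → ℝ) (p : ℝ) : Prop := ∃ B R' : ℝ, 0 ≤ B ∧ ∀ᵐ x, R' < ‖x‖ → z x ≤ B*‖x‖^(-p)

namespace ResonanceSeq

variable (h : ResonanceSeq V v z g)
include h

lemma integrableOn_density (hr : 0 < r) :
    IntegrableOn (fun x => V x*z x) (closedBall 0 r) := by
  have : IntegrableOn (fun x => V x*(z x*cutoff r x)) (closedBall 0 r) :=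
    (integrable_mul_mul h.memV h.memz ((cutoff_contDiff r).continuous.memLp_of_hasCompactSupport
      (cutoff_hasCompactSupport hr))).integrableOn
  refine this.congr ?_
  filter_upwards [ae_restrict_mem measurableSet_closedBall] with x hxR
  rw [cutoff_eq_one hr (by! hxR), mul_one]

lemma integrable_weighted_density (hs : ShortRange V R d) :
    Integrable fun x => V x*z x*b(x)^d := by
  have h1 := h.integrable_weight hs.pos hs.bound (a := d/2) (by linarith [hs.pos]) (by linarith [hs.le_half])
  have h2 := h.integrableOn_density (r := R) (by linarith [hs.one_le])
  have h2' := (integrable_indicator_iff measurableSet_closedBall).2 h2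
  refine ((h2'.norm.const_mul ((1 + R)^d)).add (h1.norm.const_mul 8)).mono'
    ((h.memV.1.mul h.memz.1).mul (Continuous.aestronglyMeasurable
      ((by fun_prop : Continuous fun x : R4 => 1 + ‖x‖).rpow_const fun x => Or.inl pos!))) ?_
  filter_upwards [hs.bound] with x hx
  have hw : 0 ≤ b(x)^d := pos!
  rw [norm_mul, norm_of_nonneg hw, Pi.add_apply]
  by_cases hxR : ‖x‖ ≤ R
  · rw [indicator_of_mem (by! hxR)]
    have : b(x)^d ≤ (1 + R)^d := by gcongr; exact hs.pos.le
    nlinarith [norm_nonneg (V x*z x), norm_nonneg (z x*w(x)^(-(d/2) - 1))]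
  · push Not at hxR
    have hx1 : 1 < ‖x‖ := hs.one_le.trans_lt hxR
    have hw0 : 0 < 1 + ‖x‖ := pos!
    have b1 : ‖x‖^(-2 - 2*d) ≤ 8*b(x)^(-2 - 2*d) := by
      calc ‖x‖^(-2 - 2*d) ≤ (b(x)/2)^(-2 - 2*d) :=
            rpow_le_rpow_of_nonpos pos! lin! (by linarith [hs.pos])
        _ = 2^(2 + 2*d)*b(x)^(-2 - 2*d) := by
            rw [div_rpow hw0.le num!, show (-2 - 2*d) = -(2 + 2*d) by ring,
              rpow_neg (num! : (0 : ℝ) ≤ 2), div_inv_eq_mul, mul_comm]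
        _ ≤ 8*b(x)^(-2 - 2*d) := by
            gcongr
            calc (2 : ℝ)^(2 + 2*d) ≤ 2^(3 : ℝ) :=
                  rpow_le_rpow_of_exponent_le num! (by linarith [hs.le_half])
              _ = 8 := num!
    have b2 : b(x)^(-2 - 2*d)*b(x)^d ≤ w(x)^(-(d/2) - 1) := by
      rw [← rpow_add hw0]
      have : b(x)^(-2 - 2*d + d) = (b(x)^2)^(-(d/2) - 1) := by
        rw [← rpow_natCast, ← rpow_mul hw0.le]; congr 1; push_cast; ring
      rw [this]
      exact rpow_le_rpow_of_nonpos pos! (by nlinarith) (by linarith [hs.pos])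
    rw [indicator_of_notMem (by! hxR), norm_zero, mul_zero, zero_add, norm_mul, norm_mul,
      norm_of_nonneg (pos! : 0 ≤ w(x)^(-(d/2) - 1)), norm_eq_abs (V x)]
    calc |V x| *‖z x‖*b(x)^d
        ≤ 8*b(x)^(-2 - 2*d)*‖z x‖*b(x)^d := by gcongr; exact (hx hxR).trans b1
      _ = 8*(‖z x‖*(b(x)^(-2 - 2*d)*b(x)^d)) := by ring
      _ ≤ _ := by gcongr

lemma integrable_density (hs : ShortRange V R d) :
    Integrable fun x => V x*z x := by
  refine (h.integrable_weighted_density hs).norm.mono' (h.memV.1.mul h.memz.1) (.of_forall fun x => ?_)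
  rw [norm_mul (V x*z x)]
  refine le_mul_of_one_le_right (norm_nonneg _) ?_
  rw [norm_of_nonneg pos!]
  exact one_le_rpow (by linarith [norm_nonneg x]) hs.pos.le

omit h in
/-- Contribution of the density near `x` to its potential at `x`. -/
def near (V z : R4 → ℝ) (m : ℕ) (x : R4) : ℝ := ∫ y in closedBall x (‖x‖/2), |-(V y*z y)*(‖y - x‖^m)⁻¹|

lemma near_density_le (hs : ShortRange V R d) {x : R4} (hx : 2*R < ‖x‖) : ∀ᵐ y, y ∈ closedBall x (‖x‖/2) →
      |-(V y*z y)| ≤ 8*‖x‖^(-(2 + 2*d))*z y := by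
  have hx0 : 0 < ‖x‖ := by linarith [hs.one_le]
  filter_upwards [hs.bound, h.ae_nonneg] with y hy hz hyx
  have h1 := half_norm_le_of_mem hyx
  have h2 := hy lin!
  rw [abs_neg, abs_mul, abs_of_nonneg hz]
  refine mul_le_mul_of_nonneg_right (h2.trans ?_) hz
  rw [show -2 - 2*d = -(2 + 2*d) by ring]
  refine (rpow_neg_half_le hx0 h1 (by linarith [hs.pos])).trans ?_
  gcongr
  calc (2 : ℝ)^(2 + 2*d) ≤ 2^(3 : ℝ) :=
        rpow_le_rpow_of_exponent_le num! (by linarith [hs.le_half])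
    _ = 8 := num!

lemma near_le_of_decay (hs : ShortRange V R d) {p : ℝ} (hp : 0 ≤ p)
    (hp2 : p ≤ 2) (hd : Decay z p) {m : ℕ} (hm : m < 4) :
    ∃ B R1 : ℝ, 0 ≤ B ∧ ∀ x, R1 < ‖x‖ → near V z m x ≤ B*‖x‖^(2 - 2*d - p - m) := by
  obtain ⟨B, R', hB, hb⟩ := hd
  have hm' : (m : ℝ) < 4 := by exact_mod_cast hm
  have hm1 : (1 : ℝ) ≤ 4 - m := by
    have : (m : ℝ) ≤ 3 := by exact_mod_cast Nat.le_of_lt_succ hm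
    linarith
  refine ⟨64*B*π^2, max (2*R) (2*R'), pos!, fun x hx => ?_⟩
  have hxR : 2*R < ‖x‖ := (le_max_left _ _).trans_lt hx
  have hxR' : 2*R' < ‖x‖ := (le_max_right _ _).trans_lt hx
  have hx0 : 0 < ‖x‖ := by linarith [hs.one_le]
  have hI := integrable_ball_kernel hm (show 0 ≤ ‖x‖/2 by positivity)
  have hIx := integrableOn_closedBall_sub hI x
  calc near V z m x
      ≤ ∫ y in closedBall x (‖x‖/2),
          (8*‖x‖^(-(2 + 2*d))*(4*B*‖x‖^(-p)))*(‖y - x‖^m)⁻¹ := by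
        refine integral_mono_of_nonneg (.of_forall fun _ => abs_nonneg _) (hIx.const_mul _) ?_
        filter_upwards [ae_restrict_of_ae (h.near_density_le hs hxR), ae_restrict_of_ae hb,
          ae_restrict_mem isClosed_closedBall.measurableSet] with y h1 h2 h3
        have h4 := half_norm_le_of_mem h3
        have h5 : z y ≤ 4*B*‖x‖^(-p) := by
          refine (h2 lin!).trans ?_
          have := rpow_neg_half_le hx0 h4 hp
          have h6 : (2 : ℝ)^p ≤ 4 := by
            calc (2 : ℝ)^p ≤ 2^(2 : ℝ) := rpow_le_rpow_of_exponent_le num! hp2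
              _ = 4 := num!
          calc B*‖y‖^(-p) ≤ B*(4*‖x‖^(-p)) := by gcongr; exact this.trans (by gcongr)
            _ = _ := by ring
        rw [abs_mul, abs_of_nonneg (pos! : 0 ≤ (‖y - x‖^m)⁻¹)]
        refine mul_le_mul_of_nonneg_right ((h1 h3).trans ?_) pos!
        gcongr
    _ = (8*‖x‖^(-(2 + 2*d))*(4*B*‖x‖^(-p)))
          * (2*π^2*((‖x‖/2)^(4 - (m : ℝ))/(4 - m))) := by
        rw [integral_const_mul, setIntegral_closedBall_sub (fun z0 => (‖z0‖^m)⁻¹) x,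
          ← (integral_ball_norm_rpow hm' (show 0 ≤ ‖x‖/2 by positivity)).2]
        simp only [norm_rpow_neg_natCast]
    _ ≤ (8*‖x‖^(-(2 + 2*d))*(4*B*‖x‖^(-p)))*(2*π^2*‖x‖^(4 - (m : ℝ))) := by
        gcongr
        refine (div_le_self pos! hm1).trans ?_
        gcongr; linarith
    _ = 64*B*π^2*(‖x‖^(-(2 + 2*d))*‖x‖^(-p)*‖x‖^(4 - (m : ℝ))) := by ring
    _ = _ := by
        rw [← rpow_add hx0, ← rpow_add hx0]
        congr 2; ring

omit h in
lemma mul_le_pow_add_rpow {a b : ℝ} (ha : 0 ≤ a) (hb : 0 ≤ b) : a*b ≤ a^4 + b^(4/3 : ℝ) := by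
  rcases le_total b (a^3) with h | h
  · have : a*b ≤ a^4 := by
      calc a*b ≤ a*a^3 := by gcongr
        _ = a^4 := by ring
    have : 0 ≤ b^(4/3 : ℝ) := pos!
    linarith
  · have h1 : a ≤ b^(1/3 : ℝ) := by
      have h2 := rpow_le_rpow pos! h (num! : (0 : ℝ) ≤ 1/3)
      rw [← rpow_natCast, ← rpow_mul ha] at h2
      norm_num at h2
      convert h2 using 2
    have : a*b ≤ b^(4/3 : ℝ) := by
      calc a*b ≤ b^(1/3 : ℝ)*b := by gcongr
        _ = b^(4/3 : ℝ) := by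
          rcases hb.eq_or_lt with h0 | h0
          · rw [← h0]; norm_num
          · rw [← rpow_add_one h0.ne']; norm_num
    have : 0 ≤ a^4 := pos!
    linarith

lemma near_le_base (hs : ShortRange V R d) :
    ∃ B R1 : ℝ, 0 ≤ B ∧ ∀ x, R1 < ‖x‖ → near V z 2 x ≤ B*‖x‖^(-(2/3) : ℝ) := by
  have h4 : Integrable fun x => z x^4 := by
    have := h.memz.integrable_norm_pow num!
    refine this.congr (.of_forall fun x => ?_)
    simp only []
    rw [← norm_pow, norm_of_nonneg pos!]
  set M : ℝ := ∫ x, z x^4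
  have hM0 : 0 ≤ M := integral_nonneg fun x => pos!
  refine ⟨8*(M + 2*π^2), 2*R, pos!, fun x hx => ?_⟩
  have hx1 : 1 ≤ ‖x‖ := by linarith [hs.one_le]
  have hx0 : 0 < ‖x‖ := lin!
  obtain ⟨hI, hIv⟩ := integral_ball_norm_rpow (q := 8/3) num! (show 0 ≤ ‖x‖/2 by positivity)
  have hIx := integrableOn_closedBall_sub hI x
  calc near V z 2 x
      ≤ ∫ y in closedBall x (‖x‖/2),
          8*‖x‖^(-(2 + 2*d))*(z y^4 + ‖y - x‖^(-(8/3) : ℝ)) := by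
        refine integral_mono_of_nonneg (.of_forall fun _ => abs_nonneg _)
          ((h4.integrableOn.add hIx).const_mul _) ?_
        filter_upwards [ae_restrict_of_ae (h.near_density_le hs hx), ae_restrict_of_ae h.ae_nonneg,
          ae_restrict_mem isClosed_closedBall.measurableSet] with y h1 h2 h3
        rw [abs_mul, abs_of_nonneg (pos! : 0 ≤ (‖y - x‖^2)⁻¹)]
        calc _ ≤ 8*‖x‖^(-(2 + 2*d))*z y*(‖y - x‖^2)⁻¹ := by gcongr; exact h1 h3
          _ = 8*‖x‖^(-(2 + 2*d))*(z y*(‖y - x‖^2)⁻¹) := by ring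
          _ ≤ _ := by
            gcongr
            refine (mul_le_pow_add_rpow h2 pos!).trans (le_of_eq ?_)
            congr 1
            rw [← norm_rpow_neg_natCast, ← rpow_mul (norm_nonneg _)]
            norm_num
    _ = 8*‖x‖^(-(2 + 2*d))*((∫ y in closedBall x (‖x‖/2), z y^4)
          + 2*π^2*((‖x‖/2)^(4 - 8/3 : ℝ)/(4 - 8/3))) := by
        rw [integral_const_mul, integral_add h4.integrableOn hIx,
          setIntegral_closedBall_sub (fun z0 => ‖z0‖^(-(8/3) : ℝ)) x, hIv]
    _ ≤ 8*‖x‖^(-2 : ℝ)*((M + 2*π^2)*‖x‖^(4/3 : ℝ)) := by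
        have a1 : ‖x‖^(-(2 + 2*d)) ≤ ‖x‖^(-2 : ℝ) := rpow_le_rpow_of_exponent_le hx1 (by linarith [hs.pos])
        have a2 : ∫ y in closedBall x (‖x‖/2), z y^4 ≤ M*‖x‖^(4/3 : ℝ) :=
          (setIntegral_le_integral h4 (.of_forall fun y => pos!)).trans
            (le_mul_of_one_le_right hM0 (one_le_rpow hx1 num!))
        have a3 : (‖x‖/2)^(4 - 8/3 : ℝ)/(4 - 8/3) ≤ ‖x‖^(4/3 : ℝ) := by
          refine (div_le_self pos! num!).trans ?_
          rw [show (4 - 8/3 : ℝ) = 4/3 by norm_num]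
          gcongr; linarith
        have a4 : 2*π^2*((‖x‖/2)^(4 - 8/3 : ℝ)/(4 - 8/3)) ≤ 2*π^2*‖x‖^(4/3 : ℝ) := by gcongr
        refine mul_le_mul (by gcongr) lin! pos! pos!
    _ = 8*(M + 2*π^2)*(‖x‖^(-2 : ℝ)*‖x‖^(4/3 : ℝ)) := by ring
    _ = _ := by
        rw [← rpow_add hx0]; norm_num

lemma newton_asymptotics (hs : ShortRange V R d) : ∃ A : ℝ, 0 ≤ A ∧ ∀ᵐ x, x ≠ 0 →
      |z x - 1/(4*π^2)*(∫ y, -(V y*z y))*(‖x‖^2)⁻¹|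
        ≤ A*(‖x‖^(-d)*(‖x‖^2)⁻¹) + near V z 2 x := by
  have hr := h.integrable_density hs
  have hw : Integrable fun y => -(V y*z y)*b(y)^d :=
    (h.integrable_weighted_density hs).neg.congr (.of_forall fun y => by simp)
  set I := ∫ y, |-(V y*z y)*b(y)^d| with hI
  refine ⟨(10 + 2^(2 + 2))*I, pos!, ?_⟩
  have hpi : 1/(4*π^2) ≤ 1 := by
    rw [div_le_one pos!]
    nlinarith [pi_gt_three]
  filter_upwards [h.green_repr hr] with x ⟨hi, he⟩ hx
  have := potential_asymptotics (r := fun y => -(V y*z y)) (K := fun z0 => (‖z0‖^2)⁻¹) (m := 2)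
    (C := 10) num! hs.pos (by linarith [hs.le_half]) (measurable_kernel 2)
    (fun z0 => (abs_of_nonneg pos!).le) (fun x y hx hy => newton_kernel_diff hx hy)
    hr.neg hw hx hi
  simp only [norm_neg] at this
  rw [he, mul_assoc, ← mul_sub, abs_mul, abs_of_nonneg (pos! : 0 ≤ 1/(4*π^2)), mul_comm (∫ y, -(V y*z y)) _]
  refine (mul_le_of_le_one_left (abs_nonneg _) hpi).trans (this.trans (le_of_eq ?_))
  rw [near, hI]; ring

lemma newton_asymptotics_pd (hs : ShortRange V R d) (k : Fin 4) : ∃ A : ℝ, 0 ≤ A ∧ ∀ᵐ x, x ≠ 0 →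
      |g k x + 2*(1/(4*π^2)*(∫ y, -(V y*z y)))*(x k*(‖x‖^4)⁻¹)|
        ≤ A*(‖x‖^(-d)*(‖x‖^3)⁻¹) + near V z 3 x := by
  have hr := h.integrable_density hs
  have hw : Integrable fun y => -(V y*z y)*b(y)^d :=
    (h.integrable_weighted_density hs).neg.congr (.of_forall fun y => by simp)
  set I := ∫ y, |-(V y*z y)*b(y)^d| with hI
  refine ⟨(66 + 2^(3 + 2))*I, pos!, ?_⟩
  have hpi : 1/(2*π^2) ≤ 1 := by
    rw [div_le_one pos!]
    nlinarith [pi_gt_three]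
  filter_upwards [h.green_repr_pd hr k] with x ⟨hi, he⟩ hx
  have := potential_asymptotics (r := fun y => -(V y*z y)) (K := fun z0 => z0 k*(‖z0‖^4)⁻¹) (m := 3)
    (C := 66) num! hs.pos (by linarith [hs.le_half]) (by fun_prop)
    (fun z0 => by
      rcases eq_or_ne z0 0 with rfl | hz
      · simp
      have h1 : |z0 k| ≤ ‖z0‖ := by simpa using PiLp.norm_apply_le z0 k
      rw [abs_mul, abs_of_pos (pos! : 0 < (‖z0‖^4)⁻¹)]
      calc _ ≤ ‖z0‖*(‖z0‖^4)⁻¹ := by gcongr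
        _ = _ := by field_simp) (fun x y hx hy => newton_kernel_pd_diff k hx hy)
    hr.neg hw hx hi
  rw [norm_neg] at this
  have e : g k x + 2*(1/(4*π^2)*(∫ y, -(V y*z y)))*(x k*(‖x‖^4)⁻¹)
      = 1/(2*π^2)*((∫ y, -(V y*z y)*((y - x) k*(‖y - x‖^4)⁻¹)) - (-x) k*(‖x‖^4)⁻¹*∫ y, -(V y*z y)) := by
    rw [he, PiLp.neg_apply]; field_simp; ring
  rw [e, abs_mul, abs_of_nonneg (pos! : 0 ≤ 1/(2*π^2))]
  refine (mul_le_of_le_one_left (abs_nonneg _) hpi).trans (this.trans (le_of_eq ?_))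
  rw [near, hI]; ring

lemma decay_of_near (hs : ShortRange V R d) {p : ℝ} (hp : p ≤ 2)
    (hn : ∃ B R1 : ℝ, 0 ≤ B ∧ ∀ x, R1 < ‖x‖ → near V z 2 x ≤ B*‖x‖^(-p)) : Decay z p := by
  obtain ⟨B, R1, hB, hb⟩ := hn
  obtain ⟨A, hA, ha⟩ := h.newton_asymptotics hs
  set c := 1/(4*π^2)*(∫ y, -(V y*z y))
  refine ⟨|c| + A + B, max 1 R1, pos!, ?_⟩
  filter_upwards [ha] with x hx hxR
  have hx1 : 1 < ‖x‖ := (le_max_left _ _).trans_lt hxR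
  have h1 := hx (by rintro rfl; simp at hx1; linarith)
  have h2 := hb x ((le_max_right _ _).trans_lt hxR)
  have h3 : (‖x‖^2)⁻¹ ≤ ‖x‖^(-p) := by
    rw [← norm_rpow_neg_natCast]
    exact rpow_le_rpow_of_exponent_le hx1.le (by push_cast; linarith)
  have h4 : ‖x‖^(-d) ≤ 1 := rpow_le_one_of_one_le_of_nonpos hx1.le (by linarith [hs.pos])
  have h5 : A*(‖x‖^(-d)*(‖x‖^2)⁻¹) ≤ A*‖x‖^(-p) := by
    gcongr
    exact (mul_le_of_le_one_left pos! h4).trans h3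
  have h6 : c*(‖x‖^2)⁻¹ ≤ |c| *‖x‖^(-p) := by
    calc _ ≤ |c| *(‖x‖^2)⁻¹ := by gcongr; exact le_abs_self c
      _ ≤ _ := by gcongr
  have h7 := (abs_le.1 h1).2
  linarith

lemma decay_two (hs : ShortRange V R d) : Decay z 2 := by
  have hind : ∀ n : ℕ, Decay z (min 2 (2/3 + 2*d*n)) := by
    intro n
    induction n with
    | zero =>
      have := h.decay_of_near hs num! (h.near_le_base hs)
      convert this using 1
      norm_num
    | succ n ih =>
      have hd := hs.pos
      set p := min 2 (2/3 + 2*d*n) with hp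
      have hp0 : 0 ≤ p := le_min num! pos!
      obtain ⟨B, R1, hB, hb⟩ := h.near_le_of_decay hs hp0 (min_le_left _ _) ih (m := 2) num!
      refine h.decay_of_near hs (min_le_left _ _) ⟨B, max 1 R1, hB, fun x hx => ?_⟩
      have hx1 : 1 < ‖x‖ := (le_max_left _ _).trans_lt hx
      refine (hb x ((le_max_right _ _).trans_lt hx)).trans ?_
      refine mul_le_mul_of_nonneg_left (rpow_le_rpow_of_exponent_le hx1.le ?_) hB
      have : min 2 (2/3 + 2*d*((n + 1 : ℕ) : ℝ)) ≤ p + 2*d := by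
        push_cast
        rcases min_choice 2 (2/3 + 2*d*(n : ℝ)) with h1 | h1
        · rw [hp, h1]; exact (min_le_left _ _).trans lin!
        · rw [hp, h1]; exact (min_le_right _ _).trans lin!
      push_cast at this ⊢
      linarith
  obtain ⟨n, hn⟩ := exists_nat_ge (2/(2*d))
  have := hind n
  rwa [min_eq_left] at this
  have hd := hs.pos
  rw [div_le_iff₀ pos!] at hn
  linarith

/-- Asymptotics of the resonance function and of its gradient. -/
lemma asymptotics (hs : ShortRange V R d) {c : ℝ} (hc : c = 1/(4*π^2)*(∫ y, -(V y*z y))) :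
    ∃ A R1 : ℝ, 0 ≤ A ∧ 1 ≤ R1 ∧ ∀ᵐ x, R1 < ‖x‖ →
      |z x - c*(‖x‖^2)⁻¹| ≤ A*‖x‖^(-(2 + d)) ∧
      ∀ k, |g k x + 2*c*(x k*(‖x‖^4)⁻¹)| ≤ A*‖x‖^(-(3 + d)) := by
  have hd0 := h.decay_two hs
  obtain ⟨A0, hA0, ha0⟩ := h.newton_asymptotics hs
  choose A hA ha using h.newton_asymptotics_pd hs
  obtain ⟨B2, S2, hB2, hb2⟩ := h.near_le_of_decay hs num! le_rfl hd0 (m := 2) num!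
  obtain ⟨B3, S3, hB3, hb3⟩ := h.near_le_of_decay hs num! le_rfl hd0 (m := 3) num!
  have hAs : ∀ k, A k ≤ ∑ k, A k := fun k => single_le_sum (f := A) (fun i _ => hA i) (mem_univ k)
  have hAs0 : 0 ≤ ∑ k, A k := sum_nonneg fun i _ => hA i
  refine ⟨A0 + B2 + B3 + ∑ k, A k, max 1 (max S2 S3), pos!, le_max_left _ _, ?_⟩
  filter_upwards [ha0, ae_all_iff.2 ha] with x h0 hk hx
  have hx1 : 1 < ‖x‖ := (le_max_left _ _).trans_lt hx
  have hx0 : 0 < ‖x‖ := lin!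
  have hxne : x ≠ 0 := norm_pos_iff.1 hx0
  have hd := hs.pos
  have key : ∀ m : ℕ, ‖x‖^(-d)*(‖x‖^m)⁻¹ = ‖x‖^(-(m + d)) := fun m => by
    rw [← norm_rpow_neg_natCast, ← rpow_add hx0]; congr 1; ring
  constructor
  · rw [hc]
    refine (h0 hxne).trans ?_
    rw [key]
    have h1 := hb2 x (((le_max_left _ _).trans (le_max_right _ _)).trans_lt hx)
    have h2 : ‖x‖^(2 - 2*d - 2 - (2 : ℕ) : ℝ) ≤ ‖x‖^(-(2 + d)) :=
      rpow_le_rpow_of_exponent_le hx1.le (by push_cast; linarith)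
    have h3 : 0 ≤ ‖x‖^(-(2 + d)) := pos!
    push_cast at *
    nlinarith [mul_le_mul_of_nonneg_left h2 hB2, mul_nonneg hB3 h3, mul_nonneg hAs0 h3]
  · intro k
    rw [hc]
    refine (hk k hxne).trans ?_
    rw [key]
    have h1 := hb3 x (((le_max_right _ _).trans (le_max_right _ _)).trans_lt hx)
    have h2 : ‖x‖^(2 - 2*d - 2 - (3 : ℕ) : ℝ) ≤ ‖x‖^(-(3 + d)) :=
      rpow_le_rpow_of_exponent_le hx1.le (by push_cast; linarith)
    have h3 : 0 ≤ ‖x‖^(-(3 + d)) := pos!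
    push_cast at *
    nlinarith [mul_le_mul_of_nonneg_left h2 hB3, mul_nonneg hB2 h3, mul_nonneg hA0 h3,
      mul_le_mul_of_nonneg_right (hAs k) h3]

end ResonanceSeq

lemma hasDerivAt_posPart_pow (n : ℕ) (t : ℝ) :
    HasDerivAt (fun t : ℝ => max t 0^(n + 2)) ((n + 2)*max t 0^(n + 1)) t := by
  rcases lt_trichotomy t 0 with h | h | h
  · rw [max_eq_right h.le, zero_pow (by omega), mul_zero]
    refine (hasDerivAt_const t (0 : ℝ)).congr_of_eventuallyEq ?_
    filter_upwards [eventually_lt_nhds h] with s hs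
    rw [max_eq_right hs.le, zero_pow (by omega)]
  · subst h
    rw [max_self, zero_pow (by omega), mul_zero, hasDerivAt_iff_isLittleO]
    simp only [max_self, sub_zero, smul_zero, zero_pow (show n + 2 ≠ 0 by omega)]
    refine Asymptotics.IsBigO.trans_isLittleO (g := fun s : ℝ => s^(n + 2)) ?_
      (Asymptotics.isLittleO_pow_id (by omega))
    refine Asymptotics.IsBigO.of_bound 1 (.of_forall fun s => ?_)
    rw [norm_pow, norm_pow, one_mul]
    refine pow_le_pow_left₀ (norm_nonneg _) ?_ _
    rw [norm_eq_abs, norm_eq_abs]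
    rcases le_total s 0 with h | h
    · rw [max_eq_right h]; simp
    · rw [max_eq_left h]
  · rw [max_eq_left h.le]
    have := hasDerivAt_pow (n + 2) t
    push_cast at this
    refine this.congr_of_eventuallyEq ?_
    filter_upwards [eventually_gt_nhds h] with s hs
    rw [max_eq_left hs.le]

lemma contDiff_posPart_cube : ContDiff ℝ 2 (fun t : ℝ => max t 0^3) := by
  have d1 : deriv (fun t : ℝ => max t 0^3) = fun t => 3*max t 0^2 := by
    funext t
    rw [(hasDerivAt_posPart_pow 1 t).deriv]; push_cast; norm_num
  have d2 : deriv (fun t : ℝ => 3*max t 0^2) = fun t => 3*(2*max t 0) := by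
    funext t
    rw [((hasDerivAt_posPart_pow 0 t).const_mul 3).deriv]; push_cast; norm_num
  rw [show (2 : WithTop ℕ∞) = 1 + 1 by norm_num, contDiff_succ_iff_deriv]
  refine ⟨fun t => (hasDerivAt_posPart_pow 1 t).differentiableAt, by simp, ?_⟩
  rw [d1, show (1 : WithTop ℕ∞) = 0 + 1 by norm_num, contDiff_succ_iff_deriv]
  refine ⟨fun t => ((hasDerivAt_posPart_pow 0 t).const_mul 3).differentiableAt, by simp, ?_⟩
  rw [d2]
  exact contDiff_zero.2 (by fun_prop)

/-- The profile `1 - (S/s)^a` of the exterior barrier. -/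
def barr (S a s : ℝ) : ℝ := 1 - S^a*s^(-a)

section Barrier

variable {S a : ℝ}

lemma hasDerivAt_barr (hs : 0 < s) :
    HasDerivAt (barr S a) (a*(S^a*s^(-a))/s) s := by
  have h1 := (((hasDerivAt_id s).rpow_const (p := -a) (Or.inl hs.ne')).const_mul (S^a)).const_sub 1
  refine h1.congr_deriv ?_
  simp only [id]
  rw [rpow_sub_one hs.ne']
  field_simp

lemma hasDerivAt_barr_two (hs : 0 < s) :
    HasDerivAt (fun s => a*(S^a*s^(-a))/s) (-(a*(a + 1)*(S^a*s^(-a))/s^2)) s := by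
  have h1 := ((((hasDerivAt_id s).rpow_const (p := -a) (Or.inl hs.ne')).const_mul (S^a)).const_mul
    a).div (hasDerivAt_id s) hs.ne'
  refine h1.congr_deriv ?_
  simp only [id]
  rw [rpow_sub_one hs.ne']
  field_simp
  ring

lemma contDiffOn_barr {n : WithTop ℕ∞} : ContDiffOn ℝ n (barr S a) (Ioi 0) := by
  intro s hs
  have hs : 0 < s := hs
  refine ContDiffAt.contDiffWithinAt ?_
  exact contDiffAt_const.sub (contDiffAt_const.mul (contDiffAt_id.rpow_const_of_ne hs.ne'))

lemma hasDerivAt_barr_cube (hs : 0 < s) : HasDerivAt (fun s => max (barr S a s) 0^3)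
      (3*max (barr S a s) 0^2*(a*(S^a*s^(-a))/s)) s := by
  have := (hasDerivAt_posPart_pow 1 (barr S a s)).comp s (hasDerivAt_barr hs)
  refine this.congr_deriv ?_
  push_cast; norm_num

lemma hasDerivAt_barr_cube_two (hs : 0 < s) : HasDerivAt (fun s => 3*max (barr S a s) 0^2*(a*(S^a*s^(-a))/s))
      (6*max (barr S a s) 0*(a*(S^a*s^(-a))/s)^2 - 3*max (barr S a s) 0^2*(a*(a + 1)*(S^a*s^(-a))/s^2)) s := by
  have := (((hasDerivAt_posPart_pow 0 (barr S a s)).comp s (hasDerivAt_barr hs)).const_mul 3).mul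
    (hasDerivAt_barr_two (S := S) (a := a) hs)
  refine this.congr_deriv ?_
  simp only [Function.comp]
  push_cast
  ring

end Barrier

namespace ResonanceSeq

lemma integrable_mul_weight_two (h : ResonanceSeq V v z g) (hd : 0 < d) {R1 : ℝ} (hA : 0 ≤ A) (hR1 : 1 ≤ R1)
    (hz : ∀ᵐ x, R1 < ‖x‖ → |z x| ≤ A*‖x‖^(-(2 + d))) :
    Integrable fun x => z x*b(x)^(-2 : ℝ) := by
  have h1 : IntegrableOn z (closedBall 0 R1) :=
    (h.memz.locallyIntegrable num!).integrableOn_isCompact (isCompact_closedBall 0 R1)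
  have h1' := (integrable_indicator_iff measurableSet_closedBall).2 h1
  have h2 := integrable_one_add_norm (E := R4) (μ := volume) (r := 4 + d) (by simp [hd])
  refine (h1'.norm.add (h2.const_mul (A*2^(2 + d)))).mono' (h.memz.1.mul
    (Continuous.aestronglyMeasurable ((by fun_prop : Continuous fun x : R4 => 1 + ‖x‖).rpow_const
      fun x => Or.inl pos!))) ?_
  filter_upwards [hz] with x hx
  have hw0 : 0 < 1 + ‖x‖ := pos!
  have hw : 0 ≤ b(x)^(-2 : ℝ) := pos!
  have n2 : 0 ≤ A*2^(2 + d)*b(x)^(-(4 + d)) := pos!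
  rw [norm_mul, norm_of_nonneg hw, Pi.add_apply]
  by_cases hxR : ‖x‖ ≤ R1
  · rw [indicator_of_mem (by! hxR)]
    have : b(x)^(-2 : ℝ) ≤ 1 := rpow_le_one_of_one_le_of_nonpos (by linarith [norm_nonneg x]) num!
    have := mul_le_of_le_one_right (norm_nonneg (z x)) this
    linarith
  · rw [indicator_of_notMem (by! hxR), norm_zero, zero_add]
    push Not at hxR
    have hx1 : 1 < ‖x‖ := hR1.trans_lt hxR
    have b : ‖x‖^(-(2 + d)) ≤ 2^(2 + d)*b(x)^(-(2 + d)) := by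
      calc ‖x‖^(-(2 + d)) ≤ (b(x)/2)^(-(2 + d)) := rpow_le_rpow_of_nonpos pos! lin! lin!
        _ = _ := by
            rw [div_rpow hw0.le num!, rpow_neg (num! : (0 : ℝ) ≤ 2), div_inv_eq_mul, mul_comm]
    calc ‖z x‖*b(x)^(-2 : ℝ)
        ≤ A*(2^(2 + d)*b(x)^(-(2 + d)))*b(x)^(-2 : ℝ) := by
          gcongr
          exact (hx hxR).trans (by gcongr)
      _ = A*2^(2 + d)*(b(x)^(-(2 + d))*b(x)^(-2 : ℝ)) := by ring
      _ = _ := by rw [← rpow_add hw0]; congr 2; ring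

/-- A resonance function of fast decay vanishes outside a ball. -/
lemma eq_zero_outside (h : ResonanceSeq V v z g) (hs : ShortRange V R d) {R1 : ℝ} (hA : 0 ≤ A)
    (hR1 : 1 ≤ R1) (hz : ∀ᵐ x, R1 < ‖x‖ → |z x| ≤ A*‖x‖^(-(2 + d))) :
    ∃ R2 : ℝ, 0 < R2 ∧ ∀ᵐ x, R2 < ‖x‖ → z x = 0 := by
  have hd := hs.pos
  have hw2 := h.integrable_mul_weight_two hd hA hR1 hz
  obtain ⟨S, hS1, hSR, hSd⟩ : ∃ S : ℝ, 1 ≤ S ∧ 1 + R^2 ≤ S ∧ 4/(3*d) ≤ S^d := by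
    obtain ⟨a, ha⟩ := eventually_atTop.1 ((tendsto_rpow_atTop hd).eventually_ge_atTop (4/(3*d)))
    refine ⟨max (max 1 (1 + R^2)) a, (le_max_left _ _).trans (le_max_left _ _),
      (le_max_right _ _).trans (le_max_left _ _), ha _ (le_max_right _ _)⟩
  set f : ℝ → ℝ := fun s => max (barr S d s) 0^3
  set F : R4 → ℝ := fun x => f (1 + ‖x - 0‖^2) with hF
  have hFx : ∀ x, F x = f w(x) := fun x => by simp [hF]
  have hspos : ∀ x : R4, 0 < w(x) := fun x => pos!
  set M : R4 → ℝ := fun x => max (barr S d w(x)) 0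
  set n : R4 → ℝ := fun x => S^d*w(x)^(-d) with hn
  have hn0 : ∀ x, 0 < n x := fun x => by have := hspos x; positivity
  have hM0 : ∀ x, 0 ≤ M x := fun x => le_max_right _ _
  have hM1 : ∀ x, M x ≤ 1 := fun x => by
    refine max_le ?_ zero_le_one
    have := hn0 x
    simp only [barr]
    linarith
  have hMn : ∀ x, M x = 0 ∨ (n x ≤ 1 ∧ S < w(x)) := fun x => by
    rcases le_or_gt (barr S d w(x)) 0 with h1 | h1
    · left; exact max_eq_right h1
    · right
      have h2 : n x < 1 := by simp only [barr] at h1; linarith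
      refine ⟨h2.le, ?_⟩
      by_contra hcon
      push Not at hcon
      have : 1 ≤ n x := by
        rw [hn]
        simp only []
        rw [rpow_neg (hspos x).le, ← div_eq_mul_inv, one_le_div (by have := hspos x; positivity)]
        gcongr
      linarith
  have hsm : ContDiff ℝ 2 F := contDiff_radial (contDiff_posPart_cube.comp_contDiffOn contDiffOn_barr) one_pos 0
  have hlap : ∀ x, lap F x = 8*(3*M x^2*(d*n x/w(x)))
      + 4*‖x‖^2*(6*M x*(d*n x/w(x))^2 - 3*M x^2*(d*(d + 1)*n x/w(x)^2)) := fun x => by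
    have := lap_radial (f := f) (t := 1) (a := 0) (y := x) one_pos
      (fun s hs => hasDerivAt_barr_cube hs) (hasDerivAt_barr_cube_two pos!)
    rw [show F = fun y => f w(y) from funext hFx]
    simp only [sub_zero] at this
    exact this
  have hpd : ∀ j x, pd j F x = 2*(3*M x^2*(d*n x/w(x)))*x j := fun j x => by
    have := pd_radial (f := f) (t := 1) (a := 0) (y := x) j (hasDerivAt_barr_cube pos!)
    rw [show F = fun y => f w(y) from funext hFx]
    simp only [sub_zero, PiLp.zero_apply] at this
    exact this
  have hd2 := hs.le_half
  have hsub : ∀ x, 6*d*(M x^2*n x/w(x)) ≤ lap F x := fun x => by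
    rw [hlap]
    have hp := hspos x
    have h1 := hn0 x
    have h2 := hM0 x
    have e : 4*‖x‖^2*(3*M x^2*(d*(d + 1)*n x/w(x)^2))
        ≤ 4*w(x)*(3*M x^2*(d*(d + 1)*n x/w(x)^2)) := by
      gcongr; linarith
    have e2 : 4*w(x)*(3*M x^2*(d*(d + 1)*n x/w(x)^2)) = 12*(d + 1)*(d*(M x^2*n x/w(x))) := by field_simp; ring
    have e3 : 8*(3*M x^2*(d*n x/w(x))) = 24*(d*(M x^2*n x/w(x))) := by ring
    have e4 : 0 ≤ 4*‖x‖^2*(6*M x*(d*n x/w(x))^2) := pos!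
    have e5 : 0 ≤ d*(M x^2*n x/w(x)) := pos!
    rw [mul_sub]
    nlinarith
  have hbd : ∀ x, lap F x ≤ 60*w(x)⁻¹ := fun x => by
    rw [hlap]
    have hp := hspos x
    rcases hMn x with h1 | ⟨h1, -⟩
    · rw [h1]; simp; positivity
    have h2 := hM0 x
    have h3 := hM1 x
    have h4 := (hn0 x).le
    set q := w(x)⁻¹ with hq
    have hq0 : 0 < q := pos!
    have hxq : ‖x‖^2*q ≤ 1 := by
      rw [hq, ← div_eq_mul_inv]; exact div_le_one_of_le₀ lin! hp.le
    have a1 : M x^2*(d*n x) ≤ 1 := by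
      refine mul_le_one₀ (pow_le_one₀ h2 h3) pos! (mul_le_one₀ lin! h4 h1)
    have a2 : M x*(d*n x)^2 ≤ 1 := by
      refine mul_le_one₀ h3 pos! (pow_le_one₀ pos! (mul_le_one₀ lin! h4 h1))
    have e1 : 8*(3*M x^2*(d*n x/w(x))) = 24*(M x^2*(d*n x))*q := by
      rw [hq]; ring
    have e2 : 4*‖x‖^2*(6*M x*(d*n x/w(x))^2)
        = 24*(M x*(d*n x)^2)*(‖x‖^2*q)*q := by
      rw [hq]; ring
    have e3 : 0 ≤ 4*‖x‖^2*(3*M x^2*(d*(d + 1)*n x/w(x)^2)) := by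
      positivity
    have e4 : 24*(M x*(d*n x)^2)*(‖x‖^2*q)*q ≤ 24*1*1*q := by gcongr
    have e5 : 24*(M x^2*(d*n x))*q ≤ 24*1*q := by gcongr
    rw [mul_sub, e1, e2]
    linarith
  have hqw : ∀ x : R4, w(x)⁻¹ ≤ 2*b(x)^(-2 : ℝ) := fun x => by
    have := one_add_norm_sq_rpow_le x (zero_le_one)
    rw [rpow_neg_one, rpow_one] at this
    norm_num at this ⊢
    exact this
  have hlap0 : ∀ x, 0 ≤ lap F x := fun x => by
    refine le_trans ?_ (hsub x)
    have := hn0 x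
    positivity
  have hF01 : ∀ x, 0 ≤ F x ∧ F x ≤ 1 := fun x => by
    rw [hFx]
    exact ⟨pow_nonneg (hM0 x) 3, pow_le_one₀ (hM0 x) (hM1 x)⟩
  have hiL : Integrable fun x => z x*lap F x := by
    refine (hw2.norm.const_mul 120).mono' (h.memz.1.mul (continuous_lap hsm).aestronglyMeasurable)
      (.of_forall fun x => ?_)
    have hb := hqw x
    rw [norm_mul, norm_mul, norm_of_nonneg (hlap0 x), norm_of_nonneg (pos! : 0 ≤ b(x)^(-2 : ℝ))]
    calc ‖z x‖*lap F x ≤ ‖z x‖*(120*b(x)^(-2 : ℝ)) := by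
          gcongr; exact (hbd x).trans lin!
      _ = _ := by ring
  have hiV : Integrable fun x => V x*(z x*F x) :=
    (integrable_mul_bdd (h.integrable_density hs) hsm.continuous (C := 1) fun x => by
      rw [abs_of_nonneg (hF01 x).1]; exact (hF01 x).2).congr (.of_forall fun y => mul_assoc _ _ _)
  have key := h.ext_very_weak hsm (C := 6) (b := 0) (fun x => by
      rw [abs_of_nonneg (hF01 x).1]
      simp only [neg_zero, rpow_zero]
      linarith [(hF01 x).2])
    (fun j x => by
      rw [hpd, abs_mul]
      have hp := hspos x
      rcases hMn x with h1 | ⟨h1, -⟩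
      · rw [h1]; simp; positivity
      have h2 := hM0 x
      have h3 := hM1 x
      have h4 := (hn0 x).le
      have hxj : |x j| ≤ ‖x‖ := by simpa using PiLp.norm_apply_le x j
      have a1 : M x^2*(d*n x) ≤ 1/2 := by
        have : M x^2*n x ≤ 1 := mul_le_one₀ (pow_le_one₀ h2 h3) h4 h1
        nlinarith [mul_nonneg (pow_nonneg h2 2) h4]
      have e1 : |2*(3*M x^2*(d*n x/w(x)))|
          = 6*(M x^2*(d*n x))*w(x)⁻¹ := by
        rw [abs_of_nonneg pos!]; ring
      rw [e1, show (-0 - 1 : ℝ) = -1 by norm_num, rpow_neg_one]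
      have a2 : w(x)⁻¹*‖x‖ ≤ 2*b(x)⁻¹ := by
        rw [inv_mul_eq_div, ← div_eq_mul_inv, div_le_div_iff₀ hp pos!]
        nlinarith [sq_nonneg (‖x‖ - 1), norm_nonneg x]
      calc _ ≤ 6*(1/2)*w(x)⁻¹*‖x‖ := by gcongr
        _ = 3*(w(x)⁻¹*‖x‖) := by ring
        _ ≤ 3*(2*b(x)⁻¹) := by gcongr
        _ = _ := by ring)
    (by convert hw2 using 3; norm_num) hiL hiV
  have hz0 := h.ae_nonneg
  have hpos : ∀ᵐ x, 3*d*(z x*(M x^2*n x/w(x)))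
      ≤ z x*lap F x - V x*(z x*F x) := by
    filter_upwards [hz0, hs.bound] with x hx hVx
    have hp := hspos x
    rcases hMn x with h1 | ⟨h1, h2⟩
    · have : F x = 0 := by rw [hFx]; change M x^3 = 0; rw [h1]; norm_num
      rw [this, h1, hlap, h1]; simp
    have hR0 : 0 ≤ R := by linarith [hs.one_le]
    have hxR : R < ‖x‖ := by
      by_contra hcon
      push Not at hcon
      nlinarith [norm_nonneg x]
    have hx1 : 1 < ‖x‖ := hs.one_le.trans_lt hxR
    have b1 : |V x| ≤ 3*d*(n x/w(x)) := by
      refine (hVx hxR).trans ?_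
      have e1 : ‖x‖^(-2 - 2*d) = (‖x‖^2)^(-(1 + d)) := by
        rw [← rpow_natCast, ← rpow_mul (norm_nonneg _)]; congr 1; push_cast; ring
      have e2 : (‖x‖^2)^(-(1 + d)) ≤ (w(x)/2)^(-(1 + d)) := rpow_le_rpow_of_nonpos pos! (by nlinarith) lin!
      have e3 : (w(x)/2)^(-(1 + d)) = 2^(1 + d)*w(x)^(-(1 + d)) := by
        rw [div_rpow hp.le num!, rpow_neg (num! : (0 : ℝ) ≤ 2), div_inv_eq_mul, mul_comm]
      have e4 : (2 : ℝ)^(1 + d) ≤ 4 := by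
        calc (2 : ℝ)^(1 + d) ≤ 2^(2 : ℝ) := rpow_le_rpow_of_exponent_le num! lin!
          _ = 4 := num!
      have e5 : w(x)^(-(1 + d)) = w(x)^(-d)/w(x) := by rw [← rpow_sub_one hp.ne']; congr 1; ring
      have e6 : 4 ≤ 3*d*S^d := by rw [div_le_iff₀ pos!] at hSd; linarith
      calc ‖x‖^(-2 - 2*d) ≤ 2^(1 + d)*w(x)^(-(1 + d)) := by
            rw [e1, ← e3]; exact e2
        _ ≤ 4*(w(x)^(-d)/w(x)) := by rw [e5]; gcongr
        _ ≤ (3*d*S^d)*(w(x)^(-d)/w(x)) := by gcongr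
        _ = _ := by rw [hn]; ring
    have b2 : V x*F x ≤ 3*d*(M x^2*n x/w(x)) := by
      have hFM : F x ≤ M x^2 := by
        rw [hFx]; change M x^3 ≤ M x^2
        exact pow_le_pow_of_le_one (hM0 x) (hM1 x) num!
      calc V x*F x ≤ |V x| *F x := mul_le_mul_of_nonneg_right (le_abs_self _) (hF01 x).1
        _ ≤ 3*d*(n x/w(x))*M x^2 := by
          exact mul_le_mul b1 hFM (hF01 x).1 (by have := hn0 x; positivity)
        _ = _ := by ring
    have b3 := hsub x
    have := mul_le_mul_of_nonneg_left (sub_le_sub b3 b2) hx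
    nlinarith
  have hzero : ∀ᵐ x, z x*lap F x - V x*(z x*F x) = 0 := by
    have hnn : 0 ≤ᵐ[volume] fun x => z x*lap F x - V x*(z x*F x) := by
      filter_upwards [hpos, hz0] with x hx hx0
      refine le_trans ?_ hx
      have := hn0 x
      positivity
    have hI : ∫ x, (z x*lap F x - V x*(z x*F x)) = 0 := by rw [integral_sub hiL hiV, key, sub_self]
    exact (integral_eq_zero_iff_of_nonneg_ae hnn (hiL.sub hiV)).1 hI
  refine ⟨S, lin!, ?_⟩
  filter_upwards [hzero, hpos, hz0] with x h1 h2 h3 hxS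
  rw [h1] at h2
  have hsS : S < w(x) := by nlinarith
  have hMpos : 0 < M x := by
    refine lt_max_of_lt_left ?_
    simp only [barr]
    rw [sub_pos, rpow_neg (hspos x).le, ← div_eq_mul_inv, div_lt_one (by have := hspos x; positivity)]
    exact rpow_lt_rpow lin! hsS hd
  have hq : 0 < M x^2*n x/w(x) := by
    have := hn0 x
    have := hspos x
    positivity
  by_contra hne
  have : 0 < z x := lt_of_le_of_ne h3 (Ne.symm hne)
  have : 0 < 3*d*(z x*(M x^2*n x/w(x))) := pos!
  linarith

end ResonanceSeq

lemma pd_eq_of_hasFDerivAt {f' : R4 →L[ℝ] ℝ} {x : R4} (h : HasFDerivAt f f' x)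
    (j : Fin 4) : pd j f x = f' (single j 1) := by
  rw [pd, h.fderiv]

lemma pd_comp_real {G : ℝ → ℝ} {G' : ℝ} {x : R4} (hf : DifferentiableAt ℝ f x)
    (hG : HasDerivAt G G' (f x)) (j : Fin 4) : pd j (fun y => G (f y)) x = G'*pd j f x := by
  have := hG.comp_hasFDerivAt x hf.hasFDerivAt
  rw [show (fun y => G (f y)) = G ∘ f from rfl, pd_eq_of_hasFDerivAt this]; simp [pd]

namespace ResonanceSeq

lemma ae_eq_zero_of_eq_zero_outside (h : ResonanceSeq V v z g) {R2 : ℝ} (hR2 : 0 < R2)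
    (h0 : ∀ᵐ x, R2 < ‖x‖ → z x = 0) : ∀ᵐ x, z x = 0 := by
  set r := R2 + 1 with hr
  have hr0 : 0 < r := pos!
  set q := cutoff r
  have hq : Test q := ⟨(cutoff_contDiff r).of_le (by simp), cutoff_hasCompactSupport hr0⟩
  have hq0 : ∀ x, 0 ≤ q x := cutoff_nonneg r
  have hq1 : ∀ x, q x ≤ 1 := cutoff_le_one r
  have hVq : Integrable fun x => |V x| *q x^2 := integrable_mul_sq h.memV.norm (hq.memLp 4)
  set M := 8*dir q + 4*(∫ x, |V x| *q x^2) + 2 with hM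
  have key : ∀ k : ℕ, ∃ n ≥ k, nrm 4 (fun x => q x*log (1 + v n x*(k + 1)))^2
      ≤ (sobC ℝ : ℝ)^2*M := by
    intro k
    obtain ⟨e, he, hek⟩ : ∃ e : ℝ, 0 < e ∧ (k + 1 : ℝ) = e⁻¹ := ⟨s(k)⁻¹, pos!, by simp⟩
    have hve : ∀ n x, e ≤ v n x + e := fun n x => by linarith [h.nonneg n x]
    have hve0 : ∀ n x, 0 < v n x + e := fun n x => he.trans_le (hve n x)
    set f : ℕ → R4 → ℝ := fun n x => (q x*(v n x + e)⁻¹)*q x with hf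
    set ψ : ℕ → R4 → ℝ := fun n x => log (1 + v n x*e⁻¹)*q x with hψ
    have hft : ∀ n, Test (f n) := fun n => hq.mul_left
      (hq.contDiff.mul (((h.test n).contDiff.add contDiff_const).inv fun x => (hve0 n x).ne'))
    have hlog : ∀ n x, (0 : ℝ) < 1 + v n x*e⁻¹ := fun n x => by have := h.nonneg n x; positivity
    have hψt : ∀ n, Test (ψ n) := fun n => hq.mul_left
      ((contDiff_const.add ((h.test n).contDiff.mul contDiff_const)).log fun x => (hlog n x).ne')
    have hpf : ∀ n j x, pd j (f n) x = 2*q x*pd j q x*(v n x + e)⁻¹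
        - q x^2*pd j (v n) x*((v n x + e)⁻¹)^2 := by
      intro n j x
      have hi : HasDerivAt (fun t : ℝ => (t + e)⁻¹) (-((v n x + e)⁻¹)^2) (v n x) := by
        exact (((hasDerivAt_id' (v n x)).add_const e).inv (hve0 n x).ne').congr_deriv (by field_simp)
      have hd : DifferentiableAt ℝ (fun y => (v n y + e)⁻¹) x :=
        (((h.test n).diff x).add_const e).inv (hve0 n x).ne'
      rw [pd_mul j ((hq.diff x).fun_mul hd) (hq.diff x), pd_mul j (hq.diff x) hd,
        pd_comp_real ((h.test n).diff x) hi]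
      ring
    have hpψ : ∀ n j x, pd j (ψ n) x = q x*(pd j (v n) x*(v n x + e)⁻¹)
        + log (1 + v n x*e⁻¹)*pd j q x := by
      intro n j x
      have hi : HasDerivAt (fun t : ℝ => log (1 + t*e⁻¹)) ((v n x + e)⁻¹) (v n x) := by
        refine (((((hasDerivAt_id' (v n x)).mul_const e⁻¹).const_add 1).log (hlog n x).ne')).congr_deriv ?_
        have := (hve0 n x).ne'
        have := (hlog n x).ne'
        field_simp
        rw [add_comm, div_self (by rwa [add_comm])]
      have hd : DifferentiableAt ℝ (fun y => log (1 + v n y*e⁻¹)) x :=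
        ((((h.test n).diff x).mul_const e⁻¹).const_add 1).log (hlog n x).ne'
      rw [pd_mul j hd (hq.diff x), pd_comp_real ((h.test n).diff x) hi]
      ring
    have hi1 : ∀ n x, (v n x + e)⁻¹ ≤ e⁻¹ := fun n x => inv_anti₀ he (hve n x)
    have hi0 : ∀ n x, 0 ≤ (v n x + e)⁻¹ := fun n x => (inv_pos.2 (hve0 n x)).le
    have hbf := h.tendsto_bf hft (C := 8*(e⁻¹)^2*dir q + 2*(e⁻¹)^4
        + (e⁻¹)^2*∫ x, |V x| *q x^2) fun n => by
      rw [qf_eq]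
      refine add_le_add ?_ ?_
      · rw [← mul_one (2*(e⁻¹)^4), ← h.dir_eq n]
        simp only [dir, mul_sum, ← sum_add_distrib]
        refine sum_le_sum fun j _ => ?_
        have i1 := ((hq.memLp_pd j 2).integrable_sq).const_mul (8*(e⁻¹)^2)
        have i2 := (((h.test n).memLp_pd j 2).integrable_sq).const_mul (2*(e⁻¹)^4)
        rw [← integral_const_mul, ← integral_const_mul, ← integral_add i1 i2]
        refine integral_mono ((hft n).memLp_pd j 2).integrable_sq (i1.fun_add i2) fun x => ?_
        rw [hpf]
        set w := (v n x + e)⁻¹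
        have a1 : (q x*pd j q x*w)^2 ≤ pd j q x^2*(e⁻¹)^2 := by
          have : (q x*w)^2 ≤ (1*e⁻¹)^2 := by have := hq0 x; have := hi0 n x; gcongr; exacts [hq1 x, hi1 n x]
          nlinarith [mul_le_mul_of_nonneg_left this (sq_nonneg (pd j q x))]
        have a2 : (q x^2*pd j (v n) x*w^2)^2 ≤ pd j (v n) x^2*(e⁻¹)^4 := by
          have : q x^4*w^4 ≤ 1^4*(e⁻¹)^4 := by have := hq0 x; have := hi0 n x; gcongr; exacts [hq1 x, hi1 n x]
          nlinarith [mul_le_mul_of_nonneg_left this (sq_nonneg (pd j (v n) x))]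
        nlinarith [sq_nonneg (2*(q x*pd j q x*w) + q x^2*pd j (v n) x*w^2)]
      · rw [← integral_const_mul]
        refine integral_mono (integrable_mul_sq h.memV ((hft n).memLp 4)) (hVq.const_mul _) fun x => ?_
        have : f n x^2 ≤ (e⁻¹)^2*q x^2 := by
          have : f n x ≤ e⁻¹*q x := by
            simp only [hf]
            have := mul_le_mul (hq1 x) (hi1 n x) (hi0 n x) zero_le_one
            exact mul_le_mul_of_nonneg_right lin! (hq0 x)
          rw [← mul_pow]
          exact pow_le_pow_left₀ (mul_nonneg (mul_nonneg (hq0 x) (hi0 n x)) (hq0 x)) this 2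
        calc V x*f n x^2 ≤ |V x| *f n x^2 := mul_le_mul_of_nonneg_right (le_abs_self _) (sq_nonneg _)
          _ ≤ |V x| *((e⁻¹)^2*q x^2) := by gcongr
          _ = _ := by ring
    have hout : Tendsto (fun n => ∑ j, ∫ x, (pd j q x*v n x)^2) atTop (𝓝 0) := by
      rw [← Finset.sum_const_zero (s := (univ : Finset (Fin 4)))]
      refine tendsto_finsetSum _ fun j _ => ?_
      have hp4 := hq.memLp_pd j 4
      refine squeeze_zero (fun n => integral_nonneg fun x => sq_nonneg _)
        (g := fun n => (nrm 4 (pd j q)*nrm 4 (v n - z))^2) (fun n => ?_) ?_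
      · have hm := ((h.test n).memLp 4).sub h.memz
        have e1 : ∫ x, (pd j q x*v n x)^2 = ∫ x, (pd j q x*(v n - z) x)^2 := by
          refine integral_congr_ae ?_
          filter_upwards [h0] with x hx
          rcases lt_or_ge ‖x‖ r with hxr | hxr
          · simp only [q, pd_cutoff_eq_zero hr0 j hxr]; ring
          · simp only [Pi.sub_apply, hx (by rw [hr] at hxr; linarith), sub_zero]
        rw [e1, ← nrm_two_sq_real (memLp_mul_four_four hp4 hm)]
        exact pow_le_pow_left₀ (nrm_nonneg _ _) (nrm_mul_four_four_le hp4 hm) 2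
      · simpa using (h.lim.const_mul (nrm 4 (pd j q))).pow 2
    have hsum := (hbf.const_mul 4).neg.add (hout.const_mul (2*(e⁻¹)^2))
    simp only [mul_zero, neg_zero, add_zero] at hsum
    obtain ⟨n, hn, hnk⟩ := ((hsum.eventually_lt_const (show (0 : ℝ) < 2 by norm_num)).and
      (eventually_ge_atTop k)).exists
    refine ⟨n, hnk, ?_⟩
    have hd : dir (ψ n) ≤ M := by
      have hpp : ∀ j, ∫ x, pd j (ψ n) x^2 ≤ 8*(∫ x, pd j q x^2) - 4*(∫ x, pd j (v n) x*pd j (f n) x)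
          + 2*(e⁻¹)^2*∫ x, (pd j q x*v n x)^2 := by
        intro j
        have i1 := ((hq.memLp_pd j 2).integrable_sq).const_mul 8
        have i2 := ((h.test n).integrable_pd_mul (hft n) j).const_mul 4
        have i12 : Integrable fun x => 8*pd j q x^2 - 4*(pd j (v n) x*pd j (f n) x) := i1.sub i2
        have i3 := ((memLp_mul_four_four (hq.memLp_pd j 4) ((h.test n).memLp 4)).integrable_sq).const_mul
          (2*(e⁻¹)^2)
        rw [← integral_const_mul, ← integral_const_mul, ← integral_const_mul, ← integral_sub i1 i2,
          ← integral_add i12 i3]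
        refine integral_mono ((hψt n).memLp_pd j 2).integrable_sq (i12.fun_add i3) fun x => ?_
        rw [hpf, hpψ]
        set w := (v n x + e)⁻¹
        set X := q x*(pd j (v n) x*w) with hX
        set l := log (1 + v n x*e⁻¹)
        have hl1 : l ≤ v n x*e⁻¹ := by have := log_le_sub_one_of_pos (hlog n x); linarith
        have hl0 : 0 ≤ l := log_nonneg (by have := mul_nonneg (h.nonneg n x) (inv_pos.2 he).le; linarith)
        have hl2 : l^2*pd j q x^2 ≤ (v n x*e⁻¹)^2*pd j q x^2 := by gcongr
        have e0 : pd j (v n) x*(2*q x*pd j q x*w - q x^2*pd j (v n) x*w^2)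
          = 2*pd j q x*X - X^2 := by rw [hX]; ring
        rw [e0]
        nlinarith [sq_nonneg (2*pd j q x - X), sq_nonneg (X - l*pd j q x)]
      have h1 : dir (ψ n) ≤ 8*dir q - 4*∑ j, (∫ x, pd j (v n) x*pd j (f n) x)
          + 2*(e⁻¹)^2*∑ j, ∫ x, (pd j q x*v n x)^2 := by
        simp only [dir, mul_sum, ← sum_add_distrib, ← Finset.sum_sub_distrib]
        exact sum_le_sum fun j _ => hpp j
      have h2 : ∫ x, V x*(v n x*f n x) ≤ ∫ x, |V x| *q x^2 := by
        refine integral_mono (integrable_mul_mul h.memV ((h.test n).memLp 4) ((hft n).memLp 4)) hVq fun x => ?_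
        have e0 : v n x*f n x = (v n x*(v n x + e)⁻¹)*q x^2 := by simp only [hf]; ring
        have a0 : 0 ≤ v n x*(v n x + e)⁻¹ := mul_nonneg (h.nonneg n x) (hi0 n x)
        have a1 : v n x*(v n x + e)⁻¹ ≤ 1 := by rw [← div_eq_mul_inv, div_le_one (hve0 n x)]; linarith
        simp only [e0]
        calc V x*(v n x*(v n x + e)⁻¹*q x^2) ≤ |V x| *(v n x*(v n x + e)⁻¹*q x^2) :=
              mul_le_mul_of_nonneg_right (le_abs_self _) pos!
          _ ≤ |V x| *(1*q x^2) := by gcongr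
          _ = _ := by ring
      have h3 : ∑ j, (∫ x, pd j (v n) x*pd j (f n) x)
          = bf V (v n) (f n) - ∫ x, V x*(v n x*f n x) := by rw [bf]; ring
      rw [h3] at h1
      rw [hM]; linarith
    have e0 : (fun x => q x*log (1 + v n x*(k + 1))) = ψ n := by funext x; simp only [hψ, hek]; ring
    rw [e0]
    exact (hψt n).sobolev.trans (by gcongr)
  choose n hnk hn using key
  obtain ⟨K, hK0, hK⟩ : ∃ K, 0 ≤ K ∧ K = √((sobC ℝ : ℝ)^2*M) := ⟨_, sqrt_nonneg _, rfl⟩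
  set u : ℕ → R4 → ℝ := fun k x => q x*log (1 + v (n k) x*(k + 1)) with hu
  have hum : ∀ k, Measurable (u k) := fun k => by
    have := (h.test (n k)).contDiff.continuous.measurable
    have := hq.contDiff.continuous.measurable
    simp only [hu]; fun_prop
  have hlogpos : ∀ k x, (1 : ℝ) ≤ 1 + v (n k) x*(k + 1) := fun k x => by
    have := mul_nonneg (h.nonneg (n k) x) (show (0 : ℝ) ≤ k + 1 by positivity); linarith
  have hu4 : ∀ k, MemLp (u k) 4 := fun k => by
    have ht : Test (fun x => log (1 + v (n k) x*(k + 1))*q x) := hq.mul_left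
      ((contDiff_const.add ((h.test (n k)).contDiff.mul contDiff_const)).log
        fun x => (zero_lt_one.trans_le (hlogpos k x)).ne')
    simpa only [hu, mul_comm] using ht.memLp 4
  have hint : ∀ k, ∫⁻ x, ‖u k x‖ₑ^(4 : ℝ) ≤ ofReal K^(4 : ℝ) := fun k => by
    have h1 : nrm 4 (u k) ≤ K := hK ▸ le_sqrt_of_sq_le (hn k)
    rw [nrm, ← ENNReal.le_ofReal_iff_toReal_le (hu4 k).2.ne hK0] at h1
    rw [eLpNorm_eq_lintegral_rpow_enorm_toReal num! num!] at h1
    have h2 := ENNReal.rpow_le_rpow h1 (show (0 : ℝ) ≤ 4 by norm_num)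
    rw [← ENNReal.rpow_mul] at h2
    simpa using h2
  have hme : ∀ k, Measurable fun x => ‖u k x‖ₑ^(4 : ℝ) := fun k => (hum k).enorm.pow_const _
  have hF := lintegral_liminf_le (μ := volume) (u := atTop) hme
  have hF2 : ∫⁻ x, liminf (fun k => ‖u k x‖ₑ^(4 : ℝ)) atTop ≠ ⊤ := by
    refine ne_top_of_le_ne_top (b := ofReal K^(4 : ℝ)) (by simp) (hF.trans ?_)
    exact (liminf_le_liminf (.of_forall hint)).trans (by simp)
  have hae := ae_lt_top (μ := volume) (f := fun x => liminf (fun k => ‖u k x‖ₑ^(4 : ℝ)) atTop)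
    (Measurable.liminf hme) hF2
  filter_upwards [hae, h0, h.ae_nonneg, h.lim_ae] with x hx hx0 hx1 hx2
  rcases lt_or_ge R2 ‖x‖ with hxr | hxr
  · exact hx0 hxr
  by_contra hne
  have hpos : 0 < z x := lt_of_le_of_ne hx1 (Ne.symm hne)
  have hqx : q x = 1 := cutoff_eq_one hr0 (by rw [hr]; linarith)
  have hnt : Tendsto n atTop atTop := tendsto_atTop_mono hnk tendsto_id
  have ht : Tendsto (fun k => u k x) atTop atTop := by
    simp only [hu, hqx, one_mul]
    refine tendsto_log_atTop.comp (tendsto_atTop_add_const_left _ _ ?_)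
    exact (hx2.comp hnt).pos_mul_atTop hpos (tendsto_atTop_add_const_right _ _ tendsto_natCast_atTop_atTop)
  have ht2 : Tendsto (fun k => ‖u k x‖ₑ^(4 : ℝ)) atTop (𝓝 ⊤) := by
    have : Tendsto (fun k => ofReal (u k x)^(4 : ℝ)) atTop (𝓝 ⊤) := by
      have := (continuous_rpow_const (y := 4)).tendsto ⊤ |>.comp (ENNReal.tendsto_ofReal_nhds_top.2 ht)
      simpa [comp_def] using this
    refine this.congr fun k => ?_
    rw [enorm_eq_ofReal]
    exact mul_nonneg (hq0 x) (log_nonneg (hlogpos k x))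
  rw [ht2.liminf_eq] at hx
  exact lt_irrefl _ hx

/-- The resonance decays exactly like a multiple of the fundamental solution. -/
lemma density_ne_zero (h : ResonanceSeq V v z g) (hs : ShortRange V R d) :
    ∫ y, -(V y*z y) ≠ 0 := by
  intro hc
  obtain ⟨A, R1, hA, hR1, has⟩ := h.asymptotics hs (c := 0) (by rw [hc]; ring)
  obtain ⟨R2, hR2, h0⟩ := h.eq_zero_outside hs hA hR1 (has.mono fun x hx hxr => by simpa using (hx hxr).1)
  have hz := h.ae_eq_zero_of_eq_zero_outside hR2 h0
  have : ∫ x, V x*z x^2 = 0 := integral_eq_zero_of_ae (by filter_upwards [hz] with x hx; simp [hx])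
  linarith [h.integral_potential]

end ResonanceSeq

/-- `f` is integrable near the origin and bounded by a multiple of `|x|^(-a)` for `|x| > r`. -/
structure Dec (r a A : ℝ) (f : R4 → ℝ) : Prop where
  nonneg : 0 ≤ A
  meas : AEStronglyMeasurable f volume
  intOn : IntegrableOn f (closedBall 0 r)
  near : ∫ x in closedBall 0 r, |f x| ≤ A
  far : ∀ᵐ x, r < ‖x‖ → |f x| ≤ A*‖x‖^(-a)

lemma integral_tail_norm_rpow {q : ℝ} (hq : 4 < q) (hr : 0 < r) :
    IntegrableOn (fun z : R4 => ‖z‖^(-q)) (closedBall 0 r)ᶜ ∧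
    ∫ z in (closedBall (0 : R4) r)ᶜ, ‖z‖^(-q) = 2*π^2*(r^(4 - q)/(q - 4)) := by
  have hm : MeasurableSet (closedBall (0 : R4) r)ᶜ := isClosed_closedBall.measurableSet.compl
  have e : (closedBall (0 : R4) r)ᶜ.indicator (fun z : R4 => ‖z‖^(-q))
      = fun z => (Ioi r).indicator (fun t : ℝ => t^(-q)) ‖z‖ := by
    funext z
    by_cases hz : r < ‖z‖
    · rw [indicator_of_mem (by! hz), indicator_of_mem (by! hz)]
    · rw [indicator_of_notMem (by! hz), indicator_of_notMem (by! hz)]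
  have e2 : ∀ t ∈ Ioi (0 : ℝ), t^3*(Ioi r).indicator (fun t : ℝ => t^(-q)) t
      = (Ioi r).indicator (fun t : ℝ => t^(3 - q)) t := by
    intro t ht
    by_cases hz : r < t
    · rw [indicator_of_mem (by! hz), indicator_of_mem (by! hz), ← rpow_natCast, ← rpow_add ht]
      congr 1
    · rw [indicator_of_notMem (by! hz), indicator_of_notMem (by! hz), mul_zero]
  have hinter : Ioi (0 : ℝ) ∩ Ioi r = Ioi r := Set.inter_eq_right.2 (Set.Ioi_subset_Ioi hr.le)
  have hi := integrableOn_Ioi_rpow_of_lt (show 3 - q < -1 by linarith) hr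
  rw [← integrable_indicator_iff hm, ← integral_indicator hm, e]
  constructor
  · rw [integrable_radial_iff, integrableOn_congr_fun e2 measurableSet_Ioi]
    exact ((integrable_indicator_iff measurableSet_Ioi).2 hi).integrableOn
  · rw [integral_radial, setIntegral_congr_fun measurableSet_Ioi e2,
      setIntegral_indicator measurableSet_Ioi, hinter, integral_Ioi_rpow_of_lt lin! hr]
    congr 1
    rw [show 3 - q + 1 = 4 - q by ring, neg_div, ← div_neg, neg_sub]

namespace Dec

variable {r a b A B : ℝ} {f g : R4 → ℝ}

lemma integral_ball_le (hr : 1 ≤ r) (ha4 : a < 4) (hf : Dec r a A f)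
    (hs : r ≤ s) : IntegrableOn f (closedBall 0 s) ∧
      ∫ x in closedBall 0 s, |f x| ≤ (1 + 2*π^2/(4 - a))*A*s^(4 - a) := by
  have hs1 := hr.trans hs
  have hb := integral_ball_norm_rpow ha4 (zero_le_one.trans hs1)
  have hm : MeasurableSet (closedBall (0 : R4) r) := isClosed_closedBall.measurableSet
  have hi1 : IntegrableOn ((closedBall (0 : R4) r).indicator fun x => |f x|)
      (closedBall 0 s) := ((integrable_indicator_iff hm).2 hf.intOn.abs).integrableOn
  have hi2 := hb.1.const_mul A
  have hle : ∀ᵐ x ∂volume.restrict (closedBall 0 s),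
      |f x| ≤ (closedBall (0 : R4) r).indicator (fun x => |f x|) x + A*‖x‖^(-a) := by
    filter_upwards [ae_restrict_of_ae hf.far] with x hx
    by_cases hxr : r < ‖x‖
    · rw [indicator_of_notMem (by! hxr), zero_add]; exact hx hxr
    · rw [indicator_of_mem (by! hxr)]
      exact le_add_of_nonneg_right (mul_nonneg hf.nonneg pos!)
  have hI : IntegrableOn f (closedBall 0 s) := (hi1.add hi2).mono' hf.meas.restrict (by! hle)
  refine ⟨hI, (integral_mono_ae hI.abs (hi1.add hi2) hle).trans ?_⟩
  simp only [Pi.add_apply]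
  rw [integral_add hi1 hi2, integral_const_mul, hb.2, setIntegral_indicator hm,
    Set.inter_eq_right.2 (closedBall_subset_closedBall hs)]
  have h1 : (1 : ℝ) ≤ s^(4 - a) := one_le_rpow hs1 lin!
  have h2 := hf.near
  have h3 : A ≤ A*s^(4 - a) := le_mul_of_one_le_right hf.nonneg h1
  calc _ ≤ A*s^(4 - a) + A*(2*π^2*(s^(4 - a)/(4 - a))) := lin!
    _ = _ := by ring

lemma cross (hr : 1 ≤ r) (ha : 0 < a) (ha4 : a < 4) (hb : 0 < b) (hb4 : b < 4) (hab : 4 < a + b) :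
    ∃ C : ℝ, 0 ≤ C ∧ ∀ {A B : ℝ} {f g : R4 → ℝ}, Dec r a A f → Dec r b B g → ∀ l : R4,
      2*r < ‖l‖ → Integrable (fun x => f x*g (x + l)) ∧ ∫ x, |f x*g (x + l)| ≤ C*(A*B)*‖l‖^(4 - a - b) := by
  set C0 : ℝ := (1 + 2*π^2/(4 - a)) + (1 + 2*π^2/(4 - b)) + 2*(2*π^2/(a + b - 4)) with hC0
  refine ⟨C0*(1/2)^(4 - a - b), pos!, ?_⟩
  intro A B f g hf hg l hl
  set s := ‖l‖/2 with hs
  have hrs : r < s := by rw [hs]; linarith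
  have hs0 : 0 < s := lin!
  have hms : ∀ c : R4, MeasurableSet (closedBall c s) := fun c => isClosed_closedBall.measurableSet
  obtain ⟨if1, if2⟩ := hf.integral_ball_le hr ha4 hrs.le
  obtain ⟨ig1, ig2⟩ := hg.integral_ball_le hr hb4 hrs.le
  obtain ⟨it1, it2⟩ := integral_tail_norm_rpow hab hs0
  set F1 : R4 → ℝ := (closedBall (0 : R4) s).indicator (fun x => |f x|)
  set G1 : R4 → ℝ := (closedBall (0 : R4) s).indicator (fun x => |g x|)
  set T : R4 → ℝ := (closedBall (0 : R4) s)ᶜ.indicator (fun x => ‖x‖^(-(a + b)))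
  have jF : Integrable F1 := (integrable_indicator_iff (hms 0)).2 if1.abs
  have jG : Integrable G1 := (integrable_indicator_iff (hms 0)).2 ig1.abs
  have jT : Integrable T := it1.integrable_indicator (hms 0).compl
  have bF : ∫ x, F1 x ≤ _ := (integral_indicator (hms 0)).le.trans if2
  have bG : ∫ x, G1 x ≤ _ := (integral_indicator (hms 0)).le.trans ig2
  have bT : ∫ x, T x = _ := (integral_indicator (hms 0).compl).trans it2
  have nF : ∀ x, 0 ≤ F1 x := fun x => Set.indicator_nonneg (fun _ _ => abs_nonneg _) x
  have nG : ∀ x, 0 ≤ G1 x := fun x => Set.indicator_nonneg (fun _ _ => abs_nonneg _) x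
  have nT : ∀ x, 0 ≤ T x := fun x => Set.indicator_nonneg (fun _ _ => pos!) x
  have hA := hf.nonneg
  have hB := hg.nonneg
  have hqm := quasiMeasurePreserving_add_right (volume : Measure R4) l
  have hdom : ∀ᵐ x, |f x*g (x + l)| ≤ (B*s^(-b))*F1 x + (A*s^(-a))*G1 (x + l)
      + (A*B)*(T x + T (x + l)) := by
    filter_upwards [hf.far, hqm.ae hg.far] with x hx hy
    rw [abs_mul]
    have p0 : 0 ≤ (B*s^(-b))*F1 x := mul_nonneg pos! (nF x)
    have p1 : 0 ≤ (A*s^(-a))*G1 (x + l) := mul_nonneg pos! (nG _)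
    have p2 : 0 ≤ (A*B)*T x := mul_nonneg pos! (nT _)
    have p3 : 0 ≤ (A*B)*T (x + l) := mul_nonneg pos! (nT _)
    have tri : ‖l‖ ≤ ‖x‖ + ‖x + l‖ := by
      have := norm_sub_le (x + l) x; rw [add_sub_cancel_left] at this; linarith
    by_cases h1 : ‖x‖ ≤ s
    · have h2 : s ≤ ‖x + l‖ := by rw [hs] at *; linarith
      have e1 : F1 x = |f x| := indicator_of_mem (by! h1) _
      have h3 := hy lin!
      have h4 : ‖x + l‖^(-b) ≤ s^(-b) := rpow_le_rpow_of_nonpos hs0 h2 lin!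
      have : |f x| *|g (x + l)| ≤ |f x| *(B*s^(-b)) := by gcongr; exact h3.trans (by gcongr)
      rw [e1] at p0 ⊢; linarith
    · push Not at h1
      have h3 := hx lin!
      by_cases h2 : ‖x + l‖ ≤ s
      · have e2 : G1 (x + l) = |g (x + l)| := indicator_of_mem (by! h2) _
        have h4 : ‖x‖^(-a) ≤ s^(-a) := rpow_le_rpow_of_nonpos hs0 h1.le lin!
        have : |f x| *|g (x + l)| ≤ (A*s^(-a))*|g (x + l)| := by gcongr; exact h3.trans (by gcongr)
        rw [e2] at p1 ⊢; linarith
      · push Not at h2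
        have h4 := hy lin!
        have e1 : T x = ‖x‖^(-(a + b)) := indicator_of_mem (by! h1) _
        have e2 : T (x + l) = ‖x + l‖^(-(a + b)) := indicator_of_mem (by! h2) _
        have hx0 : 0 < ‖x‖ := hs0.trans h1
        have hy0 : 0 < ‖x + l‖ := hs0.trans h2
        have h5 : ‖x‖^(-a)*‖x + l‖^(-b) ≤ T x + T (x + l) := by
          rw [e1, e2]
          rcases le_total ‖x‖ ‖x + l‖ with h | h
          · have : ‖x + l‖^(-b) ≤ ‖x‖^(-b) := rpow_le_rpow_of_nonpos hx0 h lin!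
            calc _ ≤ ‖x‖^(-a)*‖x‖^(-b) := by gcongr
              _ = ‖x‖^(-(a + b)) := by rw [← rpow_add hx0]; congr 1; ring
              _ ≤ _ := le_add_of_nonneg_right pos!
          · have : ‖x‖^(-a) ≤ ‖x + l‖^(-a) := rpow_le_rpow_of_nonpos hy0 h lin!
            calc _ ≤ ‖x + l‖^(-a)*‖x + l‖^(-b) := by gcongr
              _ = ‖x + l‖^(-(a + b)) := by rw [← rpow_add hy0]; congr 1; ring
              _ ≤ _ := le_add_of_nonneg_left pos!
        calc |f x| *|g (x + l)| ≤ (A*‖x‖^(-a))*(B*‖x + l‖^(-b)) := by gcongr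
          _ = (A*B)*(‖x‖^(-a)*‖x + l‖^(-b)) := by ring
          _ ≤ (A*B)*(T x + T (x + l)) := by gcongr
          _ ≤ _ := lin!
  have k1 := jF.const_mul (B*s^(-b))
  have k2 := (jG.comp_add_right l).const_mul (A*s^(-a))
  have k3 := (jT.fun_add (jT.comp_add_right l)).const_mul (A*B)
  have hI : Integrable (fun x => f x*g (x + l)) := ((k1.fun_add k2).fun_add k3).mono'
    (hf.meas.mul (hg.meas.comp_quasiMeasurePreserving hqm)) hdom
  refine ⟨hI, (integral_mono_ae hI.abs ((k1.fun_add k2).fun_add k3) hdom).trans ?_⟩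
  have e : ∫ x, ((B*s^(-b))*F1 x + (A*s^(-a))*G1 (x + l) + (A*B)*(T x + T (x + l)))
      = (B*s^(-b))*(∫ x, F1 x) + (A*s^(-a))*(∫ x, G1 x) + (A*B)*(2*∫ x, T x) := by
    rw [integral_add (k1.fun_add k2) k3, integral_add k1 k2, integral_const_mul, integral_const_mul,
      integral_const_mul, integral_add_right_eq_self G1, integral_add jT (jT.comp_add_right l),
      integral_add_right_eq_self T]
    ring
  rw [e, bT]
  have r1 : s^(-b)*s^(4 - a) = s^(4 - a - b) := by rw [← rpow_add hs0]; congr 1; ring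
  have r2 : s^(-a)*s^(4 - b) = s^(4 - a - b) := by rw [← rpow_add hs0]; congr 1; ring
  have r3 : s^(4 - (a + b)) = s^(4 - a - b) := by congr 1; ring
  have r4 : (1/2 : ℝ)^(4 - a - b)*‖l‖^(4 - a - b) = s^(4 - a - b) := by
    rw [← mul_rpow num! (norm_nonneg _)]; congr 1; rw [hs]; ring
  calc _ ≤ (B*s^(-b))*((1 + 2*π^2/(4 - a))*A*s^(4 - a))
        + (A*s^(-a))*((1 + 2*π^2/(4 - b))*B*s^(4 - b))
        + (A*B)*(2*(2*π^2*(s^(4 - (a + b))/(a + b - 4)))) := by gcongr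
    _ = C0*(A*B)*s^(4 - a - b) := by
      rw [hC0, r3, ← r1]
      linear_combination (A*B*(1 + 2*π^2/(4 - b)))*(r2 - r1)
    _ = _ := by rw [← r4]; ring

end Dec

/-- The damping factor `((1 + N)/(N + s))^k`. -/
def damp (k N s : ℝ) : ℝ := ((1 + N)/(N + s))^k

/-- The regularized Newton potential `1/(1 + |x|²)`. -/
def newt (x : R4) : ℝ := w(x)⁻¹

def newtPd (j : Fin 4) (x : R4) : ℝ := -2*x j*(w(x)^2)⁻¹

/-- The damped regularized Newton potential. -/
def newtL (k N : ℝ) (x : R4) : ℝ := w(x)⁻¹*damp k N w(x)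

def newtLPd (k N : ℝ) (j : Fin 4) (x : R4) : ℝ := -2*x j*(newtL k N x*(w(x)⁻¹ + k*(N + w(x))⁻¹))

/-- The derivative of `newtL k N x` in `N`. -/
def newtLDeriv (k N : ℝ) (x : R4) : ℝ := newtL k N x*(k*(‖x‖^2*((1 + N)*(N + w(x)))⁻¹))

lemma damp_pos (hN : 0 ≤ N) (hs : 1 ≤ s) : 0 < damp k N s := rpow_pos_of_pos pos! _

lemma damp_le_one (hk : 0 ≤ k) (hN : 0 ≤ N) (hs : 1 ≤ s) : damp k N s ≤ 1 :=
  rpow_le_one pos! ((div_le_one pos!).2 lin!) hk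

lemma hasDerivAt_damp (hN : 0 ≤ N) (hs : 0 < s) :
    HasDerivAt (damp k N) (-(k*(N + s)⁻¹*damp k N s)) s := by
  have h0 : 0 < (1 + N)/(N + s) := pos!
  have h1 : HasDerivAt (fun s => (1 + N)/(N + s)) (-((1 + N)/(N + s)^2)) s := by
    refine ((hasDerivAt_const s (1 + N)).div ((hasDerivAt_id' s).const_add N) pos!).congr_deriv ?_
    ring
  refine (h1.rpow_const (p := k) (Or.inl h0.ne')).congr_deriv ?_
  rw [rpow_sub_one h0.ne', damp]; field_simp

lemma one_sub_damp_le (hk : 0 ≤ k) (hN : 0 ≤ N) (hs : 1 ≤ s) :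
    1 - damp k N s ≤ 4*k*((s - 1)*((1 + N)^(-(1/4) : ℝ)*(N + s)^(-(3/4) : ℝ))) := by
  have hM : 0 < 1 + N := pos!
  have hNs : 0 < N + s := pos!
  set y := (N + s)/(1 + N) with hy
  have hy0 : 0 < y := pos!
  have hy1 : 1 ≤ y := by rw [hy, one_le_div hM]; linarith
  have e1 : damp k N s = exp (-(k*log y)) := by
    rw [damp, show (1 + N)/(N + s) = y⁻¹ by rw [hy, inv_div], rpow_def_of_pos pos!, log_inv]
    congr 1; ring
  have e2 : 1 - damp k N s ≤ k*log y := by rw [e1]; linarith [add_one_le_exp (-(k*log y))]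
  have e3 : log y ≤ 4*(y^(1/4 : ℝ) - 1) := by
    have h1 := log_le_sub_one_of_pos (rpow_pos_of_pos hy0 (1/4 : ℝ))
    rw [log_rpow hy0] at h1; linarith
  have e4 : y^(1/4 : ℝ) - 1 ≤ (y - 1)*y^(-(3/4) : ℝ) := by
    have h1 : y*y^(-(3/4) : ℝ) = y^(1/4 : ℝ) := by nth_rw 1 [← rpow_one y]; rw [← rpow_add hy0]; norm_num
    have h2 : y^(-(3/4) : ℝ) ≤ 1 := rpow_le_one_of_one_le_of_nonpos hy1 num!
    linarith
  have e5 : (y - 1)*y^(-(3/4) : ℝ)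
      = (s - 1)*((1 + N)^(-(1/4) : ℝ)*(N + s)^(-(3/4) : ℝ)) := by
    have h1 : (1 + N)^(-(1/4) : ℝ) = (1 + N)⁻¹*((1 + N)^(-(3/4) : ℝ))⁻¹ := by
      rw [← rpow_neg hM.le, ← rpow_neg_one (1 + N), ← rpow_add hM]; norm_num
    rw [h1, hy, div_rpow hNs.le hM.le]
    field_simp; ring
  calc _ ≤ k*log y := e2
    _ ≤ k*(4*((y - 1)*y^(-(3/4) : ℝ))) := by gcongr; linarith
    _ = _ := by rw [e5]; ring

lemma one_le_one_add_sq (x : R4) : 1 ≤ w(x) := le_add_of_nonneg_right (sq_nonneg _)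

lemma newt_eq (x : R4) : newt x = w(x)^(-(2/2) : ℝ) := by
  rw [newt, show (-(2/2) : ℝ) = -1 by norm_num, rpow_neg_one]

lemma newtL_pos (hN : 0 ≤ N) (x : R4) : 0 < newtL k N x := mul_pos pos! (damp_pos hN (one_le_one_add_sq x))

lemma newtL_le (hk : 0 ≤ k) (hN : 0 ≤ N) (x : R4) : newtL k N x ≤ newt x :=
  mul_le_of_le_one_right pos! (damp_le_one hk hN (one_le_one_add_sq x))

lemma abs_newtL_sub_le (hk : 0 ≤ k) (hN : 0 ≤ N) (x : R4) : |newtL k N x - newt x| ≤ newt x := by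
  have h1 := newtL_pos (k := k) hN x
  have h2 := newtL_le hk hN x
  rw [abs_le]; constructor <;> linarith

lemma rpow_split {M : ℝ} (hM : 0 < M) : M^(-(1/4) : ℝ)*M^(-(3/4) : ℝ) = M⁻¹ := by
  rw [← rpow_add hM, ← rpow_neg_one]; norm_num

lemma abs_newtL_sub_le_inv (hk : 0 ≤ k) (hN : 0 ≤ N) (x : R4) :
    |newtL k N x - newt x| ≤ 4*k*(1 + N)⁻¹ := by
  have hs := one_le_one_add_sq x
  have h1 := one_sub_damp_le hk hN hs
  have h2 := damp_le_one hk hN hs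
  have hM : 0 < 1 + N := pos!
  have h3 : (N + w(x))^(-(3/4) : ℝ) ≤ (1 + N)^(-(3/4) : ℝ) := rpow_le_rpow_of_nonpos hM lin! num!
  have e : newtL k N x - newt x = -(w(x)⁻¹*(1 - damp k N w(x))) := by rw [newtL, newt]; ring
  rw [e, abs_neg, abs_of_nonneg (mul_nonneg pos! lin!)]
  calc _ ≤ w(x)⁻¹*(4*k*((w(x) - 1)
        * ((1 + N)^(-(1/4) : ℝ)*(1 + N)^(-(3/4) : ℝ)))) := by
          refine mul_le_mul_of_nonneg_left (h1.trans ?_) pos!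
          have : 0 ≤ w(x) - 1 := lin!
          gcongr
    _ = 4*k*(1 + N)⁻¹*(w(x)⁻¹*‖x‖^2) := by rw [rpow_split hM]; ring
    _ ≤ 4*k*(1 + N)⁻¹*1 := by
          gcongr; rw [inv_mul_le_one₀ pos!]; linarith
    _ = _ := mul_one _

lemma abs_coord_le_rpow (x : R4) (j : Fin 4) : |x j| ≤ w(x)^(1/2 : ℝ) := by
  have := abs_coord_le x 0 j
  simp only [PiLp.zero_apply, sub_zero] at this
  exact this.trans (norm_le_rpow_half x)

lemma abs_newtPd_le (j : Fin 4) (x : R4) : |newtPd j x| ≤ 2*w(x)^(-(3/2) : ℝ) := by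
  have hs : 0 < w(x) := pos!
  rw [newtPd, abs_mul, abs_mul, abs_of_pos (show 0 < (w(x)^2)⁻¹ by positivity)]
  calc _ ≤ |(-2 : ℝ)| *w(x)^(1/2 : ℝ)*(w(x)^2)⁻¹ := by
        gcongr; exact abs_coord_le_rpow x j
    _ = _ := by
        rw [show (w(x)^2)⁻¹ = w(x)^(-2 : ℝ) by rw [rpow_neg hs.le, rpow_two],
          mul_assoc, ← rpow_add hs]; norm_num

lemma abs_newtLPd_le (hk : 0 ≤ k) (hk1 : k ≤ 1) (hN : 0 ≤ N) (j : Fin 4) (x : R4) :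
    |newtLPd k N j x| ≤ 4*w(x)^(-(3/2) : ℝ) := by
  have hs : 0 < w(x) := pos!
  have h1 : newtL k N x*(w(x)⁻¹ + k*(N + w(x))⁻¹)
      ≤ 2*(w(x)^2)⁻¹ := by
    have h2 : (N + w(x))⁻¹ ≤ w(x)⁻¹ := inv_anti₀ hs lin!
    have h3 : k*(N + w(x))⁻¹ ≤ 1*w(x)⁻¹ := by gcongr
    calc _ ≤ newt x*(2*w(x)⁻¹) := by
          have := (newtL_pos (k := k) hN x).le
          gcongr
          · exact (by unfold newt; positivity : 0 ≤ newt x)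
          · exact newtL_le hk hN x
          · linarith
      _ = _ := by rw [newt, ← inv_pow]; ring
  have h0 : 0 ≤ newtL k N x*(w(x)⁻¹ + k*(N + w(x))⁻¹) := mul_nonneg (newtL_pos hN x).le pos!
  rw [newtLPd, abs_mul, abs_of_nonneg h0]
  have h4 := abs_newtPd_le j x
  rw [newtPd, abs_mul, abs_of_pos (show 0 < (w(x)^2)⁻¹ by positivity)] at h4
  calc _ ≤ |-2*x j| *(2*(w(x)^2)⁻¹) := by gcongr
    _ ≤ _ := lin!

lemma abs_newtLPd_sub_le (hk : 0 ≤ k) (hN : 0 ≤ N) (j : Fin 4) (x : R4) :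
    |newtLPd k N j x - newtPd j x| ≤ 10*k*((1 + N)^(-(1/4) : ℝ)
      * (w(x)^(-(1/2) : ℝ)*(N + w(x))^(-(3/4) : ℝ))) := by
  have hs := one_le_one_add_sq x
  have hx := abs_coord_le_rpow x j
  have h1 := one_sub_damp_le hk hN hs
  have h2 := damp_le_one hk hN hs
  have h0 := (damp_pos (k := k) hN hs).le
  rw [newtLPd, newtPd, newtL]
  set s := w(x)
  set p := damp k N s
  have hs0 : 0 < s := lin!
  have hM : 0 < 1 + N := pos!
  have hNs : 0 < N + s := pos!
  set m := (1 + N)^(-(1/4) : ℝ)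
  set n := (N + s)^(-(3/4) : ℝ)
  have h3 : (N + s)⁻¹ ≤ m*n := by
    rw [← rpow_split hNs]
    have : (N + s)^(-(1/4) : ℝ) ≤ m := rpow_le_rpow_of_nonpos hM lin! num!
    gcongr
  have e : -2*x j*(s⁻¹*p*(s⁻¹ + k*(N + s)⁻¹)) - -2*x j*(s^2)⁻¹
      = 2*x j*(s⁻¹*(s⁻¹*(1 - p) - k*(p*(N + s)⁻¹))) := by
    rw [pow_two, mul_inv]; ring
  have hr : s^(1/2 : ℝ)*s⁻¹ = s^(-(1/2) : ℝ) := by rw [← rpow_neg_one, ← rpow_add hs0]; norm_num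
  have hb : |s⁻¹*(1 - p) - k*(p*(N + s)⁻¹)| ≤ 5*k*(m*n) := by
    have a1 : s⁻¹*(1 - p) ≤ 4*k*(m*n) := by
      calc s⁻¹*(1 - p) ≤ s⁻¹*(4*k*(s*(m*n))) := by
            refine mul_le_mul_of_nonneg_left (h1.trans ?_) pos!
            have : (s - 1)*(m*n) ≤ s*(m*n) := mul_le_mul_of_nonneg_right lin! pos!
            exact mul_le_mul_of_nonneg_left this pos!
        _ = _ := by field_simp
    have a0 : 0 ≤ s⁻¹*(1 - p) := mul_nonneg pos! lin!
    have a3 : k*(p*(N + s)⁻¹) ≤ k*(m*n) := by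
      have : p*(N + s)⁻¹ ≤ 1*(m*n) := mul_le_mul h2 h3 pos! zero_le_one
      exact mul_le_mul_of_nonneg_left lin! hk
    have a2 : 0 ≤ k*(p*(N + s)⁻¹) := pos!
    rw [abs_le]; constructor <;> linarith
  rw [e, abs_mul, abs_mul, abs_mul, abs_of_pos (show 0 < s⁻¹ by positivity), abs_two]
  calc _ ≤ 2*s^(1/2 : ℝ)*(s⁻¹*(5*k*(m*n))) := by gcongr
    _ = 10*k*(m*((s^(1/2 : ℝ)*s⁻¹)*n)) := by ring
    _ = _ := by rw [hr]

lemma newtLDeriv_nonneg (hk : 0 ≤ k) (hN : 0 ≤ N) (x : R4) : 0 ≤ newtLDeriv k N x :=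
  mul_nonneg (newtL_pos hN x).le pos!

lemma newtLDeriv_le (hk : 0 ≤ k) (hN : 0 ≤ N) (x : R4) :
    newtLDeriv k N x ≤ k*(1 + N)⁻¹*(damp k N w(x)*(N + w(x))⁻¹) := by
  have h1 : w(x)⁻¹*‖x‖^2 ≤ 1 := by rw [inv_mul_le_one₀ pos!]; linarith
  have h0 := (damp_pos (k := k) hN (one_le_one_add_sq x)).le
  calc newtLDeriv k N x = k*(1 + N)⁻¹*(damp k N w(x)*(N + w(x))⁻¹)
        * (w(x)⁻¹*‖x‖^2) := by rw [newtLDeriv, newtL, mul_inv]; ring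
    _ ≤ _ := mul_le_of_le_one_right pos! h1

lemma contDiff_newtL (hN : 0 ≤ N) : ContDiff ℝ ∞ (newtL k N) := by
  have h : ContDiff ℝ ∞ fun x : R4 => w(x) := contDiff_const.add (contDiff_norm_sq ℝ)
  refine (h.inv fun x => pos!).mul ?_
  refine ContDiff.rpow_const_of_ne (contDiff_const.div (contDiff_const.add h) fun x => pos!) fun x => pos!

lemma contDiff_newt : ContDiff ℝ ∞ newt := (contDiff_const.add (contDiff_norm_sq ℝ)).inv fun x => pos!

lemma pd_newtL (hN : 0 ≤ N) (j : Fin 4) : pd j (newtL k N) = newtLPd k N j := by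
  funext x
  have hd : HasDerivAt (fun s => s⁻¹*damp k N s) (-(w(x)^2)⁻¹*damp k N w(x)
        + w(x)⁻¹ * -(k*(N + w(x))⁻¹*damp k N w(x))) (1 + ‖x - 0‖^2) := by
    rw [sub_zero]
    exact (hasDerivAt_inv pos!).mul (hasDerivAt_damp hN pos!)
  have := pd_radial (f := fun s => s⁻¹*damp k N s) j hd
  simp only [sub_zero, PiLp.zero_apply] at this
  rw [show newtL k N = fun y => w(y)⁻¹*damp k N w(y) from rfl, this, newtLPd, newtL, pow_two w(x), mul_inv]
  ring

lemma pd_newt (j : Fin 4) : pd j newt = newtPd j := by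
  funext x
  have hd : HasDerivAt (fun s : ℝ => s⁻¹) (-(w(x)^2)⁻¹) (1 + ‖x - 0‖^2) := by
    rw [sub_zero]; exact hasDerivAt_inv pos!
  have := pd_radial (f := fun s => s⁻¹) j hd
  simp only [sub_zero, PiLp.zero_apply] at this
  rw [show newt = fun y => w(y)⁻¹ from rfl, this, newtPd]; ring

lemma continuous_newtPd (j : Fin 4) : Continuous (newtPd j) :=
  pd_newt j ▸ continuous_pd (contDiff_newt.of_le (by simp)) j

lemma continuous_newtLPd (hN : 0 ≤ N) (j : Fin 4) : Continuous (newtLPd k N j) :=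
  pd_newtL (k := k) hN j ▸ continuous_pd ((contDiff_newtL hN).of_le (by simp)) j

lemma continuous_newtLDeriv (hN : 0 ≤ N) : Continuous (newtLDeriv k N) := by
  have := (contDiff_newtL (k := k) hN).continuous
  unfold newtLDeriv
  refine this.mul (continuous_const.mul ((by fun_prop : Continuous fun x : R4 => ‖x‖^2).mul
    (Continuous.inv₀ (by fun_prop) fun x => pos!)))

lemma integral_weight {M b : ℝ} (hM : 0 < M) (hb : 0 < b) :
    Integrable (fun x : R4 => (‖x‖^2)⁻¹*(M + ‖x‖^2)^(-1 - b)) ∧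
    ∫ x : R4, (‖x‖^2)⁻¹*(M + ‖x‖^2)^(-1 - b) = π^2*(M^(-b)/b) := by
  have hpos : ∀ r : ℝ, 0 < M + r^2 := fun r => pos!
  have hsq : ∀ r : ℝ, HasDerivAt (fun r : ℝ => M + r^2) (2*r) r := fun r => by
    simpa using (hasDerivAt_pow 2 r).const_add M
  have hQ : ∀ r : ℝ, HasDerivAt (fun r : ℝ => -((M + r^2)^(-b)/(2*b)))
      (r*(M + r^2)^(-1 - b)) r := fun r => by
    refine ((((hsq r).rpow_const (p := -b) (Or.inl (hpos r).ne')).div_const (2*b)).neg).congr_deriv ?_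
    rw [show -b - 1 = -1 - b by ring]; field_simp
  have hlim : Tendsto (fun r : ℝ => -((M + r^2)^(-b)/(2*b))) atTop (𝓝 0) := by
    have h1 : Tendsto (fun r : ℝ => M + r^2) atTop atTop :=
      tendsto_atTop_add_const_left _ _ (tendsto_pow_atTop two_ne_zero)
    simpa using (((tendsto_rpow_neg_atTop hb).comp h1).div_const (2*b)).neg
  have := integral_radial_of_hasDerivAt (f := fun r => (r^2)⁻¹*(M + r^2)^(-1 - b))
    (hQ 0).continuousAt.continuousWithinAt (fun r hr => (hQ r).congr_deriv (by have : r ≠ 0 := ne_of_gt hr; field_simp)) (fun r _ => by have := hpos r; positivity) hlim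
  refine ⟨this.1, this.2.trans ?_⟩
  simp only [ne_eq, OfNat.ofNat_ne_zero, not_false_eq_true, zero_pow, add_zero, sub_neg_eq_add, zero_add]
  field_simp

lemma integral_log_weight {M : ℝ} (hM : 1 ≤ M) : Integrable (fun x : R4 => (‖x‖^2)⁻¹*(w(x)⁻¹ - (M + ‖x‖^2)⁻¹)) ∧
    ∫ x : R4, (‖x‖^2)⁻¹*(w(x)⁻¹ - (M + ‖x‖^2)⁻¹) = π^2*log M := by
  have hpos : ∀ M : ℝ, 1 ≤ M → ∀ r : ℝ, 0 < M + r^2 := fun M hM r => pos!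
  have hsq : ∀ M : ℝ, 1 ≤ M → ∀ r : ℝ, HasDerivAt (fun r : ℝ => log (M + r^2))
      (2*r/(M + r^2)) r := fun M hM r =>
    HasDerivAt.log (by simpa using (hasDerivAt_pow 2 r).const_add M) (hpos M hM r).ne'
  have hQ : ∀ r : ℝ, HasDerivAt (fun r : ℝ => 1/2*(log (1 + r^2) - log (M + r^2)))
      (r*((1 + r^2)⁻¹ - (M + r^2)⁻¹)) r := fun r =>
    (((hsq 1 le_rfl r).sub (hsq M hM r)).const_mul (1/2)).congr_deriv (by ring)
  have hlim : Tendsto (fun r : ℝ => 1/2*(log (1 + r^2) - log (M + r^2))) atTop (𝓝 0) := by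
    have h1 : Tendsto (fun r : ℝ => M + r^2) atTop atTop :=
      tendsto_atTop_add_const_left _ _ (tendsto_pow_atTop two_ne_zero)
    have h2 : Tendsto (fun r : ℝ => log (1 - (M - 1)*(M + r^2)⁻¹)) atTop (𝓝 0) := by
      have h3 : Tendsto (fun r : ℝ => 1 - (M - 1)*(M + r^2)⁻¹) atTop (𝓝 1) := by
        simpa using ((tendsto_inv_atTop_zero.comp h1).const_mul (M - 1)).const_sub 1
      simpa [comp_def] using (continuousAt_log one_ne_zero).tendsto.comp h3
    have h4 := h2.const_mul (1/2 : ℝ)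
    rw [mul_zero] at h4
    refine h4.congr fun r => ?_
    rw [← log_div (hpos 1 le_rfl r).ne' (hpos M hM r).ne']
    congr 2; have := (hpos M hM r).ne'; field_simp; ring
  have := integral_radial_of_hasDerivAt (f := fun r => (r^2)⁻¹*((1 + r^2)⁻¹ - (M + r^2)⁻¹))
    (hQ 0).continuousAt.continuousWithinAt (fun r hr => (hQ r).congr_deriv (by have : r ≠ 0 := ne_of_gt hr; field_simp)) (fun r _ => mul_nonneg pos! (sub_nonneg.2 (inv_anti₀ pos! lin!))) hlim
  refine ⟨this.1, this.2.trans ?_⟩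
  simp only [ne_eq, OfNat.ofNat_ne_zero, not_false_eq_true, zero_pow, add_zero, log_one]
  ring

lemma damp_sq (hN : 0 ≤ N) (x : R4) : damp k N w(x)^2*(N + w(x))⁻¹
    = (1 + N)^(2*k)*(1 + N + ‖x‖^2)^(-1 - 2*k) := by
  have hM : 0 < 1 + N + ‖x‖^2 := pos!
  rw [damp, show N + w(x) = 1 + N + ‖x‖^2 by ring, ← rpow_natCast,
    ← rpow_mul pos!, div_rpow pos! hM.le, rpow_sub hM,
    rpow_neg_one, mul_comm k]
  push_cast; ring

lemma ae_ne_zero_R4 : ∀ᵐ x : R4, x ≠ 0 := by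
  have : Nontrivial R4 := inferInstance
  simp [ae_iff]

lemma integral_newtL_sq_le (hk : 0 < k) (hN : 0 ≤ N) : Integrable (fun x => newtL k N x^2) ∧
    ∫ x, newtL k N x^2 ≤ π^2*(log (1 + N) + 1/(2*k)) := by
  have hM : 0 < 1 + N := pos!
  obtain ⟨i1, e1⟩ := integral_log_weight (M := 1 + N) lin!
  obtain ⟨i2, e2⟩ := integral_weight hM (show 0 < 2*k by positivity)
  have i3 := i2.const_mul ((1 + N)^(2*k))
  have hle : ∀ᵐ x : R4, newtL k N x^2 ≤ (‖x‖^2)⁻¹*(w(x)⁻¹ - (1 + N + ‖x‖^2)⁻¹)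
      + (1 + N)^(2*k)*((‖x‖^2)⁻¹*(1 + N + ‖x‖^2)^(-1 - 2*k)) := by
    filter_upwards [ae_ne_zero_R4] with x hx
    rw [mul_left_comm, ← damp_sq hN, ← mul_add, newtL]
    have hp0 := (damp_pos (k := k) hN (one_le_one_add_sq x)).le
    have hp1 : damp k N w(x)^2 ≤ 1 := pow_le_one₀ hp0 (damp_le_one hk.le hN (one_le_one_add_sq x))
    rw [show N + w(x) = 1 + N + ‖x‖^2 by ring]
    have h1 : (1 + N + ‖x‖^2)⁻¹ ≤ w(x)⁻¹ := inv_anti₀ pos! lin!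
    have h2 : w(x)⁻¹ ≤ (‖x‖^2)⁻¹ := inv_anti₀ pos! lin!
    set q := damp k N w(x)^2
    calc (w(x)⁻¹*damp k N w(x))^2 = w(x)⁻¹*(w(x)⁻¹*q) := by ring
      _ ≤ (‖x‖^2)⁻¹*(w(x)⁻¹*q) := by gcongr
      _ ≤ _ := by
        refine mul_le_mul_of_nonneg_left ?_ pos!
        nlinarith [mul_nonneg (sub_nonneg.2 h1) (sub_nonneg.2 hp1)]
  have hi : Integrable (fun x => newtL k N x^2) := (i1.fun_add i3).mono'
    ((contDiff_newtL hN).continuous.pow 2).aestronglyMeasurable (hle.mono fun x hx => by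
      rwa [norm_of_nonneg (sq_nonneg _)])
  refine ⟨hi, (integral_mono_ae hi (i1.fun_add i3) hle).trans (le_of_eq ?_)⟩
  rw [integral_add i1 i3, integral_const_mul, e1, e2, rpow_neg hM.le]
  have : (1 + N)^(2*k) ≠ 0 := pos!
  field_simp

lemma integral_newtLDeriv_sq_le (hk : 0 < k) (hN : 0 ≤ N) : Integrable (fun x => newtLDeriv k N x^2) ∧
    ∫ x, newtLDeriv k N x^2 ≤ π^2*k/2*((1 + N)^2)⁻¹ := by
  have hM : 0 < 1 + N := pos!
  obtain ⟨i2, e2⟩ := integral_weight hM (show 0 < 2*k by positivity)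
  have i3 := (i2.const_mul ((1 + N)^(2*k))).const_mul (k^2*((1 + N)^2)⁻¹)
  have hle : ∀ᵐ x : R4, newtLDeriv k N x^2 ≤ k^2*((1 + N)^2)⁻¹*((1 + N)^(2*k)
      * ((‖x‖^2)⁻¹*(1 + N + ‖x‖^2)^(-1 - 2*k))) := by
    filter_upwards [ae_ne_zero_R4] with x hx
    have h1 := pow_le_pow_left₀ (newtLDeriv_nonneg hk.le hN x) (newtLDeriv_le hk.le hN x) 2
    refine h1.trans ?_
    have h2 : (N + w(x))⁻¹ ≤ (‖x‖^2)⁻¹ := inv_anti₀ pos! lin!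
    rw [mul_left_comm ((1 + N)^(2*k)), ← damp_sq hN]
    calc _ = k^2*((1 + N)^2)⁻¹*((N + w(x))⁻¹
          * (damp k N w(x)^2*(N + w(x))⁻¹)) := by rw [← inv_pow]; ring
      _ ≤ _ := by gcongr
  have hi : Integrable (fun x => newtLDeriv k N x^2) := i3.mono'
    ((continuous_newtLDeriv hN).pow 2).aestronglyMeasurable (hle.mono fun x hx => by
      rwa [norm_of_nonneg (sq_nonneg _)])
  refine ⟨hi, (integral_mono_ae hi i3 hle).trans (le_of_eq ?_)⟩
  rw [integral_const_mul, integral_const_mul, e2, rpow_neg hM.le]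
  have : (1 + N)^(2*k) ≠ 0 := pos!
  field_simp

lemma integral_newtLPd_sub_sq_le (hk : 0 ≤ k) (hN : 0 ≤ N) (j : Fin 4) :
    Integrable (fun x => (newtLPd k N j x - newtPd j x)^2) ∧
    ∫ x, (newtLPd k N j x - newtPd j x)^2 ≤ 200*π^2*k^2*(1 + N)⁻¹ := by
  have hM : 0 < 1 + N := pos!
  obtain ⟨i2, e2⟩ := integral_weight hM (show (0 : ℝ) < 1/2 by norm_num)
  have i3 := i2.const_mul (100*k^2*(1 + N)^(-(1/2) : ℝ))
  have hsq : ∀ {y q : ℝ}, 0 < y → (y^q)^2 = y^(2*q) := fun {y q} hy => by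
    rw [← rpow_natCast, ← rpow_mul hy.le, mul_comm]; norm_num
  have hle : ∀ᵐ x : R4, (newtLPd k N j x - newtPd j x)^2 ≤ 100*k^2*(1 + N)^(-(1/2) : ℝ)
      * ((‖x‖^2)⁻¹*(1 + N + ‖x‖^2)^(-1 - 1/2 : ℝ)) := by
    filter_upwards [ae_ne_zero_R4] with x hx
    have h1 := pow_le_pow_left₀ (abs_nonneg _) (abs_newtLPd_sub_le hk hN j x) 2
    rw [sq_abs] at h1
    refine h1.trans ?_
    have h2 : w(x)⁻¹ ≤ (‖x‖^2)⁻¹ := inv_anti₀ pos! lin!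
    simp only [mul_pow]
    rw [hsq hM, hsq pos!, hsq pos!,
      show (2 * -(1/4) : ℝ) = -(1/2) by norm_num, show (2 * -(1/2) : ℝ) = -1 by norm_num,
      show (2 * -(3/4) : ℝ) = -1 - 1/2 by norm_num, rpow_neg_one,
      show N + w(x) = 1 + N + ‖x‖^2 by ring]
    calc _ = 100*k^2*(1 + N)^(-(1/2) : ℝ)
          * (w(x)⁻¹*(1 + N + ‖x‖^2)^(-1 - 1/2 : ℝ)) := by ring
      _ ≤ _ := by gcongr
  have hi : Integrable (fun x => (newtLPd k N j x - newtPd j x)^2) := i3.mono'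
    (((continuous_newtLPd hN j).sub (continuous_newtPd j)).pow 2).aestronglyMeasurable
    (hle.mono fun x hx => by rwa [norm_of_nonneg (sq_nonneg _)])
  refine ⟨hi, (integral_mono_ae hi i3 hle).trans (le_of_eq ?_)⟩
  have h3 : (1 + N)^(-(1/2) : ℝ)*(1 + N)^(-(1/2) : ℝ) = (1 + N)⁻¹ := by
    rw [← rpow_add hM, ← rpow_neg_one]; norm_num
  rw [integral_const_mul, e2, ← h3]
  ring

lemma HasWeakPartial.add_const_mul {n : ℕ} {i : Fin n} {f f' g g' : EuclideanSpace ℝ (Fin n) → ℝ}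
    (h : HasWeakPartial i f g) (h' : HasWeakPartial i f' g') (c : ℝ) :
    HasWeakPartial i (fun x => f x + c*f' x) (fun x => g x + c*g' x) := by
  refine ⟨h.1.add (h'.1.smul c), h.2.1.add (h'.2.1.smul c), fun z hz hc => ?_⟩
  have hd : Continuous fun x => fderiv ℝ z x (single i 1) :=
    (hz.continuous_fderiv (by simp)).clm_apply continuous_const
  have hdc : HasCompactSupport fun x => fderiv ℝ z x (single i 1) := hc.fderiv_apply (𝕜 := ℝ) _
  have i1 := h.1.integrable_smul_left_of_hasCompactSupport hd hdc
  have i2 := h'.1.integrable_smul_left_of_hasCompactSupport hd hdc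
  have i3 := h.2.1.integrable_smul_left_of_hasCompactSupport hz.continuous hc
  have i4 := h'.2.1.integrable_smul_left_of_hasCompactSupport hz.continuous hc
  have e1 := h.2.2 z hz hc
  have e2 := h'.2.2 z hz hc
  simp only [smul_eq_mul, mul_add, mul_left_comm _ c] at *
  rw [integral_add i1 (i2.const_mul c), integral_add i3 (i4.const_mul c), integral_const_mul,
    integral_const_mul, e1, e2]
  ring

lemma HasWeakPartial.comp_add {i : Fin 4} {g : R4 → ℝ} (h : HasWeakPartial i f g) (y : R4) :
    HasWeakPartial i (fun x => f (x + y)) (fun x => g (x + y)) := by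
  have hl : ∀ {u : R4 → ℝ}, LocallyIntegrable u → LocallyIntegrable fun x => u (x + y) := fun hu =>
    (locallyIntegrable_map_homeomorph (Homeomorph.addRight y)).1 (by
      rwa [show (volume : Measure R4).map (Homeomorph.addRight y) = volume from
        (measurePreserving_add_right volume y).map_eq])
  refine ⟨hl h.1, hl h.2.1, fun z hz hc => ?_⟩
  have := h.2.2 (fun x => z (x - y)) (hz.comp (contDiff_id.sub contDiff_const))
    (hc.comp_homeomorph (Homeomorph.subRight y))
  simp only [fderiv_comp_sub] at this
  rw [← integral_add_right_eq_self (fun x => fderiv ℝ z (x - y) _ • f x) y,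
    ← integral_add_right_eq_self (fun x => z (x - y) • g x) y] at this
  simpa only [add_sub_cancel_right] using this

lemma memLp_of_le_weight (hf : Continuous f) {C a p : ℝ} (hp : 0 < p) (ha : 0 ≤ a)
    (h : 4 < a*p) (hC : ∀ x, |f x| ≤ C*w(x)^(-(a/2))) :
    MemLp f (ofReal p) := by
  have hC0 : 0 ≤ C := by have := (abs_nonneg _).trans (hC 0); simpa using this
  refine ((memLp_weight hp h).const_mul (C*2^(a/2))).mono' hf.aestronglyMeasurable
    (.of_forall fun x => (hC x).trans ?_)
  have := one_add_norm_sq_rpow_le x (show 0 ≤ a/2 by positivity)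
  rw [mul_div_cancel₀ a two_ne_zero] at this
  rw [mul_assoc]; gcongr

namespace Dec

variable {r a b A B : ℝ} {f g : R4 → ℝ}

lemma exists_of_far (hf : AEStronglyMeasurable f volume) (hi : IntegrableOn f (closedBall 0 r))
    (hfar : ∀ᵐ x, r < ‖x‖ → |f x| ≤ B*‖x‖^(-a)) : ∃ A, 0 ≤ A ∧ Dec r a A f := by
  refine ⟨max (max B 0) (∫ x in closedBall 0 r, |f x|), pos!, pos!, hf, hi,
    le_max_right _ _, hfar.mono fun x hx hxr => (hx hxr).trans ?_⟩
  gcongr; exact (le_max_left _ _).trans (le_max_left _ _)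

lemma mono (hf : Dec r a A f) (hAB : A ≤ B) : Dec r a B f :=
  ⟨hf.nonneg.trans hAB, hf.meas, hf.intOn, hf.near.trans hAB, hf.far.mono fun x hx hxr =>
    (hx hxr).trans (by gcongr)⟩

lemma weaken (hr : 1 ≤ r) (hf : Dec r a A f) (hab : b ≤ a) : Dec r b A f :=
  ⟨hf.nonneg, hf.meas, hf.intOn, hf.near, hf.far.mono fun x hx hxr => (hx hxr).trans (mul_le_mul_of_nonneg_left
      (rpow_le_rpow_of_exponent_le (hr.trans hxr.le) lin!) hf.nonneg)⟩

lemma of_abs_le (hf : Dec r a A f) (hg : AEStronglyMeasurable g volume) (hB : 0 ≤ B)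
    (h : ∀ x, |g x| ≤ B*|f x|) : Dec r a (B*A) g := by
  have hi : IntegrableOn g (closedBall 0 r) :=
    (hf.intOn.abs.const_mul B).mono' hg.restrict (.of_forall h)
  refine ⟨mul_nonneg hB hf.nonneg, hg, hi, ?_, hf.far.mono fun x hx hxr => ?_⟩
  · refine (integral_mono hi.abs (hf.intOn.abs.const_mul B) h).trans ?_
    rw [integral_const_mul]; exact mul_le_mul_of_nonneg_left hf.near hB
  · rw [mul_assoc]; exact (h x).trans (mul_le_mul_of_nonneg_left (hx hxr) hB)

lemma add (hf : Dec r a A f) (hg : Dec r a B g) : Dec r a (A + B) (fun x => f x + g x) := by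
  refine ⟨add_nonneg hf.nonneg hg.nonneg, hf.meas.add hg.meas, hf.intOn.add hg.intOn, ?_, ?_⟩
  · refine (integral_mono (hf.intOn.add hg.intOn).abs (hf.intOn.abs.fun_add hg.intOn.abs)
      fun x => abs_add_le _ _).trans ?_
    rw [integral_add hf.intOn.abs hg.intOn.abs]; exact add_le_add hf.near hg.near
  · filter_upwards [hf.far, hg.far] with x h1 h2 hxr
    rw [add_mul]; exact (abs_add_le _ _).trans (add_le_add (h1 hxr) (h2 hxr))

/-- The constant in `Dec.of_le`. -/
def vol (r : ℝ) : ℝ := 1 + (volume : Measure R4).real (closedBall 0 r)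

lemma of_le (hr : 1 ≤ r) (ha : 0 ≤ a) (hf : Continuous f) (hB : 0 ≤ B)
    (h : ∀ x, |f x| ≤ B*w(x)^(-(a/2))) : Dec r a (vol r*B) f := by
  have hv : 0 ≤ (volume : Measure R4).real (closedBall 0 r) := measureReal_nonneg
  have hi : IntegrableOn f (closedBall 0 r) := hf.continuousOn.integrableOn_compact (isCompact_closedBall _ _)
  refine ⟨by unfold vol; positivity, hf.aestronglyMeasurable, hi, ?_, .of_forall fun x hx => ?_⟩
  · refine (setIntegral_mono hi.abs (integrableOn_const (C := B) measure_closedBall_lt_top.ne)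
      fun x => (h x).trans ?_).trans ?_
    · exact mul_le_of_le_one_right hB (rpow_le_one_of_one_le_of_nonpos (one_le_one_add_sq x) lin!)
    · rw [setIntegral_const, smul_eq_mul]; unfold vol; nlinarith
  · have hx0 : 0 < ‖x‖ := lin!
    refine (h x).trans ?_
    have e : ‖x‖^(-a) = (‖x‖^2)^(-(a/2)) := by rw [← rpow_natCast, ← rpow_mul hx0.le]; congr 1; push_cast; ring
    have h1 : w(x)^(-(a/2)) ≤ ‖x‖^(-a) := by rw [e]; exact rpow_le_rpow_of_nonpos pos! lin! lin!
    calc _ ≤ B*‖x‖^(-a) := by gcongr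
      _ ≤ vol r*B*‖x‖^(-a) := by
        rw [vol]; gcongr; nlinarith

end Dec

/-- A normalized zero-energy resonance `z = w + 1/(1 + |x|²)` with weak gradient `g`. -/
structure Res (V z : R4 → ℝ) (g : Fin 4 → R4 → ℝ) (r d A : ℝ) : Prop where
  memV : MemLp V 2
  one_le : 1 ≤ r
  pos : 0 < d
  le_half : d ≤ 1/2
  bound : ∀ᵐ x, r < ‖x‖ → |V x| ≤ 1*‖x‖^(-(2 + 2*d))
  memz : MemLp z 4
  memg : ∀ j, MemLp (g j) 2
  weak : ∀ f, Test f → ∑ j, (∫ x, g j x*pd j f x) + ∫ x, V x*(z x*f x) = 0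
  self : ∑ j, (∫ x, g j x^2) + ∫ x, V x*z x^2 = 0
  grad : ∀ f, Test f → ∀ j, ∫ x, z x*pd j f x = -∫ x, g j x*f x
  asym : ∀ᵐ x, r < ‖x‖ → |z x - newt x| ≤ A*‖x‖^(-(2 + d)) ∧ ∀ k, |g k x - newtPd k x| ≤ A*‖x‖^(-(3 + d))
  int : Integrable fun x => V x*z x
  charge : ∫ x, V x*z x = -(4*π^2)

lemma exists_res (hV : IsShortRange V) (hres : HasVirtualLevel V) :
    ∃ z g r d A, Res V z g r d A := by
  obtain ⟨R, d, hs⟩ := hV.exists_shortRange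
  obtain ⟨v, z, g, h⟩ := exists_resonanceSeq hV.1 hres
  set c := 1/(4*π^2)*(∫ y, -(V y*z y)) with hc
  have hc0 : c ≠ 0 := mul_ne_zero pos! (h.density_ne_zero hs)
  obtain ⟨A, R1, hA, hR1, has⟩ := h.asymptotics hs hc
  have hs1 := hs.one_le
  have hint := h.integrable_density hs
  have hself : ∑ j, (∫ x, g j x^2) + ∫ x, V x*z x^2 = 0 := by
    have h1 : Tendsto (fun n => dir (v n)) atTop (𝓝 (∑ j, ∫ x, g j x^2)) := by
      refine tendsto_finsetSum _ fun j _ => ?_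
      have hm := fun n => (h.test n).memLp_pd j 2
      have h2 : Tendsto (fun n => nrm 2 (pd j (v n))) atTop (𝓝 (nrm 2 (g j))) := by
        rw [tendsto_iff_norm_sub_tendsto_zero]
        refine squeeze_zero (fun _ => norm_nonneg _) (fun n => ?_) (h.lim_pd j)
        have a1 := nrm_add_le one_le_two ((hm n).sub (h.memg j)) (h.memg j)
        have a2 := nrm_add_le one_le_two ((h.memg j).sub (hm n)) (hm n)
        rw [sub_add_cancel] at a1 a2
        rw [nrm_sub_comm 2 (g j)] at a2
        rw [norm_eq_abs, abs_le]; constructor <;> linarith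
      simpa only [nrm_two_sq_real (hm _), nrm_two_sq_real (h.memg j)] using h2.pow 2
    simp only [h.dir_eq] at h1
    rw [h.integral_potential, ← tendsto_nhds_unique tendsto_const_nhds h1]
    norm_num
  refine ⟨fun x => c⁻¹*z x, fun j x => c⁻¹*g j x, max R R1, d, |c⁻¹| *A + 4, hV.1,
    hs1.trans (le_max_left _ _), hs.pos, hs.le_half, ?_, h.memz.const_mul _,
    fun j => (h.memg j).const_mul _, fun f hf => ?_, ?_, fun f hf j => ?_, ?_, ?_, ?_⟩
  · filter_upwards [hs.bound] with x hx hxr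
    rw [one_mul, show -(2 + 2*d) = -2 - 2*d by ring]; exact hx ((le_max_left _ _).trans_lt hxr)
  · have e : ∀ x, V x*(c⁻¹*z x*f x) = c⁻¹*(V x*(z x*f x)) := fun x => by ring
    simp only [e]
    simp only [mul_assoc, integral_const_mul, ← mul_sum, ← mul_add, h.weak_eq hf, mul_zero]
  · have e : ∀ x, V x*(c⁻¹*z x)^2 = c⁻¹^2*(V x*z x^2) := fun x => by ring
    simp only [e]
    simp only [mul_pow, integral_const_mul, ← mul_sum, ← mul_add, hself, mul_zero]
  · simp only [mul_assoc, integral_const_mul, h.integral_mul_pd hf j, mul_neg]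
  · filter_upwards [has] with x hx hxr
    have hx1 : 1 < ‖x‖ := by linarith [(le_max_right R R1).trans_lt hxr]
    obtain ⟨h1, h2⟩ := hx ((le_max_right _ _).trans_lt hxr)
    have hd := hs.le_half
    have hp : ∀ {n : ℕ} {q : ℝ}, q ≤ n → (‖x‖^n)⁻¹ ≤ ‖x‖^(-q) := fun {n q} hq => by
      rw [← norm_rpow_neg_natCast]; exact rpow_le_rpow_of_exponent_le hx1.le lin!
    constructor
    · have e : c⁻¹*z x - newt x = c⁻¹*(z x - c*(‖x‖^2)⁻¹)
          + (‖x‖^2)⁻¹*w(x)⁻¹ := by rw [newt]; field_simp; ring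
      have b1 : (‖x‖^2)⁻¹*w(x)⁻¹ ≤ ‖x‖^(-(2 + d)) := by
        refine le_trans ?_ (hp (n := 4) (by norm_num; linarith))
        rw [← mul_inv]; exact inv_anti₀ pos! (by nlinarith)
      rw [e]
      refine (abs_add_le _ _).trans ?_
      rw [abs_mul, abs_of_pos (show 0 < (‖x‖^2)⁻¹*w(x)⁻¹ by positivity)]
      have : 0 ≤ ‖x‖^(-(2 + d)) := pos!
      nlinarith [mul_le_mul_of_nonneg_left h1 (abs_nonneg c⁻¹)]
    · intro k
      have e : c⁻¹*g k x - newtPd k x = c⁻¹*(g k x + 2*c*(x k*(‖x‖^4)⁻¹))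
          - 2*x k*((1 + 2*‖x‖^2)*((‖x‖^4)⁻¹*(w(x)^2)⁻¹)) := by
        rw [newtPd]; field_simp; ring
      have hk : |x k| ≤ ‖x‖ := by simpa using abs_coord_le x 0 k
      have b1 : |2*x k*((1 + 2*‖x‖^2)*((‖x‖^4)⁻¹*(w(x)^2)⁻¹))|
          ≤ 4*‖x‖^(-(3 + d)) := by
        rw [abs_mul, abs_mul, abs_two, abs_of_pos (show 0 < (1 + 2*‖x‖^2)
          * ((‖x‖^4)⁻¹*(w(x)^2)⁻¹) by positivity)]
        have b2 : (1 + 2*‖x‖^2)*(w(x)^2)⁻¹ ≤ 2*(‖x‖^2)⁻¹ := by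
          rw [← div_eq_mul_inv, ← div_eq_mul_inv, div_le_div_iff₀ pos! pos!]
          nlinarith [sq_nonneg ‖x‖]
        calc _ = 2*|x k| *((‖x‖^4)⁻¹*((1 + 2*‖x‖^2)*(w(x)^2)⁻¹)) := by ring
          _ ≤ 2*‖x‖*((‖x‖^4)⁻¹*(2*(‖x‖^2)⁻¹)) := by gcongr
          _ = 4*(‖x‖^5)⁻¹ := by field_simp; norm_num
          _ ≤ _ := by gcongr; exact hp (by norm_num; linarith)
      rw [e]
      refine (abs_sub _ _).trans ?_
      rw [abs_mul]
      have : 0 ≤ ‖x‖^(-(3 + d)) := pos!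
      nlinarith [mul_le_mul_of_nonneg_left (h2 k) (abs_nonneg c⁻¹)]
  · simpa only [mul_left_comm] using hint.const_mul c⁻¹
  · simp only [mul_left_comm _ c⁻¹, integral_const_mul]
    have : ∫ x, V x*z x = -(4*π^2*c) := by rw [hc, integral_neg]; field_simp
    rw [this]; field_simp

/-- The trial function attached to one potential well. -/
def trial (z : R4 → ℝ) (k N : ℝ) (x : R4) : ℝ := z x - newt x + newtL k N x

def trialPd (g : Fin 4 → R4 → ℝ) (k N : ℝ) (j : Fin 4) (x : R4) : ℝ := g j x - newtPd j x + newtLPd k N j x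

/-- Uniform decay constants for all functions built from a resonance. -/
structure DecConsts (V z : R4 → ℝ) (g : Fin 4 → R4 → ℝ) (r d C : ℝ) : Prop where
  nonneg : 0 ≤ C
  pot : Dec r (2 + 2*d) C V
  dens : Dec r (4 - d/2) C fun x => V x*z x
  densWt : Dec r (3 + d) C fun x => V x*z x*b(x)
  rem : Dec r (2 + d) C fun x => z x - newt x
  remPd : ∀ j, Dec r (3 + d) C fun x => g j x - newtPd j x
  newt : Dec r 2 C newt
  sqrtNewt : Dec r 1 C fun x => w(x)^(-(1/2) : ℝ)
  newtPd : ∀ j, Dec r 3 C (newtPd j)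
  trial : ∀ {k N : ℝ}, 0 ≤ k → 0 ≤ N → Dec r 2 C (trial z k N)
  trialSq : ∀ {k N : ℝ}, 0 ≤ k → 0 ≤ N → Dec r (4 - d) C fun x => _root_.trial z k N x^2
  trialPd : ∀ {k N : ℝ}, 0 ≤ k → k ≤ 1 → 0 ≤ N → ∀ j, Dec r 3 C (trialPd g k N j)
  corrPd : ∀ {k N : ℝ}, 0 ≤ k → 0 ≤ N → ∀ j,
    Dec r (5/2) (C*(k*(1 + N)^(-(1/4) : ℝ))) fun x => newtLPd k N j x - _root_.newtPd j x
  potCorr : ∀ {k N : ℝ}, 0 ≤ k → 0 ≤ N →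
    Dec r (2 + 2*d) (C*(k*(1 + N)⁻¹)) fun x => V x*(newtL k N x - _root_.newt x)
  deriv : ∀ {k N : ℝ}, 0 ≤ k → 0 ≤ N → Dec r 2 (C*(k*(1 + N)⁻¹)) (newtLDeriv k N)

lemma memLp_newt_four : MemLp newt 4 := by
  have := memLp_of_le_weight contDiff_newt.continuous (C := 1) (a := 2) (p := 4) num!
    num! num! fun x => by rw [one_mul, ← newt_eq, abs_of_pos (by unfold newt; positivity)]
  simpa using this

lemma memLp_two_of_le_weight (hf : Continuous f) {C : ℝ}
    (hC : ∀ x, |f x| ≤ C*w(x)^(-(3/2) : ℝ)) : MemLp f 2 := by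
  simpa using memLp_of_le_weight hf (a := 3) (p := 2) num! num! num! hC

lemma memLp_newtL (hk : 0 < k) (hN : 0 ≤ N) : MemLp (newtL k N) 2 :=
  (memLp_two_iff_integrable_sq (contDiff_newtL hN).continuous.aestronglyMeasurable).2
    (integral_newtL_sq_le hk hN).1

lemma MeasureTheory.MemLp.integrableOn_ball {p : ℝ≥0∞} (hp : 1 ≤ p) (hf : MemLp f p) (r : ℝ) :
    IntegrableOn f (closedBall 0 r) := by
  have : IsFiniteMeasure (volume.restrict (closedBall (0 : R4) r)) := ⟨by! measure_closedBall_lt_top⟩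
  exact (hf.restrict _).integrable hp

namespace Res

variable (h : Res V z g r d A)
include h

lemma memLp_rem_four : MemLp (fun x => z x - newt x) 4 := h.memz.sub memLp_newt_four

lemma memLp_rem : MemLp (fun x => z x - newt x) 2 := by
  have hm := h.memLp_rem_four.1
  rw [memLp_two_iff_integrable_sq hm, ← integrableOn_univ,
    ← Set.union_compl_self (closedBall (0 : R4) r), integrableOn_union]
  have hr : 0 < r := by linarith [h.one_le]
  refine ⟨(memLp_sq_four h.memLp_rem_four).integrableOn_ball one_le_two r, ?_⟩
  have hd := h.pos
  refine ((integral_tail_norm_rpow (q := 4 + 2*d) lin! hr).1.const_mul (A^2)).mono' (hm.pow 2).restrict ?_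
  filter_upwards [ae_restrict_of_ae h.asym, ae_restrict_mem isClosed_closedBall.measurableSet.compl]
    with x hx hxr
  have hxr : r < ‖x‖ := by! hxr
  have h1 := pow_le_pow_left₀ (abs_nonneg _) (hx hxr).1 2
  rw [norm_of_nonneg (sq_nonneg _), ← sq_abs]
  refine h1.trans (le_of_eq ?_)
  rw [mul_pow, ← rpow_natCast (‖x‖^_), ← rpow_mul (norm_nonneg _)]
  congr 2; push_cast; ring

lemma hasWeakPartial (j : Fin 4) : HasWeakPartial j z (g j) :=
  ⟨h.memz.locallyIntegrable num!, (h.memg j).locallyIntegrable one_le_two, fun f hf hc => by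
    simpa only [smul_eq_mul, mul_comm, pd] using h.grad f ⟨hf.of_le (by simp), hc⟩ j⟩

lemma hasWeakPartial_trial (hN : 0 ≤ N) (j : Fin 4) :
    HasWeakPartial j (trial z k N) (trialPd g k N j) := by
  have h1 : HasWeakPartial j newt (newtPd j) := by
    rw [← pd_newt]; exact HasWeakPartial.of_contDiff (contDiff_newt.of_le (by simp))
  have h2 : HasWeakPartial j (newtL k N) (newtLPd k N j) := by
    rw [← pd_newtL hN]; exact HasWeakPartial.of_contDiff ((contDiff_newtL hN).of_le (by simp))
  have := ((h.hasWeakPartial j).add_const_mul h1 (-1)).add_const_mul h2 1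
  simp only [neg_mul, one_mul, ← sub_eq_add_neg] at this
  exact this

lemma memLp_trial (hk : 0 < k) (hN : 0 ≤ N) : MemLp (trial z k N) 2 := h.memLp_rem.add (memLp_newtL hk hN)

lemma memLp_trialPd (hk : 0 ≤ k) (hk1 : k ≤ 1) (hN : 0 ≤ N) (j : Fin 4) : MemLp (trialPd g k N j) 2 :=
  ((h.memg j).sub (memLp_two_of_le_weight (continuous_newtPd j) (abs_newtPd_le j))).add
    (memLp_two_of_le_weight (continuous_newtLPd hN j) (abs_newtLPd_le hk hk1 hN j))

omit h in
lemma memLp_corr (hk : 0 ≤ k) (hN : 0 ≤ N) : MemLp (fun x => newtL k N x - newt x) 4 :=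
  memLp_newt_four.of_le ((contDiff_newtL hN).continuous.sub contDiff_newt.continuous).aestronglyMeasurable
    (.of_forall fun x => (abs_newtL_sub_le hk hN x).trans (le_abs_self _))

lemma memLp_trial_four (hk : 0 ≤ k) (hN : 0 ≤ N) : MemLp (trial z k N) 4 := by
  have e : trial z k N = fun x => z x + (newtL k N x - newt x) := by funext x; rw [trial]; ring
  rw [e]; exact h.memz.add (memLp_corr hk hN)

/-- The zero-energy equation tested with functions in `H¹`. -/
lemma weak_H1 {F : Fin 4 → R4 → ℝ} (hf : MemLp f 2)
    (hF : ∀ j, MemLp (F j) 2) (hw : ∀ j, HasWeakPartial j f (F j)) (hf4 : MemLp f 4) :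
    ∑ j, (∫ x, g j x*F j x) + ∫ x, V x*(z x*f x) = 0 := by
  obtain ⟨u, hu, -, hu2⟩ := exists_contDiff_approx hf hF hw
  have hut : ∀ n, Test (u n) := fun n => ⟨(hu n).1.of_le (by simp), (hu n).2⟩
  have h1 : ∀ j, Tendsto (fun n => nrm 2 (pd j (u n) - F j)) atTop (𝓝 0) := fun j => by
    simpa [nrm, comp_def] using (tendsto_toReal zero_ne_top).comp (hu2 j)
  have h2 : Tendsto (fun n => nrm 4 (u n - f)) atTop (𝓝 0) := by
    have h3 : Tendsto (fun n => (sobC ℝ : ℝ≥0∞)*∑ j, eLpNorm (pd j (u n) - F j) 2) atTop (𝓝 0) := by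
      have := ENNReal.Tendsto.const_mul (tendsto_finsetSum univ fun j _ => hu2 j)
        (a := (sobC ℝ : ℝ≥0∞)) (Or.inr coe_ne_top)
      simpa using this
    have h4 := tendsto_of_tendsto_of_tendsto_of_le_of_le tendsto_const_nhds h3 (fun n => zero_le) fun n =>
      sobolev_H1 (u := u n - f) (g := fun j => pd j (u n) - F j) (((hut n).memLp 2).sub hf)
        (fun j => ((hut n).memLp_pd j 2).sub (hF j)) fun j => by
          have := (HasWeakPartial.of_contDiff (i := j) (hut n).contDiff).add_const_mul (hw j) (-1)
          simp only [neg_mul, one_mul, ← sub_eq_add_neg] at this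
          exact this
    simpa [nrm, comp_def] using (tendsto_toReal zero_ne_top).comp h4
  have h5 := (tendsto_finsetSum univ fun j _ => tendsto_integral_mul
    (fun n => (hut n).memLp_pd j 2) (hF j) (h.memg j) (h1 j)).add
    (tendsto_integral_mul_mul h.memV (fun n => (hut n).memLp 4) hf4 h.memz h2)
  have h6 := fun n => h.weak (u n) (hut n)
  simp only [mul_comm (g _ _), mul_comm (z _)] at h6 ⊢
  simp only [h6] at h5
  exact tendsto_nhds_unique h5 tendsto_const_nhds

lemma exists_decConsts : ∃ C, DecConsts V z g r d C := by
  have hr := h.one_le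
  have hd := h.pos
  have hd2 := h.le_half
  have hz : ∀ᵐ x, r < ‖x‖ → |z x| ≤ (|A| + 1)*‖x‖^(-2 : ℝ) := by
    filter_upwards [h.asym] with x hx hxr
    have hx1 : 1 < ‖x‖ := hr.trans_lt hxr
    have h1 := (hx hxr).1
    have h2 : newt x ≤ ‖x‖^(-2 : ℝ) := by
      rw [rpow_neg (norm_nonneg _), rpow_two, newt]; exact inv_anti₀ pos! lin!
    have h3 : A*‖x‖^(-(2 + d)) ≤ |A| *‖x‖^(-2 : ℝ) :=
      mul_le_mul (le_abs_self A) (rpow_le_rpow_of_exponent_le hx1.le lin!) pos! (abs_nonneg _)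
    have h4 : 0 < newt x := by unfold newt; positivity
    rw [abs_le] at h1 ⊢; constructor <;> nlinarith [h1.1, h1.2]
  have hVz : ∀ᵐ x, r < ‖x‖ → |V x*z x| ≤ (|A| + 1)*‖x‖^(-(4 + 2*d)) := by
    filter_upwards [h.bound, hz] with x h1 h2 hxr
    have hx0 : 0 < ‖x‖ := lin!
    rw [abs_mul]
    calc _ ≤ (1*‖x‖^(-(2 + 2*d)))*((|A| + 1)*‖x‖^(-2 : ℝ)) := by gcongr; exacts [h1 hxr, h2 hxr]
      _ = (|A| + 1)*(‖x‖^(-(2 + 2*d))*‖x‖^(-2 : ℝ)) := by ring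
      _ = _ := by rw [← rpow_add hx0]; ring_nf
  obtain ⟨C1, n1, d1⟩ := Dec.exists_of_far h.memV.1 (h.memV.integrableOn_ball one_le_two r) h.bound
  obtain ⟨C2, n2, d2⟩ := Dec.exists_of_far h.int.1 h.int.integrableOn hVz
  obtain ⟨C3, n3, d3⟩ : ∃ C, 0 ≤ C ∧ Dec r (3 + d) C fun x => V x*z x*b(x) := by
    refine Dec.exists_of_far (B := (|A| + 1)*2) (h.int.1.mul (by fun_prop)) ?_ ?_
    · exact h.int.integrableOn.mul_continuousOn (by fun_prop) (isCompact_closedBall _ _)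
    · filter_upwards [hVz] with x h1 hxr
      have hx1 : 1 < ‖x‖ := lin!
      have hx0 : 0 < ‖x‖ := lin!
      rw [abs_mul, abs_of_pos (show 0 < 1 + ‖x‖ by positivity)]
      calc _ ≤ (|A| + 1)*‖x‖^(-(4 + 2*d))*(2*‖x‖^(1 : ℝ)) := by
            rw [rpow_one]; gcongr; exacts [h1 hxr, by linarith]
        _ = (|A| + 1)*2*(‖x‖^(-(4 + 2*d))*‖x‖^(1 : ℝ)) := by ring
        _ ≤ _ := by
            rw [← rpow_add hx0]; gcongr
            · exact hx1.le
            · linarith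
  obtain ⟨C4, n4, d4⟩ := Dec.exists_of_far (a := 2 + d) h.memLp_rem.1
    (h.memLp_rem.integrableOn_ball one_le_two r) (h.asym.mono fun x hx hxr => (hx hxr).1)
  have hG : ∀ j, MemLp (fun x => g j x - newtPd j x) 2 := fun j =>
    (h.memg j).sub (memLp_two_of_le_weight (continuous_newtPd j) (abs_newtPd_le j))
  have h5 : ∀ j, ∃ C, 0 ≤ C ∧ Dec r (3 + d) C fun x => g j x - newtPd j x := fun j =>
    Dec.exists_of_far (hG j).1 ((hG j).integrableOn_ball one_le_two r)
      (h.asym.mono fun x hx hxr => (hx hxr).2 j)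
  choose C5 n5 d5 using h5
  obtain ⟨C6, n6, d6⟩ : ∃ C, 0 ≤ C ∧ Dec r (4 - d) C fun x => (z x - newt x)^2 := by
    have hm := memLp_sq_four h.memLp_rem_four
    refine Dec.exists_of_far hm.1 (hm.integrableOn_ball one_le_two r) (B := A^2) ?_
    filter_upwards [h.asym] with x hx hxr
    have hx1 : 1 < ‖x‖ := lin!
    have h1 := pow_le_pow_left₀ (abs_nonneg _) (hx hxr).1 2
    rw [abs_of_nonneg (sq_nonneg _), ← sq_abs]
    refine h1.trans ?_
    rw [mul_pow, ← rpow_natCast (‖x‖^_), ← rpow_mul (norm_nonneg _)]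
    gcongr
    · exact hx1.le
    · push_cast; linarith
  set v := Dec.vol r
  have hv : 0 ≤ v := add_nonneg zero_le_one measureReal_nonneg
  have S5 : ∀ j, C5 j ≤ ∑ j, C5 j := fun j => single_le_sum (fun i _ => n5 i) (mem_univ j)
  have S0 : 0 ≤ ∑ j, C5 j := sum_nonneg fun i _ => n5 i
  have hnewt : ∀ x, |newt x| ≤ 1*w(x)^(-(2/2) : ℝ) := fun x => by
    rw [one_mul, ← newt_eq, abs_of_pos (by unfold newt; positivity)]
  have dn := Dec.of_le hr num! contDiff_newt.continuous zero_le_one hnewt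
  have dn2 : Dec r (4 - d) (v*1) fun x => newt x^2 :=
    (Dec.of_le hr (a := 4) num! (contDiff_newt.continuous.pow 2) zero_le_one fun x => by
      have e : newt x^2 = w(x)^(-(4/2) : ℝ) := by
        rw [newt, ← rpow_neg_one, ← rpow_natCast, ← rpow_mul pos!]; norm_num
      rw [one_mul, ← e]; exact (abs_of_nonneg (sq_nonneg (newt x))).le).weaken hr lin!
  have hkm : ∀ {k N : ℝ}, 0 ≤ N → AEStronglyMeasurable (newtL k N) volume := fun hN =>
    (contDiff_newtL hN).continuous.aestronglyMeasurable
  have dL : ∀ {k N : ℝ}, 0 ≤ k → 0 ≤ N → Dec r 2 (1*(v*1)) (newtL k N) := fun {k N} hk hN =>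
    dn.of_abs_le (hkm hN) zero_le_one fun x => by
      rw [abs_of_pos (newtL_pos hN x), one_mul]; exact (newtL_le hk hN x).trans (le_abs_self _)
  refine ⟨4*C1 + C2 + C3 + C4 + ∑ j, C5 j + 2*C6 + 10*v, pos!, d1.mono lin!,
    (d2.weaken hr lin!).mono lin!, d3.mono lin!, d4.mono lin!,
    fun j => (d5 j).mono (by linarith [S5 j]), dn.mono lin!, ?_, ?_, ?_, ?_, ?_, ?_, ?_, ?_⟩
  · refine (Dec.of_le hr zero_le_one (Continuous.rpow_const (by fun_prop) fun x =>
      Or.inl pos!) zero_le_one fun x => ?_).mono (B := _) lin!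
    rw [one_mul, abs_of_nonneg pos!]
  · exact fun j => (Dec.of_le hr num! (continuous_newtPd j) zero_le_two
      (abs_newtPd_le j)).mono lin!
  · exact fun hk hN => ((d4.weaken hr lin!).add (dL hk hN)).mono lin!
  · intro k N hk hN
    refine ((d6.add dn2).of_abs_le ((h.memLp_trial_four hk hN).1.pow 2) zero_le_two fun x => ?_).mono lin!
    have h1 := newtL_pos (k := k) hN x
    have h2 := pow_le_pow_left₀ h1.le (newtL_le hk hN x) 2
    simp only [Pi.pow_apply, trial]
    rw [abs_of_nonneg (sq_nonneg _), abs_of_nonneg pos!]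
    nlinarith [sq_nonneg (z x - newt x - newtL k N x)]
  · exact fun hk hk1 hN j => (((d5 j).weaken hr lin!).add (Dec.of_le hr num!
      (continuous_newtLPd hN j) zero_le_four (abs_newtLPd_le hk hk1 hN j))).mono (by linarith [S5 j])
  · intro k N hk hN j
    refine (Dec.of_le hr (B := 10*k*(1 + N)^(-(1/4) : ℝ)) num!
      ((continuous_newtLPd hN j).sub (continuous_newtPd j)) pos! fun x =>
        (abs_newtLPd_sub_le hk hN j x).trans ?_).mono ?_
    · have hs : 0 < w(x) := pos!
      have e : w(x)^(-(5/2/2) : ℝ)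
          = w(x)^(-(1/2) : ℝ)*w(x)^(-(3/4) : ℝ) := by
        rw [← rpow_add hs]; norm_num
      have : (N + w(x))^(-(3/4) : ℝ) ≤ w(x)^(-(3/4) : ℝ) := rpow_le_rpow_of_nonpos hs lin! num!
      rw [e, ← mul_assoc (10*k)]; gcongr
    · calc _ = 10*v*(k*(1 + N)^(-(1/4) : ℝ)) := by ring
        _ ≤ _ := by gcongr; linarith
  · intro k N hk hN
    refine (d1.of_abs_le (B := 4*k*(1 + N)⁻¹) (h.memV.1.mul ((hkm hN).sub
      contDiff_newt.continuous.aestronglyMeasurable)) pos! fun x => ?_).mono ?_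
    · rw [Pi.mul_apply, abs_mul, mul_comm]
      exact mul_le_mul_of_nonneg_right (abs_newtL_sub_le_inv hk hN x) (abs_nonneg _)
    · calc _ = 4*C1*(k*(1 + N)⁻¹) := by ring
        _ ≤ _ := by gcongr; linarith
  · intro k N hk hN
    refine (dn.of_abs_le (B := k*(1 + N)⁻¹) (continuous_newtLDeriv hN).aestronglyMeasurable
      pos! fun x => ?_).mono ?_
    · rw [abs_of_nonneg (newtLDeriv_nonneg hk hN x)]
      refine (newtLDeriv_le hk hN x).trans (mul_le_mul_of_nonneg_left ?_ pos!)
      refine le_trans (mul_le_mul (damp_le_one hk hN (one_le_one_add_sq x))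
        (inv_anti₀ pos! (lin! : w(x) ≤ N + w(x))) pos!
        zero_le_one) ?_
      rw [one_mul]; exact le_abs_self _
    · calc _ = v*(k*(1 + N)⁻¹) := by ring
        _ ≤ _ := by gcongr; linarith

end Res

lemma MeasureTheory.MemLp.comp_add {p : ℝ≥0∞} (hf : MemLp f p) (y : R4) : MemLp (fun x => f (x + y)) p :=
  hf.comp_measurePreserving (measurePreserving_add_right volume y)

lemma integrable_mul_two {g : R4 → ℝ} (hf : MemLp f 2) (hg : MemLp g 2) :
    Integrable fun x => f x*g x := hf.integrable_mul hg

lemma abs_newt_sub_le {y : R4} (hy : 1 ≤ ‖y‖) (x : R4) :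
    |newt (x + y) - (‖y‖^2)⁻¹| ≤ (‖y‖^2)⁻¹*(b(x)
      * (2*‖y‖*newt (x + y) + (1 + ‖x + y‖^2)^(-(1/2) : ℝ))) := by
  have hs : 0 < 1 + ‖x + y‖^2 := pos!
  have h1 : |‖x + y‖ - ‖y‖| ≤ ‖x‖ := by simpa using abs_norm_sub_norm_le (x + y) y
  have hU := norm_le_rpow_half (x + y)
  have e2 : (1 + ‖x + y‖^2)^(-(1/2) : ℝ) = (1 + ‖x + y‖^2)^(1/2 : ℝ)*newt (x + y) := by
    rw [newt, ← rpow_neg_one, ← rpow_add hs]; norm_num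
  have e1 : newt (x + y) - (‖y‖^2)⁻¹
      = (‖y‖^2)⁻¹*((‖y‖^2 - 1 - ‖x + y‖^2)*newt (x + y)) := by
    rw [newt]; field_simp; ring
  have hn : 0 < newt (x + y) := by unfold newt; positivity
  rw [e1, e2, abs_mul, abs_mul, abs_of_pos hn, abs_of_pos (show 0 < (‖y‖^2)⁻¹ by positivity)]
  set σ := (1 + ‖x + y‖^2)^(1/2 : ℝ)
  have h2 : |‖y‖^2 - 1 - ‖x + y‖^2| ≤ b(x)*(2*‖y‖ + σ) := by
    have h3 : |(‖x + y‖ - ‖y‖)*(‖x + y‖ + ‖y‖)| ≤ ‖x‖*(‖x + y‖ + ‖y‖) := by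
      rw [abs_mul, abs_of_nonneg (show 0 ≤ ‖x + y‖ + ‖y‖ by positivity)]; gcongr
    have := norm_nonneg x
    have := norm_nonneg (x + y)
    rw [abs_le] at h3 ⊢
    constructor <;> nlinarith [h3.1, h3.2]
  calc _ ≤ (‖y‖^2)⁻¹*(b(x)*(2*‖y‖ + σ)*newt (x + y)) := by gcongr
    _ = _ := by ring

namespace Res

variable (h : Res V z g r d A)
include h

lemma integrable_mul_newt : Integrable fun x => |V x| *newt x := by
  have := (h.int.sub (h.memV.integrable_mul h.memLp_rem)).abs
  refine this.congr (.of_forall fun x => ?_)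
  simp only [Pi.sub_apply, Pi.mul_apply]
  rw [show V x*z x - V x*(z x - newt x) = V x*newt x by ring, abs_mul,
    abs_of_pos (show 0 < newt x by unfold newt; positivity)]

omit h in
lemma memLp_corrPd (hk : 0 ≤ k) (hN : 0 ≤ N) (j : Fin 4) : MemLp (fun x => newtLPd k N j x - newtPd j x) 2 :=
  (memLp_two_iff_integrable_sq ((continuous_newtLPd hN j).sub
    (continuous_newtPd j)).aestronglyMeasurable).2 (integral_newtLPd_sub_sq_le hk hN j).1

lemma self_energy_le (hk : 0 < k) (hk1 : k ≤ 1) (hN : 0 ≤ N) :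
    ∑ j, (∫ x, trialPd g k N j x^2) + ∫ x, V x*(trial z k N x*trial z k N x)
      ≤ (800*π^2 + 4*∫ x, |V x| *newt x)*(k*(1 + N)⁻¹) := by
  have hu4 := h.memLp_trial_four hk.le hN
  have hk4 := memLp_corr hk.le hN
  have h0 := h.weak_H1 (h.memLp_trial hk hN) (h.memLp_trialPd hk.le hk1 hN) (h.hasWeakPartial_trial hN) hu4
  have e1 : ∀ j, ∫ x, trialPd g k N j x^2 = (∫ x, (newtLPd k N j x - newtPd j x)^2)
      + 2*(∫ x, g j x*trialPd g k N j x) - ∫ x, g j x^2 := fun j => by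
    have i1 := (integral_newtLPd_sub_sq_le hk.le hN j).1
    have i2 := (integrable_mul_two (h.memg j) (h.memLp_trialPd hk.le hk1 hN j)).const_mul 2
    rw [← integral_const_mul, ← integral_add i1 i2, ← integral_sub (i1.fun_add i2) (h.memg j).integrable_sq]
    refine integral_congr_ae (.of_forall fun x => ?_)
    simp only [trialPd]; ring
  have e2 : ∫ x, V x*(trial z k N x*trial z k N x) = (∫ x, V x*(newtL k N x - newt x)^2)
      + 2*(∫ x, V x*(z x*trial z k N x)) - ∫ x, V x*z x^2 := by
    have i1 := integrable_mul_sq h.memV hk4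
    have i2 := (integrable_mul_mul h.memV h.memz hu4).const_mul 2
    rw [← integral_const_mul, ← integral_add i1 i2,
      ← integral_sub (i1.fun_add i2) (integrable_mul_sq h.memV h.memz)]
    refine integral_congr_ae (.of_forall fun x => ?_)
    simp only [trial]; ring
  have b1 : ∑ j, (∫ x, (newtLPd k N j x - newtPd j x)^2) ≤ 800*π^2*(k*(1 + N)⁻¹) := by
    refine (Finset.sum_le_card_nsmul _ _ (200*π^2*(k*(1 + N)⁻¹)) fun j _ => ?_).trans (le_of_eq (by simp; ring))
    refine (integral_newtLPd_sub_sq_le hk.le hN j).2.trans ?_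
    rw [mul_assoc]; gcongr; nlinarith
  have b2 : ∫ x, V x*(newtL k N x - newt x)^2 ≤ 4*(∫ x, |V x| *newt x)*(k*(1 + N)⁻¹) := by
    rw [mul_right_comm, ← integral_const_mul]
    refine integral_mono (integrable_mul_sq h.memV hk4) (h.integrable_mul_newt.const_mul _) fun x => ?_
    simp only
    rw [← sq_abs]
    calc _ ≤ |V x| *|newtL k N x - newt x|^2 := mul_le_mul_of_nonneg_right (le_abs_self _) (sq_nonneg _)
      _ ≤ |V x| *(4*k*(1 + N)⁻¹*newt x) := by
          rw [sq]; gcongr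
          · exact abs_newtL_sub_le_inv hk.le hN x
          · exact abs_newtL_sub_le hk.le hN x
      _ = _ := by ring
  have h1 := h.self
  simp only [e1, e2, sum_add_distrib, Finset.sum_sub_distrib, ← mul_sum]
  linarith

/-- The energy form of the sum of two trial functions. -/
lemma energy_expand (hk : 0 < k) (hk1 : k ≤ 1) (hN : 0 ≤ N) (y : R4) :
    ∑ j, (∫ x, (trialPd g k N j x + trialPd g k N j (x + y))^2)
        + ∫ x, (V x + V (x + y))*(trial z k N x + trial z k N (x + y))^2
      = 2*(∑ j, (∫ x, trialPd g k N j x^2) + ∫ x, V x*(trial z k N x*trial z k N x))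
        + 2*(∑ j, ∫ x, (newtLPd k N j x - newtPd j x)*trialPd g k N j (x + y))
        + 2*(∫ x, V x*(newtL k N x - newt x)*trial z k N (x + y))
        + (∫ x, V x*trial z k N (x + y)^2) + (∫ x, V x*trial z k N (x + -y)^2)
        + 2*∫ x, V x*(trial z k N x*trial z k N (x + -y)) := by
  set u := trial z k N with hu
  have hu4 : MemLp u 4 := h.memLp_trial_four hk.le hN
  have hu4' := hu4.comp_add y
  have hG := h.memLp_trialPd hk.le hk1 hN
  have hVy := h.memV.comp_add y
  have hk4 := memLp_corr hk.le hN
  have h0 := h.weak_H1 ((h.memLp_trial hk hN).comp_add y) (fun j => (hG j).comp_add y)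
    (fun j => (h.hasWeakPartial_trial hN j).comp_add y) hu4'
  have e1 : ∀ j, ∫ x, (trialPd g k N j x + trialPd g k N j (x + y))^2
      = 2*(∫ x, trialPd g k N j x^2) + 2*(∫ x, g j x*trialPd g k N j (x + y))
        + 2*∫ x, (newtLPd k N j x - newtPd j x)*trialPd g k N j (x + y) := fun j => by
    have i1 := (hG j).integrable_sq
    have i2 := ((hG j).comp_add y).integrable_sq
    have i3 := (integrable_mul_two (h.memg j) ((hG j).comp_add y)).const_mul 2
    have i4 := (integrable_mul_two (memLp_corrPd hk.le hN j) ((hG j).comp_add y)).const_mul 2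
    have e : ∫ x, trialPd g k N j (x + y)^2 = ∫ x, trialPd g k N j x^2 :=
      integral_add_right_eq_self (fun x => trialPd g k N j x^2) y
    rw [two_mul]
    nth_rw 2 [← e]
    rw [← integral_const_mul, ← integral_const_mul, ← integral_add i1 i2,
      ← integral_add (i1.fun_add i2) i3, ← integral_add ((i1.fun_add i2).fun_add i3) i4]
    refine integral_congr_ae (.of_forall fun x => ?_)
    simp only [trialPd]; ring
  have e2 : ∫ x, (V x + V (x + y))*(u x + u (x + y))^2 = (∫ x, V x*(u x*u x))
      + (∫ x, V (x + y)*(u (x + y)*u (x + y))) + (∫ x, V x*(u (x + y)*u (x + y)))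
      + (∫ x, V (x + y)*(u x*u x)) + 2*(∫ x, V x*(z x*u (x + y)))
      + 2*(∫ x, V x*((newtL k N x - newt x)*u (x + y)))
      + 2*∫ x, V (x + y)*(u x*u (x + y)) := by
    have i1 := integrable_mul_mul h.memV hu4 hu4
    have i2 := integrable_mul_mul hVy hu4' hu4'
    have i3 := integrable_mul_mul h.memV hu4' hu4'
    have i4 := integrable_mul_mul hVy hu4 hu4
    have i5 := (integrable_mul_mul h.memV h.memz hu4').const_mul 2
    have i6 := (integrable_mul_mul h.memV hk4 hu4').const_mul 2
    have i7 := (integrable_mul_mul hVy hu4 hu4').const_mul 2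
    have i12 := i1.fun_add i2
    have i13 := i12.fun_add i3
    have i14 := i13.fun_add i4
    have i15 := i14.fun_add i5
    simp only [← integral_const_mul]
    rw [← integral_add i1 i2, ← integral_add i12 i3, ← integral_add i13 i4, ← integral_add i14 i5,
      ← integral_add i15 i6, ← integral_add (i15.fun_add i6) i7]
    refine integral_congr_ae (.of_forall fun x => ?_)
    have : u x = z x + (newtL k N x - newt x) := by rw [hu, trial]; ring
    simp only [this]; ring
  have s1 : ∫ x, V (x + y)*(u (x + y)*u (x + y)) = ∫ x, V x*(u x*u x) :=
    integral_add_right_eq_self (fun x => V x*(u x*u x)) y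
  have s2 : ∫ x, V (x + y)*(u x*u x) = ∫ x, V x*u (x + -y)^2 := by
    rw [← integral_add_right_eq_self _ (-y)]; simp only [neg_add_cancel_right, sq]
  have s3 : ∫ x, V (x + y)*(u x*u (x + y)) = ∫ x, V x*(u x*u (x + -y)) := by
    rw [← integral_add_right_eq_self _ (-y)]; simp only [neg_add_cancel_right, mul_comm (u (_ + -y))]
  rw [e2, s1, s2, s3]
  rw [← hu] at h0
  simp only [e1, sum_add_distrib, ← mul_sum, mul_assoc, ← sq (u (_ + y))]
  linarith

lemma energy_le : ∃ C : ℝ, 0 ≤ C ∧ ∀ k : ℝ, 0 < k → k ≤ 1 → ∀ y : R4, 2*r < ‖y‖ →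
    ∑ j, (∫ x, (trialPd g k (‖y‖^2) j x + trialPd g k (‖y‖^2) j (x + y))^2)
        + ∫ x, (V x + V (x + y))*(trial z k (‖y‖^2) x + trial z k (‖y‖^2) (x + y))^2
      ≤ (-(8*π^2) + C*(k + ‖y‖^(-(d/2))))*(‖y‖^2)⁻¹ := by
  obtain ⟨C, D⟩ := h.exists_decConsts
  have hC := D.nonneg
  have hr := h.one_le
  have hd := h.pos
  have hd2 := h.le_half
  obtain ⟨C1, n1, X1⟩ := Dec.cross hr (a := 5/2) (b := 3) num! num! num! num! num!
  obtain ⟨C2, n2, X2⟩ := Dec.cross hr (a := 2 + 2*d) (b := 2) lin! lin! num! num! lin!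
  obtain ⟨C3, n3, X3⟩ := Dec.cross hr (a := 2 + 2*d) (b := 4 - d) lin! lin! lin! lin! lin!
  obtain ⟨C4, n4, X4⟩ := Dec.cross hr (a := 4 - d/2) (b := 2 + d) lin! lin! lin! lin! lin!
  obtain ⟨C5, n5, X5⟩ := Dec.cross hr (a := 3 + d) (b := 2) lin! lin! lin! lin! lin!
  obtain ⟨C6, n6, X6⟩ := Dec.cross hr (a := 3 + d) (b := 1) lin! lin! lin! lin! lin!
  set I := ∫ x, |V x| *newt x
  set J := ∫ x, |V x*z x| with hJ
  have hI0 : 0 ≤ I := integral_nonneg fun x => mul_nonneg (abs_nonneg _) (by unfold newt; positivity)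
  refine ⟨2*(800*π^2 + 4*I) + 8*(C1*(C*C)) + 4*(C2*(C*C)) + 2*(C3*(C*C))
    + 2*(C4*(C*C)) + 4*(C5*(C*C)) + 2*(C6*(C*C)) + 8*J, pos!, ?_⟩
  intro k hk hk1 y hy
  set L := ‖y‖ with hL
  have hL1 : 1 < L := lin!
  have hL0 : 0 < L := lin!
  have hN : 0 ≤ L^2 := pos!
  have hy' : 2*r < ‖-y‖ := by rwa [norm_neg]
  have hM : (1 + L^2)⁻¹ ≤ (L^2)⁻¹ := inv_anti₀ pos! lin!
  have h2 : L^(-2 : ℝ) = (L^2)⁻¹ := by rw [rpow_neg hL0.le, rpow_two]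
  set e := L^(-(d/2)) with he
  have hpow : ∀ {q : ℝ}, q ≤ -2 - d/2 → L^q ≤ e*(L^2)⁻¹ := fun {q} hq => by
    rw [← h2, he, ← rpow_add hL0]; exact rpow_le_rpow_of_exponent_le hL1.le lin!
  have pow_one : ∀ {q : ℝ}, q ≤ 0 → L^q ≤ 1 := fun hq => rpow_le_one_of_one_le_of_nonpos hL1.le hq
  rw [h.energy_expand hk hk1 hN]
  have b0 := (h.self_energy_le hk hk1 hN).trans (mul_le_mul_of_nonneg_left
    (mul_le_mul_of_nonneg_left hM hk.le) pos!)
  have b1 : ∑ j, ∫ x, (newtLPd k (L^2) j x - newtPd j x)*trialPd g k (L^2) j (x + y)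
      ≤ 4*(C1*(C*C))*(k*(L^2)⁻¹) := by
    refine (Finset.sum_le_card_nsmul _ _ (C1*(C*C)*(k*(L^2)⁻¹)) fun j _ => ?_).trans (le_of_eq (by simp; ring))
    refine ((le_abs_self _).trans (abs_integral_le_integral_abs)).trans
      ((X1 (D.corrPd hk.le hN j) (D.trialPd hk.le hk1 hN j) y hy).2.trans ?_)
    have a1 : (1 + L^2)^(-(1/4) : ℝ) ≤ L^(-(1/2) : ℝ) := by
      refine (rpow_le_rpow_of_nonpos pos! (show L^2 ≤ 1 + L^2 by linarith) num!).trans (le_of_eq ?_)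
      rw [← rpow_natCast, ← rpow_mul hL0.le]; norm_num
    calc _ ≤ C1*(C*(k*L^(-(1/2) : ℝ))*C)*L^(4 - 5/2 - 3 : ℝ) := by gcongr
      _ = C1*(C*C)*(k*(L^(-(1/2) : ℝ)*L^(4 - 5/2 - 3 : ℝ))) := by ring
      _ = _ := by rw [← rpow_add hL0, ← h2]; norm_num
  have b2 : ∀ z0 : R4, ‖z0‖ = L → ∫ x, V x*(newtL k (L^2) x - newt x)*trial z k (L^2) (x + z0)
      ≤ C2*(C*C)*(k*(L^2)⁻¹) := fun z0 hz => by
    refine ((le_abs_self _).trans abs_integral_le_integral_abs).trans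
      ((X2 (D.potCorr hk.le hN) (D.trial hk.le hN) z0 (by rwa [hz])).2.trans ?_)
    rw [hz]
    calc _ ≤ C2*(C*(k*(L^2)⁻¹)*C)*1 := by gcongr; exact pow_one lin!
      _ = _ := by ring
  have b3 : ∀ z0 : R4, ‖z0‖ = L → ∫ x, V x*trial z k (L^2) (x + z0)^2
      ≤ C3*(C*C)*(e*(L^2)⁻¹) := fun z0 hz => by
    refine ((le_abs_self _).trans abs_integral_le_integral_abs).trans
      ((X3 D.pot (D.trialSq hk.le hN) z0 (by rwa [hz])).2.trans ?_)
    rw [hz]; gcongr; exact hpow lin!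
  have b4 : ∫ x, V x*(trial z k (L^2) x*trial z k (L^2) (x + -y))
      ≤ -(4*π^2)*(L^2)⁻¹ + C2*(C*C)*(k*(L^2)⁻¹) + (C4*(C*C) + 2*(C5*(C*C)) + C6*(C*C))*(e*(L^2)⁻¹)
        + 4*J*(k*(L^2)⁻¹) := by
    have i1 := (X2 (D.potCorr hk.le hN) (D.trial hk.le hN) (-y) hy').1
    obtain ⟨i2, c2⟩ := X4 D.dens D.rem (-y) hy'
    obtain ⟨i5, c5⟩ := X5 D.densWt D.newt (-y) hy'
    obtain ⟨i6, c6⟩ := X6 D.densWt D.sqrtNewt (-y) hy'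
    have hkb : ∀ x, |V x*z x*(newtL k (L^2) (x + -y) - newt (x + -y))|
        ≤ 4*(k*(L^2)⁻¹)*|V x*z x| := fun x => by
      rw [abs_mul, mul_comm]
      refine mul_le_mul_of_nonneg_right ((abs_newtL_sub_le_inv hk.le hN _).trans ?_) (abs_nonneg _)
      rw [mul_assoc]; gcongr
    have hkm : AEStronglyMeasurable (fun x => newtL k (L^2) (x + -y) - newt (x + -y)) volume := by
      have := (contDiff_newtL (k := k) hN).continuous
      have := contDiff_newt.continuous
      exact (by fun_prop : Continuous _).aestronglyMeasurable
    have i3 : Integrable fun x => V x*z x*(newtL k (L^2) (x + -y) - newt (x + -y)) :=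
      (h.int.abs.const_mul _).mono' (h.int.1.mul hkm) (.of_forall hkb)
    have i56 := ((i5.abs.const_mul (2*L)).add i6.abs).const_mul (L^2)⁻¹
    have hnb : ∀ x, |V x*z x*(newt (x + -y) - (L^2)⁻¹)| ≤ (L^2)⁻¹*(2*L*|V x*z x*b(x)*newt (x + -y)|
          + |V x*z x*b(x)*(1 + ‖x + -y‖^2)^(-(1/2) : ℝ)|) := fun x => by
      have := abs_newt_sub_le (y := -y) (by rw [norm_neg]; exact hL1.le) x
      rw [norm_neg, ← hL] at this
      have hn : 0 < newt (x + -y) := by unfold newt; positivity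
      simp only [abs_mul, abs_of_pos hn, abs_of_pos (show 0 < 1 + ‖x‖ by positivity),
        abs_of_pos (show 0 < (1 + ‖x + -y‖^2)^(-(1/2) : ℝ) by positivity)]
      refine (mul_le_mul_of_nonneg_left this pos!).trans (le_of_eq ?_)
      ring
    have i4 : Integrable fun x => V x*z x*(newt (x + -y) - (L^2)⁻¹) := by
      refine i56.mono' (h.int.1.mul ?_) (.of_forall hnb)
      have := contDiff_newt.continuous
      exact (by fun_prop : Continuous _).aestronglyMeasurable
    have i7 := h.int.mul_const (L^2)⁻¹
    have i12 := i1.fun_add i2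
    have i13 := i12.fun_add i3
    have i14 := i13.fun_add i4
    have ee : ∫ x, V x*(trial z k (L^2) x*trial z k (L^2) (x + -y))
        = (∫ x, V x*(newtL k (L^2) x - newt x)*trial z k (L^2) (x + -y))
          + (∫ x, V x*z x*(z (x + -y) - newt (x + -y)))
          + (∫ x, V x*z x*(newtL k (L^2) (x + -y) - newt (x + -y)))
          + (∫ x, V x*z x*(newt (x + -y) - (L^2)⁻¹)) + ∫ x, V x*z x*(L^2)⁻¹ := by
      rw [← integral_add i1 i2, ← integral_add i12 i3, ← integral_add i13 i4, ← integral_add i14 i7]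
      refine integral_congr_ae (.of_forall fun x => ?_)
      simp only [trial]; ring
    have d2 := ((le_abs_self _).trans abs_integral_le_integral_abs).trans c2
    have d3 : ∫ x, V x*z x*(newtL k (L^2) (x + -y) - newt (x + -y)) ≤ 4*(k*(L^2)⁻¹)*J := by
      rw [hJ, ← integral_const_mul]
      exact integral_mono i3 (h.int.abs.const_mul _) fun x => (le_abs_self _).trans (hkb x)
    have d4 : ∫ x, V x*z x*(newt (x + -y) - (L^2)⁻¹)
        ≤ (2*(C5*(C*C)) + C6*(C*C))*(e*(L^2)⁻¹) := by
      refine (integral_mono i4 i56 fun x => (le_abs_self _).trans (hnb x)).trans ?_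
      simp only [Pi.add_apply]
      rw [integral_const_mul, integral_add (i5.abs.const_mul _) i6.abs, integral_const_mul]
      rw [norm_neg] at c5 c6
      have p5 : L*L^(4 - (3 + d) - 2) ≤ e := by
        nth_rw 1 [← rpow_one L]
        rw [← rpow_add hL0]; exact rpow_le_rpow_of_exponent_le hL1.le lin!
      have p6 : L^(4 - (3 + d) - 1) ≤ e := rpow_le_rpow_of_exponent_le hL1.le lin!
      calc _ ≤ (L^2)⁻¹*(2*L*(C5*(C*C)*L^(4 - (3 + d) - 2))
            + C6*(C*C)*L^(4 - (3 + d) - 1)) := by gcongr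
        _ = (L^2)⁻¹*(2*(C5*(C*C))*(L*L^(4 - (3 + d) - 2))
            + C6*(C*C)*L^(4 - (3 + d) - 1)) := by ring
        _ ≤ (L^2)⁻¹*(2*(C5*(C*C))*e + C6*(C*C)*e) := by gcongr
        _ = _ := by ring
    rw [norm_neg] at d2
    have d2' := d2.trans (mul_le_mul_of_nonneg_left (hpow lin!) pos!)
    have d1 := b2 (-y) (norm_neg y)
    rw [ee, integral_mul_const, h.charge]
    linarith
  have b2' := b2 y rfl
  have b3' := b3 y rfl
  have b3'' := b3 (-y) (norm_neg y)
  have q1 : 0 ≤ k*(L^2)⁻¹ := pos!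
  have q2 : 0 ≤ e*(L^2)⁻¹ := pos!
  have q : ∀ {c c' : ℝ}, 0 ≤ c → 0 ≤ c' → c*(k*(L^2)⁻¹) + c'*(e*(L^2)⁻¹)
      ≤ (c + c')*((k + e)*(L^2)⁻¹) := fun hc hc' => by
    nlinarith [mul_nonneg hc q2, mul_nonneg hc' q1]
  have := q (c := 2*(800*π^2 + 4*I) + 8*(C1*(C*C)) + 4*(C2*(C*C)) + 8*J)
    (c' := 2*(C3*(C*C)) + 2*(C4*(C*C)) + 4*(C5*(C*C)) + 2*(C6*(C*C)))
    pos! pos!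
  linarith

end Res

lemma hasDerivAt_feynman {B t : ℝ} (hB : 0 < B) (hD : 0 < B + t*(A - B)) :
    HasDerivAt (fun t => t^2*(1/(2*B) + (A - 3*B)/(6*B^2)*t)*((B + t*(A - B))^3)⁻¹)
      (t*(1 - t)*((B + t*(A - B))^4)⁻¹) t := by
  have h1 : HasDerivAt (fun t => B + t*(A - B)) (A - B) t := by
    simpa using ((hasDerivAt_id' t).mul_const (A - B)).const_add B
  have h2 := (hasDerivAt_inv_pow 3 hD).comp t h1
  have h3 := (hasDerivAt_pow 2 t).mul (((hasDerivAt_id' t).const_mul ((A - 3*B)/(6*B^2))).const_add (1/(2*B)))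
  refine (h3.mul h2).congr_deriv ?_
  simp only [Pi.mul_apply, Function.comp]
  field_simp
  ring

lemma feynman {B : ℝ} (hA : 0 < A) (hB : 0 < B) :
    (A^2)⁻¹*(B^2)⁻¹ = 6*∫ t in (0 : ℝ)..1, t*(1 - t)*((B + t*(A - B))^4)⁻¹ := by
  have hD : ∀ t ∈ Set.uIcc (0 : ℝ) 1, 0 < B + t*(A - B) := fun t ht => by
    rw [Set.uIcc_of_le zero_le_one] at ht
    rcases ht.1.eq_or_lt with h | h
    · rw [← h]; linarith
    · nlinarith [ht.2, mul_pos h hA, mul_nonneg (sub_nonneg.2 ht.2) hB.le]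
  rw [intervalIntegral.integral_eq_sub_of_hasDerivAt (fun t ht => hasDerivAt_feynman hB (hD t ht))]
  · rw [show B + 1*(A - B) = A by ring]; field_simp; ring
  · refine ContinuousOn.intervalIntegrable fun t ht => ContinuousAt.continuousWithinAt ?_
    have := (pow_pos (hD t ht) 4).ne'
    fun_prop (disch := assumption)

section Moments

variable {t : ℝ}

lemma integrable_moment (ht : 1 ≤ t) {u : R4 → ℝ} (hu : Continuous u) {c : ℝ} {m : ℕ} {q : ℝ}
    (hc : ∀ z, |u z| ≤ c*w(z)^q) (hm : 2 < m - q) :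
    Integrable fun z : R4 => u z*((t + ‖z‖^2)^m)⁻¹ := by
  have hc0 : 0 ≤ c := by have := (abs_nonneg _).trans (hc 0); simpa using this
  have := memLp_of_le_weight (f := fun z : R4 => u z*((t + ‖z‖^2)^m)⁻¹) (C := c) (a := 2*(m - q))
    (p := 1) (hu.mul (Continuous.inv₀ (by fun_prop) fun z => pos!)) one_pos lin!
    lin! fun z => by
      have hs : 0 < w(z) := pos!
      rw [abs_mul, abs_of_pos (show 0 < ((t + ‖z‖^2)^m)⁻¹ by positivity)]
      calc _ ≤ (c*w(z)^q)*(w(z)^m)⁻¹ := by gcongr; exact hc z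
        _ = _ := by
          rw [show (w(z)^m)⁻¹ = w(z)^(-(m : ℝ)) by
            rw [rpow_neg hs.le, rpow_natCast], mul_assoc, ← rpow_add hs]; congr 2; ring
  rwa [ENNReal.ofReal_one, memLp_one_iff_integrable] at this

lemma abs_coord_add_le (z : R4) (j : Fin 4) (c : ℝ) : |z j + c| ≤ (1 + |c|)*w(z)^(1/2 : ℝ) := by
  have h1 := abs_coord_le_rpow z j
  have h2 : 1 ≤ w(z)^(1/2 : ℝ) := one_le_rpow (one_le_one_add_sq z) num!
  nlinarith [abs_add_le (z j) c, abs_nonneg c]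

lemma abs_coord_mul_le (z : R4) (j : Fin 4) (c : ℝ) : |z j*(z j + c)| ≤ (1 + |c|)*w(z)^(1 : ℝ) := by
  have hs : 0 < w(z) := pos!
  rw [abs_mul]
  calc _ ≤ w(z)^(1/2 : ℝ)*((1 + |c|)*w(z)^(1/2 : ℝ)) := by
        gcongr; exacts [abs_coord_le_rpow z j, abs_coord_add_le z j c]
    _ = (1 + |c|)*(w(z)^(1/2 : ℝ)*w(z)^(1/2 : ℝ)) := by ring
    _ = _ := by rw [← rpow_add hs]; norm_num

lemma integral_moment (ht : 1 ≤ t) (j : Fin 4) (c : ℝ) :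
    ∫ z : R4, z j*(z j + c)*((t + ‖z‖^2)^4)⁻¹ = 1/6*∫ z : R4, ((t + ‖z‖^2)^3)⁻¹ := by
  have ht0 : 0 < t := lin!
  have hF : ContDiff ℝ 1 fun z : R4 => ((t + ‖z‖^2)^3)⁻¹ := by
    simpa using contDiff_radial (contDiffOn_inv_pow 3) ht0 (0 : R4)
  have hpd : ∀ z, pd j (fun z : R4 => ((t + ‖z‖^2)^3)⁻¹) z = -6*(z j*((t + ‖z‖^2)^4)⁻¹) := fun z => by
    have := pd_radial (a := 0) (y := z) j (hasDerivAt_inv_pow 3 (show 0 < t + ‖z - 0‖^2 by positivity))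
    simp only [sub_zero, PiLp.zero_apply] at this
    rw [this]; push_cast; ring
  have hu : ContDiff ℝ 1 fun z : R4 => z j + c := by simpa using (contDiff_coord j (0 : R4)).add contDiff_const
  have hpu : ∀ z : R4, pd j (fun z : R4 => z j + c) z = 1 := fun z => by
    have := pd_coord j j 0 z
    simp only [PiLp.zero_apply, sub_zero, if_true] at this
    rw [← this, pd, pd, fderiv_add_const]
  have i1 := integrable_moment ht (u := fun z => z j*(z j + c)) (m := 4) (q := 1) (by fun_prop)
    (abs_coord_mul_le · j c) num!
  have i2 := integrable_moment ht (u := fun z => z j + c) (m := 3) (q := 1/2) (by fun_prop)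
    (abs_coord_add_le · j c) num!
  have i3 := integrable_moment ht (u := fun _ => 1) (m := 3) (q := 0) (c := 1) (by fun_prop) (by simp) num!
  have e1 : ∀ z : R4, (z j + c)*pd j (fun z : R4 => ((t + ‖z‖^2)^3)⁻¹) z
      = -6*(z j*(z j + c)*((t + ‖z‖^2)^4)⁻¹) := fun z => by rw [hpd]; ring
  have := integral_mul_fderiv_eq_neg_fderiv_mul_of_integrable (μ := (volume : Measure R4))
    (f := fun z : R4 => z j + c) (g := fun z : R4 => ((t + ‖z‖^2)^3)⁻¹) (v := single j 1)
    (i3.congr (.of_forall fun z => by have := hpu z; rw [pd] at this; simp only [this]))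
    ((i1.const_mul (-6)).congr (.of_forall fun z => (e1 z).symm)) i2
    (fun z _ => hu.differentiable one_ne_zero z) (fun z _ => hF.differentiable one_ne_zero z)
  change ∫ z : R4, (z j + c)*pd j (fun z : R4 => ((t + ‖z‖^2)^3)⁻¹) z
    = -∫ z : R4, pd j (fun z : R4 => z j + c) z*((t + ‖z‖^2)^3)⁻¹ at this
  simp only [e1, hpu, integral_const_mul, one_mul] at this
  linarith

lemma integral_moment_four (ht : 1 ≤ t) :
    t*∫ z : R4, ((t + ‖z‖^2)^4)⁻¹ = 1/3*∫ z : R4, ((t + ‖z‖^2)^3)⁻¹ := by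
  have i1 : ∀ j : Fin 4, Integrable fun z : R4 => z j*(z j + 0)*((t + ‖z‖^2)^4)⁻¹ := fun j =>
    integrable_moment ht (q := 1) (by fun_prop) (abs_coord_mul_le · j 0) num!
  have i2 := integrable_moment ht (u := fun _ => t) (m := 4) (q := 0) (c := t) (by fun_prop)
    (by simp [abs_of_pos (zero_lt_one.trans_le ht)]) num!
  have e : ∫ z : R4, ((t + ‖z‖^2)^3)⁻¹ = t*(∫ z : R4, ((t + ‖z‖^2)^4)⁻¹)
      + ∑ j : Fin 4, ∫ z : R4, z j*(z j + 0)*((t + ‖z‖^2)^4)⁻¹ := by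
    rw [← integral_const_mul, ← integral_finsetSum _ fun j _ => i1 j,
      ← integral_add i2 (integrable_finsetSum _ fun j _ => i1 j)]
    refine integral_congr_ae (.of_forall fun z => ?_)
    simp only [← sum_mul, add_zero, ← sq]
    have h1 := sum_coord_sq 0 z
    simp only [PiLp.zero_apply, sub_zero] at h1
    have : t + ‖z‖^2 ≠ 0 := pos!
    rw [h1]; field_simp
  simp only [integral_moment ht, sum_const, card_univ, Fintype.card_fin, nsmul_eq_mul] at e
  push_cast at e
  linarith

end Moments

/-- The interaction of the gradients of two Newton potentials in a plane containing both centres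
is nonnegative. -/
lemma newtPd_interaction_nonneg {y : R4} (h0 : y 0 = 0) (h1 : y 1 = 0) :
    0 ≤ ∑ j ∈ {2, 3}, ∫ x, newtPd j x*newtPd j (x + y) := by
  set P : R4 → ℝ := fun x => ∑ j ∈ {2, 3}, x j*(x j + y j) with hP
  set F : ℝ → R4 → ℝ := fun t x => P x*(t*(1 - t) * ((1 + ‖x + y‖^2 + t*(w(x) - (1 + ‖x + y‖^2)))^4)⁻¹) with hF
  have hpoint : ∀ x, ∑ j ∈ ({2, 3} : Finset (Fin 4)), newtPd j x*newtPd j (x + y)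
      = 24*∫ t in (0 : ℝ)..1, F t x := fun x => by
    have := feynman (A := w(x)) (B := 1 + ‖x + y‖^2) pos! pos!
    simp only [hF, intervalIntegral.integral_const_mul]
    rw [show 24*(P x*∫ t in (0 : ℝ)..1, t*(1 - t) *
      ((1 + ‖x + y‖^2 + t*(w(x) - (1 + ‖x + y‖^2)))^4)⁻¹) = 4*P x*(6*∫ t in (0 : ℝ)..1,
      t*(1 - t)*((1 + ‖x + y‖^2 + t*(w(x) - (1 + ‖x + y‖^2)))^4)⁻¹) by ring, ← this]
    simp only [hP, newtPd, mul_sum, sum_mul, PiLp.add_apply]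
    exact sum_congr rfl fun j _ => by ring
  have hD : ∀ t x, 1 + ‖x + y‖^2 + t*(w(x) - (1 + ‖x + y‖^2))
      = 1 + t*(1 - t)*‖y‖^2 + ‖x + (1 - t) • y‖^2 := fun t x => by
    rw [norm_add_sq_real, norm_add_sq_real, norm_smul, inner_smul_right, mul_pow, norm_eq_abs, sq_abs]
    ring
  have hinner : ∀ t ∈ Icc (0 : ℝ) 1, 0 ≤ ∫ x, F t x := fun t ht => by
    have hm : 0 ≤ t*(1 - t) := mul_nonneg ht.1 (by linarith [ht.2])
    set t0 := 1 + t*(1 - t)*‖y‖^2 with ht0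
    have ht1 : 1 ≤ t0 := le_add_of_nonneg_right pos!
    have i1 : ∀ j, Integrable fun z : R4 => z j*(z j + (2*t - 1)*y j)*((t0 + ‖z‖^2)^4)⁻¹ :=
      fun j => integrable_moment ht1 (q := 1) (by fun_prop) (abs_coord_mul_le · j _) num!
    have i2 := integrable_moment ht1 (u := fun _ => t*(1 - t)*‖y‖^2) (m := 4) (q := 0)
      (c := t*(1 - t)*‖y‖^2) (by fun_prop) (by simp [abs_of_nonneg, hm]) num!
    have hy2 : y 2^2 + y 3^2 = ‖y‖^2 := by
      have := sum_coord_sq 0 y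
      simpa [Fin.sum_univ_four, h0, h1] using this
    have e : ∫ x, F t x = t*(1 - t)*(∑ j ∈ {2, 3}, (∫ z : R4, z j*(z j + (2*t - 1)*y j)
        * ((t0 + ‖z‖^2)^4)⁻¹) - t*(1 - t)*‖y‖^2*∫ z : R4, ((t0 + ‖z‖^2)^4)⁻¹) := by
      rw [← integral_add_right_eq_self (F t) (-((1 - t) • y)), ← integral_finsetSum _ fun j _ => i1 j,
        ← integral_const_mul (t*(1 - t)*‖y‖^2), ← integral_sub (integrable_finsetSum _ fun j _ => i1 j) i2,
        ← integral_const_mul]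
      refine integral_congr_ae (.of_forall fun z => ?_)
      simp only [hF, hD, neg_add_cancel_right, hP, ← ht0]
      rw [sum_pair (by decide), sum_pair (by decide), ← hy2]
      simp only [PiLp.add_apply, PiLp.neg_apply, PiLp.smul_apply, smul_eq_mul]
      ring
    rw [e, sum_pair (by decide), integral_moment ht1, integral_moment ht1]
    have := integral_moment_four ht1
    have h4 : 0 ≤ ∫ z : R4, ((t0 + ‖z‖^2)^4)⁻¹ := integral_nonneg fun z => pos!
    refine mul_nonneg hm ?_
    rw [ht0] at this ⊢
    nlinarith
  set M := 2*w(y)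
  have hi : Integrable (uncurry F) ((volume.restrict (Ioc (0 : ℝ) 1)).prod volume) := by
    have i3 := integrable_moment le_rfl (u := fun _ => 1) (m := 3) (q := 0) (c := 1) (by fun_prop) (by simp)
      num!
    refine Integrable.mono' (Integrable.mul_prod (μ := volume.restrict (Ioc (0 : ℝ) 1))
      (integrable_const ((∑ j ∈ ({2, 3} : Finset (Fin 4)), (1 + |y j|))*M^4)) i3)
      (Measurable.aestronglyMeasurable (by simp only [hF, hP]; fun_prop)) ?_
    filter_upwards [(Measure.quasiMeasurePreserving_fst (ν := (volume : Measure R4))).ae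
      (ae_restrict_mem (μ := (volume : Measure ℝ)) measurableSet_Ioc)] with ⟨t, x⟩ ht
    obtain ⟨h0, h1⟩ : 0 < t ∧ t ≤ 1 := ht
    simp only [uncurry, hF, norm_eq_abs, one_mul]
    have hA : 0 < w(x) := pos!
    have hM : 0 < M := pos!
    have hAB : w(x) ≤ M*(1 + ‖x + y‖^2) := by
      have : ‖x‖ ≤ ‖x + y‖ + ‖y‖ := by simpa using norm_sub_le (x + y) y
      nlinarith [sq_nonneg (‖x + y‖ - ‖y‖), pow_le_pow_left₀ (norm_nonneg x) this 2,
        mul_nonneg (sq_nonneg ‖y‖) (sq_nonneg ‖x + y‖)]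
    set X := w(x)
    set Y := 1 + ‖x + y‖^2
    have hXM : X ≤ M*X := le_mul_of_one_le_left hA.le (by nlinarith [sq_nonneg ‖y‖])
    have hDX : M⁻¹*X ≤ Y + t*(X - Y) := by
      rw [inv_mul_le_iff₀ hM]
      nlinarith
    have h4 : ((Y + t*(X - Y))^4)⁻¹ ≤ M^4*(X^4)⁻¹ := by
      have := inv_anti₀ pos! (pow_le_pow_left₀ pos! hDX 4)
      rwa [mul_pow, mul_inv, inv_pow, inv_inv] at this
    have hpos : 0 ≤ ((Y + t*(X - Y))^4)⁻¹ := pos!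
    have hPx : |P x| ≤ (∑ j ∈ ({2, 3} : Finset (Fin 4)), (1 + |y j|))*X := by
      rw [sum_mul]
      exact (Finset.abs_sum_le_sum_abs _ _).trans (sum_le_sum fun j _ => by
        simpa using abs_coord_mul_le x j (y j))
    rw [abs_mul, abs_mul, abs_of_nonneg hpos, abs_of_nonneg (mul_nonneg h0.le (sub_nonneg.2 h1))]
    calc _ ≤ ((∑ j ∈ ({2, 3} : Finset (Fin 4)), (1 + |y j|))*X)*(1*(M^4*(X^4)⁻¹)) := by
          gcongr; nlinarith
      _ = _ := by field_simp
  rw [← integral_finsetSum _ fun j _ => integrable_mul_two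
    (memLp_two_of_le_weight (continuous_newtPd j) (abs_newtPd_le j))
    ((memLp_two_of_le_weight (continuous_newtPd j) (abs_newtPd_le j)).comp_add y)]
  simp only [hpoint, integral_const_mul, intervalIntegral.integral_of_le zero_le_one]
  rw [← integral_integral_swap hi]
  exact mul_nonneg num! (setIntegral_nonneg measurableSet_Ioc fun t ht => hinner t ⟨ht.1.le, ht.2⟩)

lemma integral_mul_comp_add (f g : R4 → ℝ) (y : R4) :
    ∫ x, f x*g (x + y) = ∫ x, g x*f (x + -y) := by
  rw [← integral_add_right_eq_self _ (-y)]; simp only [neg_add_cancel_right, mul_comm]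

lemma memLp_newtPd (j : Fin 4) : MemLp (newtPd j) 2 :=
  memLp_two_of_le_weight (continuous_newtPd j) (abs_newtPd_le j)

lemma memLp_newtLDeriv (hk : 0 < k) (hN : 0 ≤ N) : MemLp (newtLDeriv k N) 2 :=
  (memLp_two_iff_integrable_sq (continuous_newtLDeriv hN).aestronglyMeasurable).2
    (integral_newtLDeriv_sq_le hk hN).1

lemma integral_add_comp_sq_le (hf : MemLp f 2) (y : R4) :
    ∫ x, (f x + f (x + y))^2 ≤ 4*∫ x, f x^2 := by
  have i1 := hf.integrable_sq
  have i2 := (hf.comp_add y).integrable_sq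
  have e : ∫ x, f (x + y)^2 = ∫ x, f x^2 := integral_add_right_eq_self (fun x => f x^2) y
  refine (integral_mono (hf.add (hf.comp_add y)).integrable_sq ((i1.fun_add i2).const_mul 2) fun x => ?_).trans ?_
  · simp only [Pi.add_apply]; nlinarith [sq_nonneg (f x - f (x + y))]
  · rw [integral_const_mul, integral_add i1 i2, e]; linarith

namespace Res

/-- The derivative of the two-centre trial function along the separation, centred at one well. -/
def sepPd (g : Fin 4 → R4 → ℝ) (k : ℝ) (y : R4) (j : Fin 4) (x : R4) : ℝ :=
  1/2*(trialPd g k (‖y‖^2) j (x + y) - trialPd g k (‖y‖^2) j x)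
    + 2*y j*(newtLDeriv k (‖y‖^2) x + newtLDeriv k (‖y‖^2) (x + y))

lemma sepPd_expand (h : Res V z g r d A) (hk : 0 < k) (hk1 : k ≤ 1) (y : R4) (j : Fin 4) :
    (∫ x, sepPd g k y j x^2) - 1/4*∫ x, (trialPd g k (‖y‖^2) j x + trialPd g k (‖y‖^2) j (x + y))^2
      = -(∫ x, newtPd j x*newtPd j (x + y))
        - (∫ x, (trialPd g k (‖y‖^2) j x - newtPd j x)*trialPd g k (‖y‖^2) j (x + y))
        - (∫ x, (trialPd g k (‖y‖^2) j x - newtPd j x)*newtPd j (x + -y))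
        + 2*y j*(∫ x, newtLDeriv k (‖y‖^2) x*trialPd g k (‖y‖^2) j (x + y))
        - 2*y j*(∫ x, newtLDeriv k (‖y‖^2) x*trialPd g k (‖y‖^2) j (x + -y))
        + 4*y j^2*∫ x, (newtLDeriv k (‖y‖^2) x + newtLDeriv k (‖y‖^2) (x + y))^2 := by
  have hN : 0 ≤ ‖y‖^2 := pos!
  have hn := memLp_newtPd j
  have hG := h.memLp_trialPd hk.le hk1 hN j
  have hD := memLp_newtLDeriv hk hN
  unfold sepPd
  set G := trialPd g k (‖y‖^2) j
  set D := newtLDeriv k (‖y‖^2)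
  set n := newtPd j
  rw [← integral_mul_comp_add n (fun x => G x - n x), ← integral_mul_comp_add G D]
  have s : ∫ x, G (x + y)*D (x + y) = ∫ x, G x*D x := integral_add_right_eq_self (fun x => G x*D x) y
  have i1 := ((hG.add (hG.comp_add y)).integrable_sq).const_mul (1/4)
  have i2 := (integrable_mul_two hn (hn.comp_add y)).const_mul (-1)
  have i3 := (integrable_mul_two (hG.sub hn) (hG.comp_add y)).const_mul (-1)
  have i4 := (integrable_mul_two hn ((hG.sub hn).comp_add y)).const_mul (-1)
  have i5 := (integrable_mul_two hD (hG.comp_add y)).const_mul (2*y j)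
  have i6 := (integrable_mul_two hG (hD.comp_add y)).const_mul (-(2*y j))
  have i7 := (integrable_mul_two (hG.comp_add y) (hD.comp_add y)).const_mul (2*y j)
  have i8 := (integrable_mul_two hG hD).const_mul (-(2*y j))
  have i9 := ((hD.add (hD.comp_add y)).integrable_sq).const_mul (4*y j^2)
  simp only [Pi.add_apply, Pi.sub_apply] at i1 i3 i4 i9
  have j2 := i1.fun_add i2
  have j3 := j2.fun_add i3
  have j4 := j3.fun_add i4
  have j5 := j4.fun_add i5
  have j6 := j5.fun_add i6
  have j7 := j6.fun_add i7
  have e : ∫ x, (1/2*(G (x + y) - G x) + 2*y j*(D x + D (x + y)))^2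
      = 1/4*(∫ x, (G x + G (x + y))^2) + -1*(∫ x, n x*n (x + y))
        + -1*(∫ x, (G x - n x)*G (x + y)) + -1*(∫ x, n x*(G (x + y) - n (x + y)))
        + 2*y j*(∫ x, D x*G (x + y)) + -(2*y j)*(∫ x, G x*D (x + y))
        + 2*y j*(∫ x, G (x + y)*D (x + y)) + -(2*y j)*(∫ x, G x*D x)
        + 4*y j^2*∫ x, (D x + D (x + y))^2 := by
    simp only [← integral_const_mul]
    rw [← integral_add i1 i2, ← integral_add j2 i3, ← integral_add j3 i4, ← integral_add j4 i5,
      ← integral_add j5 i6, ← integral_add j6 i7, ← integral_add j7 i8, ← integral_add (j7.fun_add i8) i9]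
    exact integral_congr_ae (.of_forall fun x => by ring)
  rw [e, s]; ring

lemma sepPd_le (h : Res V z g r d A) : ∃ C : ℝ, 0 ≤ C ∧ ∀ k : ℝ, 0 < k → k ≤ 1 → ∀ y : R4,
    2*r < ‖y‖ → y 0 = 0 → y 1 = 0 →
    ∑ j ∈ {2, 3}, ((∫ x, sepPd g k y j x^2)
        - 1/4*∫ x, (trialPd g k (‖y‖^2) j x + trialPd g k (‖y‖^2) j (x + y))^2)
      ≤ C*(k + ‖y‖^(-(d/2)))*(‖y‖^2)⁻¹ := by
  obtain ⟨C, D⟩ := h.exists_decConsts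
  have hC := D.nonneg
  have hr := h.one_le
  have hd := h.pos
  have hd2 := h.le_half
  obtain ⟨C1, n1, X1⟩ := Dec.cross hr (a := 5/2) (b := 3) num! num! num! num! num!
  obtain ⟨C2, n2, X2⟩ := Dec.cross hr (a := 3 + d) (b := 3) lin! lin! num! num! lin!
  obtain ⟨C3, n3, X3⟩ := Dec.cross hr (a := 2) (b := 3) num! num! num! num! num!
  refine ⟨2*(2*(C1*(C*C) + C2*(C*C)) + 4*(C3*(C*C)) + 8*π^2), pos!, ?_⟩
  intro k hk hk1 y hy h0 h1
  have hJ := newtPd_interaction_nonneg h0 h1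
  have hexp := h.sepPd_expand hk hk1 y
  set L := ‖y‖
  have hL1 : 1 < L := lin!
  have hL0 : 0 < L := lin!
  have hN : 0 ≤ L^2 := pos!
  have hM : (1 + L^2)⁻¹ ≤ (L^2)⁻¹ := inv_anti₀ pos! lin!
  have h2 : L^(-2 : ℝ) = (L^2)⁻¹ := by rw [rpow_neg hL0.le, rpow_two]
  set e := L^(-(d/2)) with he
  have he0 : 0 < e := pos!
  have bR : ∀ (j : Fin 4) {f : R4 → ℝ}, Dec r 3 C f → ∀ z0 : R4, ‖z0‖ = L →
      -(∫ x, (trialPd g k (L^2) j x - newtPd j x)*f (x + z0))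
        ≤ (C1*(C*C) + C2*(C*C))*((k + e)*(L^2)⁻¹) := fun j f hf z0 hz => by
    obtain ⟨i1, c1⟩ := X1 (D.corrPd hk.le hN j) hf z0 (by rwa [hz])
    obtain ⟨i2, c2⟩ := X2 (D.remPd j) hf z0 (by rwa [hz])
    rw [hz] at c1 c2
    have a1 : (1 + L^2)^(-(1/4) : ℝ) ≤ L^(-(1/2) : ℝ) := by
      refine (rpow_le_rpow_of_nonpos pos! (show L^2 ≤ 1 + L^2 by linarith) num!).trans (le_of_eq ?_)
      rw [← rpow_natCast, ← rpow_mul hL0.le]; norm_num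
    have d1 : C1*(C*(k*(1 + L^2)^(-(1/4) : ℝ))*C)*L^(4 - 5/2 - 3 : ℝ)
        ≤ C1*(C*C)*((k + e)*(L^2)⁻¹) := by
      calc _ ≤ C1*(C*(k*L^(-(1/2) : ℝ))*C)*L^(4 - 5/2 - 3 : ℝ) := by gcongr
        _ = C1*(C*C)*(k*(L^(-(1/2) : ℝ)*L^(4 - 5/2 - 3 : ℝ))) := by ring
        _ = C1*(C*C)*(k*(L^2)⁻¹) := by rw [← rpow_add hL0, ← h2]; norm_num
        _ ≤ _ := by gcongr; linarith
    have d2 : C2*(C*C)*L^(4 - (3 + d) - 3) ≤ C2*(C*C)*((k + e)*(L^2)⁻¹) := by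
      refine mul_le_mul_of_nonneg_left ?_ pos!
      calc L^(4 - (3 + d) - 3) ≤ e*(L^2)⁻¹ := by
            rw [← h2, he, ← rpow_add hL0]; exact rpow_le_rpow_of_exponent_le hL1.le lin!
        _ ≤ _ := by gcongr; linarith
    have es : ∫ x, (trialPd g k (L^2) j x - newtPd j x)*f (x + z0)
        = (∫ x, (newtLPd k (L^2) j x - newtPd j x)*f (x + z0)) + ∫ x, (g j x - newtPd j x)*f (x + z0) := by
      rw [← integral_add i1 i2]
      exact integral_congr_ae (.of_forall fun x => by simp only [trialPd]; ring)
    have a := ((neg_le_abs _).trans abs_integral_le_integral_abs).trans (c1.trans d1)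
    have b := ((neg_le_abs _).trans abs_integral_le_integral_abs).trans (c2.trans d2)
    rw [es]; linarith
  have bD : ∀ (j : Fin 4) (z0 : R4), ‖z0‖ = L → |2*y j*∫ x, newtLDeriv k (L^2) x*trialPd g k (L^2) j (x + z0)|
      ≤ 2*(C3*(C*C))*(k*(L^2)⁻¹) := fun j z0 hz => by
    have c3 := (X3 (D.deriv hk.le hN) (D.trialPd hk.le hk1 hN j) z0 (by rwa [hz])).2
    have hyj : |y j| ≤ L := by simpa using PiLp.norm_apply_le y j
    rw [abs_mul, abs_mul, abs_two]
    calc _ ≤ 2*L*(C3*(C*(k*(L^2)⁻¹)*C)*L^(4 - 2 - 3 : ℝ)) := by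
          rw [hz] at c3
          gcongr; exact abs_integral_le_integral_abs.trans (c3.trans (by gcongr))
      _ = _ := by rw [show (4 - 2 - 3 : ℝ) = -1 by norm_num, rpow_neg_one]; field_simp
  have bQ : ∀ j : Fin 4, 4*y j^2*∫ x, (newtLDeriv k (L^2) x + newtLDeriv k (L^2) (x + y))^2
      ≤ 8*π^2*(k*(L^2)⁻¹) := fun j => by
    have hyj : y j^2 ≤ L^2 := by
      rw [← sq_abs]; exact pow_le_pow_left₀ (abs_nonneg _) (by simpa using PiLp.norm_apply_le y j) 2
    have a := (integral_add_comp_sq_le (memLp_newtLDeriv hk hN) y).trans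
      (mul_le_mul_of_nonneg_left (integral_newtLDeriv_sq_le hk hN).2 num!)
    calc _ ≤ 4*L^2*(4*(π^2*k/2*((L^2)^2)⁻¹)) := by
          refine mul_le_mul lin! (a.trans ?_) (integral_nonneg fun x => sq_nonneg _) pos!
          gcongr; linarith
      _ = _ := by field_simp; ring
  have key : ∀ j : Fin 4, (∫ x, sepPd g k y j x^2)
        - 1/4*(∫ x, (trialPd g k (L^2) j x + trialPd g k (L^2) j (x + y))^2)
      ≤ -(∫ x, newtPd j x*newtPd j (x + y)) + (2*(C1*(C*C) + C2*(C*C)) + 4*(C3*(C*C))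
        + 8*π^2)*((k + e)*(L^2)⁻¹) := fun j => by
    have a1 := bR j (D.trialPd hk.le hk1 hN j) y rfl
    have a2 := bR j (D.newtPd j) (-y) (norm_neg y)
    have a3 := (abs_le.1 (bD j y rfl)).2
    have a4 := (abs_le.1 (bD j (-y) (norm_neg y))).1
    have a5 := bQ j
    rw [hexp]
    have : 0 ≤ (4*(C3*(C*C)) + 8*π^2)*(e*(L^2)⁻¹) := pos!
    linarith
  rw [sum_pair (by decide)] at hJ ⊢
  linarith [key 2, key 3]

end Res

lemma integral_newtL_sq_ge (hk : 0 < k) (hk1 : k ≤ 1) (hN : 0 ≤ N) :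
    π^2*(log (1 + N) - 2) ≤ ∫ x, newtL k N x^2 := by
  have hM : 0 < 1 + N := pos!
  obtain ⟨i1, e1⟩ := integral_log_weight (M := 1 + N) lin!
  obtain ⟨i2, e2⟩ := integral_weight hM one_pos
  obtain ⟨i3, e3⟩ := integral_weight one_pos one_pos
  have i4 := (integral_newtL_sq_le hk hN).1
  have i2' := i2.const_mul (1 + N)
  have hle : ∀ᵐ x : R4, (‖x‖^2)⁻¹*(w(x)⁻¹ - (1 + N + ‖x‖^2)⁻¹)
      ≤ newtL k N x^2 + (1 + N)*((‖x‖^2)⁻¹*(1 + N + ‖x‖^2)^(-1 - 1 : ℝ)) + (‖x‖^2)⁻¹*w(x)^(-1 - 1 : ℝ) := by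
    filter_upwards [ae_ne_zero_R4] with x hx
    have hx0 : 0 < ‖x‖^2 := pos!
    have hd : (1 + N)/(N + w(x)) ≤ damp k N w(x) := by
      nth_rw 1 [← rpow_one ((1 + N)/_)]
      exact rpow_le_rpow_of_exponent_ge pos! ((div_le_one pos!).2 lin!) hk1
    have h1 : (w(x)⁻¹*((1 + N)/(N + w(x))))^2 ≤ newtL k N x^2 := by unfold newtL; gcongr
    have hr : ∀ t : ℝ, 0 < t → t^(-1 - 1 : ℝ) = (t^2)⁻¹ := fun t ht => by
      rw [show (-1 - 1 : ℝ) = -2 by norm_num, rpow_neg ht.le, rpow_two]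
    rw [hr _ pos!, hr _ pos!]
    refine le_trans ?_ (add_le_add_left (add_le_add_left h1 _) _)
    generalize ‖x‖^2 = t at hx0
    have e : ((1 + t)⁻¹*((1 + N)/(N + (1 + t))))^2 + (1 + N)*(t⁻¹*((1 + N + t)^2)⁻¹)
        + t⁻¹*((1 + t)^2)⁻¹ - t⁻¹*((1 + t)⁻¹ - (1 + N + t)⁻¹)
        = (2 + 2*N + 4*(N*t) + 5*t + 2*t^2)*(t⁻¹*((1 + t)^2)⁻¹*((1 + N + t)^2)⁻¹) := by
      rw [show N + (1 + t) = 1 + N + t by ring]; field_simp; ring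
    have : 0 ≤ (2 + 2*N + 4*(N*t) + 5*t + 2*t^2)*(t⁻¹*((1 + t)^2)⁻¹*((1 + N + t)^2)⁻¹) := pos!
    linarith
  have := integral_mono_ae i1 ((i4.fun_add i2').fun_add i3) hle
  rw [integral_add (i4.fun_add i2') i3, integral_add i4 i2', integral_const_mul, e1, e2, e3,
    rpow_neg_one, rpow_neg_one] at this
  have e : (1 + N)*(π^2*((1 + N)⁻¹/1)) = π^2 := by field_simp
  rw [e] at this
  simp only [inv_one, div_one, mul_one] at this
  linarith

lemma newtL_le_rpow (hk : 0 ≤ k) (hN : 0 ≤ N) (x : R4) :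
    newtL k N x ≤ (1 + N)^k*w(x)^(-(1 + k)) := by
  have hs : 0 < w(x) := pos!
  rw [newtL, damp, div_rpow pos! pos!, neg_add, rpow_add hs, rpow_neg_one, rpow_neg hs.le]
  calc _ ≤ w(x)⁻¹*((1 + N)^k/w(x)^k) := mul_le_mul_of_nonneg_left (div_le_div_of_nonneg_left pos! pos!
          (rpow_le_rpow hs.le lin! hk)) pos!
    _ = _ := by ring

lemma newtL_overlap_le (hk : 0 < k) (hk1 : k < 1) (hr : 1 ≤ r) :
    ∃ K, ∀ y : R4, 2*r < ‖y‖ → ∫ x, newtL k (‖y‖^2) x*newtL k (‖y‖^2) (x + y) ≤ K := by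
  obtain ⟨C, n, X⟩ := Dec.cross hr (a := 2 + 2*k) (b := 2 + 2*k) lin! lin! lin! lin! lin!
  refine ⟨C*(Dec.vol r*Dec.vol r)*2^(2*k), fun y hy => ?_⟩
  have hL1 : 1 ≤ ‖y‖ := lin!
  have hL0 : 0 < ‖y‖ := lin!
  set N := ‖y‖^2
  have hN : 0 ≤ N := pos!
  have hM : 0 < 1 + N := pos!
  have hd : Dec r (2 + 2*k) (Dec.vol r*(1 + N)^k) (newtL k N) := by
    refine Dec.of_le hr lin! (contDiff_newtL hN).continuous pos! fun x => ?_
    rw [abs_of_pos (newtL_pos hN x), show (2 + 2*k)/2 = 1 + k by ring]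
    exact newtL_le_rpow hk.le hN x
  refine ((le_abs_self _).trans abs_integral_le_integral_abs).trans ((X hd hd y hy).2.trans ?_)
  have hv : 0 ≤ Dec.vol r := by unfold Dec.vol; positivity
  have h1 : (1 + N)^k*(1 + N)^k ≤ 2^(2*k)*‖y‖^(4*k) := by
    rw [← rpow_add hM, ← two_mul, show 4*k = 2*(2*k) by ring, rpow_mul hL0.le, rpow_two,
      ← mul_rpow zero_le_two pos!]
    exact rpow_le_rpow hM.le (by nlinarith) pos!
  calc _ = C*(Dec.vol r*Dec.vol r)*(((1 + N)^k*(1 + N)^k)*‖y‖^(-(4*k))) := by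
        rw [show 4 - (2 + 2*k) - (2 + 2*k) = -(4*k) by ring]; ring
    _ ≤ C*(Dec.vol r*Dec.vol r)*((2^(2*k)*‖y‖^(4*k))*‖y‖^(-(4*k))) := by gcongr
    _ = _ := by rw [mul_assoc (2^(2*k)), ← rpow_add hL0, add_neg_cancel, rpow_zero, mul_one]

namespace Res

lemma norm_sq_le (h : Res V z g r d A) (hk : 0 < k) (hk1 : k < 1) {m : ℝ} (hm : 0 < m) :
    ∃ K, ∀ y : R4, 2*r < ‖y‖ → ∫ x, (trial z k (‖y‖^2) x + trial z k (‖y‖^2) (x + y))^2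
        ≤ (1 + m)*(2*π^2)*log w(y) + K := by
  obtain ⟨K, hK⟩ := newtL_overlap_le hk hk1 h.one_le
  have hw := h.memLp_rem
  refine ⟨(1 + m)*(2*π^2/(2*k) + 2*K) + (1 + m⁻¹)*(4*∫ x, (z x - newt x)^2), fun y hy => ?_⟩
  have hN : 0 ≤ ‖y‖^2 := pos!
  have hu := h.memLp_trial hk hN
  have hn := memLp_newtL hk hN
  have i0 := (hu.add (hu.comp_add y)).integrable_sq
  have i1 := hn.integrable_sq
  have i2 := (hn.comp_add y).integrable_sq
  have i3 := (integrable_mul_two hn (hn.comp_add y)).const_mul 2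
  have i4 := (hw.add (hw.comp_add y)).integrable_sq
  simp only [Pi.add_apply] at i0 i4
  have i5 := ((i1.fun_add i2).fun_add i3).const_mul (1 + m)
  have i6 := i4.const_mul (1 + m⁻¹)
  have e : ∫ x, newtL k (‖y‖^2) (x + y)^2 = ∫ x, newtL k (‖y‖^2) x^2 :=
    integral_add_right_eq_self (fun x => newtL k (‖y‖^2) x^2) y
  have h1 := integral_mono i0 (i5.fun_add i6) fun x => by
    simp only [trial]
    generalize z x - newt x = a, z (x + y) - newt (x + y) = b, newtL k (‖y‖^2) x = c,
      newtL k (‖y‖^2) (x + y) = d0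
    have h2 : 0 ≤ m*(c + d0 - m⁻¹*(a + b))^2 := pos!
    have h3 : m*(c + d0 - m⁻¹*(a + b))^2
        = m*(c + d0)^2 - 2*(c + d0)*(a + b) + m⁻¹*(a + b)^2 := by field_simp; ring
    nlinarith
  rw [integral_add i5 i6, integral_const_mul, integral_const_mul, integral_add (i1.fun_add i2) i3,
    integral_add i1 i2, integral_const_mul, e] at h1
  have h4 := (integral_newtL_sq_le hk hN).2
  have h5 := mul_le_mul_of_nonneg_left (integral_add_comp_sq_le hw y) (show 0 ≤ 1 + m⁻¹ by positivity)
  have h6 : (∫ x, newtL k (‖y‖^2) x^2) + (∫ x, newtL k (‖y‖^2) x^2)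
      + 2*(∫ x, newtL k (‖y‖^2) x*newtL k (‖y‖^2) (x + y))
      ≤ 2*π^2*log w(y) + (2*π^2/(2*k) + 2*K) := by
    have := hK y hy
    have e : 2*(π^2*(log w(y) + 1/(2*k))) = 2*π^2*log w(y) + 2*π^2/(2*k) := by ring
    linarith
  have h7 := mul_le_mul_of_nonneg_left h6 (show 0 ≤ 1 + m by positivity)
  linarith

lemma norm_sq_ge (h : Res V z g r d A) : ∃ K, ∀ k : ℝ, 0 < k → k ≤ 1 → ∀ y : R4,
    π^2/2*log w(y) - K ≤ ∫ x, (trial z k (‖y‖^2) x + trial z k (‖y‖^2) (x + y))^2 := by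
  have hw := h.memLp_rem
  refine ⟨π^2 + 4*∫ x, (z x - newt x)^2, fun k hk hk1 y => ?_⟩
  have hN : 0 ≤ ‖y‖^2 := pos!
  have hu := h.memLp_trial hk hN
  have i0 := (hu.add (hu.comp_add y)).integrable_sq
  have i1 := (memLp_newtL hk hN).integrable_sq.const_mul (1/2)
  have i4 := (hw.add (hw.comp_add y)).integrable_sq
  simp only [Pi.add_apply] at i0 i4
  have h1 := integral_mono i1 (i0.fun_add i4) fun x => by
    have hp := newtL_pos (k := k) hN x
    have hq := newtL_pos (k := k) hN (x + y)
    simp only [trial]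
    generalize z x - newt x = a, z (x + y) - newt (x + y) = b, newtL k (‖y‖^2) x = c at *
    generalize newtL k (‖y‖^2) (x + y) = d0 at *
    nlinarith [sq_nonneg (c + d0 + 2*(a + b)), mul_pos hp hq, sq_nonneg d0]
  rw [integral_add i0 i4, integral_const_mul] at h1
  have h2 := integral_newtL_sq_ge hk hk1 hN
  have h3 := integral_add_comp_sq_le hw y
  linarith

end Res

open Classical in
/-- The class in `L²(ℝ⁴; ℂ)` of a real square-integrable function. -/
def toL2 (f : R4 → ℝ) : L2R4 := if h : MemLp f 2 then MemLp.toLp (fun x => (f x : ℂ)) h.ofReal else 0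

section ToL2

variable {f h : R4 → ℝ}

lemma toL2_eq (hf : MemLp f 2) : toL2 f = MemLp.toLp (fun x => (f x : ℂ)) hf.ofReal := dif_pos hf

lemma toL2_add (hf : MemLp f 2) (hh : MemLp h 2) :
    toL2 (fun x => f x + h x) = toL2 f + toL2 h := by
  rw [toL2_eq hf, toL2_eq hh, toL2_eq (show MemLp (fun x => f x + h x) 2 volume from hf.add hh), ← MemLp.toLp_add]
  congr 1; funext x; simp

lemma toL2_const_mul (c : ℝ) (hf : MemLp f 2) : toL2 (fun x => c*f x) = c • toL2 f := by
  rw [toL2_eq hf, toL2_eq (hf.const_mul c), ← MemLp.toLp_const_smul]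
  congr 1; funext x; simp

lemma norm_toL2_sq (hf : MemLp f 2) : ‖toL2 f‖^2 = ∫ x, f x^2 := by rw [toL2_eq hf, norm_toLp_sq]; simp

lemma edist_toL2 (hf : MemLp f 2) (hh : MemLp h 2) :
    edist (toL2 f) (toL2 h) = eLpNorm (fun x => f x - h x) 2 := by
  rw [toL2_eq hf, toL2_eq hh, Lp.edist_toLp_toLp]
  exact eLpNorm_congr_norm_ae (.of_forall fun x => by rw [Pi.sub_apply, ← Complex.ofReal_sub, norm_real])

lemma tendsto_toL2 {ι : Type*} {l : Filter ι} [l.IsCountablyGenerated] {F : ι → R4 → ℝ} {b : R4 → ℝ}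
    (hF : ∀ i, MemLp (F i) 2) (hf : MemLp f 2) (hb : MemLp b 2) (hle : ∀ᶠ i in l, ∀ x, |F i x| ≤ b x)
    (hfb : ∀ x, |f x| ≤ b x) (hlim : ∀ x, Tendsto (F · x) l (𝓝 (f x))) :
    Tendsto (fun i => toL2 (F i)) l (𝓝 (toL2 f)) := by
  rw [tendsto_iff_edist_tendsto_0]
  simp only [edist_toL2 (hF _) hf]
  refine tendsto_eLpNorm_of_dominated num! num! (fun i => ((hF i).sub hf).1) (hb.add hb)
    (hle.mono fun i hi => .of_forall fun x => ?_) (.of_forall fun x => by simpa using (hlim x).sub_const (f x))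
  exact (abs_sub _ _).trans (add_le_add (hi x) (hfb x))

/-- Differentiation of a dominated family in `L²`. -/
lemma hasDerivAt_toL2 {F F' : ℝ → R4 → ℝ} {b : R4 → ℝ} {t : ℝ} (hF : ∀ t, MemLp (F t) 2)
    (hF' : MemLp (F' t) 2) (hb : MemLp b 2) (hd : ∀ s x, HasDerivAt (F · x) (F' s x) s)
    (hle : ∀ s ∈ ball t 1, ∀ x, |F' s x| ≤ b x) :
    HasDerivAt (fun s => toL2 (F s)) (toL2 (F' t)) t := by
  rw [hasDerivAt_iff_tendsto_slope]
  have e : slope (fun s => toL2 (F s)) t = fun s => toL2 fun x => (s - t)⁻¹*(F s x + -1*F t x) := by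
    funext s
    rw [toL2_const_mul _ (show MemLp (fun x => F s x + -1*F t x) 2 volume from
      (hF s).add ((hF t).const_mul _)), toL2_add (hF s) ((hF t).const_mul _),
      toL2_const_mul _ (hF t), slope_def_module, neg_one_smul, sub_eq_add_neg (toL2 _)]
  rw [e]
  refine tendsto_toL2 (fun s => ((hF s).add ((hF t).const_mul _)).const_mul _) hF' hb ?_
    (hle t (mem_ball_self one_pos)) fun x => ?_
  · filter_upwards [nhdsWithin_le_nhds (ball_mem_nhds t one_pos), self_mem_nhdsWithin] with s hs hst x
    have := (convex_ball t (1 : ℝ)).norm_image_sub_le_of_norm_hasDerivWithin_le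
      (fun s _ => (hd s x).hasDerivWithinAt) (fun s hs => hle s hs x) (mem_ball_self one_pos) hs
    rw [neg_one_mul, ← sub_eq_add_neg, abs_mul, abs_inv, inv_mul_le_iff₀ (abs_pos.2 (sub_ne_zero.2 hst)), mul_comm]
    exact this
  · exact (hasDerivAt_iff_tendsto_slope.1 (hd t x)).congr fun s => by rw [slope_def_field]; ring

lemma continuous_toL2_comp_add (hf : MemLp f 2) : Continuous fun y : R4 => toL2 fun x => f (x + y) := by
  let g : R4 → C(R4, R4) := fun y => ⟨fun x => x + y, by fun_prop⟩
  have hg : Continuous g := ContinuousMap.continuous_of_continuous_uncurry _ (by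
    simp only [g, Function.uncurry_def, ContinuousMap.coe_mk]; fun_prop)
  have hgm : ∀ y, MeasurePreserving (g y) (volume : Measure R4) volume := measurePreserving_add_right volume
  have hc := Continuous.compMeasurePreservingLp (f := fun _ : R4 => toL2 f) (g := g) continuous_const hg hgm
    num!
  refine hc.congr fun y => ?_
  rw [toL2_eq hf, toL2_eq (hf.comp_add y)]; rfl

/-- `a (1 + |x|²)^(-q)` bounds translations by bounded vectors as well. -/
lemma rpow_comp_add_le {q : ℝ} (hq : 0 ≤ q) {x y : R4} (hy : ‖y‖ ≤ R) :
    (1 + ‖x + y‖^2)^(-q) ≤ (2*(1 + R^2))^q*w(x)^(-q) := by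
  have hs : 0 < w(x) := pos!
  have hs' : 0 < 1 + ‖x + y‖^2 := pos!
  rw [rpow_neg hs.le, rpow_neg hs'.le, ← div_eq_mul_inv, ← div_rpow pos! hs.le, ← inv_rpow hs'.le]
  refine rpow_le_rpow pos! ?_ hq
  rw [inv_le_comm₀ hs' pos!, inv_div, div_le_iff₀ pos!]
  have h1 : ‖x‖ ≤ ‖x + y‖ + ‖y‖ := by simpa using norm_sub_le (x + y) y
  have h2 := pow_le_pow_left₀ (norm_nonneg y) hy 2
  nlinarith [sq_nonneg (‖x + y‖ - ‖y‖), pow_le_pow_left₀ (norm_nonneg x) h1 2,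
    mul_nonneg (sq_nonneg R) (sq_nonneg ‖x + y‖)]

lemma memLp_weight_two {q : ℝ} (hq : 1 < q) (C : ℝ) : MemLp (fun x : R4 => |C| *w(x)^(-q)) 2 := by
  have := memLp_of_le_weight (f := fun x : R4 => |C| *w(x)^(-q)) (C := |C|) (a := 2*q) (p := 2)
    (continuous_const.mul (Continuous.rpow_const (by fun_prop) fun x => Or.inl pos!)) num!
    lin! lin! fun x => by rw [abs_of_nonneg pos!]; apply le_of_eq; congr 2; ring
  simpa using this

lemma Test.exists_le_weight (hf : Test f) (j : Fin 4) (q : ℝ) : ∃ C, ∀ x, |pd j f x| ≤ C*w(x)^(-q) := by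
  have hc : Continuous fun x => pd j f x*w(x)^q :=
    (continuous_pd hf.1 j).mul (Continuous.rpow_const (by fun_prop) fun x => Or.inl pos!)
  obtain ⟨C, hC⟩ := hc.bounded_above_of_compact_support
    ((hf.2.fderiv_apply (𝕜 := ℝ) (single j 1)).mul_right (f' := fun x => w(x)^q))
  refine ⟨C, fun x => ?_⟩
  have hs : 0 < w(x) := pos!
  rw [rpow_neg hs.le, ← div_eq_mul_inv, le_div_iff₀ pos!]
  have := hC x
  rwa [norm_mul, norm_eq_abs, norm_of_nonneg pos!] at this

lemma Test.hasDerivAt_toL2_comp_add (hf : Test f) (j : Fin 4) (y : R4) (t : ℝ) :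
    HasDerivAt (fun t : ℝ => toL2 fun x => f (x + (y + t • single j 1)))
      (toL2 fun x => pd j f (x + (y + t • single j 1))) t := by
  obtain ⟨C, hC⟩ := hf.exists_le_weight j (3/2)
  refine hasDerivAt_toL2 (F' := fun t x => pd j f (x + (y + t • single j 1)))
    (fun t => (hf.memLp 2).comp_add _) ((hf.memLp_pd j 2).comp_add _)
    (memLp_weight_two (q := 3/2) num! (|C| *(2*(1 + (‖y‖ + (|t| + 1))^2))^(3/2 : ℝ)))
    (fun s x => ?_) fun s hs x => ?_
  · have h1 : HasDerivAt (fun s : ℝ => x + (y + s • single j (1 : ℝ))) (single j 1) s := by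
      simpa using (((hasDerivAt_id' s).smul_const (single j (1 : ℝ))).const_add y).const_add x
    exact ((hf.1.differentiable one_ne_zero _).hasFDerivAt.comp_hasDerivAt s h1)
  · have hy : ‖y + s • single j (1 : ℝ)‖ ≤ ‖y‖ + (|t| + 1) := by
      refine (norm_add_le _ _).trans (add_le_add_right ?_ _)
      simp only [norm_smul, PiLp.norm_single, norm_one, mul_one, norm_eq_abs]
      have : |s - t| < 1 := hs
      linarith [abs_sub_abs_le_abs_sub s t]
    refine (hC _).trans ((mul_le_mul_of_nonneg_right (le_abs_self C) pos!).trans ?_)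
    rw [abs_of_nonneg (a := |C| *_) pos!, mul_assoc]
    exact mul_le_mul_of_nonneg_left (rpow_comp_add_le num! hy) (abs_nonneg C)

/-- Translation of an `H¹` function is differentiable in `L²`. -/
lemma hasDerivAt_toL2_comp_add {g : Fin 4 → R4 → ℝ} (hf : MemLp f 2) (hg : ∀ j, MemLp (g j) 2)
    (hw : ∀ j, HasWeakPartial j f (g j)) (j : Fin 4) (y : R4) (t : ℝ) :
    HasDerivAt (fun t : ℝ => toL2 fun x => f (x + (y + t • single j 1)))
      (toL2 fun x => g j (x + (y + t • single j 1))) t := by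
  obtain ⟨u, hu, hu1, hu2⟩ := exists_contDiff_approx hf hg hw
  have hut : ∀ n, Test (u n) := fun n => ⟨(hu n).1.of_le (by simp), (hu n).2⟩
  have he0 : ∀ {v w : R4 → ℝ}, MemLp v 2 → MemLp w 2 → ∀ y : R4,
      edist (toL2 fun x => v (x + y)) (toL2 fun x => w (x + y)) = eLpNorm (v - w) 2 := fun hv hw y => by
    rw [edist_toL2 (hv.comp_add y) (hw.comp_add y)]
    have := eLpNorm_comp_measurePreserving (p := 2) (hv.sub hw).1 (measurePreserving_add_right volume y)
    exact this
  refine hasDerivAt_of_tendstoUniformly (l := atTop)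
    (g' := fun t => toL2 fun x => g j (x + (y + t • single j 1)))
    (f' := fun n t => toL2 fun x => pd j (u n) (x + (y + t • single j 1))) ?_
    (.of_forall fun n t => (hut n).hasDerivAt_toL2_comp_add j y t) (fun t => ?_) t
  · rw [EMetric.tendstoUniformly_iff]
    intro e he
    filter_upwards [(hu2 j).eventually_lt_const he] with n hn t
    rwa [edist_comm, he0 ((hut n).memLp_pd j 2) (hg j)]
  · rw [tendsto_iff_edist_tendsto_0]
    simp only [he0 ((hut _).memLp 2) hf]
    exact hu1

end ToL2

variable {c : ℝ}

lemma hasDerivAt_newtL_curve {N : ℝ → ℝ} {z : ℝ → R4} {N' t : ℝ} {j : Fin 4} (hN : HasDerivAt N N' t)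
    (hz : HasDerivAt z (c • single j 1) t) (h0 : 0 ≤ N t) :
    HasDerivAt (fun t => newtL k (N t) (z t)) (c*newtLPd k (N t) j (z t) + N'*newtLDeriv k (N t) (z t)) t := by
  have hs : HasDerivAt (fun t => 1 + ‖z t‖^2) (2*(c*z t j)) t := by
    refine (hz.norm_sq.const_add 1).congr_deriv ?_
    rw [inner_smul_right, inner_single_right]; simp
  have hp : 0 < 1 + ‖z t‖^2 := pos!
  have hq0 : 0 < (1 + N t)/(N t + (1 + ‖z t‖^2)) := pos!
  have hq := ((hN.const_add 1).div (hN.add hs) (show N t + (1 + ‖z t‖^2) ≠ 0 by positivity)).rpow_const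
    (p := k) (Or.inl hq0.ne')
  refine ((hs.inv hp.ne').mul hq).congr_deriv ?_
  simp only [Pi.add_apply, Pi.div_apply, Pi.inv_apply]
  rw [rpow_sub_one hq0.ne', newtLPd, newtLDeriv, newtL, damp]
  generalize ((1 + N t)/(N t + (1 + ‖z t‖^2)))^k = d
  field_simp
  ring

/-- The derivative of `newtL k |l|² (x + c l)` in the direction `l_j`. -/
def newtLine (k c : ℝ) (j : Fin 4) (l x : R4) : ℝ :=
  c*newtLPd k (‖l‖^2) j (x + c • l) + 2*l j*newtLDeriv k (‖l‖^2) (x + c • l)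

lemma hasDerivAt_newtL_line (j : Fin 4) (l x : R4) (t : ℝ) :
    HasDerivAt (fun t : ℝ => newtL k (‖l + t • single j (1 : ℝ)‖^2) (x + c • (l + t • single j 1)))
      (newtLine k c j (l + t • single j 1) x) t := by
  have h1 : HasDerivAt (fun s : ℝ => l + s • single j (1 : ℝ)) (single j 1) t := by
    simpa using ((hasDerivAt_id' t).smul_const (single j (1 : ℝ))).const_add l
  refine (hasDerivAt_newtL_curve h1.norm_sq ((h1.const_smul c).const_add x) pos!).congr_deriv ?_
  rw [newtLine, inner_single_right]; simp

lemma continuous_newtL_param (k c : ℝ) (x : R4) : Continuous fun l : R4 => newtL k (‖l‖^2) (x + c • l) := by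
  unfold newtL damp
  exact (Continuous.inv₀ (by fun_prop) fun l => pos!).mul (Continuous.rpow_const
    (Continuous.div (by fun_prop) (by fun_prop) fun l => pos!) fun l => Or.inl pos!)

lemma continuous_newtLine_param (j : Fin 4) (x : R4) : Continuous fun l => newtLine k c j l x := by
  have h1 := continuous_newtL_param k c x
  have h2 : Continuous fun l : R4 => (1 + ‖x + c • l‖^2)⁻¹ := Continuous.inv₀ (by fun_prop) fun l => pos!
  have h3 : Continuous fun l : R4 => (‖l‖^2 + (1 + ‖x + c • l‖^2))⁻¹ :=
    Continuous.inv₀ (by fun_prop) fun l => pos!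
  have h4 : Continuous fun l : R4 => (w(l)*(‖l‖^2 + (1 + ‖x + c • l‖^2)))⁻¹ :=
    Continuous.inv₀ (by fun_prop) fun l => pos!
  unfold newtLine newtLPd newtLDeriv
  fun_prop

lemma exists_newtLine_le (hk : 0 < k) (hk1 : k ≤ 1/2) (hc : |c| ≤ 1) (R : ℝ) :
    ∃ C : ℝ, ∀ l : R4, ‖l‖ ≤ R → ∀ x, |newtL k (‖l‖^2) (x + c • l)| ≤ |C| *w(x)^(-(1 + k)) ∧
      ∀ j, |newtLine k c j l x| ≤ |C| *w(x)^(-(1 + k)) := by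
  refine ⟨(4 + (1 + 2*R)*(1 + R^2)^k)*(2*(1 + R^2))^(1 + k), fun l hl x => ?_⟩
  have hR : 0 ≤ R := (norm_nonneg _).trans hl
  have hN : 0 ≤ ‖l‖^2 := pos!
  rw [abs_of_nonneg (a := _*_^(1 + k)) pos!, mul_assoc]
  have hcl : ‖c • l‖ ≤ R := by
    rw [norm_smul, norm_eq_abs]; exact (mul_le_of_le_one_left (norm_nonneg _) hc).trans hl
  have hw := rpow_comp_add_le (q := 1 + k) pos! (x := x) hcl
  set z := x + c • l
  have hs := one_le_one_add_sq z
  set W := w(z)^(-(1 + k))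
  have hW0 : 0 < W := pos!
  have h0 := (newtL_pos (k := k) hN z).le
  have h1 : newtL k (‖l‖^2) z ≤ (1 + R^2)^k*W := (newtL_le_rpow hk.le hN z).trans (by gcongr)
  have h2 : |newtLDeriv k (‖l‖^2) z| ≤ (1 + R^2)^k*W := by
    rw [abs_of_nonneg (newtLDeriv_nonneg hk.le hN z), newtLDeriv]
    refine (mul_le_of_le_one_right h0 (mul_le_one₀ lin! pos! ?_)).trans h1
    rw [mul_inv_le_iff₀ pos!]
    nlinarith [sq_nonneg ‖z‖]
  have h3 : ∀ j, |newtLPd k (‖l‖^2) j z| ≤ 4*W := fun j =>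
    (abs_newtLPd_le hk.le lin! hN j z).trans (mul_le_mul_of_nonneg_left
      (rpow_le_rpow_of_exponent_le hs lin!) num!)
  have hK : 0 < (1 + R^2)^k := pos!
  have hKW := mul_pos hK hW0
  have hf : (4 + (1 + 2*R)*(1 + R^2)^k)*W
      ≤ (4 + (1 + 2*R)*(1 + R^2)^k)*((2*(1 + R^2))^(1 + k)*w(x)^(-(1 + k))) := by
    gcongr
  refine ⟨?_, fun j => ?_⟩
  · rw [abs_of_nonneg h0]
    nlinarith [mul_nonneg hR hKW.le]
  · refine le_trans ?_ hf
    have hlj : |l j| ≤ R := le_trans (by simpa using PiLp.norm_apply_le l j) hl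
    refine (abs_add_le _ _).trans ?_
    rw [abs_mul, abs_mul, abs_mul, abs_two]
    have a1 := mul_le_mul hc (h3 j) (abs_nonneg _) zero_le_one
    have a2 := mul_le_mul hlj h2 (abs_nonneg _) hR
    nlinarith

namespace Res

variable (h : Res V z g r d A)
include h

omit h in
/-- The derivative of the translated trial function in the direction `l_j`. -/
def wellPd (g : Fin 4 → R4 → ℝ) (k c : ℝ) (j : Fin 4) (l x : R4) : ℝ :=
  c*(g j (x + c • l) - newtPd j (x + c • l)) + newtLine k c j l x

omit h in
lemma memLp_newtLine (hk : 0 < k) (hk1 : k ≤ 1) (j : Fin 4) (l : R4) : MemLp (newtLine k c j l) 2 := by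
  have hN : 0 ≤ ‖l‖^2 := pos!
  exact (((memLp_two_of_le_weight (continuous_newtLPd hN j) (abs_newtLPd_le hk.le hk1 hN j)).comp_add _).const_mul
    c).add (((memLp_newtLDeriv hk hN).comp_add _).const_mul _)

lemma memLp_remPd (j : Fin 4) : MemLp (fun x => g j x - newtPd j x) 2 := (h.memg j).sub (memLp_newtPd j)

lemma memLp_wellPd (hk : 0 < k) (hk1 : k ≤ 1) (j : Fin 4) (l : R4) : MemLp (wellPd g k c j l) 2 :=
  (((h.memLp_remPd j).comp_add _).const_mul c).add (memLp_newtLine hk hk1 j l)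

lemma continuous_well (hk : 0 < k) (hk1 : k ≤ 1/2) (hc : |c| ≤ 1) :
    Continuous fun l : R4 => toL2 fun x => trial z k (‖l‖^2) (x + c • l) := by
  have hm : ∀ l : R4, MemLp (fun x => newtL k (‖l‖^2) (x + c • l)) 2 := fun l =>
    (memLp_newtL hk pos!).comp_add _
  refine (((continuous_toL2_comp_add h.memLp_rem).comp (continuous_const_smul c)).add
    (g := fun l => toL2 fun x => newtL k (‖l‖^2) (x + c • l)) ?_).congr fun l =>
    (toL2_add (h.memLp_rem.comp_add _) (hm l)).symm
  refine continuous_iff_continuousAt.2 fun l => ?_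
  obtain ⟨C, hC⟩ := exists_newtLine_le hk hk1 hc (‖l‖ + 1)
  refine tendsto_toL2 hm (hm l) (memLp_weight_two (q := 1 + k) lin! C) ?_
    (fun x => (hC l lin! x).1) fun x => (continuous_newtL_param k c x).continuousAt
  filter_upwards [continuous_norm.continuousAt.eventually_lt_const (lt_add_one ‖l‖)] with k0 hk0 x
  exact (hC k0 hk0.le x).1

lemma continuous_wellPd (hk : 0 < k) (hk1 : k ≤ 1/2) (hc : |c| ≤ 1) (j : Fin 4) :
    Continuous fun l : R4 => toL2 (wellPd g k c j l) := by
  have hm : ∀ l : R4, MemLp (newtLine k c j l) 2 := memLp_newtLine hk lin! j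
  refine ((((continuous_toL2_comp_add (h.memLp_remPd j)).comp (continuous_const_smul c)).const_smul c).add
    (g := fun l => toL2 (newtLine k c j l)) ?_).congr fun l => by
      change c • toL2 (fun x => g j (x + c • l) - newtPd j (x + c • l)) + toL2 (newtLine k c j l) = _
      rw [← toL2_const_mul c ((h.memLp_remPd j).comp_add _)]
      exact (toL2_add (((h.memLp_remPd j).comp_add _).const_mul c) (hm l)).symm
  refine continuous_iff_continuousAt.2 fun l => ?_
  obtain ⟨C, hC⟩ := exists_newtLine_le hk hk1 hc (‖l‖ + 1)
  refine tendsto_toL2 hm (hm l) (memLp_weight_two (q := 1 + k) lin! C) ?_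
    (fun x => (hC l lin! x).2 j) fun x => (continuous_newtLine_param j x).continuousAt
  filter_upwards [continuous_norm.continuousAt.eventually_lt_const (lt_add_one ‖l‖)] with k0 hk0 x
  exact (hC k0 hk0.le x).2 j

lemma hasDerivAt_well (hk : 0 < k) (hk1 : k ≤ 1/2) (hc : |c| ≤ 1) (j : Fin 4) (l : R4) :
    HasDerivAt (fun t : ℝ => toL2 fun x => trial z k (‖l + t • single j (1 : ℝ)‖^2)
      (x + c • (l + t • single j 1))) (toL2 (wellPd g k c j l)) 0 := by
  have hm : ∀ l : R4, MemLp (fun x => newtL k (‖l‖^2) (x + c • l)) 2 := fun l =>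
    (memLp_newtL hk pos!).comp_add _
  obtain ⟨C, hC⟩ := exists_newtLine_le hk hk1 hc (‖l‖ + 1)
  have h1 := hasDerivAt_toL2 (t := 0) (fun t => hm (l + t • single j (1 : ℝ)))
    (memLp_newtLine hk lin! j _) (memLp_weight_two (q := 1 + k) lin! C)
    (fun s x => hasDerivAt_newtL_line j l x s) fun s hs x => (hC _ (by
      refine (norm_add_le _ _).trans (add_le_add_right ?_ _)
      simp only [norm_smul, PiLp.norm_single, norm_one, mul_one, norm_eq_abs]
      simpa using (mem_ball.1 hs).le) x).2 j
  have hw : ∀ j, HasWeakPartial j (fun x => z x - newt x) (fun x => g j x - newtPd j x) := fun j => by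
    have h1 : HasWeakPartial j newt (newtPd j) := by
      rw [← pd_newt]; exact HasWeakPartial.of_contDiff (contDiff_newt.of_le (by simp))
    simpa only [neg_mul, one_mul, ← sub_eq_add_neg] using (h.hasWeakPartial j).add_const_mul h1 (-1)
  have h2 := hasDerivAt_toL2_comp_add h.memLp_rem h.memLp_remPd hw j (c • l) (c*0)
  have h3 := (h2.scomp (0 : ℝ) ((hasDerivAt_id' (0 : ℝ)).const_mul c)).add h1
  rw [zero_smul, add_zero, mul_zero, zero_smul, add_zero, mul_one,
    ← toL2_const_mul c ((h.memLp_remPd j).comp_add _), ← toL2_add (((h.memLp_remPd j).comp_add _).const_mul c)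
    (memLp_newtLine hk lin! j _)] at h3
  refine h3.congr_of_eventuallyEq (.of_forall fun t => ?_)
  simp only [Pi.add_apply, Function.comp]
  rw [mul_smul, ← smul_add, ← toL2_add (h.memLp_rem.comp_add _) (hm _)]
  rfl

end Res

lemma memL2loc_of_continuous {n : ℕ} {F : Type*} [NormedAddCommGroup F] {f : EuclideanSpace ℝ (Fin n) → F}
    (hf : Continuous f) : MemL2loc f := fun K hK => by
  obtain ⟨C, hC⟩ := hK.exists_bound_of_continuousOn hf.continuousOn
  have : IsFiniteMeasure (volume.restrict K) := ⟨by! hK.measure_lt_top⟩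
  exact .of_bound hf.aestronglyMeasurable C ((ae_restrict_iff' hK.measurableSet).2 (.of_forall hC))

/-- A smooth function equal to `s^(-1/2)` for `s ≥ 1`. -/
def nrmz (s : ℝ) : ℝ := (√(1 + smoothTransition s*(s - 1)))⁻¹

lemma nrmz_arg_pos (s : ℝ) : 0 < 1 + smoothTransition s*(s - 1) := by
  have h0 := smoothTransition.nonneg s
  have h1 := smoothTransition.le_one s
  rcases le_or_gt s 0 with h | h
  · rw [smoothTransition.zero_of_nonpos h]; simp
  · rcases le_total s 1 with h' | h' <;> nlinarith

lemma contDiff_nrmz : ContDiff ℝ 1 nrmz := by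
  have h : ContDiff ℝ 1 fun s : ℝ => 1 + smoothTransition s*(s - 1) :=
    contDiff_const.add ((smoothTransition.contDiff (n := 1)).mul (contDiff_id.sub contDiff_const))
  exact (h.sqrt fun s => (nrmz_arg_pos s).ne').inv fun s => (sqrt_pos.2 (nrmz_arg_pos s)).ne'

lemma nrmz_of_one_le (hs : 1 ≤ s) : nrmz s = (√s)⁻¹ := by
  rw [nrmz, smoothTransition.one_of_one_le hs]; congr 2; ring

lemma deriv_nrmz (hs : 1 < s) : deriv nrmz s = -(1/2*((√s)^3)⁻¹) := by
  have h0 : 0 < √s := sqrt_pos.2 lin!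
  have h1 : HasDerivAt (fun s => (√s)⁻¹) (-(1/2*((√s)^3)⁻¹)) s :=
    ((hasDerivAt_sqrt lin!).inv h0.ne').congr_deriv (by field_simp)
  exact (h1.congr_of_eventuallyEq ((eventually_gt_nhds hs).mono fun t ht => nrmz_of_one_le ht.le)).deriv

lemma norm_nrmz_deriv_le {E : Type*} [NormedAddCommGroup E] [InnerProductSpace ℝ E] {u v : E} (hu : 1 < ‖u‖) :
    ‖nrmz (‖u‖^2) • v + (deriv nrmz (‖u‖^2)*(2*inner ℝ u v)) • u‖^2 ≤ (‖u‖^2)⁻¹*‖v‖^2 := by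
  have h1 : 1 < ‖u‖^2 := by nlinarith
  have h0 : 0 < ‖u‖ := lin!
  rw [nrmz_of_one_le h1.le, deriv_nrmz h1, sqrt_sq h0.le, norm_add_sq_real, norm_smul, norm_smul,
    inner_smul_left, inner_smul_right, mul_pow, mul_pow, norm_eq_abs, norm_eq_abs, sq_abs, sq_abs,
    real_inner_comm u v]
  have : (‖u‖⁻¹)^2*‖v‖^2 + 2*(‖u‖⁻¹*(-(1/2*(‖u‖^3)⁻¹)*(2*inner ℝ u v)*inner ℝ u v))
      + (-(1/2*(‖u‖^3)⁻¹)*(2*inner ℝ u v))^2*‖u‖^2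
      = (‖u‖^2)⁻¹*‖v‖^2 - (inner ℝ u v*(‖u‖^2)⁻¹)^2 := by field_simp; ring
  simp only [conj_trivial]
  nlinarith [sq_nonneg (inner ℝ u v*(‖u‖^2)⁻¹)]

lemma hasWeakPartial_toL2 {g : R4 → ℝ} {j : Fin 4} (hf : MemLp f 2) (hg : MemLp g 2)
    (hw : HasWeakPartial j f g) : HasWeakPartial j ⇑(toL2 f) ⇑(toL2 g) := by
  rw [toL2_eq hf, toL2_eq hg]
  exact hw.ofReal.congr_ae (MemLp.coeFn_toLp _).symm (MemLp.coeFn_toLp _).symm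

lemma HasWeakPartial.const_mul {g : R4 → ℝ} {j : Fin 4} (hw : HasWeakPartial j f g) (a : ℝ) :
    HasWeakPartial j (fun x => a*f x) (fun x => a*g x) := by
  have := hw.add_const_mul hw (a - 1)
  simpa only [show ∀ t : ℝ, t + (a - 1)*t = a*t from fun t => by ring] using this

lemma energy_toL2 (W : R4 → ℝ) {g : Fin 4 → R4 → ℝ} (hf : MemLp f 2) (hg : ∀ j, MemLp (g j) 2)
    (hw : ∀ j, HasWeakPartial j f (g j)) (a : ℝ) :
    energy W (a • toL2 f) = a^2*(∑ j, (∫ x, g j x^2) + ∫ x, W x*f x^2) := by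
  rw [← toL2_const_mul a hf, toL2_eq (hf.const_mul a), energy_mkH1 W _ (fun j => ((hg j).const_mul a).ofReal)
    fun j => ((hw j).const_mul a).ofReal, mul_add, mul_sum]
  simp only [← integral_const_mul, Complex.coe_algebraMap, norm_real, norm_eq_abs, sq_abs, mul_pow,
    mul_left_comm]

lemma sepVec_add (r : R2) (t : ℝ) (i : Fin 2) : sepVec (r + t • single i 1)
    = sepVec r + t • single (Fin.natAdd 2 i) 1 := by
  ext k; fin_cases i <;> fin_cases k <;> simp [sepVec]

lemma norm_sepVec (r : R2) : ‖sepVec r‖ = ‖r‖ := by simp [norm_eq, sepVec, Fin.sum_univ_four]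

lemma continuous_sepVec : Continuous sepVec := by
  refine (PiLp.continuous_toLp 2 _).comp (continuous_pi fun k => ?_)
  fin_cases k <;> simp <;> fun_prop

namespace Res

variable (h : Res V z g r d A)
include h

omit h in
/-- The two-centre trial function. -/
def pair (z : R4 → ℝ) (k : ℝ) (l x : R4) : ℝ :=
  trial z k (‖l‖^2) (x + (1/2 : ℝ) • l) + trial z k (‖l‖^2) (x + (-(1/2) : ℝ) • l)

omit h in
def pairPd (g : Fin 4 → R4 → ℝ) (k : ℝ) (j : Fin 4) (l x : R4) : ℝ :=
  trialPd g k (‖l‖^2) j (x + (1/2 : ℝ) • l) + trialPd g k (‖l‖^2) j (x + (-(1/2) : ℝ) • l)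

omit h in
lemma shift_add (l x : R4) : x + (1/2 : ℝ) • l + (1/2 : ℝ) • l = x + l := by module

omit h in
lemma shift_sub (l x : R4) : x + (1/2 : ℝ) • l + (-(1/2) : ℝ) • l = x := by module

lemma memLp_pair (hk : 0 < k) (l : R4) : MemLp (pair z k l) 2 :=
  ((h.memLp_trial hk pos!).comp_add _).add ((h.memLp_trial hk pos!).comp_add _)

lemma memLp_pairPd (hk : 0 < k) (hk1 : k ≤ 1) (l : R4) (j : Fin 4) : MemLp (pairPd g k j l) 2 :=
  ((h.memLp_trialPd hk.le hk1 pos! j).comp_add _).add ((h.memLp_trialPd hk.le hk1 pos! j).comp_add _)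

lemma hasWeakPartial_pair (l : R4) (j : Fin 4) :
    HasWeakPartial j (pair z k l) (pairPd g k j l) := by
  have := h.hasWeakPartial_trial (k := k) (N := ‖l‖^2) pos! j
  have := (this.comp_add ((1/2 : ℝ) • l)).add_const_mul (this.comp_add ((-(1/2) : ℝ) • l)) 1
  simp only [one_mul] at this
  exact this

lemma norm_pair_sq (hk : 0 < k) (l : R4) : ‖toL2 (pair z k l)‖^2
    = ∫ x, (trial z k (‖l‖^2) x + trial z k (‖l‖^2) (x + l))^2 := by
  rw [norm_toL2_sq (h.memLp_pair hk l), ← integral_add_right_eq_self _ ((1/2 : ℝ) • l)]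
  simp only [pair, shift_add, shift_sub, add_comm (trial z k (‖l‖^2) (_ + l))]

omit h in
lemma integral_pairPd_sq (l : R4) (j : Fin 4) : ∫ x, pairPd g k j l x^2
    = ∫ x, (trialPd g k (‖l‖^2) j x + trialPd g k (‖l‖^2) j (x + l))^2 := by
  rw [← integral_add_right_eq_self _ ((1/2 : ℝ) • l)]
  simp only [pairPd, shift_add, shift_sub, add_comm (trialPd g k (‖l‖^2) j (_ + l))]

omit h in
lemma integral_doubleWell_pair (l : R4) : ∫ x, doubleWell V l x*pair z k l x^2
    = ∫ x, (V x + V (x + l))*(trial z k (‖l‖^2) x + trial z k (‖l‖^2) (x + l))^2 := by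
  rw [← integral_add_right_eq_self _ ((1/2 : ℝ) • l)]
  simp only [doubleWell, pair, shift_add, shift_sub, add_sub_cancel_right, add_comm (trial z k (‖l‖^2) (_ + l))]

omit h in
/-- The derivative of the two-centre trial function in the direction `l_j`. -/
def pairDeriv (g : Fin 4 → R4 → ℝ) (k : ℝ) (j : Fin 4) (l : R4) : L2R4 :=
  toL2 (wellPd g k (1/2) j l) + toL2 (wellPd g k (-(1/2)) j l)

lemma toL2_pair (hk : 0 < k) (l : R4) : toL2 (pair z k l)
    = (toL2 fun x => trial z k (‖l‖^2) (x + (1/2 : ℝ) • l))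
      + toL2 fun x => trial z k (‖l‖^2) (x + (-(1/2) : ℝ) • l) :=
  toL2_add ((h.memLp_trial hk pos!).comp_add _) ((h.memLp_trial hk pos!).comp_add _)

lemma norm_pairDeriv_sq (hk : 0 < k) (hk1 : k ≤ 1) (j : Fin 4) (l : R4) :
    ‖pairDeriv g k j l‖^2 = ∫ x, sepPd g k l j x^2 := by
  have hm := fun c => h.memLp_wellPd (c := c) hk hk1 j l
  rw [pairDeriv, ← toL2_add (hm _) (hm _), norm_toL2_sq (show MemLp (fun x => wellPd g k (1/2) j l x
    + wellPd g k (-(1/2)) j l x) 2 volume from (hm _).add (hm _)), ← integral_add_right_eq_self _ ((1/2 : ℝ) • l)]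
  refine integral_congr_ae (.of_forall fun x => ?_)
  simp only [wellPd, newtLine, sepPd, trialPd, shift_add, shift_sub]
  ring

lemma continuous_pair (hk : 0 < k) (hk1 : k ≤ 1/2) :
    Continuous fun l => toL2 (pair z k l) := by
  simp only [h.toL2_pair hk]
  exact (h.continuous_well hk hk1 (by norm_num [abs_le])).add (h.continuous_well hk hk1 (by norm_num [abs_le]))

lemma continuous_pairDeriv (hk : 0 < k) (hk1 : k ≤ 1/2) (j : Fin 4) : Continuous (pairDeriv g k j) :=
  (h.continuous_wellPd hk hk1 (by norm_num [abs_le]) j).add (h.continuous_wellPd hk hk1 (by norm_num [abs_le]) j)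

lemma hasDerivAt_pair (hk : 0 < k) (hk1 : k ≤ 1/2) (j : Fin 4) (l : R4) :
    HasDerivAt (fun t : ℝ => toL2 (pair z k (l + t • single j 1))) (pairDeriv g k j l) 0 := by
  simp only [h.toL2_pair hk]
  exact (h.hasDerivAt_well hk hk1 (by norm_num [abs_le]) j l).add (h.hasDerivAt_well hk hk1 (by norm_num [abs_le]) j l)

end Res

namespace Res

variable (h : Res V z g r d A)
include h

omit h in
/-- The normalized two-centre trial function. -/
def state (z : R4 → ℝ) (k : ℝ) (l : R4) : L2R4 := nrmz (‖toL2 (pair z k l)‖^2) • toL2 (pair z k l)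

omit h in
def stateDeriv (z : R4 → ℝ) (g : Fin 4 → R4 → ℝ) (k : ℝ) (j : Fin 4) (l : R4) : L2R4 :=
  nrmz (‖toL2 (pair z k l)‖^2) • pairDeriv g k j l
    + (deriv nrmz (‖toL2 (pair z k l)‖^2)*(2*inner ℝ (toL2 (pair z k l)) (pairDeriv g k j l)))
      • toL2 (pair z k l)

lemma hasWeakPartial_state (hk : 0 < k) (hk1 : k ≤ 1) (l : R4) (j : Fin 4) :
    HasWeakPartial j ⇑(state z k l) ⇑(nrmz (‖toL2 (pair z k l)‖^2) • toL2 (pairPd g k j l)) := by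
  rw [state, ← toL2_const_mul _ (h.memLp_pair hk l), ← toL2_const_mul _ (h.memLp_pairPd hk hk1 l j)]
  exact hasWeakPartial_toL2 ((h.memLp_pair hk l).const_mul _) ((h.memLp_pairPd hk hk1 l j).const_mul _)
    ((h.hasWeakPartial_pair l j).const_mul _)

lemma continuous_state (hk : 0 < k) (hk1 : k ≤ 1/2) : Continuous (state z k) :=
  (contDiff_nrmz.continuous.comp ((h.continuous_pair hk hk1).norm.pow 2)).smul (h.continuous_pair hk hk1)

lemma continuous_stateDeriv (hk : 0 < k) (hk1 : k ≤ 1/2) (j : Fin 4) :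
    Continuous (stateDeriv z g k j) := by
  have h1 := h.continuous_pair hk hk1
  have h2 := h.continuous_pairDeriv hk hk1 j
  exact ((contDiff_nrmz.continuous.comp (h1.norm.pow 2)).smul h2).add
    ((((contDiff_nrmz.continuous_deriv le_rfl).comp (h1.norm.pow 2)).mul
      (continuous_const.mul (h1.inner h2))).smul h1)

lemma hasDerivAt_state (hk : 0 < k) (hk1 : k ≤ 1/2) (j : Fin 4) (l : R4) :
    HasDerivAt (fun t : ℝ => state z k (l + t • single j 1)) (stateDeriv z g k j l) 0 := by
  have h1 := h.hasDerivAt_pair hk hk1 j l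
  have h2 := ((contDiff_nrmz.differentiable one_ne_zero _).hasDerivAt.comp (0 : ℝ) h1.norm_sq).smul h1
  simp only [zero_smul, add_zero, Function.comp] at h2
  exact h2

lemma hasWeakPartial_state_sepVec (hk : 0 < k) (hk1 : k ≤ 1/2) (i : Fin 2) :
    HasWeakPartial i (fun r0 : R2 => state z k (sepVec r0)) fun r0 => stateDeriv z g k (Fin.natAdd 2 i) (sepVec r0) :=
  HasWeakPartial.of_hasLineDerivAt ((h.continuous_state hk hk1).comp continuous_sepVec)
    ((h.continuous_stateDeriv hk hk1 _).comp continuous_sepVec) fun r0 => by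
      have := h.hasDerivAt_state hk hk1 (Fin.natAdd 2 i) (sepVec r0)
      simpa only [HasLineDerivAt, sepVec_add] using this

lemma norm_stateDeriv_sq_le (hk : 0 < k) (hk1 : k ≤ 1) (j : Fin 4) {l : R4} (hn : 1 < ‖toL2 (pair z k l)‖) :
    ‖stateDeriv z g k j l‖^2 ≤ (‖toL2 (pair z k l)‖^2)⁻¹*∫ x, sepPd g k l j x^2 := by
  rw [← h.norm_pairDeriv_sq hk hk1]; exact norm_nrmz_deriv_le hn

end Res

lemma normalized_energy_le {E n l e0 P : ℝ} (he : 0 < e0) (he1 : e0 ≤ 1) (hee : e0 ≤ e) (hn : 0 < n) (hl : 0 < l)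
    (hs : 0 ≤ s) (hP : 0 < P) (hE : E ≤ -((8 - e0)*P)*s) (hn2 : n ≤ (4 + e0)*(P*l)) :
    n⁻¹*E ≤ -(2 - e)*s*l⁻¹ := by
  have h3 : (2 - e)*n ≤ (8 - e0)*P*l := by
    have h5 := mul_le_mul_of_nonneg_left hn2 (show 0 ≤ 2 - e0 by linarith)
    have h6 := mul_le_mul_of_nonneg_right (show 2 - e ≤ 2 - e0 by linarith) hn.le
    have h7 : 0 ≤ (e0 + e0^2)*(P*l) := pos!
    linarith
  have h4 : (2 - e)*l⁻¹ ≤ n⁻¹*((8 - e0)*P) := by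
    rw [← div_eq_mul_inv, inv_mul_eq_div, div_le_div_iff₀ hl hn]; linarith
  have h8 := mul_le_mul_of_nonneg_left hE (inv_pos.2 hn).le
  have h9 := mul_le_mul_of_nonneg_right h4 hs
  linarith

lemma norm_arith {n L K₁ K₂ : ℝ} (he : 0 < e) (hL : 1 ≤ L) (h1 : 1 ≤ log L) (h2 : K₂ ≤ log L)
    (hK : ((1 + e/8)*(2*π^2)*log 2 + K₁)/e ≤ log L)
    (hlow : π^2/2*log (1 + L^2) - K₂ ≤ n)
    (hup : n ≤ (1 + e/8)*(2*π^2)*log (1 + L^2) + K₁) :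
    π^2/2*log L ≤ n ∧ n ≤ (4 + e)*(π^2*log L) := by
  have hpi : 9 < π^2 := by nlinarith [pi_gt_three]
  have hl1 : 2*log L ≤ log (1 + L^2) := by
    have := log_le_log (x := L^2) (y := 1 + L^2) pos! lin!
    rwa [log_pow, Nat.cast_ofNat] at this
  have hl2 : log (1 + L^2) ≤ log 2 + 2*log L := by
    have := log_le_log (x := 1 + L^2) (y := 2*L^2) pos! (by nlinarith)
    rwa [log_mul two_ne_zero pos!, log_pow, Nat.cast_ofNat] at this
  rw [div_le_iff₀ he] at hK
  have h3 := mul_le_mul_of_nonneg_right hpi.le (show 0 ≤ log L by linarith)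
  refine ⟨?_, ?_⟩
  · have := mul_le_mul_of_nonneg_left hl1 (show 0 ≤ π^2/2 by positivity)
    linarith
  · have q1 := mul_le_mul_of_nonneg_left hl2 (show 0 ≤ (1 + e/8)*(2*π^2) by positivity)
    have q2 := mul_le_mul_of_nonneg_left h3 he.le
    linarith [mul_pos he (show 0 < log L by linarith)]

theorem lemma3p3 (V : R4 → ℝ) (hV : IsShortRange V) (hres : HasVirtualLevel V)
    (ε : ℝ) (hε : 0 < ε) :
    ∃ L₀ : ℝ, 0 < L₀ ∧ ∃ Φ : R4 → L2R4,
      (∀ ℓ : R4, MemH1 (Φ ℓ)) ∧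
      (∀ ℓ : R4, L₀ < ‖ℓ‖ →
        ‖Φ ℓ‖ = 1 ∧
        energy (doubleWell V ℓ) (Φ ℓ) ≤ -(2 - ε) * (‖ℓ‖ ^ 2)⁻¹ * (Real.log ‖ℓ‖)⁻¹) ∧
      -- `r ↦ Φ (0, 0, r)` is in `H¹_loc(ℝ²; L²(ℝ⁴))` with weak gradient `(D 0, D 1)`
      MemL2loc (fun r : R2 => Φ (sepVec r)) ∧
      ∃ D : Fin 2 → R2 → L2R4,
        (∀ j : Fin 2, MemL2loc (D j) ∧ HasWeakPartial j (fun r : R2 => Φ (sepVec r)) (D j)) ∧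
        ∀ r : R2, L₀ < ‖r‖ →
          (‖D 0 r‖ ^ 2 + ‖D 1 r‖ ^ 2)
              - 1 / 4 * (‖weakPartial 2 (Φ (sepVec r))‖ ^ 2
                  + ‖weakPartial 3 (Φ (sepVec r))‖ ^ 2)
            ≤ (2 / 3 + ε) * (‖r‖ ^ 2)⁻¹ * (Real.log ‖r‖)⁻¹ := by
  obtain ⟨φ, g, ρ, δ, A, h⟩ := exists_res hV hres
  obtain ⟨C₁, hC₁, hE⟩ := h.energy_le
  obtain ⟨C₂, hC₂, hS⟩ := h.sepPd_le
  obtain ⟨K₂, hlow⟩ := h.norm_sq_ge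
  have hδ := h.pos
  have hpi : 9 < π^2 := by nlinarith [pi_gt_three]
  set e := min ε 1
  have he0 : 0 < e := pos!
  have he1 : e ≤ 1 := min_le_right _ _
  set κ := e/(4*(1 + C₁ + C₂))
  have hκ : 0 < κ := pos!
  have hκe : κ*(4*(1 + C₁ + C₂)) = e := div_mul_cancel₀ _ pos!
  have p1 := mul_nonneg hκ.le hC₁
  have p2 := mul_nonneg hκ.le hC₂
  have hκ1 : κ ≤ 1/2 := lin!
  obtain ⟨K₁, hup⟩ := h.norm_sq_le hκ lin! (m := e/8) pos!
  have hev : ∀ᶠ L : ℝ in atTop, 2*ρ < L ∧ 1 ≤ L ∧ L^(-(δ/2)) ≤ κ ∧ 1 ≤ log L ∧ K₂ ≤ log L ∧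
      ((1 + e/8)*(2*π^2)*log 2 + K₁)/e ≤ log L := by
    filter_upwards [eventually_gt_atTop (2*ρ), eventually_ge_atTop 1,
      (tendsto_rpow_neg_atTop (show 0 < δ/2 by linarith)).eventually_le_const hκ,
      tendsto_log_atTop.eventually_ge_atTop 1, tendsto_log_atTop.eventually_ge_atTop K₂,
      tendsto_log_atTop.eventually_ge_atTop _] with L a b c d f g using ⟨a, b, c, d, f, g⟩
  obtain ⟨L₀, hL₀⟩ := eventually_atTop.1 hev
  have key : ∀ ℓ : R4, max L₀ 1 < ‖ℓ‖ → 2*ρ < ‖ℓ‖ ∧ κ + ‖ℓ‖^(-(δ/2)) ≤ 2*κ ∧ 1 ≤ log ‖ℓ‖ ∧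
      π^2/2*log ‖ℓ‖ ≤ ‖toL2 (Res.pair φ κ ℓ)‖^2 ∧
      ‖toL2 (Res.pair φ κ ℓ)‖^2 ≤ (4 + e)*(π^2*log ‖ℓ‖) ∧ 1 < ‖toL2 (Res.pair φ κ ℓ)‖ := by
    intro ℓ hℓ
    obtain ⟨a, b, c, d, f, k⟩ := hL₀ ‖ℓ‖ ((le_max_left _ _).trans hℓ.le)
    have n1 := hlow κ hκ lin! ℓ
    have n2 := hup ℓ a
    rw [← h.norm_pair_sq hκ] at n1 n2
    obtain ⟨m1, m2⟩ := norm_arith he0 b d f k n1 n2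
    refine ⟨a, lin!, d, m1, m2, lt_of_pow_lt_pow_left₀ 2 (norm_nonneg _) ?_⟩
    linarith [mul_le_mul_of_nonneg_right hpi.le (show 0 ≤ log ‖ℓ‖ by linarith)]
  have hsq : ∀ ℓ : R4, max L₀ 1 < ‖ℓ‖ → nrmz (‖toL2 (Res.pair φ κ ℓ)‖^2) = ‖toL2 (Res.pair φ κ ℓ)‖⁻¹ :=
    fun ℓ hℓ => by
      have h1 := (key ℓ hℓ).2.2.2.2.2
      rw [nrmz_of_one_le (one_le_pow₀ h1.le), sqrt_sq (norm_nonneg _)]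
  refine ⟨max L₀ 1, pos!, Res.state φ κ, fun ℓ j => ⟨_, h.hasWeakPartial_state hκ lin! ℓ j⟩,
    fun ℓ hℓ => ?_, memL2loc_of_continuous ((h.continuous_state hκ hκ1).comp continuous_sepVec),
    fun i r => Res.stateDeriv φ g κ (Fin.natAdd 2 i) (sepVec r), fun i =>
      ⟨memL2loc_of_continuous ((h.continuous_stateDeriv hκ hκ1 _).comp continuous_sepVec),
        h.hasWeakPartial_state_sepVec hκ hκ1 i⟩, fun r hr => ?_⟩
  · obtain ⟨a, b, d, m1, m2, m3⟩ := key ℓ hℓ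
    have hn : 0 < ‖toL2 (Res.pair φ κ ℓ)‖ := lin!
    have hL : 0 < ‖ℓ‖ := lt_of_le_of_lt pos! hℓ
    refine ⟨?_, ?_⟩
    · rw [Res.state, hsq ℓ hℓ, norm_smul, norm_inv, norm_norm, inv_mul_cancel₀ hn.ne']
    · have h1 := hE κ hκ lin! ℓ a
      rw [Res.state, energy_toL2 _ (h.memLp_pair hκ ℓ) (h.memLp_pairPd hκ lin! ℓ)
        (h.hasWeakPartial_pair ℓ), hsq ℓ hℓ, inv_pow, Res.integral_doubleWell_pair]
      simp only [Res.integral_pairPd_sq]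
      have h2 : -(8*π^2) + C₁*(κ + ‖ℓ‖^(-(δ/2))) ≤ -((8 - e)*π^2) := by
        have h3 := mul_le_mul_of_nonneg_left b hC₁
        have h4 : e ≤ e*π^2 := le_mul_of_one_le_right he0.le lin!
        linarith
      exact normalized_energy_le he0 he1 (min_le_left ε 1) pos! lin! pos!
        pos! (h1.trans (mul_le_mul_of_nonneg_right h2 pos!)) m2
  · rw [← norm_sepVec] at hr ⊢
    set ℓ := sepVec r with hℓ
    obtain ⟨a, b, d, m1, m2, m3⟩ := key ℓ hr
    have h1 := hS κ hκ lin! ℓ a (by simp [hℓ, sepVec]) (by simp [hℓ, sepVec])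
    rw [weakPartial_eq (h.hasWeakPartial_state hκ lin! ℓ 2),
      weakPartial_eq (h.hasWeakPartial_state hκ lin! ℓ 3), norm_smul, norm_smul, mul_pow, mul_pow,
      hsq ℓ hr, norm_inv, norm_norm, inv_pow, norm_toL2_sq (h.memLp_pairPd hκ lin! ℓ 2),
      norm_toL2_sq (h.memLp_pairPd hκ lin! ℓ 3), Res.integral_pairPd_sq, Res.integral_pairPd_sq]
    have d0 : ‖Res.stateDeriv φ g κ (Fin.natAdd 2 (0 : Fin 2)) ℓ‖^2 ≤ _ :=
      h.norm_stateDeriv_sq_le hκ lin! 2 m3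
    have d1 : ‖Res.stateDeriv φ g κ (Fin.natAdd 2 (1 : Fin 2)) ℓ‖^2 ≤ _ :=
      h.norm_stateDeriv_sq_le hκ lin! 3 m3
    rw [sum_pair (by decide)] at h1
    have h2 : C₂*(κ + ‖ℓ‖^(-(δ/2))) ≤ 1 := by linarith [mul_le_mul_of_nonneg_left b hC₂]
    have hn2 : 0 < ‖toL2 (Res.pair φ κ ℓ)‖^2 := pos!
    have h3 : (‖toL2 (Res.pair φ κ ℓ)‖^2)⁻¹ ≤ (2/3 + ε)*(log ‖ℓ‖)⁻¹ := by
      rw [← div_eq_mul_inv, ← one_div, div_le_div_iff₀ hn2 lin!]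
      have h4 := mul_pos hε hn2
      have h5 := mul_le_mul_of_nonneg_right hpi.le (show 0 ≤ log ‖ℓ‖ by linarith)
      linarith
    have h4 := mul_le_mul_of_nonneg_left (h1.trans (mul_le_mul_of_nonneg_right h2 pos!))
      (inv_pos.2 hn2).le
    have h5 := mul_le_mul_of_nonneg_right h3 (show 0 ≤ (‖ℓ‖^2)⁻¹ by positivity)
    linarith

end
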